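/- Let $R$ be a principal ideal domain and let $(C,d,\Delta,\varepsilon)$ be a connected coaugmented chain coalgebra over $R$, in non-negative degrees, with $C_0=R\cdot 1$ and with $R$-free underlying module. Put $\overline C=\ker\varepsilon$, write $\Delta(c)=\sum c_{(1)}\otimes c_{(2)}$, and set $s^{-1}1=0$. All signs follow the Koszul rule. *Constructions.* The cobar construction is $\Omega C=(T(s^{-1}\overline C),d_\Omega)$, where $d_\Omega$ is the derivation with $d_\Omega(s^{-1}c)=-s^{-1}(dc)+\sum(-1)^{|c_{(1)}|}s^{-1}c_{(1)}|s^{-1}c_{(2)}$. The coHochschild complex is $\widehat{\mathscr H}(C)=(C\otimes\Omega C,\,d_{\widehat{\mathscr H}})$ with $$d_{\widehat{\mathscr H}}(x\otimes w)=dx\otimes w+(-1)^{|x|}x\otimes d_\Omega w-\sum(-1)^{|x_{(1)}|}x_{(1)}\otimes s^{-1}x_{(2)}|w+\sum(-1)^{(|x_{(1)}|-1)(|x_{(2)}|+|w|)}x_{(2)}\otimes w|s^{-1}x_{(1)} .$$ There are a natural inclusion $\Omega C\to\widehat{\mathscr H}(C)$, $w\mapsto 1\otimes w$, and a natural projection $\widehat{\mathscr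 H}(C)\to C$ induced by the augmentation of $\Omega C$. The Milgram map is the algebra map $q:\Omega(C\otimes C)\to\Omega C\otimes\Omega C$ with $q(s^{-1}(c\otimes 1))=s^{-1}c\otimes 1$, $q(s^{-1}(1\otimes c'))=1\otimes s^{-1}c'$ and $q(s^{-1}(c\otimes c'))=0$ for $c,c'\in\overline C$. It extends to $\hat q:\widehat{\mathscr H}(C\otimes C)\to\widehat{\mathscr H}(C)\otimes\widehat{\mathscr H}(C)$ by $\hat q((x\otimes x')\otimes w)=\big((x\otimes 1)\otimes(x'\otimes 1)\big)\cdot q(w)$. *Weak Alexander–Whitney structures.* Let $\omega:\Omega C\to\Omega(C\otimes C)$ be a chain algebra map such that $\omega(s^{-1}c)-s^{-1}\Delta(c)$ is a sum of words of length at least $2$ for every $c$; then $(C,\omega)$ is called a weak Alexander–Whitney coalgebra. Write $\omega(s^{-1}e)=\sum_k s^{-1}e_{(k,1)}|\cdots|s^{-1}e_{(k,k)}$ for $e\in\overline C$, and define $\hat\omega:\widehat{\mathscr H}(C)\to\widehat{\mathscr H}(C\otimes C)$ by $\hat\omega(1\otimes w)=1\otimes\omega(w)$ and $$\hat\omega(e\otimes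 w)=\sum_{k}\sum_{i=1}^{k}\pm\, e_{(k,i)}\otimes s^{-1}e_{(k,i+1)}|\cdots|s^{-1}e_{(k,k)}\cdot\omega(w)\cdot s^{-1}e_{(k,1)}|\cdots|s^{-1}e_{(k,i-1)}\qquad(e\in\overline C),$$ where $\pm$ is the Koszul sign of moving the word $s^{-1}e_{(k,1)}|\cdots|s^{-1}e_{(k,i-1)}$ to the right past $s^{-1}e_{(k,i)}|\cdots|s^{-1}e_{(k,k)}\cdot\omega(w)$. Put $\psi=q\omega$ and $\hat\psi=\hat q\,\hat\omega$. Let $\omega_k:C\to(C\otimes C)^{\otimes k}$ be the components of $\omega$, so that $\omega(s^{-1}c)=\sum_k (s^{-1})^{\otimes k}\omega_k(c)$, with $\omega_1=\Delta$ on all of $C$ and $\omega_k(1)=0$ for $k\ge 2$. Let $\mathrm{Id}\wedge\omega$ and $\omega\wedge\mathrm{Id}:\Omega(C\otimes C)\to\Omega(C\otimes C\otimes C)$ be the algebra maps whose $k$-th components are $\Delta^{(k-1)}\otimes\omega_k$ and $\omega_k\otimes\Delta^{(k-1)}$, followed by the permutation of the factors into $(C\otimes C\otimes C)^{\otimes k}$.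 Call $(C,\omega)$ *strict* if $(\mathrm{Id}\wedge\omega)\omega=(\omega\wedge\mathrm{Id})\omega$. Call it *quasistrict* if there is a chain homotopy $H$ from $f=(\mathrm{Id}\wedge\omega)\omega$ to $g=(\omega\wedge\mathrm{Id})\omega$ with $H(ab)=H(a)f(b)+(-1)^{|a|}g(a)H(b)$ for all $a,b$. **Theorem.** Let $(C,\omega)$ be a weak Alexander–Whitney coalgebra over $R$. 1. $\widehat{\mathscr H}(C)$ is a chain complex, and $\hat\psi:\widehat{\mathscr H}(C)\to\widehat{\mathscr H}(C)\otimes\widehat{\mathscr H}(C)$ is a chain map of degree $0$. 2. $\hat\psi$ extends $\psi$ and covers $\Delta$: it makes the squares with $\psi:\Omega C\to\Omega C\otimes\Omega C$ (via the natural inclusions) and with $\Delta:C\to C\otimes C$ (via the natural projections) commute. 3. $\hat\psi$ is natural: if $(C',\omega')$ is another weak Alexander–Whitney coalgebra over $R$ and $f:C\to C'$ is a morphism of coaugmented chain coalgebras with $\omega'\circ\Omega f=\Omega(f\otimes f)\circ\omega$, then $\hat\psi'\circ\widehat{\mathscr H}(f)=(\widehat{\mathscr H}(f)\otimes\widehat{\mathscr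 H}(f))\circ\hat\psi$, where $\hat\psi'$ is the comultiplication of $\widehat{\mathscr H}(C')$ and $\widehat{\mathscr H}(f)=f\otimes\Omega f$. 4. If $(C,\omega)$ is strict, then $\hat\psi$ is coassociative: $(\hat\psi\otimes 1)\hat\psi=(1\otimes\hat\psi)\hat\psi$. 5. If $(C,\omega)$ is quasistrict, then $\hat\psi$ is coassociative up to chain homotopy: there is a chain homotopy from $(\hat\psi\otimes 1)\hat\psi$ to $(1\otimes\hat\psi)\hat\psi$. -/

import Mathlib

open scoped TensorProduct DirectSum

namespace CoHoch

noncomputable section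

/-! ### Graded modules and Koszul signs -/

/-- A (non-negative) grading of an `R`-module `M`: an internal direct sum decomposition
`M = ⨁ₙ Mₙ`. -/
structure Grading (R M : Type*) [CommRing R] [AddCommGroup M] [Module R M] where
  gr : ℕ → Submodule R M
  dec : DirectSum.Decomposition gr

/-- A linear map into `⨁ₙ gr n` that splits every element into homogeneous components gives a
decomposition. -/
abbrev mkDecomposition {R M : Type*} [CommRing R] [AddCommGroup M] [Module R M]
    (gr : ℕ → Submodule R M) (f : M →ₗ[R] ⨁ n, gr n)
    (h₁ : ∀ x, DirectSum.coeAddMonoidHom gr (f x) = x)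
    (h₂ : ∀ n (x : M) (hx : x ∈ gr n), f x = DirectSum.lof R ℕ (fun n => gr n) n ⟨x, hx⟩) :
    DirectSum.Decomposition gr where
  decompose' := f
  left_inv := h₁
  right_inv := by
    intro z
    induction z using DirectSum.induction_on with
    | zero => simp
    | of i x =>
      rw [DirectSum.coeAddMonoidHom_of, h₂ i x x.2]
      rfl
    | add x y hx hy => rw [map_add, map_add, hx, hy]

namespace Grading

variable {R M N : Type*} [CommRing R] [AddCommGroup M] [Module R M] [AddCommGroup N] [Module R N]

/-- The linear map `⨁ Mₙ → P` with given components, as a map on `M`. -/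
def elim (G : Grading R M) {P : Type*} [AddCommMonoid P] [Module R P]
    (φ : ∀ n, G.gr n →ₗ[R] P) : M →ₗ[R] P :=
  letI := G.dec
  DirectSum.toModule R ℕ P φ ∘ₗ (DirectSum.decomposeLinearEquiv G.gr).toLinearMap

theorem elim_apply (G : Grading R M) {P : Type*} [AddCommMonoid P] [Module R P]
    (φ : ∀ n, G.gr n →ₗ[R] P) {n : ℕ} {x : M} (hx : x ∈ G.gr n) :
    G.elim φ x = φ n ⟨x, hx⟩ := by
  let := G.dec
  simp only [elim, LinearMap.comp_apply, LinearEquiv.coe_coe,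
    DirectSum.decomposeLinearEquiv_apply]
  rw [DirectSum.decompose_of_mem _ hx]
  exact DirectSum.toModule_lof R n _

/-- Induction over homogeneous elements. -/
theorem induction (G : Grading R M) {p : M → Prop} (h0 : p 0)
    (hg : ∀ n, ∀ x ∈ G.gr n, p x) (ha : ∀ x y, p x → p y → p (x + y)) (x : M) : p x := by
  let := G.dec
  exact DirectSum.Decomposition.inductionOn G.gr h0 (fun {i} m => hg i m m.2) ha x

/-- Multiplication of the degree `n` component by the scalar `c n`. -/
def scale (G : Grading R M) (c : ℕ → R) : M →ₗ[R] M :=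
  G.elim fun n => c n • (G.gr n).subtype

theorem scale_apply (G : Grading R M) (c : ℕ → R) {n : ℕ} {x : M} (hx : x ∈ G.gr n) :
    G.scale c x = c n • x := by
  simp [scale, elim_apply G _ hx]

/-- The sign operator `x ↦ (-1)^{|x|} x`. -/
def sgn (G : Grading R M) : M →ₗ[R] M := G.scale fun n => (-1) ^ n

theorem sgn_apply (G : Grading R M) {n : ℕ} {x : M} (hx : x ∈ G.gr n) :
    G.sgn x = (-1 : R) ^ n • x := G.scale_apply _ hx

/-- The Koszul symmetry `x ⊗ y ↦ (-1)^{|x| |y|} y ⊗ x`, written by means of the even and the odd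
part of `x`. See `swap_apply`. -/
def swap (G : Grading R M) (H : Grading R N) : M ⊗[R] N →ₗ[R] N ⊗[R] M :=
  (TensorProduct.comm R M N).toLinearMap ∘ₗ
    (TensorProduct.map (G.scale fun n => if Even n then 1 else 0) LinearMap.id +
      TensorProduct.map (G.scale fun n => if Even n then 0 else 1) H.sgn)

theorem swap_apply (G : Grading R M) (H : Grading R N) {m n : ℕ} {x : M} {y : N}
    (hx : x ∈ G.gr m) (hy : y ∈ H.gr n) :
    G.swap H (x ⊗ₜ y) = (-1 : R) ^ (m * n) • (y ⊗ₜ[R] x) := by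
  simp only [swap, LinearMap.comp_apply, LinearMap.add_apply, TensorProduct.map_tmul,
    scale_apply G _ hx, sgn_apply H hy, LinearMap.id_apply, LinearEquiv.coe_coe]
  rcases Nat.even_or_odd m with h | h
  · simp [h, (h.mul_right n).neg_one_pow]
  · simp [Nat.not_even_iff_odd.mpr h, pow_mul, h.neg_one_pow, TensorProduct.smul_tmul']

/-- Degree `n` part of `M ⊗ N`: the span of the `x ⊗ y` with `|x| + |y| = n`. -/
def tensorGr (G : Grading R M) (H : Grading R N) (n : ℕ) : Submodule R (M ⊗[R] N) :=
  Submodule.span R {z | ∃ i j, i + j = n ∧ ∃ x ∈ G.gr i, ∃ y ∈ H.gr j, z = x ⊗ₜ[R] y}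

theorem tmul_mem (G : Grading R M) (H : Grading R N) {i j : ℕ} {x : M} {y : N}
    (hx : x ∈ G.gr i) (hy : y ∈ H.gr j) : x ⊗ₜ[R] y ∈ G.tensorGr H (i + j) :=
  Submodule.subset_span ⟨i, j, rfl, x, hx, y, hy, rfl⟩

/-- Splitting a tensor into homogeneous components. -/
def tensorSplit (G : Grading R M) (H : Grading R N) :
    M ⊗[R] N →ₗ[R] ⨁ n, G.tensorGr H n :=
  TensorProduct.lift <| G.elim fun i => LinearMap.flip <| H.elim fun j => LinearMap.flip <|
    LinearMap.mk₂ R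
      (fun (x : G.gr i) (y : H.gr j) => DirectSum.lof R ℕ (fun n => G.tensorGr H n) (i + j)
        ⟨(x : M) ⊗ₜ[R] (y : N), G.tmul_mem H x.2 y.2⟩)
      (fun x x' y => by
        rw [← map_add]; congr 1; exact Subtype.ext (TensorProduct.add_tmul _ _ _))
      (fun c x y => by
        rw [← map_smul]; congr 1)
      (fun x y y' => by
        rw [← map_add]; congr 1; exact Subtype.ext (TensorProduct.tmul_add _ _ _))
      (fun c x y => by
        rw [← map_smul]; congr 1; exact Subtype.ext (TensorProduct.tmul_smul _ _ _))

theorem tensorSplit_tmul (G : Grading R M) (H : Grading R N) {i j : ℕ} {x : M} {y : N}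
    (hx : x ∈ G.gr i) (hy : y ∈ H.gr j) :
    G.tensorSplit H (x ⊗ₜ y) =
      DirectSum.lof R ℕ (fun n => G.tensorGr H n) (i + j) ⟨x ⊗ₜ y, G.tmul_mem H hx hy⟩ := by
  simp only [tensorSplit, TensorProduct.lift.tmul]
  rw [elim_apply G _ hx, LinearMap.flip_apply, elim_apply H _ hy]
  rfl

/-- The tensor product of graded modules. -/
def tensor (G : Grading R M) (H : Grading R N) : Grading R (M ⊗[R] N) where
  gr := G.tensorGr H
  dec := mkDecomposition _ (G.tensorSplit H)
    (by
      intro z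
      induction z using TensorProduct.induction_on with
      | zero => simp
      | add a b ha hb => rw [map_add, map_add, ha, hb]
      | tmul x y =>
        induction x using G.induction with
        | h0 => simp
        | ha x x' h h' => rw [TensorProduct.add_tmul, map_add, map_add, h, h']
        | hg i x hx =>
          induction y using H.induction with
          | h0 => simp
          | ha y y' h h' => rw [TensorProduct.tmul_add, map_add, map_add, h, h']
          | hg j y hy =>
            rw [tensorSplit_tmul G H hx hy]
            exact DirectSum.coeAddMonoidHom_of _ _ _)
    (by
      intro n z hz
      induction hz using Submodule.span_induction with
      | mem z h =>
        obtain ⟨i, j, rfl, x, hx, y, hy, rfl⟩ := h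
        exact tensorSplit_tmul G H hx hy
      | zero => rw [map_zero]; exact (map_zero _).symm
      | add a b _ _ ha hb => rw [map_add, ha, hb, ← map_add]; rfl
      | smul c a _ ha => rw [map_smul, ha, ← map_smul]; rfl)

/-- The Koszul interchange
`(a ⊗ b) ⊗ (a' ⊗ b') ↦ (-1)^{|b| |a'|} (a ⊗ a') ⊗ (b ⊗ b')`. -/
def interchange {A B A' B' : Type*} [AddCommGroup A] [Module R A] [AddCommGroup B] [Module R B]
    [AddCommGroup A'] [Module R A'] [AddCommGroup B'] [Module R B']
    (GB : Grading R B) (GA' : Grading R A') :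
    (A ⊗[R] B) ⊗[R] (A' ⊗[R] B') →ₗ[R] (A ⊗[R] A') ⊗[R] (B ⊗[R] B') :=
  (TensorProduct.assoc R A A' (B ⊗[R] B')).symm.toLinearMap ∘ₗ
    LinearMap.lTensor A ((TensorProduct.assoc R A' B B').toLinearMap ∘ₗ
      LinearMap.rTensor B' (GB.swap GA') ∘ₗ (TensorProduct.assoc R B A' B').symm.toLinearMap) ∘ₗ
    (TensorProduct.assoc R A B (A' ⊗[R] B')).toLinearMap

end Grading

/-! ### Tensor algebras on graded modules -/

section TensorAlg

variable {R V : Type*} [CommRing R] [AddCommGroup V] [Module R V]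

/-- Degree `n` part of `TV`: the span of the words `v₁ | ⋯ | vₖ` with `|v₁| + ⋯ + |vₖ| = n`. -/
def wordGr (G : Grading R V) (n : ℕ) : Submodule R (TensorAlgebra R V) :=
  Submodule.span R {w | ∃ l : List (Σ k, G.gr k), (l.map Sigma.fst).sum = n ∧
    w = (l.map fun p => TensorAlgebra.ι R (p.2 : V)).prod}

instance wordGr_gradedMonoid (G : Grading R V) : SetLike.GradedMonoid (wordGr G) where
  one_mem := Submodule.subset_span ⟨[], rfl, rfl⟩
  mul_mem := by
    intro i j a b ha hb
    have h := Submodule.mul_mem_mul ha hb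
    rw [wordGr, wordGr, Submodule.span_mul_span] at h
    refine Submodule.span_mono ?_ h
    rintro _ ⟨_, ⟨l, hl, rfl⟩, _, ⟨l', hl', rfl⟩, rfl⟩
    exact ⟨l ++ l', by simp [hl, hl'], by simp⟩

theorem ι_mem_wordGr (G : Grading R V) {n : ℕ} {v : V} (hv : v ∈ G.gr n) :
    TensorAlgebra.ι R v ∈ wordGr G n :=
  Submodule.subset_span ⟨[⟨n, v, hv⟩], by simp, by simp⟩

/-- Splitting an element of `TV` into homogeneous components. -/
def wordSplit (G : Grading R V) : TensorAlgebra R V →ₐ[R] ⨁ n, wordGr G n :=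
  TensorAlgebra.lift R <| G.elim fun n => DirectSum.lof R ℕ (fun n => wordGr G n) n ∘ₗ
    LinearMap.codRestrict _ (TensorAlgebra.ι R ∘ₗ (G.gr n).subtype)
      fun v => ι_mem_wordGr G v.2

theorem wordSplit_ι (G : Grading R V) {n : ℕ} {v : V} (hv : v ∈ G.gr n) :
    wordSplit G (TensorAlgebra.ι R v) =
      DirectSum.of (fun n => wordGr G n) n ⟨TensorAlgebra.ι R v, ι_mem_wordGr G hv⟩ := by
  rw [wordSplit, TensorAlgebra.lift_ι_apply, Grading.elim_apply G _ hv]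
  rfl

theorem wordSplit_prod (G : Grading R V) (l : List (Σ k, G.gr k)) :
    ∃ h, wordSplit G (l.map fun p => TensorAlgebra.ι R (p.2 : V)).prod =
      DirectSum.of (fun n => wordGr G n) (l.map Sigma.fst).sum
        ⟨(l.map fun p => TensorAlgebra.ι R (p.2 : V)).prod, h⟩ := by
  induction l with
  | nil => exact ⟨SetLike.GradedOne.one_mem, by simp; rfl⟩
  | cons p l ih =>
    obtain ⟨h, ih⟩ := ih
    refine ⟨Submodule.subset_span ⟨p :: l, rfl, rfl⟩, ?_⟩
    simp only [List.map_cons, List.prod_cons, map_mul, ih]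
    rw [wordSplit_ι G p.2.2, DirectSum.of_mul_of]
    rfl

instance wordGr_gradedAlgebra (G : Grading R V) : GradedAlgebra (wordGr G) :=
  GradedAlgebra.ofAlgHom _ (wordSplit G)
    (by
      ext v
      simp only [LinearMap.comp_apply, AlgHom.toLinearMap_apply, AlgHom.comp_apply,
        AlgHom.id_apply]
      induction v using G.induction with
      | h0 => simp
      | ha x y hx hy => simp only [map_add, hx, hy]
      | hg n v hv => rw [wordSplit_ι G hv, DirectSum.coeAlgHom_of])
    (by
      rintro n ⟨w, hw⟩
      show wordSplit G w = DirectSum.lof R ℕ (fun n => wordGr G n) n ⟨w, hw⟩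
      induction hw using Submodule.span_induction with
      | mem w h =>
        obtain ⟨l, rfl, rfl⟩ := h
        exact (wordSplit_prod G l).2
      | zero => rw [map_zero]; exact (map_zero _).symm
      | add a b _ _ ha hb => rw [map_add, ha, hb, ← map_add]; rfl
      | smul c a _ ha => rw [map_smul, ha, ← map_smul]; rfl)

/-- The graded module underlying the tensor algebra `TV`. -/
def wordGrading (G : Grading R V) : Grading R (TensorAlgebra R V) where
  gr := wordGr G
  dec := inferInstance

variable {X : Type*} [AddCommGroup X] [Module R X]

/-- Recursion on words from the left: the unique linear `F` on `TV` with `F 1 = x₀` and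
`F (v | w) = step v (F w)`. -/
def foldLeft (x₀ : X) (step : V →ₗ[R] Module.End R X) : TensorAlgebra R V →ₗ[R] X :=
  LinearMap.applyₗ x₀ ∘ₗ (TensorAlgebra.lift R step).toLinearMap

theorem foldLeft_one (x₀ : X) (step : V →ₗ[R] Module.End R X) : foldLeft x₀ step 1 = x₀ := by
  simp [foldLeft]

theorem foldLeft_ι_mul (x₀ : X) (step : V →ₗ[R] Module.End R X) (v : V) (w : TensorAlgebra R V) :
    foldLeft x₀ step (TensorAlgebra.ι R v * w) = step v (foldLeft x₀ step w) := by
  simp [foldLeft]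

/-- Recursion on words from the right: the unique linear `F` on `TV` with `F 1 = x₀` and
`F (w | v) = step v (F w)`. -/
def foldRight (x₀ : X) (step : V →ₗ[R] Module.End R X) : TensorAlgebra R V →ₗ[R] X :=
  LinearMap.applyₗ x₀ ∘ₗ (MulOpposite.opLinearEquiv R).symm.toLinearMap ∘ₗ
    (TensorAlgebra.lift R ((MulOpposite.opLinearEquiv R).toLinearMap ∘ₗ step)).toLinearMap

theorem foldRight_one (x₀ : X) (step : V →ₗ[R] Module.End R X) : foldRight x₀ step 1 = x₀ := by
  simp [foldRight]

theorem foldRight_mul_ι (x₀ : X) (step : V →ₗ[R] Module.End R X) (v : V)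
    (w : TensorAlgebra R V) :
    foldRight x₀ step (w * TensorAlgebra.ι R v) = step v (foldRight x₀ step w) := by
  simp [foldRight]

/-- Auxiliary step for `wordRec`: it carries the word itself along. -/
def wordStep (a : V →ₗ[R] TensorAlgebra R V →ₗ[R] X) (b : V →ₗ[R] Module.End R X) :
    V →ₗ[R] Module.End R (TensorAlgebra R V × X) :=
  LinearMap.mk₂ R
    (fun v p => (TensorAlgebra.ι R v * p.1, a v p.1 + b v p.2))
    (by intros; ext <;> simp [add_mul]; abel)
    (by intros; ext <;> simp)
    (by intros; ext <;> simp [mul_add]; abel)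
    (by intros; ext <;> simp)

/-- Recursion on words from the left in which the step may also use the remaining word: the unique
linear `F` on `TV` with `F 1 = 0` and `F (v | w) = a v w + b v (F w)`. -/
def wordRec (a : V →ₗ[R] TensorAlgebra R V →ₗ[R] X) (b : V →ₗ[R] Module.End R X) :
    TensorAlgebra R V →ₗ[R] X :=
  LinearMap.snd R (TensorAlgebra R V) X ∘ₗ foldLeft (1, 0) (wordStep a b)

theorem wordRec_fst (a : V →ₗ[R] TensorAlgebra R V →ₗ[R] X) (b : V →ₗ[R] Module.End R X)
    (w : TensorAlgebra R V) : (foldLeft (1, 0) (wordStep a b) w).1 = w := by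
  have key : ∀ u p, (TensorAlgebra.lift R (wordStep a b) u p).1 = u * p.1 := by
    intro u
    induction u using TensorAlgebra.induction with
    | algebraMap r => intro p; simp [Algebra.smul_def]
    | ι v => intro p; simp [wordStep]
    | mul x y hx hy => intro p; simp [hx, hy, mul_assoc]
    | add x y hx hy => intro p; simp [hx, hy, add_mul]
  simpa [foldLeft] using key w (1, 0)

theorem wordRec_one (a : V →ₗ[R] TensorAlgebra R V →ₗ[R] X) (b : V →ₗ[R] Module.End R X) :
    wordRec a b 1 = 0 := by
  simp [wordRec, foldLeft_one]

theorem wordRec_ι_mul (a : V →ₗ[R] TensorAlgebra R V →ₗ[R] X) (b : V →ₗ[R] Module.End R X)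
    (v : V) (w : TensorAlgebra R V) :
    wordRec a b (TensorAlgebra.ι R v * w) = a v w + b v (wordRec a b w) := by
  have h : wordRec a b (TensorAlgebra.ι R v * w) =
      a v (foldLeft (1, 0) (wordStep a b) w).1 + b v (wordRec a b w) := by
    simp only [wordRec, LinearMap.comp_apply, foldLeft_ι_mul]
    simp [wordStep]
  rw [h, wordRec_fst]

end TensorAlg

/-! ### Chain coalgebras -/

section Coalg

/-- The data of a connected, coaugmented chain coalgebra: a non-negatively graded module with a
differential, a comultiplication, a counit and a coaugmentation `R → C`, `r ↦ r • one`, such that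
`C₀ = R • one` and the counit splits the coaugmentation. The remaining laws are in `ChainCoalg`. -/
structure PreCoalg (R C : Type*) [CommRing R] [AddCommGroup C] [Module R C] extends
    Grading R C where
  d : C →ₗ[R] C
  comul : C →ₗ[R] C ⊗[R] C
  counit : C →ₗ[R] R
  one : C
  counit_one : counit one = 1
  gr_zero : gr 0 = Submodule.span R {one}
  counit_pos : ∀ n, ∀ x ∈ gr (n + 1), counit x = 0

variable {R C D E C' : Type*} [CommRing R] [AddCommGroup C] [Module R C] [AddCommGroup D]
  [Module R D] [AddCommGroup E] [Module R E] [AddCommGroup C'] [Module R C']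

/-- The differential `d ⊗ 1 + 1 ⊗ d` (with the Koszul sign) of a tensor product of complexes. -/
def tensorD (G : Grading R C) (dC : C →ₗ[R] C) (dD : D →ₗ[R] D) : C ⊗[R] D →ₗ[R] C ⊗[R] D :=
  TensorProduct.map dC LinearMap.id + TensorProduct.map G.sgn dD

namespace PreCoalg

/-- The tensor product of chain coalgebras. Its comultiplication is the composite of `Δ ⊗ Δ` with
the Koszul interchange of the two middle factors. -/
def tensor (K : PreCoalg R C) (L : PreCoalg R D) : PreCoalg R (C ⊗[R] D) where
  toGrading := K.toGrading.tensor L.toGrading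
  d := tensorD K.toGrading K.d L.d
  comul := Grading.interchange K.toGrading L.toGrading ∘ₗ TensorProduct.map K.comul L.comul
  counit := LinearMap.mul' R R ∘ₗ TensorProduct.map K.counit L.counit
  one := K.one ⊗ₜ L.one
  counit_one := by simp [K.counit_one, L.counit_one]
  gr_zero := by
    apply le_antisymm
    · refine Submodule.span_le.mpr ?_
      rintro _ ⟨i, j, hij, x, hx, y, hy, rfl⟩
      obtain ⟨rfl, rfl⟩ : i = 0 ∧ j = 0 := by omega
      rw [K.gr_zero] at hx
      rw [L.gr_zero] at hy
      obtain ⟨r, rfl⟩ := Submodule.mem_span_singleton.mp hx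
      obtain ⟨s, rfl⟩ := Submodule.mem_span_singleton.mp hy
      exact Submodule.mem_span_singleton.mpr ⟨r * s, by
        rw [TensorProduct.smul_tmul_smul]⟩
    · refine (Submodule.span_singleton_le_iff_mem _ _).mpr ?_
      refine Grading.tmul_mem _ _ (i := 0) (j := 0) ?_ ?_
      · rw [K.gr_zero]; exact Submodule.mem_span_singleton_self _
      · rw [L.gr_zero]; exact Submodule.mem_span_singleton_self _
  counit_pos := by
    intro n z hz
    induction hz using Submodule.span_induction with
    | zero => simp
    | add a b _ _ ha hb => rw [map_add, ha, hb, add_zero]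
    | smul c a _ ha => rw [map_smul, ha, smul_zero]
    | mem z h =>
      obtain ⟨i, j, hij, x, hx, y, hy, rfl⟩ := h
      rcases i with _ | i
      · obtain rfl : j = n + 1 := by omega
        simp [L.counit_pos n y hy]
      · simp [K.counit_pos i x hx]

/-- The coaugmentation coideal `C̄`, realised as the kernel of the counit. -/
abbrev bar (K : PreCoalg R C) : Type _ := LinearMap.ker K.counit

/-- The projection `C → C̄`, `c ↦ c - ε(c) 1`, along the coaugmentation. -/
def proj (K : PreCoalg R C) : C →ₗ[R] K.bar :=
  LinearMap.codRestrict _ (LinearMap.id - K.counit.smulRight K.one) fun c => by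
    simp [K.counit_one]

/-- Degree `n` part of the desuspension `s⁻¹ C̄`: the elements of `C̄` of degree `n + 1`. -/
def barGr (K : PreCoalg R C) (n : ℕ) : Submodule R K.bar :=
  (K.gr (n + 1)).comap (LinearMap.ker K.counit).subtype

/-- Splitting an element of `C` into the homogeneous components of its image in `s⁻¹ C̄`. -/
def barSplit (K : PreCoalg R C) : C →ₗ[R] ⨁ n, K.barGr n :=
  K.toGrading.elim fun n => match n with
    | 0 => 0
    | n + 1 => DirectSum.lof R ℕ (fun n => K.barGr n) n ∘ₗ
        LinearMap.codRestrict _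
          (LinearMap.codRestrict _ (K.gr (n + 1)).subtype fun x => K.counit_pos n x x.2)
          fun x => x.2

theorem barSplit_apply (K : PreCoalg R C) {n : ℕ} {x : C} (hx : x ∈ K.gr (n + 1)) :
    K.barSplit x = DirectSum.lof R ℕ (fun n => K.barGr n) n ⟨⟨x, K.counit_pos n x hx⟩, hx⟩ := by
  rw [barSplit, Grading.elim_apply _ _ hx]
  rfl

theorem barSplit_coe (K : PreCoalg R C) (x : C) :
    ((DirectSum.coeAddMonoidHom K.barGr (K.barSplit x) : K.bar) : C) =
      x - K.counit x • K.one := by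
  induction x using K.toGrading.induction with
  | h0 => simp
  | ha x y hx hy =>
    rw [map_add, map_add, Submodule.coe_add, hx, hy, map_add, add_smul]; abel
  | hg n x hx =>
    rcases n with _ | n
    · rw [barSplit, Grading.elim_apply _ _ hx]
      rw [K.gr_zero] at hx
      obtain ⟨r, rfl⟩ := Submodule.mem_span_singleton.mp hx
      simp [K.counit_one]
    · rw [K.barSplit_apply hx, K.counit_pos n x hx, zero_smul, sub_zero]
      exact congrArg Subtype.val (DirectSum.coeAddMonoidHom_of K.barGr n _)

/-- The graded module `s⁻¹ C̄`. -/
def barGrading (K : PreCoalg R C) : Grading R K.bar where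
  gr := K.barGr
  dec := mkDecomposition _ (K.barSplit ∘ₗ (LinearMap.ker K.counit).subtype)
    (by
      intro x
      refine Subtype.ext ?_
      have h := K.barSplit_coe x.1
      rw [LinearMap.mem_ker.mp x.2, zero_smul, sub_zero] at h
      exact h)
    (by
      intro n x hx
      exact K.barSplit_apply hx)

/-! ### The cobar construction -/

/-- The algebra `T (s⁻¹ C̄)` underlying the cobar construction `Ω C`. -/
abbrev Cobar (K : PreCoalg R C) : Type _ := TensorAlgebra R K.bar

/-- The grading of `Ω C`, with `|s⁻¹c₁ | ⋯ | s⁻¹cₙ| = ∑ (|cᵢ| - 1)`. -/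
abbrev cobarGrading (K : PreCoalg R C) : Grading R K.Cobar := wordGrading K.barGrading

/-- `c ↦ s⁻¹ c`, with the convention that `s⁻¹` vanishes on elements of degree `0`. -/
def sInv (K : PreCoalg R C) : C →ₗ[R] K.Cobar := TensorAlgebra.ι R ∘ₗ K.proj

/-- The differential on generators:
`c ↦ - s⁻¹(dc) + ∑ (-1)^{|c₍₁₎|} s⁻¹c₍₁₎ | s⁻¹c₍₂₎`. Since `s⁻¹ 1 = 0`, only the reduced
comultiplication of `c` contributes. -/
def cobarGen (K : PreCoalg R C) : C →ₗ[R] K.Cobar :=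
  -(K.sInv ∘ₗ K.d) +
    LinearMap.mul' R K.Cobar ∘ₗ TensorProduct.map (K.sInv ∘ₗ K.sgn) K.sInv ∘ₗ K.comul

/-- The differential of `Ω C`: the derivation `d (v | w) = dv | w + (-1)^{|v|} v | dw` extending
`cobarGen`. -/
def cobarD (K : PreCoalg R C) : K.Cobar →ₗ[R] K.Cobar :=
  wordRec (LinearMap.mul R K.Cobar ∘ₗ K.cobarGen ∘ₗ (LinearMap.ker K.counit).subtype)
    (LinearMap.mul R K.Cobar ∘ₗ K.cobarGrading.sgn ∘ₗ TensorAlgebra.ι R)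

/-- The chain algebra map `Ω f` induced by a morphism of chain coalgebras. -/
def cobarMap (K : PreCoalg R C) (L : PreCoalg R D) (f : C →ₗ[R] D) : K.Cobar →ₐ[R] L.Cobar :=
  TensorAlgebra.lift R (L.sInv ∘ₗ f ∘ₗ (LinearMap.ker K.counit).subtype)

/-- The map `c ⊗ c' ↦ s⁻¹c ⊗ ε(c') + ε(c) ⊗ s⁻¹c'`, that is `c ⊗ 1 ↦ s⁻¹c ⊗ 1`,
`1 ⊗ c' ↦ 1 ⊗ s⁻¹c'` and `c ⊗ c' ↦ 0` for `c ∈ C̄`, `c' ∈ C̄'`. -/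
def milgramGen (K : PreCoalg R C) (L : PreCoalg R D) : C ⊗[R] D →ₗ[R] K.Cobar ⊗[R] L.Cobar :=
  TensorProduct.map K.sInv (Algebra.linearMap R L.Cobar ∘ₗ L.counit) +
    TensorProduct.map (Algebra.linearMap R K.Cobar ∘ₗ K.counit) L.sInv

/-- The Milgram map `q : Ω(C ⊗ C') → Ω C ⊗ Ω C'`: the algebra map extending `milgramGen`, where the
product of the target is
`(a ⊗ b)(a' ⊗ b') = (-1)^{|b| |a'|} aa' ⊗ bb'` (Mathlib's graded tensor product of algebras). -/
def milgram (K : PreCoalg R C) (L : PreCoalg R D) :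
    (K.tensor L).Cobar →ₗ[R] K.Cobar ⊗[R] L.Cobar :=
  (GradedTensorProduct.of R (wordGr K.barGrading) (wordGr L.barGrading)).symm.toLinearMap ∘ₗ
    (TensorAlgebra.lift R
      ((GradedTensorProduct.of R (wordGr K.barGrading) (wordGr L.barGrading)).toLinearMap ∘ₗ
        K.milgramGen L ∘ₗ (LinearMap.ker (K.tensor L).counit).subtype)).toLinearMap

/-! ### The coHochschild complex -/

/-- The module `C ⊗ T (s⁻¹ C̄)` underlying the coHochschild complex `Ĥ(C) = Ĥ(C, C)`. -/
abbrev CoHH (K : PreCoalg R C) : Type _ := C ⊗[R] K.Cobar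

/-- The total grading of `Ĥ(C)`. -/
abbrev hhGrading (K : PreCoalg R C) : Grading R K.CoHH := K.toGrading.tensor K.cobarGrading

/-- `x ⊗ w ↦ ∑ (-1)^{|x₍₁₎|} x₍₁₎ ⊗ s⁻¹x₍₂₎ | w`. -/
def hhRight (K : PreCoalg R C) : K.CoHH →ₗ[R] K.CoHH :=
  LinearMap.lTensor C (LinearMap.mul' R K.Cobar) ∘ₗ
    (TensorProduct.assoc R C K.Cobar K.Cobar).toLinearMap ∘ₗ
    LinearMap.rTensor K.Cobar (TensorProduct.map K.sgn K.sInv ∘ₗ K.comul)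

/-- `x ⊗ w ↦ ∑ (-1)^{(|x₍₁₎| - 1)(|x₍₂₎| + |w|)} x₍₂₎ ⊗ w | s⁻¹x₍₁₎`. -/
def hhLeft (K : PreCoalg R C) : K.CoHH →ₗ[R] K.CoHH :=
  LinearMap.lTensor C (LinearMap.mul' R K.Cobar) ∘ₗ
    (TensorProduct.assoc R C K.Cobar K.Cobar).toLinearMap ∘ₗ
    K.cobarGrading.swap K.hhGrading ∘ₗ
    (TensorProduct.assoc R K.Cobar C K.Cobar).toLinearMap ∘ₗ
    LinearMap.rTensor K.Cobar (LinearMap.rTensor C K.sInv ∘ₗ K.comul)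

/-- The differential of the coHochschild complex,
`d(x ⊗ w) = dx ⊗ w + (-1)^{|x|} x ⊗ dw - ∑ (-1)^{|x₍₁₎|} x₍₁₎ ⊗ s⁻¹x₍₂₎ | w
  + ∑ (-1)^{(|x₍₁₎| - 1)(|x₍₂₎| + |w|)} x₍₂₎ ⊗ w | s⁻¹x₍₁₎`.
With the sign conventions of `cobarD`, the signs of the last two sums are forced by `d² = 0`. -/
def hhD (K : PreCoalg R C) : K.CoHH →ₗ[R] K.CoHH :=
  tensorD K.toGrading K.d K.cobarD - K.hhRight + K.hhLeft

/-- The natural inclusion `Ω C → Ĥ(C)`, `w ↦ 1 ⊗ w`. -/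
def hhIncl (K : PreCoalg R C) : K.Cobar →ₗ[R] K.CoHH := TensorProduct.mk R C K.Cobar K.one

/-- The natural projection `Ĥ(C) → C`, `x ⊗ w ↦ ε(w) x`, where `ε` is the augmentation of `Ω C`. -/
def hhProj (K : PreCoalg R C) : K.CoHH →ₗ[R] C :=
  (TensorProduct.rid R C).toLinearMap ∘ₗ
    LinearMap.lTensor C (TensorAlgebra.algebraMapInv : K.Cobar →ₐ[R] R).toLinearMap

/-- The map `Ĥ(f)` induced by a morphism of chain coalgebras. -/
def hhMap (K : PreCoalg R C) (L : PreCoalg R D) (f : C →ₗ[R] D) : K.CoHH →ₗ[R] L.CoHH :=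
  TensorProduct.map f (K.cobarMap L f).toLinearMap

/-- The map that marks a letter of a word in all possible ways:
`v₁ | ⋯ | vₖ ↦ ∑ᵢ v₁ | ⋯ | vᵢ₋₁ ⊗ (vᵢ ⊗ vᵢ₊₁ | ⋯ | vₖ)`, recursively
`v | w ↦ 1 ⊗ (v ⊗ w) + v · (marks of w)`. -/
def mark (K : PreCoalg R C) : K.Cobar →ₗ[R] K.Cobar ⊗[R] (K.bar ⊗[R] K.Cobar) :=
  wordRec ((LinearMap.compr₂ (TensorProduct.mk R K.bar K.Cobar)
      (TensorProduct.mk R K.Cobar (K.bar ⊗[R] K.Cobar) 1)))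
    (LinearMap.rTensorHom (K.bar ⊗[R] K.Cobar) ∘ₗ LinearMap.mul R K.Cobar ∘ₗ TensorAlgebra.ι R)

/-- Cyclic rotation of a word about each of its letters, with another word inserted:
`(s⁻¹c₁ | ⋯ | s⁻¹cₖ) ⊗ w ↦ ∑ᵢ ± cᵢ ⊗ s⁻¹cᵢ₊₁ | ⋯ | s⁻¹cₖ | w | s⁻¹c₁ | ⋯ | s⁻¹cᵢ₋₁`,
where `±` is the Koszul sign of moving `s⁻¹c₁ | ⋯ | s⁻¹cᵢ₋₁` past
`s⁻¹cᵢ | s⁻¹cᵢ₊₁ | ⋯ | s⁻¹cₖ | w`. -/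
def rotate (K : PreCoalg R C) : K.Cobar ⊗[R] K.Cobar →ₗ[R] K.CoHH :=
  TensorProduct.map (LinearMap.ker K.counit).subtype (LinearMap.mul' R K.Cobar) ∘ₗ
    (TensorProduct.assoc R K.bar K.Cobar K.Cobar).toLinearMap ∘ₗ
    K.cobarGrading.swap (K.barGrading.tensor K.cobarGrading) ∘ₗ
    LinearMap.lTensor K.Cobar
      (LinearMap.lTensor K.bar (LinearMap.mul' R K.Cobar) ∘ₗ
        (TensorProduct.assoc R K.bar K.Cobar K.Cobar).toLinearMap) ∘ₗ
    (TensorProduct.assoc R K.Cobar (K.bar ⊗[R] K.Cobar) K.Cobar).toLinearMap ∘ₗ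
    LinearMap.rTensor K.Cobar K.mark

/-- The map `ω̂ : Ĥ(C) → Ĥ(C')` induced by an algebra map `ω : Ω C → Ω C'`. With
`ω (s⁻¹e) = ∑ₖ s⁻¹e₍ₖ,₁₎ | ⋯ | s⁻¹e₍ₖ,ₖ₎` for `e ∈ C̄`, it sends `1 ⊗ w` to `1 ⊗ ω(w)` and `e ⊗ w` to
`∑ₖ ∑ᵢ ± e₍ₖ,ᵢ₎ ⊗ s⁻¹e₍ₖ,ᵢ₊₁₎ | ⋯ | s⁻¹e₍ₖ,ₖ₎ | ω(w) | s⁻¹e₍ₖ,₁₎ | ⋯ | s⁻¹e₍ₖ,ᵢ₋₁₎`. -/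
def hhHat (K : PreCoalg R C) (L : PreCoalg R D) (ω : K.Cobar →ₐ[R] L.Cobar) :
    K.CoHH →ₗ[R] L.CoHH :=
  TensorProduct.map (K.counit.smulRight L.one) ω.toLinearMap +
    L.rotate ∘ₗ TensorProduct.map (ω.toLinearMap ∘ₗ K.sInv) ω.toLinearMap

/-- The extended Milgram map `q̂ : Ĥ(C ⊗ C') → Ĥ(C) ⊗ Ĥ(C')`,
`(x ⊗ x') ⊗ w ↦ ((x ⊗ 1) ⊗ (x' ⊗ 1)) · q(w)`, that is, if `q(w) = ∑ w₁ ⊗ w₂`,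
`(x ⊗ x') ⊗ w ↦ ∑ (-1)^{|x'| |w₁|} (x ⊗ w₁) ⊗ (x' ⊗ w₂)`. -/
def milgramHat (K : PreCoalg R C) (L : PreCoalg R D) :
    (K.tensor L).CoHH →ₗ[R] K.CoHH ⊗[R] L.CoHH :=
  Grading.interchange L.toGrading K.cobarGrading ∘ₗ LinearMap.lTensor (C ⊗[R] D) (K.milgram L)

/-! ### Alexander–Whitney structures -/

/-- The loop comultiplication `ψ = q ω : Ω C → Ω C ⊗ Ω C`. -/
def loopComul (K : PreCoalg R C) (ω : K.Cobar →ₐ[R] (K.tensor K).Cobar) :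
    K.Cobar →ₗ[R] K.Cobar ⊗[R] K.Cobar :=
  K.milgram K ∘ₗ ω.toLinearMap

/-- The comultiplication `ψ̂ = q̂ ω̂ : Ĥ(C) → Ĥ(C) ⊗ Ĥ(C)`. -/
def hhComul (K : PreCoalg R C) (ω : K.Cobar →ₐ[R] (K.tensor K).Cobar) :
    K.CoHH →ₗ[R] K.CoHH ⊗[R] K.CoHH :=
  K.milgramHat K ∘ₗ K.hhHat (K.tensor K) ω

/-- `v ↦ (y ↦ ∑ (-1)^{|v| |y₍₁₎|} y₍₁₎ ⊗ s⁻¹(c ⊗ y₍₂₎))` for `v = s⁻¹c`. -/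
def wedgeRightStep (K : PreCoalg R C) (L : PreCoalg R D) :
    K.bar →ₗ[R] D →ₗ[R] D ⊗[R] (K.tensor L).Cobar :=
  TensorProduct.curry
    (LinearMap.lTensor D ((K.tensor L).sInv ∘ₗ
        LinearMap.rTensor D (LinearMap.ker K.counit).subtype) ∘ₗ
      (TensorProduct.assoc R D K.bar D).toLinearMap ∘ₗ
      LinearMap.rTensor D (K.barGrading.swap L.toGrading) ∘ₗ
      (TensorProduct.assoc R K.bar D D).symm.toLinearMap ∘ₗ
      LinearMap.lTensor K.bar L.comul)

/-- The map
`(s⁻¹c₁ | ⋯ | s⁻¹cₖ, y) ↦ ∑ ± s⁻¹(c₁ ⊗ y₍₁₎) | ⋯ | s⁻¹(cₖ ⊗ y₍ₖ₎)` with the Koszul sign, where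
`∑ y₍₁₎ ⊗ ⋯ ⊗ y₍ₖ₎` is the iterated comultiplication of `y`; for `k = 0` it is `(1, y) ↦ ε(y)`.
The recursion splits off the last letter. -/
def distribRight (K : PreCoalg R C) (L : PreCoalg R D) :
    K.Cobar →ₗ[R] D →ₗ[R] (K.tensor L).Cobar :=
  foldRight (Algebra.linearMap R (K.tensor L).Cobar ∘ₗ L.counit)
    (LinearMap.mk₂ R
      (fun v F => LinearMap.mul' R (K.tensor L).Cobar ∘ₗ
        LinearMap.rTensor (K.tensor L).Cobar F ∘ₗ K.wedgeRightStep L v)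
      (by intros; simp [LinearMap.comp_add])
      (by intros; simp [LinearMap.comp_smul])
      (by intros; simp [LinearMap.rTensor_add, LinearMap.comp_add, LinearMap.add_comp])
      (by intros; simp [LinearMap.rTensor_smul, LinearMap.comp_smul, LinearMap.smul_comp]))

/-- For an algebra map `ω : Ω C → Ω C'`, the algebra map `ω ∧ Id : Ω(C ⊗ D) → Ω(C' ⊗ D)` whose
`k`-th member is the composite of `ωₖ ⊗ Δ^{(k-1)}` with the permutation
`C'^{⊗k} ⊗ D^{⊗k} ≅ (C' ⊗ D)^{⊗k}`. Here `ωₖ(1) = 0` for `k ≥ 2` and `ω₁(1) = 1`. -/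
def wedgeRight (K : PreCoalg R C) (K' : PreCoalg R C') (L : PreCoalg R D)
    (ω : K.Cobar →ₐ[R] K'.Cobar) : (K.tensor L).Cobar →ₐ[R] (K'.tensor L).Cobar :=
  TensorAlgebra.lift R
    ((TensorProduct.lift (K'.distribRight L ∘ₗ ω.toLinearMap ∘ₗ K.sInv) +
      (K'.tensor L).sInv ∘ₗ LinearMap.rTensor D (K.counit.smulRight K'.one)) ∘ₗ
        (LinearMap.ker (K.tensor L).counit).subtype)

/-- `v ↦ (x ↦ ∑ (-1)^{|v| |x₍₂₎| + |x₍₁₎|} s⁻¹(x₍₁₎ ⊗ c) ⊗ x₍₂₎)` for `v = s⁻¹c`. -/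
def wedgeLeftStep (L : PreCoalg R D) (K : PreCoalg R C) :
    K.bar →ₗ[R] D →ₗ[R] (L.tensor K).Cobar ⊗[R] D :=
  LinearMap.flip (TensorProduct.curry
    (LinearMap.rTensor D ((L.tensor K).sInv ∘ₗ
        TensorProduct.map L.sgn (LinearMap.ker K.counit).subtype) ∘ₗ
      (TensorProduct.assoc R D K.bar D).symm.toLinearMap ∘ₗ
      LinearMap.lTensor D (L.toGrading.swap K.barGrading) ∘ₗ
      (TensorProduct.assoc R D D K.bar).toLinearMap ∘ₗ
      LinearMap.rTensor K.bar L.comul))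

/-- The map
`(s⁻¹c₁ | ⋯ | s⁻¹cₖ, x) ↦ ∑ ± s⁻¹(x₍₁₎ ⊗ c₁) | ⋯ | s⁻¹(x₍ₖ₎ ⊗ cₖ)` with the Koszul sign of
distributing `x` over the word from the left; for `k = 0` it is `(1, x) ↦ ε(x)`. -/
def distribLeft (L : PreCoalg R D) (K : PreCoalg R C) :
    K.Cobar →ₗ[R] D →ₗ[R] (L.tensor K).Cobar :=
  foldLeft (Algebra.linearMap R (L.tensor K).Cobar ∘ₗ L.counit)
    (LinearMap.mk₂ R
      (fun v F => LinearMap.mul' R (L.tensor K).Cobar ∘ₗ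
        LinearMap.lTensor (L.tensor K).Cobar F ∘ₗ L.wedgeLeftStep K v)
      (by intros; simp [LinearMap.comp_add])
      (by intros; simp [LinearMap.comp_smul])
      (by intros; simp [LinearMap.lTensor_add, LinearMap.comp_add, LinearMap.add_comp])
      (by intros; simp [LinearMap.lTensor_smul, LinearMap.comp_smul, LinearMap.smul_comp]))

/-- For an algebra map `ω : Ω C → Ω C'`, the algebra map `Id ∧ ω : Ω(D ⊗ C) → Ω(D ⊗ C')` whose
`k`-th member is the composite of `Δ^{(k-1)} ⊗ ωₖ` with the permutation
`D^{⊗k} ⊗ C'^{⊗k} ≅ (D ⊗ C')^{⊗k}`. The factor `(-1)^{|x|}` below is the Koszul sign of moving the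
desuspension past `x` in `s⁻¹(x ⊗ c)`. -/
def wedgeLeft (L : PreCoalg R D) (K : PreCoalg R C) (K' : PreCoalg R C')
    (ω : K.Cobar →ₐ[R] K'.Cobar) : (L.tensor K).Cobar →ₐ[R] (L.tensor K').Cobar :=
  TensorAlgebra.lift R
    ((TensorProduct.lift
        (LinearMap.flip (L.distribLeft K' ∘ₗ ω.toLinearMap ∘ₗ K.sInv) ∘ₗ L.sgn) +
      (L.tensor K').sInv ∘ₗ LinearMap.lTensor D (K.counit.smulRight K'.one)) ∘ₗ
        (LinearMap.ker (L.tensor K).counit).subtype)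

end PreCoalg

/-- A connected, coaugmented chain coalgebra over `R`, in non-negative degrees. -/
structure ChainCoalg (R C : Type*) [CommRing R] [AddCommGroup C] [Module R C] extends
    PreCoalg R C where
  d_mem : ∀ n, ∀ x ∈ gr (n + 1), d x ∈ gr n
  d_zero : ∀ x ∈ gr 0, d x = 0
  d_comp_d : d ∘ₗ d = 0
  comul_mem : ∀ n, ∀ x ∈ gr n, comul x ∈ (toGrading.tensor toGrading).gr n
  comul_d : comul ∘ₗ d = tensorD toGrading d d ∘ₗ comul
  counit_d : counit ∘ₗ d = 0
  coassoc : (TensorProduct.assoc R C C C).toLinearMap ∘ₗ comul.rTensor C ∘ₗ comul =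
    comul.lTensor C ∘ₗ comul
  rTensor_counit : ∀ x, counit.rTensor C (comul x) = 1 ⊗ₜ x
  lTensor_counit : ∀ x, counit.lTensor C (comul x) = x ⊗ₜ 1
  comul_one : comul one = one ⊗ₜ one

/-- `f` is a morphism of degree `k` of graded modules. -/
def HasDegree {M N : Type*} [AddCommGroup M] [Module R M] [AddCommGroup N] [Module R N]
    (G : Grading R M) (H : Grading R N) (k : ℕ) (f : M →ₗ[R] N) : Prop :=
  ∀ n, ∀ x ∈ G.gr n, f x ∈ H.gr (n + k)

/-- `d` is the differential of a non-negatively graded chain complex. -/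
structure IsDifferential {M : Type*} [AddCommGroup M] [Module R M] (G : Grading R M)
    (d : M →ₗ[R] M) : Prop where
  mem : ∀ n, ∀ x ∈ G.gr (n + 1), d x ∈ G.gr n
  zero : ∀ x ∈ G.gr 0, d x = 0
  comp_self : d ∘ₗ d = 0

/-- `f` is a chain map (of degree `0`). -/
structure IsChainMap {M N : Type*} [AddCommGroup M] [Module R M] [AddCommGroup N] [Module R N]
    (G : Grading R M) (dM : M →ₗ[R] M) (H : Grading R N) (dN : N →ₗ[R] N)
    (f : M →ₗ[R] N) : Prop where
  degree : HasDegree G H 0 f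
  comm : f ∘ₗ dM = dN ∘ₗ f

/-- `h` is a chain homotopy from `f` to `g`. -/
structure IsChainHomotopy {M N : Type*} [AddCommGroup M] [Module R M] [AddCommGroup N] [Module R N]
    (G : Grading R M) (dM : M →ₗ[R] M) (H : Grading R N) (dN : N →ₗ[R] N)
    (f g h : M →ₗ[R] N) : Prop where
  degree : HasDegree G H 1 h
  comm : dN ∘ₗ h + h ∘ₗ dM = g - f

/-- `f` is a morphism of coaugmented chain coalgebras. -/
structure IsCoalgMap (K : PreCoalg R C) (L : PreCoalg R D) (f : C →ₗ[R] D) : Prop extends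
    IsChainMap K.toGrading K.d L.toGrading L.d f where
  comul : L.comul ∘ₗ f = TensorProduct.map f f ∘ₗ K.comul
  counit : L.counit ∘ₗ f = K.counit
  one : f K.one = L.one

/-- The algebra map `ω : Ω C → Ω C'` is a chain map and realises the strong homotopy structure of
the DCSH map `f : C → C'`: `ω (s⁻¹c) = s⁻¹ f(c) +` a combination of words of length at least `2`. -/
structure Realizes (K : PreCoalg R C) (L : PreCoalg R D) (f : C →ₗ[R] D)
    (ω : K.Cobar →ₐ[R] L.Cobar) : Prop extends
    IsChainMap K.cobarGrading K.cobarD L.cobarGrading L.cobarD ω.toLinearMap where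
  higher : ∀ c, ω (K.sInv c) - L.sInv (f c) ∈
    ⨆ k : ℕ, LinearMap.range (TensorAlgebra.ι R : L.bar →ₗ[R] L.Cobar) ^ (k + 2)

/-- `(C, ω)` is a weak Alexander–Whitney coalgebra: `ω : Ω C → Ω(C ⊗ C)` is a chain algebra map
that realises the DCSH structure of the comultiplication of `C`. -/
def IsWeakAW (K : ChainCoalg R C) (ω : K.Cobar →ₐ[R] (K.tensor K.toPreCoalg).Cobar) : Prop :=
  Realizes K.toPreCoalg (K.tensor K.toPreCoalg) K.comul ω

/-- The chain coalgebra `C ⊗ (C ⊗ C)`. -/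
abbrev triple (K : ChainCoalg R C) : PreCoalg R (C ⊗[R] (C ⊗[R] C)) :=
  K.tensor (K.tensor K.toPreCoalg)

/-- The composite `(Id ∧ ω) ω : Ω C → Ω(C ⊗ C ⊗ C)`. -/
def awLeft (K : ChainCoalg R C) (ω : K.Cobar →ₐ[R] (K.tensor K.toPreCoalg).Cobar) :
    K.Cobar →ₐ[R] (triple K).Cobar :=
  (K.wedgeLeft K.toPreCoalg (K.tensor K.toPreCoalg) ω).comp ω

/-- The composite `(ω ∧ Id) ω : Ω C → Ω(C ⊗ C ⊗ C)`, where `(C ⊗ C) ⊗ C` and `C ⊗ (C ⊗ C)` are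
identified. -/
def awRight (K : ChainCoalg R C) (ω : K.Cobar →ₐ[R] (K.tensor K.toPreCoalg).Cobar) :
    K.Cobar →ₐ[R] (triple K).Cobar :=
  (((K.tensor K.toPreCoalg).tensor K.toPreCoalg).cobarMap (triple K)
    (TensorProduct.assoc R C C C).toLinearMap).comp
    ((K.wedgeRight (K.tensor K.toPreCoalg) K.toPreCoalg ω).comp ω)

/-- `(C, ω)` is strict: `(Id ∧ ω) ω = (ω ∧ Id) ω`. -/
def IsStrictAW (K : ChainCoalg R C) (ω : K.Cobar →ₐ[R] (K.tensor K.toPreCoalg).Cobar) : Prop :=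
  IsWeakAW K ω ∧ awLeft K ω = awRight K ω

/-- `H` is a derivation homotopy from `f` to `g`, where `f g : Ω C → Ω C'`. -/
structure IsDerivationHomotopy (K : PreCoalg R C) (L : PreCoalg R D)
    (f g : K.Cobar →ₐ[R] L.Cobar) (H : K.Cobar →ₗ[R] L.Cobar) : Prop extends
    IsChainHomotopy K.cobarGrading K.cobarD L.cobarGrading L.cobarD
      f.toLinearMap g.toLinearMap H where
  map_mul : ∀ n, ∀ a ∈ K.cobarGrading.gr n, ∀ b,
    H (a * b) = H a * f b + (-1 : R) ^ n • (g a * H b)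

/-- `(C, ω)` is quasistrict: there is a derivation homotopy from `(Id ∧ ω) ω` to `(ω ∧ Id) ω`. -/
def IsQuasistrictAW (K : ChainCoalg R C) (ω : K.Cobar →ₐ[R] (K.tensor K.toPreCoalg).Cobar) :
    Prop :=
  IsWeakAW K ω ∧ ∃ H, IsDerivationHomotopy K.toPreCoalg (triple K) (awLeft K ω) (awRight K ω) H

/-- A morphism `(C, ω) → (C', ω')` of weak Alexander–Whitney coalgebras: a morphism `f` of chain
coalgebras with `ω' ∘ Ω f = Ω(f ⊗ f) ∘ ω`. -/
structure IsAWMap (K : ChainCoalg R C) (ω : K.Cobar →ₐ[R] (K.tensor K.toPreCoalg).Cobar)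
    (L : ChainCoalg R D) (ω' : L.Cobar →ₐ[R] (L.tensor L.toPreCoalg).Cobar)
    (f : C →ₗ[R] D) : Prop extends IsCoalgMap K.toPreCoalg L.toPreCoalg f where
  comm_aw : ω'.comp (K.cobarMap L.toPreCoalg f) =
    ((K.tensor K.toPreCoalg).cobarMap (L.tensor L.toPreCoalg) (TensorProduct.map f f)).comp ω

/-- `(ψ̂ ⊗ 1) ψ̂ : Ĥ(C) → Ĥ(C) ⊗ (Ĥ(C) ⊗ Ĥ(C))`. -/
def comulLeft {M : Type*} [AddCommGroup M] [Module R M] (ψ : M →ₗ[R] M ⊗[R] M) :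
    M →ₗ[R] M ⊗[R] (M ⊗[R] M) :=
  (TensorProduct.assoc R M M M).toLinearMap ∘ₗ ψ.rTensor M ∘ₗ ψ

/-- `(1 ⊗ ψ̂) ψ̂ : Ĥ(C) → Ĥ(C) ⊗ (Ĥ(C) ⊗ Ĥ(C))`. -/
def comulRight {M : Type*} [AddCommGroup M] [Module R M] (ψ : M →ₗ[R] M ⊗[R] M) :
    M →ₗ[R] M ⊗[R] (M ⊗[R] M) :=
  ψ.lTensor M ∘ₗ ψ

end Coalg

end

end CoHoch

/-! The coHochschild complex behaves like the X-complex of the algebra Ω C: a copy of Ω C together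
with one-forms modulo commutators. The map `rotate` plays the role of a ⊗ b ↦ (class of Da · b),
where D is the universal derivation. It obeys the cyclic Leibniz rule `rotate_mul`, rotate(ab ⊗ w) =
rotate(a ⊗ bw) ± rotate(b ⊗ wa). Since s⁻¹1 = 0, one has x ⊗ w = ε(x)(1 ⊗ w) + rotate(s⁻¹x ⊗ w)
(`gam_sInv`), so Ĥ(C) is spanned by the elements 1 ⊗ w and the rotations (`hh_ext`). On rotations
the differential has the closed form `hhD_rotate`: d rotate(a ⊗ b) = -rotate(da ⊗ b) - (-1)^{|a|}
rotate(a ⊗ db) - 1 ⊗ ab + (-1)^{|a||b|} 1 ⊗ ba. Hence d² = 0 on Ĥ(C) follows from d² = 0 on Ω C. The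
map ω̂ sends 1 ⊗ w to 1 ⊗ ω(w) and rotate(a ⊗ w) to rotate(ωa ⊗ ωw) (`hhHat_rotate`). It is
therefore functorial in ω (`hhHat_comp`), and a chain map when ω is one (`hhHat_hhD`).

The Milgram map q is a chain map because the two mixed terms in the differential of s⁻¹(x ⊗ y) are
sent by q to opposite elements (`tensorD_milgramGen`). The same expansion with counits shows that q̂
is a chain map (`milgramHat_hhD`). So ψ̂ = q̂ω̂ is a chain map, and naturality is functoriality of
the hat construction plus naturality of q̂. For the projection to C, a rotation contributes only if
no letter is left beside the marked one. Words of length at least 2 in ω(s⁻¹c) are thus invisible,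
and Δ is what remains (`hhProj_rotate_higher`).

For coassociativity, q̂ is associative (`milgramHat_assoc`) and turns the hat of Id ∧ ω into 1 ⊗ ω̂
and that of ω ∧ Id into ω̂ ⊗ 1 (`milgramHat_wedgeLeft`, `milgramHat_wedgeRight`). Indeed, q sees a
factor distributed over a word only through its counit, and the marked letter alone keeps its share,
so counitality restores the factor. Both iterates of ψ̂ become one iterated Milgram map after the
hats of (Id ∧ ω)ω and (ω ∧ Id)ω (`comulRight_hhComul`, `comulLeft_hhComul`). Strictness makes the
two hats equal.

In the quasistrict case, let H be a derivation homotopy from f to g. With F = fs⁻¹, G = gs⁻¹ and φ =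
1 + Hs⁻¹, the homotopy identity says that φ is a gauge transformation between the twisting maps F
and G (`twist`). As Hs⁻¹ vanishes in degree 0, φ has a convolution inverse (`cvInv`). Each hat
factors through a complex C ⊗ Ω D twisted on the left and on the right, by the chain map `gam`.
Because H has g on its left and f on its right, 1 ⊗ H and the rotation of Hs⁻¹ land in complexes
with different left and right twists. Left multiplication by φ⁻¹ repairs the mismatch, and the sum
of the two corrected maps is the homotopy (`exists_hhHat`). It remains to know that f and g are
chain maps. For f = (Id ∧ ω)ω this is computed by differentiating a distributed word
(`cobarD_distribLeft`); for g it follows because g - f = dH + Hd and the differentials square to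
zero. -/

set_option linter.unusedSimpArgs false

namespace CoHoch

noncomputable section

/-! ### Signs indexed by parities -/

/-- The sign `(-1)^i` of a parity `i`. -/
def sg (R : Type*) [CommRing R] (i : ZMod 2) : R := if i = 0 then 1 else -1

section Signs

variable {R : Type*} [CommRing R]

theorem zmod_two_cases : ∀ i : ZMod 2, i = 0 ∨ i = 1 := by decide

theorem sg_zero : sg R 0 = 1 := by simp [sg]

theorem sg_one : sg R 1 = -1 := by simp [sg]

theorem sg_add (i j : ZMod 2) : sg R (i + j) = sg R i * sg R j := by
  rcases zmod_two_cases i with rfl | rfl <;> rcases zmod_two_cases j with rfl | rfl <;>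
    simp [sg, CharTwo.add_self_eq_zero]

theorem sg_mul_add (i j k : ZMod 2) : sg R (i * (j + k)) = sg R (i * j) * sg R (i * k) := by
  rw [mul_add, sg_add]

theorem sg_add_mul (i j k : ZMod 2) : sg R ((i + j) * k) = sg R (i * k) * sg R (j * k) := by
  rw [add_mul, sg_add]

theorem sg_mul_one (i : ZMod 2) : sg R (i * 1) = sg R i := by rw [mul_one]

theorem sg_one_mul (i : ZMod 2) : sg R (1 * i) = sg R i := by rw [one_mul]

theorem sg_mul_zero (i : ZMod 2) : sg R (i * 0) = 1 := by rw [mul_zero, sg_zero]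

theorem sg_zero_mul (i : ZMod 2) : sg R (0 * i) = 1 := by rw [zero_mul, sg_zero]

theorem sg_sq (i : ZMod 2) : sg R i * sg R i = 1 := by
  rw [← sg_add, CharTwo.add_self_eq_zero, sg_zero]

theorem sg_sq_left (i : ZMod 2) (r : R) : sg R i * (sg R i * r) = r := by
  rw [← mul_assoc, sg_sq, one_mul]

theorem sg_natCast (n : ℕ) : sg R (n : ZMod 2) = (-1) ^ n := by
  rcases Nat.even_or_odd n with h | h
  · rw [h.neg_one_pow, (ZMod.natCast_eq_zero_iff_even).mpr h, sg_zero]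
  · rw [h.neg_one_pow, (ZMod.natCast_eq_one_iff_odd).mpr h, sg_one]

theorem sg_smul_sg_smul {M : Type*} [AddCommGroup M] [Module R M] (i : ZMod 2) (x : M) :
    sg R i • sg R i • x = x := by rw [smul_smul, sg_sq, one_smul]

end Signs

/-! ### Homogeneous elements -/

namespace Grading

variable {R M N P Q : Type*} [CommRing R] [AddCommGroup M] [Module R M] [AddCommGroup N]
  [Module R N] [AddCommGroup P] [Module R P] [AddCommGroup Q] [Module R Q]

/-- The grading extended by `0` to negative degrees. -/
def zgr (G : Grading R M) : ℤ → Submodule R M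
  | Int.ofNat n => G.gr n
  | Int.negSucc _ => ⊥

theorem mem_zgr_natCast {G : Grading R M} {n : ℕ} {x : M} : x ∈ G.zgr n ↔ x ∈ G.gr n := Iff.rfl

theorem zgr_cast {G : Grading R M} {i j : ℤ} {x : M} (hx : x ∈ G.zgr i) (h : i = j) :
    x ∈ G.zgr j := h ▸ hx

theorem eq_zero_of_mem_zgr {G : Grading R M} {i : ℤ} (hi : i < 0) {x : M} (hx : x ∈ G.zgr i) :
    x = 0 := by
  obtain _ | n := i
  · exact absurd hi (by simp)
  · exact hx

/-- The sum of all components of a given parity. -/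
def par (G : Grading R M) (i : ZMod 2) : Submodule R M :=
  ⨆ n : {n : ℕ // (n : ZMod 2) = i}, G.gr n

theorem mem_par_of_mem {G : Grading R M} {n : ℕ} {x : M} (hx : x ∈ G.gr n) :
    x ∈ G.par (n : ZMod 2) :=
  Submodule.mem_iSup_of_mem (⟨n, rfl⟩ : {m : ℕ // (m : ZMod 2) = n}) hx

theorem mem_par_of_zgr {G : Grading R M} {n : ℤ} {x : M} (hx : x ∈ G.zgr n) :
    x ∈ G.par (n : ZMod 2) := by
  obtain n | n := n
  · have := mem_par_of_mem (n := n) hx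
    simpa using this
  · rw [eq_zero_of_mem_zgr (by simp) hx]; exact zero_mem _

theorem par_cast {G : Grading R M} {i j : ZMod 2} {x : M} (hx : x ∈ G.par i) (h : i = j) :
    x ∈ G.par j := h ▸ hx

@[elab_as_elim]
theorem par_induction {G : Grading R M} {i : ZMod 2} {p : ∀ x, x ∈ G.par i → Prop}
    (mem : ∀ (n : ℕ) (h : (n : ZMod 2) = i) (x) (hx : x ∈ G.gr n),
      p x (par_cast (mem_par_of_mem hx) h))
    (zero : p 0 (zero_mem _))
    (add : ∀ x y hx hy, p x hx → p y hy → p (x + y) (add_mem hx hy)) {x : M}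
    (hx : x ∈ G.par i) : p x hx := by
  refine Submodule.iSup_induction' _ (motive := fun x hx => p x hx) ?_ zero add hx
  exact fun n x h => mem n n.2 x h

/-- Induction over elements of homogeneous parity. -/
theorem parity_induction (G : Grading R M) {p : M → Prop}
    (hg : ∀ i, ∀ x ∈ G.par i, p x) (ha : ∀ x y, p x → p y → p (x + y)) (x : M) : p x :=
  G.induction (hg 0 0 (zero_mem _)) (fun _ x hx => hg _ x (mem_par_of_mem hx)) ha x

theorem sgn_par {G : Grading R M} {i : ZMod 2} {x : M} (hx : x ∈ G.par i) :
    G.sgn x = sg R i • x := by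
  induction hx using par_induction with
  | mem n h x hx => rw [sgn_apply _ hx, ← h, sg_natCast]
  | zero => simp
  | add x y _ _ hx hy => rw [map_add, hx, hy, smul_add]

theorem swap_par {G : Grading R M} {H : Grading R N} {i j : ZMod 2} {x : M} {y : N}
    (hx : x ∈ G.par i) (hy : y ∈ H.par j) :
    G.swap H (x ⊗ₜ y) = sg R (i * j) • (y ⊗ₜ[R] x) := by
  induction hx using par_induction with
  | mem m h x hx =>
    induction hy using par_induction with
    | mem n h' y hy => rw [swap_apply _ _ hx hy, ← h, ← h', ← Nat.cast_mul, sg_natCast]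
    | zero => simp
    | add x y _ _ hx hy => rw [TensorProduct.tmul_add, map_add, hx, hy, TensorProduct.add_tmul,
        smul_add]
  | zero => simp
  | add x y _ _ hx hy => rw [TensorProduct.add_tmul, map_add, hx, hy, TensorProduct.tmul_add, smul_add]

theorem tmul_mem_par {G : Grading R M} {H : Grading R N} {i j : ZMod 2} {x : M} {y : N}
    (hx : x ∈ G.par i) (hy : y ∈ H.par j) : x ⊗ₜ[R] y ∈ (G.tensor H).par (i + j) := by
  induction hx using par_induction with
  | mem m h x hx =>
    induction hy using par_induction with
    | mem n h' y hy =>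
      have := mem_par_of_mem (G := G.tensor H) (G.tmul_mem H hx hy)
      rwa [Nat.cast_add, h, h'] at this
    | zero => simp
    | add x y _ _ hx hy => rw [TensorProduct.tmul_add]; exact add_mem hx hy
  | zero => simp
  | add x y _ _ hx hy => rw [TensorProduct.add_tmul]; exact add_mem hx hy

theorem tmul_mem_zgr {G : Grading R M} {H : Grading R N} {i j : ℤ} {x : M} {y : N}
    (hx : x ∈ G.zgr i) (hy : y ∈ H.zgr j) : x ⊗ₜ[R] y ∈ (G.tensor H).zgr (i + j) := by
  obtain i | i := i
  · obtain j | j := j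
    · exact G.tmul_mem H hx hy
    · rw [eq_zero_of_mem_zgr (by simp) hy, TensorProduct.tmul_zero]; exact zero_mem _
  · rw [eq_zero_of_mem_zgr (by simp) hx, TensorProduct.zero_tmul]; exact zero_mem _

/-- Elements of `M ⊗ N` of homogeneous parity are sums of homogeneous tensors. -/
theorem exists_sum_of_mem_par {G : Grading R M} {H : Grading R N} {n : ZMod 2} {z : M ⊗[R] N}
    (hz : z ∈ (G.tensor H).par n) :
    ∃ (k : ℕ) (a : Fin k → M) (b : Fin k → N) (p q : Fin k → ZMod 2),
      (∀ t, a t ∈ G.par (p t)) ∧ (∀ t, b t ∈ H.par (q t)) ∧ (∀ t, n = p t + q t) ∧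
      z = ∑ t, a t ⊗ₜ[R] b t := by
  -- The additive closure, rather than the linear span, gives a plain finite sum of tensors: scalars
  -- are absorbed into the left factor.
  have key : z ∈ AddSubmonoid.closure {z | ∃ i j, n = i + j ∧ ∃ x ∈ G.par i, ∃ y ∈ H.par j,
      z = x ⊗ₜ[R] y} := by
    induction hz using par_induction with
    | mem m h z hz =>
      induction hz using Submodule.span_induction with
      | mem z hz =>
        obtain ⟨i, j, rfl, x, hx, y, hy, rfl⟩ := hz
        exact AddSubmonoid.subset_closure ⟨i, j, by simp [← h], x, mem_par_of_mem hx, y,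
          mem_par_of_mem hy, rfl⟩
      | zero => exact zero_mem _
      | add x y _ _ hx hy => exact add_mem hx hy
      | smul c z hz' hz =>
        clear hz'
        induction hz using AddSubmonoid.closure_induction with
        | mem z hz =>
          obtain ⟨i, j, h, x, hx, y, hy, rfl⟩ := hz
          exact AddSubmonoid.subset_closure ⟨i, j, h, c • x, Submodule.smul_mem _ _ hx, y, hy, rfl⟩
        | zero => rw [smul_zero]; exact zero_mem _
        | add x y _ _ hx hy => rw [smul_add]; exact add_mem hx hy
    | zero => exact zero_mem _
    | add x y _ _ hx hy => exact add_mem hx hy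
  obtain ⟨l, hl, rfl⟩ := AddSubmonoid.exists_list_of_mem_closure key
  choose i j hij a ha b hb hab using fun t : Fin l.length => hl (l.get t) (l.get_mem t)
  refine ⟨l.length, a, b, i, j, ha, hb, hij, ?_⟩
  rw [← Finset.sum_congr rfl fun t _ => hab t]
  conv_lhs => rw [← List.ofFn_get l]
  exact List.sum_ofFn

@[elab_as_elim]
theorem tensor_par_induction {G : Grading R M} {H : Grading R N} {n : ZMod 2}
    {p : M ⊗[R] N → Prop} (zero : p 0) (add : ∀ x y, p x → p y → p (x + y))
    (tmul : ∀ i j, n = i + j → ∀ x ∈ G.par i, ∀ y ∈ H.par j, p (x ⊗ₜ y)) {z : M ⊗[R] N}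
    (hz : z ∈ (G.tensor H).par n) : p z := by
  obtain ⟨k, a, b, i, j, ha, hb, hn, rfl⟩ := exists_sum_of_mem_par hz
  exact Finset.sum_induction _ p add zero fun t _ => tmul _ _ (hn t) _ (ha t) _ (hb t)

/-- Two linear maps on `M ⊗ N` agree if they agree on homogeneous tensors. -/
theorem tensor_ext (G : Grading R M) (H : Grading R N) {f g : M ⊗[R] N →ₗ[R] P}
    (h : ∀ i j, ∀ x ∈ G.par i, ∀ y ∈ H.par j, f (x ⊗ₜ y) = g (x ⊗ₜ y)) : f = g := by
  refine TensorProduct.ext' fun x y => ?_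
  induction x using G.parity_induction with
  | hg i x hx =>
    induction y using H.parity_induction with
    | hg j y hy => exact h i j x hx y hy
    | ha y y' h h' => rw [TensorProduct.tmul_add, map_add, map_add, h, h']
  | ha x x' h h' => rw [TensorProduct.add_tmul, map_add, map_add, h, h']

/-- `f` raises degrees by the integer `k`. -/
def Deg (G : Grading R M) (H : Grading R N) (k : ℤ) (f : M →ₗ[R] N) : Prop :=
  ∀ n : ℕ, ∀ x ∈ G.gr n, f x ∈ H.zgr (n + k)

variable {G : Grading R M} {H : Grading R N} {K : Grading R P} {L : Grading R Q}

theorem Deg.apply {k : ℤ} {f : M →ₗ[R] N} (hf : Deg G H k f) {i : ℤ} {x : M}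
    (hx : x ∈ G.zgr i) : f x ∈ H.zgr (i + k) := by
  obtain n | n := i
  · exact hf n x hx
  · rw [eq_zero_of_mem_zgr (by simp) hx, map_zero]; exact zero_mem _

theorem Deg.par {k : ℤ} {f : M →ₗ[R] N} (hf : Deg G H k f) {i : ZMod 2} {x : M}
    (hx : x ∈ G.par i) : f x ∈ H.par (i + (k : ZMod 2)) := by
  induction hx using par_induction with
  | mem m h x hx =>
    have := mem_par_of_zgr (hf m x hx)
    rw [← h]
    simpa using this
  | zero => simp
  | add x y _ _ hx hy => rw [map_add]; exact add_mem hx hy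

theorem Deg.par_zero {f : M →ₗ[R] N} (hf : Deg G H 0 f) {i : ZMod 2} {x : M}
    (hx : x ∈ G.par i) : f x ∈ H.par i := par_cast (hf.par hx) (by simp)

theorem Deg.par_one {f : M →ₗ[R] N} (hf : Deg G H 1 f) {i : ZMod 2} {x : M}
    (hx : x ∈ G.par i) : f x ∈ H.par (i + 1) := par_cast (hf.par hx) (by simp)

theorem Deg.par_neg_one {f : M →ₗ[R] N} (hf : Deg G H (-1) f) {i : ZMod 2} {x : M}
    (hx : x ∈ G.par i) : f x ∈ H.par (i + 1) :=
  par_cast (hf.par hx) (by simp [CharTwo.neg_eq])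

theorem Deg.comp {k l m : ℤ} {g : N →ₗ[R] P} {f : M →ₗ[R] N} (hg : Deg H K l g)
    (hf : Deg G H k f) (h : k + l = m) : Deg G K m (g ∘ₗ f) := fun n x hx =>
  zgr_cast (hg.apply (hf n x hx)) (by omega)

theorem Deg.add {k : ℤ} {f g : M →ₗ[R] N} (hf : Deg G H k f) (hg : Deg G H k g) :
    Deg G H k (f + g) := fun n x hx => add_mem (hf n x hx) (hg n x hx)

theorem Deg.sub {k : ℤ} {f g : M →ₗ[R] N} (hf : Deg G H k f) (hg : Deg G H k g) :
    Deg G H k (f - g) := fun n x hx => sub_mem (hf n x hx) (hg n x hx)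

theorem Deg.neg {k : ℤ} {f : M →ₗ[R] N} (hf : Deg G H k f) :
    Deg G H k (-f) := fun n x hx => neg_mem (hf n x hx)

theorem Deg.zero {k : ℤ} : Deg G H k 0 := fun _ _ _ => zero_mem _

theorem Deg.id : Deg G G 0 LinearMap.id := fun n _ hx => zgr_cast (i := n) hx (by simp)

theorem Deg.sgn : Deg G G 0 G.sgn := fun n x hx => by
  rw [sgn_apply _ hx]
  exact zgr_cast (i := n) (Submodule.smul_mem _ _ hx) (by simp)

theorem Deg.of_tmul {k : ℤ} {f : M ⊗[R] N →ₗ[R] P}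
    (h : ∀ i j : ℤ, ∀ x ∈ G.zgr i, ∀ y ∈ H.zgr j, f (x ⊗ₜ y) ∈ K.zgr (i + j + k)) :
    Deg (G.tensor H) K k f := by
  intro n z hz
  induction hz using Submodule.span_induction with
  | mem z hz =>
    obtain ⟨i, j, rfl, x, hx, y, hy, rfl⟩ := hz
    exact zgr_cast (h i j x hx y hy) (by simp)
  | zero => rw [map_zero]; exact zero_mem _
  | add x y _ _ hx hy => rw [map_add]; exact add_mem hx hy
  | smul c z _ hz => rw [map_smul]; exact Submodule.smul_mem _ _ hz

theorem Deg.map {k l m : ℤ} {f : M →ₗ[R] P} {g : N →ₗ[R] Q} (hf : Deg G K k f)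
    (hg : Deg H L l g) (h : k + l = m) :
    Deg (G.tensor H) (K.tensor L) m (TensorProduct.map f g) := Deg.of_tmul fun i j x hx y hy =>
  zgr_cast (tmul_mem_zgr (hf.apply hx) (hg.apply hy)) (by omega)

theorem Deg.rTensor {k : ℤ} {f : M →ₗ[R] P} (hf : Deg G K k f) :
    Deg (G.tensor H) (K.tensor H) k (f.rTensor N) := hf.map Deg.id (by simp)

theorem Deg.lTensor {k : ℤ} {f : M →ₗ[R] P} (hf : Deg G K k f) :
    Deg (H.tensor G) (H.tensor K) k (f.lTensor N) := Deg.id.map hf (by simp)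

theorem swap_mem_zgr {i j : ℤ} {x : M} {y : N} (hx : x ∈ G.zgr i) (hy : y ∈ H.zgr j) :
    G.swap H (x ⊗ₜ y) ∈ (H.tensor G).zgr (i + j) := by
  rw [swap_par (mem_par_of_zgr hx) (mem_par_of_zgr hy)]
  exact Submodule.smul_mem _ _ (zgr_cast (tmul_mem_zgr hy hx) (by omega))

theorem Deg.swap : Deg (G.tensor H) (H.tensor G) 0 (G.swap H) :=
  Deg.of_tmul fun _ _ _ hx _ hy => zgr_cast (swap_mem_zgr hx hy) (by omega)

/-- A linear condition on `M ⊗ N` in degree `n` follows from the case of homogeneous tensors. -/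
theorem Deg.of_tmul_tmul {k : ℤ} {f : (M ⊗[R] N) ⊗[R] P →ₗ[R] Q}
    (h : ∀ i j l : ℤ, ∀ x ∈ G.zgr i, ∀ y ∈ H.zgr j, ∀ z ∈ K.zgr l,
      f ((x ⊗ₜ y) ⊗ₜ z) ∈ L.zgr (i + j + l + k)) :
    Deg ((G.tensor H).tensor K) L k f := by
  refine Deg.of_tmul fun i l w hw z hz => ?_
  have : Deg (G.tensor H) L (l + k) (f ∘ₗ (TensorProduct.mk R (M ⊗[R] N) P).flip z) :=
    Deg.of_tmul fun i j x hx y hy => zgr_cast (h i j l x hx y hy z hz) (by omega)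
  exact zgr_cast (this.apply hw) (by omega)

theorem Deg.assoc :
    Deg ((G.tensor H).tensor K) (G.tensor (H.tensor K)) 0
      (TensorProduct.assoc R M N P).toLinearMap :=
  Deg.of_tmul_tmul fun _ _ _ _ hx _ hy _ hz =>
    zgr_cast (tmul_mem_zgr hx (tmul_mem_zgr hy hz)) (by omega)

theorem Deg.assoc_symm :
    Deg (G.tensor (H.tensor K)) ((G.tensor H).tensor K) 0
      (TensorProduct.assoc R M N P).symm.toLinearMap := by
  refine Deg.of_tmul fun i l x hx w hw => ?_
  have : Deg (H.tensor K) ((G.tensor H).tensor K) i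
      ((TensorProduct.assoc R M N P).symm.toLinearMap ∘ₗ TensorProduct.mk R M (N ⊗[R] P) x) :=
    Deg.of_tmul fun j l y hy z hz =>
      zgr_cast (tmul_mem_zgr (tmul_mem_zgr hx hy) hz) (by omega)
  exact zgr_cast (this.apply hw) (by omega)

theorem Deg.interchange {A B : Type*} [AddCommGroup A] [Module R A] [AddCommGroup B] [Module R B]
    {GA : Grading R A} {GB : Grading R B} {GM : Grading R M} {GN : Grading R N} :
    Deg ((GA.tensor GB).tensor (GM.tensor GN)) ((GA.tensor GM).tensor (GB.tensor GN)) 0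
      (Grading.interchange (A := A) (B' := N) GB GM) := by
  unfold Grading.interchange
  refine Deg.assoc_symm.comp ?_ (zero_add _)
  refine Deg.comp ?_ Deg.assoc (zero_add _)
  refine Deg.lTensor ?_
  refine Deg.comp Deg.assoc ?_ (zero_add _)
  exact Deg.comp (Deg.rTensor Deg.swap) Deg.assoc_symm (zero_add _)

theorem interchange_par {A B : Type*} [AddCommGroup A] [Module R A] [AddCommGroup B] [Module R B]
    {GB : Grading R B} {GM : Grading R M} {i j : ZMod 2} (a : A) {b : B} {x : M} (y : N)
    (hb : b ∈ GB.par i) (hx : x ∈ GM.par j) :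
    Grading.interchange GB GM ((a ⊗ₜ[R] b) ⊗ₜ[R] (x ⊗ₜ[R] y)) =
      sg R (i * j) • ((a ⊗ₜ x) ⊗ₜ (b ⊗ₜ y)) := by
  simp [Grading.interchange, swap_par hb hx, TensorProduct.smul_tmul']

theorem hasDegree_iff {k : ℕ} {f : M →ₗ[R] N} : HasDegree G H k f ↔ Deg G H k f := Iff.rfl

/-- Degree -1 in the integral grading also contains the vanishing on degree 0, as the components of
negative degree are zero. -/
theorem Deg.isDifferential {d : M →ₗ[R] M} (h : Deg G G (-1) d) (hd : d ∘ₗ d = 0) :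
    IsDifferential G d where
  mem n x hx := zgr_cast (j := n) (h (n + 1) x hx) (by push_cast; omega)
  zero x hx := eq_zero_of_mem_zgr (by simp) (h 0 x hx)
  comp_self := hd

theorem deg_of_mem {d : M →ₗ[R] M} (h : ∀ n, ∀ x ∈ G.gr (n + 1), d x ∈ G.gr n)
    (h0 : ∀ x ∈ G.gr 0, d x = 0) : Deg G G (-1) d := by
  rintro (_ | n) x hx
  · rw [h0 x hx]; exact zero_mem _
  · exact zgr_cast (i := n) (h n x hx) (by push_cast; omega)

end Grading

theorem tensorD_tmul_par {R M N : Type*} [CommRing R] [AddCommGroup M] [Module R M]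
    [AddCommGroup N] [Module R N] {G : Grading R M} (d : M →ₗ[R] M) (d' : N →ₗ[R] N)
    {i : ZMod 2} {x : M} (hx : x ∈ G.par i) (y : N) :
    tensorD G d d' (x ⊗ₜ y) = d x ⊗ₜ y + sg R i • (x ⊗ₜ[R] d' y) := by
  simp [tensorD, Grading.sgn_par hx, TensorProduct.smul_tmul']

theorem tensorD_deg {R M N : Type*} [CommRing R] [AddCommGroup M] [Module R M]
    [AddCommGroup N] [Module R N] {G : Grading R M} {H : Grading R N} {d : M →ₗ[R] M}
    {d' : N →ₗ[R] N} (hd : Grading.Deg G G (-1) d) (hd' : Grading.Deg H H (-1) d') :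
    Grading.Deg (G.tensor H) (G.tensor H) (-1) (tensorD G d d') :=
  (hd.map Grading.Deg.id (by simp)).add (Grading.Deg.sgn.map hd' (by simp))

end

end CoHoch

namespace CoHoch

noncomputable section

open Grading

/-! ### Homogeneous elements of tensor algebras -/

section TensorAlg

variable {R V : Type*} [CommRing R] [AddCommGroup V] [Module R V] {G : Grading R V}

theorem one_mem_wordGrading : (1 : TensorAlgebra R V) ∈ (wordGrading G).gr 0 :=
  (wordGr_gradedMonoid G).one_mem

theorem mul_mem_wordGrading {i j : ℕ} {a b : TensorAlgebra R V} (ha : a ∈ (wordGrading G).gr i)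
    (hb : b ∈ (wordGrading G).gr j) : a * b ∈ (wordGrading G).gr (i + j) :=
  (wordGr_gradedMonoid G).mul_mem ha hb

theorem one_mem_zgr : (1 : TensorAlgebra R V) ∈ (wordGrading G).zgr 0 := one_mem_wordGrading

theorem one_mem_par : (1 : TensorAlgebra R V) ∈ (wordGrading G).par 0 := by
  simpa using mem_par_of_mem (one_mem_wordGrading (G := G))

theorem algebraMap_mem_par (r : R) :
    algebraMap R (TensorAlgebra R V) r ∈ (wordGrading G).par 0 := by
  rw [Algebra.algebraMap_eq_smul_one]; exact Submodule.smul_mem _ _ one_mem_par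

theorem mul_mem_zgr {i j : ℤ} {a b : TensorAlgebra R V} (ha : a ∈ (wordGrading G).zgr i)
    (hb : b ∈ (wordGrading G).zgr j) : a * b ∈ (wordGrading G).zgr (i + j) := by
  obtain i | i := i
  · obtain j | j := j
    · exact mul_mem_wordGrading ha hb
    · rw [eq_zero_of_mem_zgr (by simp) hb, mul_zero]; exact zero_mem _
  · rw [eq_zero_of_mem_zgr (by simp) ha, zero_mul]; exact zero_mem _

theorem mul_mem_par {i j : ZMod 2} {a b : TensorAlgebra R V} (ha : a ∈ (wordGrading G).par i)
    (hb : b ∈ (wordGrading G).par j) : a * b ∈ (wordGrading G).par (i + j) := by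
  induction ha using par_induction with
  | mem m h a ha =>
    induction hb using par_induction with
    | mem n h' b hb =>
      have := mem_par_of_mem (mul_mem_wordGrading ha hb)
      rwa [Nat.cast_add, h, h'] at this
    | zero => simp
    | add x y _ _ hx hy => rw [mul_add]; exact add_mem hx hy
  | zero => simp
  | add x y _ _ hx hy => rw [add_mul]; exact add_mem hx hy

theorem ι_mem_zgr {i : ℤ} {v : V} (hv : v ∈ G.zgr i) :
    TensorAlgebra.ι R v ∈ (wordGrading G).zgr i := by
  obtain i | i := i
  · exact ι_mem_wordGr G hv
  · rw [eq_zero_of_mem_zgr (by simp) hv, map_zero]; exact zero_mem _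

theorem ι_deg : Deg G (wordGrading G) 0 (TensorAlgebra.ι R) := fun n _ hv =>
  zgr_cast (ι_mem_zgr (i := n) hv) (by simp)

theorem ι_mem_par {i : ZMod 2} {v : V} (hv : v ∈ G.par i) :
    TensorAlgebra.ι R v ∈ (wordGrading G).par i := ι_deg.par_zero hv

theorem mul'_deg : Deg ((wordGrading G).tensor (wordGrading G)) (wordGrading G) 0
    (LinearMap.mul' R (TensorAlgebra R V)) := Deg.of_tmul fun _ _ _ hx _ hy =>
  zgr_cast (mul_mem_zgr hx hy) (by omega)

/-- Induction over words, prepending letters. -/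
theorem word_induction {p : ℕ → TensorAlgebra R V → Prop} (zero : ∀ n, p n 0)
    (add : ∀ n x y, p n x → p n y → p n (x + y)) (smul : ∀ n (r : R) x, p n x → p n (r • x))
    (one : p 0 1)
    (cons : ∀ m n v w, v ∈ G.gr m → w ∈ (wordGrading G).gr n → p n w →
      p (m + n) (TensorAlgebra.ι R v * w))
    {n : ℕ} {w : TensorAlgebra R V} (hw : w ∈ (wordGrading G).gr n) : p n w := by
  induction hw using Submodule.span_induction with
  | mem w hw =>
    obtain ⟨l, rfl, rfl⟩ := hw
    induction l with
    | nil => exact one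
    | cons a l ih =>
      exact cons a.1 _ a.2 _ a.2.2 (Submodule.subset_span ⟨l, rfl, rfl⟩) ih
  | zero => exact zero n
  | add x y _ _ hx hy => exact add n x y hx hy
  | smul r x _ hx => exact smul n r x hx

theorem word_par_induction {p : ZMod 2 → TensorAlgebra R V → Prop} (zero : ∀ i, p i 0)
    (add : ∀ i x y, p i x → p i y → p i (x + y)) (smul : ∀ i (r : R) x, p i x → p i (r • x))
    (one : p 0 1)
    (cons : ∀ i j v w, v ∈ G.par i → w ∈ (wordGrading G).par j → p j w →
      p (i + j) (TensorAlgebra.ι R v * w))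
    {i : ZMod 2} {w : TensorAlgebra R V} (hw : w ∈ (wordGrading G).par i) : p i w := by
  induction hw using par_induction with
  | mem n h w hw =>
    subst h
    refine word_induction (G := G) (p := fun n w => p n w) (fun _ => zero _)
      (fun _ => add _) (fun _ => smul _) (by simpa using one) (fun m n v w hv hw h => ?_) hw
    simpa using cons m n v w (mem_par_of_mem hv) (mem_par_of_mem hw) h
  | zero => exact zero i
  | add x y _ _ hx hy => exact add i x y hx hy

/-- Induction over words, appending letters. -/
theorem word_par_induction_right {p : ZMod 2 → TensorAlgebra R V → Prop} (zero : ∀ i, p i 0)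
    (add : ∀ i x y, p i x → p i y → p i (x + y)) (smul : ∀ i (r : R) x, p i x → p i (r • x))
    (one : p 0 1)
    (snoc : ∀ i j v w, v ∈ G.par i → w ∈ (wordGrading G).par j → p j w →
      p (j + i) (w * TensorAlgebra.ι R v))
    {i : ZMod 2} {w : TensorAlgebra R V} (hw : w ∈ (wordGrading G).par i) : p i w := by
  induction hw using par_induction with
  | mem n h w hw =>
    subst h
    induction hw using Submodule.span_induction with
    | mem w hw =>
      obtain ⟨l, rfl, rfl⟩ := hw
      induction l using List.reverseRecOn with
      | nil => simpa using one
      | append_singleton l a ih =>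
        have := snoc _ _ a.2 _ (mem_par_of_mem a.2.2)
          (mem_par_of_mem (Submodule.subset_span ⟨l, rfl, rfl⟩)) ih
        simpa using this
    | zero => exact zero _
    | add x y _ _ hx hy => exact add _ x y hx hy
    | smul r x _ hx => exact smul _ r x hx
  | zero => exact zero i
  | add x y _ _ hx hy => exact add i x y hx hy

theorem sgn_mul (a b : TensorAlgebra R V) :
    (wordGrading G).sgn (a * b) = (wordGrading G).sgn a * (wordGrading G).sgn b := by
  induction a using (wordGrading G).parity_induction with
  | hg i a ha =>
    induction b using (wordGrading G).parity_induction with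
    | hg j b hb =>
      rw [sgn_par ha, sgn_par hb, sgn_par (mul_mem_par ha hb), smul_mul_smul_comm, sg_add]
    | ha x y hx hy => simp only [mul_add, map_add, hx, hy]
  | ha x y hx hy => simp only [add_mul, map_add, hx, hy]

/-- Two algebra maps that agree in the letters, stated for multiplicative linear maps. -/
theorem linearMap_ext_of_mul {X : Type*} [AddCommGroup X] [Module R X]
    {F F' : TensorAlgebra R V →ₗ[R] X} (m : X →ₗ[R] X →ₗ[R] X)
    (one : F 1 = F' 1) (h : ∀ v, F (TensorAlgebra.ι R v) = F' (TensorAlgebra.ι R v))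
    (hF : ∀ a b, F (a * b) = m (F a) (F b)) (hF' : ∀ a b, F' (a * b) = m (F' a) (F' b)) :
    F = F' := by
  refine LinearMap.ext fun w => ?_
  induction w using TensorAlgebra.induction with
  | algebraMap r => rw [Algebra.algebraMap_eq_smul_one, map_smul, map_smul, one]
  | ι v => exact h v
  | mul a b ha hb => rw [hF, hF', ha, hb]
  | add a b ha hb => rw [map_add, map_add, ha, hb]

variable {W : Type*} [AddCommGroup W] [Module R W] {H : Grading R W}

/-- An algebra map between tensor algebras preserves degrees if it does so on letters. -/
theorem algHom_deg {f : TensorAlgebra R V →ₐ[R] TensorAlgebra R W}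
    (h : Deg G (wordGrading H) 0 (f.toLinearMap ∘ₗ TensorAlgebra.ι R)) :
    Deg (wordGrading G) (wordGrading H) 0 f.toLinearMap := by
  intro n w hw
  refine word_induction (G := G) (p := fun n w => f.toLinearMap w ∈ (wordGrading H).zgr (n + 0))
    (fun _ => by simp) (fun _ x y hx hy => by rw [map_add]; exact add_mem hx hy)
    (fun _ r x hx => by rw [map_smul]; exact Submodule.smul_mem _ _ hx)
    (by simpa using one_mem_zgr) (fun m n v w hv hw ih => ?_) hw
  rw [AlgHom.toLinearMap_apply, map_mul]
  exact zgr_cast (mul_mem_zgr (h m v hv) ih) (by push_cast; ring)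

end TensorAlg

/-! ### The cobar construction -/

namespace PreCoalg

variable {R C D : Type*} [CommRing R] [AddCommGroup C] [Module R C] [AddCommGroup D]
  [Module R D] (K : PreCoalg R C) (L : PreCoalg R D)

theorem one_mem_gr : K.one ∈ K.gr 0 := by
  rw [K.gr_zero]; exact Submodule.mem_span_singleton_self _

theorem one_mem_zgr : K.one ∈ K.zgr 0 := K.one_mem_gr

theorem one_mem_par : K.one ∈ K.par 0 := by
  simpa using mem_par_of_mem K.one_mem_gr

theorem proj_coe (x : C) : (K.proj x : C) = x - K.counit x • K.one := rfl

theorem proj_one : K.proj K.one = 0 := Subtype.ext (by simp [proj_coe, K.counit_one])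

theorem proj_bar (v : K.bar) : K.proj v = v :=
  Subtype.ext (by rw [proj_coe, LinearMap.mem_ker.mp v.2, zero_smul, sub_zero])

theorem sInv_one : K.sInv K.one = 0 := by simp [sInv, proj_one]

theorem sInv_bar (v : K.bar) : K.sInv v = TensorAlgebra.ι R v := by simp [sInv, proj_bar]

/-- Connectedness is needed here: degree 0 is spanned by 1, which the projection kills, and there
the target component of degree -1 is zero. -/
theorem proj_deg : Deg K.toGrading K.barGrading (-1) K.proj := by
  rintro (_ | n) x hx
  · rw [K.gr_zero] at hx
    obtain ⟨r, rfl⟩ := Submodule.mem_span_singleton.mp hx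
    rw [map_smul, proj_one, smul_zero]; exact zero_mem _
  · refine zgr_cast (i := n) (j := (n + 1 : ℕ) + -1) ?_ (by push_cast; ring)
    change ((K.proj x : K.bar) : C) ∈ K.gr (n + 1)
    rwa [proj_coe, K.counit_pos n x hx, zero_smul, sub_zero]

/-- The grading of the source is already desuspended, so the inclusion is the suspension. -/
theorem subtype_deg : Deg K.barGrading K.toGrading 1 (LinearMap.ker K.counit).subtype :=
  fun n _ hx => mem_zgr_natCast (n := n + 1).mpr hx

theorem sInv_deg : Deg K.toGrading K.cobarGrading (-1) K.sInv := ι_deg.comp K.proj_deg (by simp)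

theorem sInv_mem_par {i : ZMod 2} {x : C} (hx : x ∈ K.par i) :
    K.sInv x ∈ K.cobarGrading.par (i + 1) := K.sInv_deg.par_neg_one hx

theorem coe_mem_par {i : ZMod 2} {v : K.bar} (hv : v ∈ K.barGrading.par i) :
    (v : C) ∈ K.par (i + 1) := K.subtype_deg.par_one hv

theorem counit_of_odd {x : C} (hx : x ∈ K.par 1) : K.counit x = 0 := by
  induction hx using par_induction with
  | mem n h x hx =>
    obtain _ | n := n
    · simp at h
    · exact K.counit_pos n x hx
  | zero => simp
  | add x y _ _ hx hy => rw [map_add, hx, hy, add_zero]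

theorem counit_of_ne {i : ℤ} (hi : i ≠ 0) {x : C} (hx : x ∈ K.zgr i) : K.counit x = 0 := by
  obtain (_ | i) | i := i
  · exact absurd rfl hi
  · exact K.counit_pos i x hx
  · rw [eq_zero_of_mem_zgr (by simp) hx, map_zero]

/-- The counit vanishes on odd elements, so a sign depending on |x| may be dropped next to ε(x). The
sign checks below rely on this constantly. -/
theorem sg_counit {i : ZMod 2} {x : C} (hx : x ∈ K.par i) :
    sg R i * K.counit x = K.counit x := by
  rcases zmod_two_cases i with rfl | rfl
  · rw [sg_zero, one_mul]
  · rw [K.counit_of_odd hx, mul_zero]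

theorem sg_mul_counit {i : ZMod 2} {x : C} (hx : x ∈ K.par i) (j : ZMod 2) :
    sg R (j * i) * K.counit x = K.counit x := by
  rcases zmod_two_cases i with rfl | rfl
  · rw [mul_zero, sg_zero, one_mul]
  · rw [K.counit_of_odd hx, mul_zero]

theorem sg_mul_counit' {i : ZMod 2} {x : C} (hx : x ∈ K.par i) (j : ZMod 2) :
    sg R (i * j) * K.counit x = K.counit x := by
  rw [mul_comm i, K.sg_mul_counit hx]

/-- The laws of a chain coalgebra that persist in tensor products for trivial reasons: degrees and
counitality. -/
structure Laws : Prop where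
  d_deg : Deg K.toGrading K.toGrading (-1) K.d
  comul_deg : Deg K.toGrading (K.toGrading.tensor K.toGrading) 0 K.comul
  counit_d : ∀ x, K.counit (K.d x) = 0
  rTensor_counit : ∀ x, K.counit.rTensor C (K.comul x) = 1 ⊗ₜ x
  lTensor_counit : ∀ x, K.counit.lTensor C (K.comul x) = x ⊗ₜ 1

variable {K L}

/-- A Sweedler presentation of the comultiplication of a homogeneous element. -/
theorem Laws.sweedler (h : K.Laws) {n : ZMod 2} {x : C} (hx : x ∈ K.par n) :
    ∃ (k : ℕ) (a b : Fin k → C) (p q : Fin k → ZMod 2),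
      (∀ t, a t ∈ K.par (p t)) ∧ (∀ t, b t ∈ K.par (q t)) ∧ (∀ t, n = p t + q t) ∧
      K.comul x = ∑ t, a t ⊗ₜ[R] b t ∧ ∑ t, K.counit (a t) • b t = x ∧
      ∑ t, K.counit (b t) • a t = x := by
  obtain ⟨k, a, b, p, q, ha, hb, hn, hx'⟩ := exists_sum_of_mem_par (h.comul_deg.par_zero hx)
  refine ⟨k, a, b, p, q, ha, hb, hn, hx', ?_, ?_⟩
  · have := congrArg (TensorProduct.lid R C) (h.rTensor_counit x)
    simpa [hx', map_sum] using this
  · have := congrArg (TensorProduct.rid R C) (h.lTensor_counit x)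
    simpa [hx', map_sum] using this

/-- For degree reasons Δ(1) is a multiple of 1 ⊗ 1, and counitality fixes the multiple. -/
theorem Laws.comul_one (h : K.Laws) : K.comul K.one = K.one ⊗ₜ K.one := by
  have h1 := h.comul_deg 0 _ K.one_mem_gr
  have h2 : K.comul K.one ∈ (K.tensor K).gr 0 := zgr_cast (j := (0 : ℕ)) h1 (by simp)
  rw [(K.tensor K).gr_zero] at h2
  obtain ⟨r, hr⟩ := Submodule.mem_span_singleton.mp h2
  have h3 := congrArg (TensorProduct.lid R C) (h.rTensor_counit K.one)
  rw [← hr] at h3 ⊢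
  have h4 := congrArg K.counit h3
  simp [tensor, K.counit_one] at h4
  simp [h4, tensor]

theorem Laws.d_one (h : K.Laws) : K.d K.one = 0 :=
  eq_zero_of_mem_zgr (by simp) (h.d_deg 0 _ K.one_mem_gr)

theorem Laws.cobarGen_one (h : K.Laws) : K.cobarGen K.one = 0 := by
  simp [cobarGen, h.d_one, h.comul_one, sInv_one]

theorem cobarD_one : K.cobarD 1 = 0 := wordRec_one _ _

theorem cobarD_ι_mul (v : K.bar) (w : K.Cobar) :
    K.cobarD (TensorAlgebra.ι R v * w) =
      K.cobarGen v * w + K.cobarGrading.sgn (TensorAlgebra.ι R v) * K.cobarD w :=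
  wordRec_ι_mul _ _ v w

/-- Writing the sign by the operator `sgn` frees the Leibniz rule from homogeneity assumptions, so
an induction over arbitrary elements of the tensor algebra is possible. -/
theorem cobarD_mul (a b : K.Cobar) :
    K.cobarD (a * b) = K.cobarD a * b + K.cobarGrading.sgn a * K.cobarD b := by
  have h1 : K.cobarGrading.sgn 1 = 1 := by rw [sgn_par CoHoch.one_mem_par, sg_zero, one_smul]
  induction a using TensorAlgebra.induction generalizing b with
  | algebraMap r =>
    simp [Algebra.algebraMap_eq_smul_one, map_smul, cobarD_one, h1]
  | ι v =>
    have := K.cobarD_ι_mul v 1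
    rw [mul_one, cobarD_one, mul_zero, add_zero, mul_one] at this
    rw [cobarD_ι_mul, this]
  | mul x y hx hy => rw [mul_assoc, hx, hy, hx, sgn_mul]; noncomm_ring
  | add x y hx hy => simp only [add_mul, map_add, hx, hy]; abel

theorem cobarD_mul_par {i : ZMod 2} {a : K.Cobar} (ha : a ∈ K.cobarGrading.par i) (b : K.Cobar) :
    K.cobarD (a * b) = K.cobarD a * b + sg R i • (a * K.cobarD b) := by
  rw [cobarD_mul, sgn_par ha, smul_mul_assoc]

theorem cobarD_ι (v : K.bar) : K.cobarD (TensorAlgebra.ι R v) = K.cobarGen v := by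
  have := K.cobarD_ι_mul v 1
  rwa [mul_one, cobarD_one, mul_zero, add_zero, mul_one] at this

theorem Laws.cobarD_sInv (h : K.Laws) (x : C) : K.cobarD (K.sInv x) = K.cobarGen x := by
  rw [sInv, LinearMap.comp_apply, cobarD_ι, proj_coe, map_sub, map_smul, h.cobarGen_one, smul_zero,
    sub_zero]

/-- The degree is -2 rather than -1 because the argument is c and not s⁻¹c. -/
theorem Laws.cobarGen_deg (h : K.Laws) : Deg K.toGrading K.cobarGrading (-2) K.cobarGen := by
  refine (K.sInv_deg.comp h.d_deg (m := -2) (by norm_num)).neg.add ?_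
  refine mul'_deg.comp (k := -2) ?_ (by norm_num)
  exact Deg.comp (k := 0) (l := -2) ((K.sInv_deg.comp Deg.sgn (m := -1) (by norm_num)).map
    K.sInv_deg (by norm_num)) h.comul_deg (by norm_num)

theorem Laws.cobarD_deg (h : K.Laws) : Deg K.cobarGrading K.cobarGrading (-1) K.cobarD := by
  intro n w hw
  refine word_induction (G := K.barGrading)
    (p := fun n w => K.cobarD w ∈ K.cobarGrading.zgr (n + -1))
    (fun _ => by simp) (fun _ x y hx hy => by rw [map_add]; exact add_mem hx hy)
    (fun _ r x hx => by rw [map_smul]; exact Submodule.smul_mem _ _ hx)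
    (by simp [cobarD_one]) (fun m n v w hv hw ih => ?_) hw
  rw [cobarD_mul, cobarD_ι]
  refine add_mem ?_ ?_
  · exact zgr_cast (mul_mem_zgr (h.cobarGen_deg.apply (K.subtype_deg m v hv))
      (mem_zgr_natCast.mpr hw)) (by push_cast; ring)
  · exact zgr_cast (mul_mem_zgr (Deg.sgn.apply (ι_mem_zgr (mem_zgr_natCast.mpr hv))) ih)
      (by push_cast; ring)

theorem tensor_comul_tmul {x : C} {y : D} {k l : ℕ} {a b : Fin k → C} {a' b' : Fin l → D}
    {q : Fin k → ZMod 2} {p : Fin l → ZMod 2} (hb : ∀ t, b t ∈ K.par (q t))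
    (ha' : ∀ t, a' t ∈ L.par (p t)) (hx : K.comul x = ∑ t, a t ⊗ₜ[R] b t)
    (hy : L.comul y = ∑ t, a' t ⊗ₜ[R] b' t) :
    (K.tensor L).comul (x ⊗ₜ y) =
      ∑ s, ∑ t, sg R (q s * p t) • ((a s ⊗ₜ[R] a' t) ⊗ₜ[R] (b s ⊗ₜ[R] b' t)) := by
  simp only [tensor, LinearMap.comp_apply, TensorProduct.map_tmul, hx, hy,
    TensorProduct.sum_tmul, TensorProduct.tmul_sum, map_sum]
  rw [Finset.sum_comm]
  exact Finset.sum_congr rfl fun s _ => Finset.sum_congr rfl fun t _ =>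
    interchange_par _ _ (hb s) (ha' t)

/-- Indexing by pairs and moving the sign into the first factor gives a single-sum Sweedler
presentation, the form required by `cobarGen_apply` and `twD_tmul`. -/
theorem tensor_comul_tmul_prod {x : C} {y : D} {k l : ℕ} {a b : Fin k → C} {a' b' : Fin l → D}
    {q : Fin k → ZMod 2} {p : Fin l → ZMod 2} (hb : ∀ t, b t ∈ K.par (q t))
    (ha' : ∀ t, a' t ∈ L.par (p t)) (hx : K.comul x = ∑ t, a t ⊗ₜ[R] b t)
    (hy : L.comul y = ∑ t, a' t ⊗ₜ[R] b' t) :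
    (K.tensor L).comul (x ⊗ₜ y) = ∑ st : Fin k × Fin l,
      (sg R (q st.1 * p st.2) • (a st.1 ⊗ₜ[R] a' st.2)) ⊗ₜ[R] (b st.1 ⊗ₜ[R] b' st.2) := by
  rw [tensor_comul_tmul hb ha' hx hy, Fintype.sum_prod_type]
  simp only [TensorProduct.smul_tmul']

theorem tensor_counit_tmul (x : C) (y : D) :
    (K.tensor L).counit (x ⊗ₜ y) = K.counit x * L.counit y := rfl

theorem tensor_one : (K.tensor L).one = K.one ⊗ₜ L.one := rfl

theorem tensor_d_tmul {i : ZMod 2} {x : C} (hx : x ∈ K.par i) (y : D) :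
    (K.tensor L).d (x ⊗ₜ y) = K.d x ⊗ₜ y + sg R i • (x ⊗ₜ L.d y) :=
  tensorD_tmul_par _ _ hx y

/-- For the counit laws, the Koszul sign in the comultiplication disappears as soon as a counit is
applied to one of the two factors that were interchanged. -/
theorem Laws.tensor (hK : K.Laws) (hL : L.Laws) : (K.tensor L).Laws where
  d_deg := tensorD_deg hK.d_deg hL.d_deg
  comul_deg := Deg.interchange.comp (hK.comul_deg.map hL.comul_deg (m := 0) (by simp)) (by simp)
  counit_d z := by
    refine LinearMap.congr_fun (f := (K.tensor L).counit ∘ₗ (K.tensor L).d) (g := 0)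
      (tensor_ext K.toGrading L.toGrading fun i j x hx y hy => ?_) z
    rw [LinearMap.comp_apply, tensor_d_tmul hx, map_add, map_smul, tensor_counit_tmul,
      tensor_counit_tmul, hK.counit_d, hL.counit_d]
    simp
  rTensor_counit z := by
    refine LinearMap.congr_fun (f := (K.tensor L).counit.rTensor (C ⊗[R] D) ∘ₗ (K.tensor L).comul)
      (g := TensorProduct.mk R R (C ⊗[R] D) 1)
      (tensor_ext K.toGrading L.toGrading fun i j x hx y hy => ?_) z
    obtain ⟨k, a, b, p, q, ha, hb, hn, hx', hl, hr⟩ := hK.sweedler hx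
    obtain ⟨k', a', b', p', q', ha', hb', hn', hy', hl', hr'⟩ := hL.sweedler hy
    rw [LinearMap.comp_apply, tensor_comul_tmul hb ha' hx' hy']
    conv_rhs => rw [← hl, ← hl']
    simp only [map_sum, map_smul, LinearMap.rTensor_tmul, tensor_counit_tmul,
      TensorProduct.sum_tmul, TensorProduct.tmul_sum]
    rw [Finset.sum_comm]
    refine Finset.sum_congr rfl fun s _ => Finset.sum_congr rfl fun t _ => ?_
    rw [TensorProduct.smul_tmul', smul_eq_mul, mul_left_comm, L.sg_mul_counit (ha' _)]
    simp only [TensorProduct.mk_apply, TensorProduct.smul_tmul_smul]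
    rw [← TensorProduct.smul_tmul, smul_eq_mul, mul_one]
  lTensor_counit z := by
    refine LinearMap.congr_fun (f := (K.tensor L).counit.lTensor (C ⊗[R] D) ∘ₗ (K.tensor L).comul)
      (g := (TensorProduct.mk R (C ⊗[R] D) R).flip 1)
      (tensor_ext K.toGrading L.toGrading fun i j x hx y hy => ?_) z
    obtain ⟨k, a, b, p, q, ha, hb, hn, hx', hl, hr⟩ := hK.sweedler hx
    obtain ⟨k', a', b', p', q', ha', hb', hn', hy', hl', hr'⟩ := hL.sweedler hy
    rw [LinearMap.comp_apply, tensor_comul_tmul hb ha' hx' hy']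
    conv_rhs => rw [← hr, ← hr']
    simp only [map_sum, map_smul, LinearMap.lTensor_tmul, tensor_counit_tmul,
      TensorProduct.sum_tmul, TensorProduct.tmul_sum]
    rw [Finset.sum_comm]
    refine Finset.sum_congr rfl fun s _ => Finset.sum_congr rfl fun t _ => ?_
    rw [← TensorProduct.tmul_smul, smul_eq_mul, ← mul_assoc, K.sg_mul_counit' (hb _)]
    simp only [LinearMap.flip_apply, TensorProduct.mk_apply, TensorProduct.smul_tmul_smul]
    rw [TensorProduct.smul_tmul, smul_eq_mul, mul_one]

end PreCoalg

variable {R C : Type*} [CommRing R] [AddCommGroup C] [Module R C]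

theorem ChainCoalg.laws (K : ChainCoalg R C) : K.toPreCoalg.Laws where
  d_deg := deg_of_mem K.d_mem K.d_zero
  comul_deg := fun n x hx => zgr_cast (i := n) (K.comul_mem n x hx) (by simp)
  counit_d := LinearMap.congr_fun K.counit_d
  rTensor_counit := K.rTensor_counit
  lTensor_counit := K.lTensor_counit

end

end CoHoch

namespace CoHoch

noncomputable section

open Grading

/-! ### Twisted differentials on `C ⊗ B` -/

namespace PreCoalg

section Twisted

variable {R C B : Type*} [CommRing R] [AddCommGroup C] [Module R C] [Ring B] [Algebra R B]
  (K : PreCoalg R C) (GB : Grading R B)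

/-- `x ⊗ b ↦ ∑ (-1)^{|x₍₁₎|} x₍₁₎ ⊗ p(x₍₂₎) b`. -/
def lft (p : C →ₗ[R] B) : C ⊗[R] B →ₗ[R] C ⊗[R] B :=
  LinearMap.lTensor C (LinearMap.mul' R B) ∘ₗ (TensorProduct.assoc R C B B).toLinearMap ∘ₗ
    LinearMap.rTensor B (TensorProduct.map K.sgn p ∘ₗ K.comul)

/-- `u ⊗ (x ⊗ b) ↦ ± x ⊗ b u`. -/
def rgtTail : B ⊗[R] (C ⊗[R] B) →ₗ[R] C ⊗[R] B :=
  LinearMap.lTensor C (LinearMap.mul' R B) ∘ₗ (TensorProduct.assoc R C B B).toLinearMap ∘ₗ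
    GB.swap (K.toGrading.tensor GB)

/-- `x ⊗ b ↦ ∑ ± x₍₂₎ ⊗ b q(x₍₁₎)`. -/
def rgt (q : C →ₗ[R] B) : C ⊗[R] B →ₗ[R] C ⊗[R] B :=
  K.rgtTail GB ∘ₗ (TensorProduct.assoc R B C B).toLinearMap ∘ₗ
    LinearMap.rTensor B (LinearMap.rTensor C q ∘ₗ K.comul)

/-- The differential on `C ⊗ B` twisted by `p` on the left and by `q` on the right. -/
def twD (dB : B →ₗ[R] B) (p q : C →ₗ[R] B) : C ⊗[R] B →ₗ[R] C ⊗[R] B :=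
  tensorD K.toGrading K.d dB - K.lft p + K.rgt GB q

/-- The differential of Ĥ(C) is the case of equal twists by s⁻¹. Independent left and right twists
and a general coefficient algebra are needed for the homotopy in the quasistrict case. -/
theorem hhD_eq_twD : K.hhD = K.twD K.cobarGrading K.cobarD K.sInv K.sInv := rfl

variable {K GB}

theorem lft_tmul {x : C} {T : Type*} [Fintype T] {a b : T → C} {p : T → ZMod 2}
    (ha : ∀ t, a t ∈ K.par (p t)) (hx : K.comul x = ∑ t, a t ⊗ₜ[R] b t) (f : C →ₗ[R] B) (w : B) :
    K.lft f (x ⊗ₜ w) = ∑ t, sg R (p t) • (a t ⊗ₜ[R] (f (b t) * w)) := by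
  simp only [lft, LinearMap.comp_apply, LinearMap.rTensor_tmul, hx, map_sum,
    TensorProduct.sum_tmul, TensorProduct.map_tmul]
  refine Finset.sum_congr rfl fun t _ => ?_
  simp [sgn_par (ha t), TensorProduct.smul_tmul']

theorem rgtTail_tmul {i j : ZMod 2} {u : B} {z : C ⊗[R] B} (hu : u ∈ GB.par i)
    (hz : z ∈ (K.toGrading.tensor GB).par j) :
    K.rgtTail GB (u ⊗ₜ z) = sg R (i * j) • (LinearMap.mulRight R u).lTensor C z := by
  simp only [rgtTail, LinearMap.comp_apply, swap_par hu hz, map_smul]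
  congr 1
  induction z using TensorProduct.induction_on with
  | zero => simp
  | tmul x y => simp
  | add x y hx hy =>
    have key : ∀ z : C ⊗[R] B, LinearMap.lTensor C (LinearMap.mul' R B)
        ((TensorProduct.assoc R C B B).toLinearMap (z ⊗ₜ u)) =
        (LinearMap.mulRight R u).lTensor C z := by
      intro z
      induction z using TensorProduct.induction_on with
      | zero => simp
      | tmul x y => simp
      | add x y hx hy => rw [TensorProduct.add_tmul, map_add, map_add, map_add, hx, hy]
    exact key _

/-- The parity δ of f is 1 for twisting maps and 0 for the gauge transformations that occur later.
-/
theorem rgt_tmul {x : C} {T : Type*} [Fintype T] {a b : T → C} {p q : T → ZMod 2}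
    (ha : ∀ t, a t ∈ K.par (p t)) (hb : ∀ t, b t ∈ K.par (q t))
    (hx : K.comul x = ∑ t, a t ⊗ₜ[R] b t) {f : C →ₗ[R] B} {δ : ZMod 2}
    (hf : ∀ i, ∀ x ∈ K.par i, f x ∈ GB.par (i + δ)) {w : B} {m : ZMod 2} (hw : w ∈ GB.par m) :
    K.rgt GB f (x ⊗ₜ w) =
      ∑ t, sg R ((p t + δ) * (q t + m)) • (b t ⊗ₜ[R] (w * f (a t))) := by
  simp only [rgt, LinearMap.comp_apply, LinearMap.rTensor_tmul, hx, map_sum,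
    TensorProduct.sum_tmul]
  refine Finset.sum_congr rfl fun t _ => ?_
  have := rgtTail_tmul (K := K) (hf _ _ (ha t)) (tmul_mem_par (hb t) hw)
  simpa using this

theorem twD_tmul {x : C} {n : ZMod 2} (hn : x ∈ K.par n) {T : Type*} [Fintype T]
    {a b : T → C} {p q : T → ZMod 2} (ha : ∀ t, a t ∈ K.par (p t)) (hb : ∀ t, b t ∈ K.par (q t))
    (hx : K.comul x = ∑ t, a t ⊗ₜ[R] b t) (dB : B →ₗ[R] B) (f : C →ₗ[R] B) {g : C →ₗ[R] B}
    (hg : ∀ i, ∀ x ∈ K.par i, g x ∈ GB.par (i + 1)) {w : B} {m : ZMod 2} (hw : w ∈ GB.par m) :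
    K.twD GB dB f g (x ⊗ₜ w) = K.d x ⊗ₜ w + sg R n • (x ⊗ₜ dB w) -
      ∑ t, sg R (p t) • (a t ⊗ₜ[R] (f (b t) * w)) +
      ∑ t, sg R ((p t + 1) * (q t + m)) • (b t ⊗ₜ[R] (w * g (a t))) := by
  rw [twD, LinearMap.add_apply, LinearMap.sub_apply, lft_tmul ha hx, rgt_tmul ha hb hx hg hw,
    tensorD_tmul_par _ _ hn]

end Twisted

/-! ### Rotation of words -/

variable {R C : Type*} [CommRing R] [AddCommGroup C] [Module R C] (K : PreCoalg R C)

theorem mark_one : K.mark 1 = 0 := wordRec_one _ _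

theorem mark_ι_mul (v : K.bar) (w : K.Cobar) :
    K.mark (TensorAlgebra.ι R v * w) = 1 ⊗ₜ (v ⊗ₜ w) +
      (LinearMap.mulLeft R (TensorAlgebra.ι R v)).rTensor _ (K.mark w) :=
  wordRec_ι_mul _ _ v w

theorem mark_deg : Deg K.cobarGrading (K.cobarGrading.tensor (K.barGrading.tensor K.cobarGrading))
    0 K.mark := by
  intro n w hw
  refine word_induction (G := K.barGrading)
    (p := fun n w => K.mark w ∈
      (K.cobarGrading.tensor (K.barGrading.tensor K.cobarGrading)).zgr (n + 0))
    (fun _ => by simp) (fun _ x y hx hy => by rw [map_add]; exact add_mem hx hy)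
    (fun _ r x hx => by rw [map_smul]; exact Submodule.smul_mem _ _ hx)
    (by simp [mark_one]) (fun m n v w hv hw ih => ?_) hw
  rw [mark_ι_mul]
  refine add_mem ?_ ?_
  · exact zgr_cast (tmul_mem_zgr CoHoch.one_mem_zgr (tmul_mem_zgr (mem_zgr_natCast.mpr hv)
      (mem_zgr_natCast.mpr hw))) (by push_cast; ring)
  · have : Deg K.cobarGrading K.cobarGrading m (LinearMap.mulLeft R (TensorAlgebra.ι R v)) :=
      fun k x hx => zgr_cast (mul_mem_zgr (ι_mem_zgr (mem_zgr_natCast.mpr hv))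
        (mem_zgr_natCast.mpr hx)) (by ring)
    exact zgr_cast (this.rTensor.apply ih) (by push_cast; ring)

/-- The part of `rotate` that follows the marking of a letter. -/
def rotateTail : (K.Cobar ⊗[R] (K.bar ⊗[R] K.Cobar)) ⊗[R] K.Cobar →ₗ[R] K.CoHH :=
  TensorProduct.map (LinearMap.ker K.counit).subtype (LinearMap.mul' R K.Cobar) ∘ₗ
    (TensorProduct.assoc R K.bar K.Cobar K.Cobar).toLinearMap ∘ₗ
    K.cobarGrading.swap (K.barGrading.tensor K.cobarGrading) ∘ₗ
    LinearMap.lTensor K.Cobar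
      (LinearMap.lTensor K.bar (LinearMap.mul' R K.Cobar) ∘ₗ
        (TensorProduct.assoc R K.bar K.Cobar K.Cobar).toLinearMap) ∘ₗ
    (TensorProduct.assoc R K.Cobar (K.bar ⊗[R] K.Cobar) K.Cobar).toLinearMap

theorem rotate_eq (a b : K.Cobar) : K.rotate (a ⊗ₜ b) = K.rotateTail (K.mark a ⊗ₜ b) := rfl

variable {K}

theorem map_swap_tmul {V B : Type*} [AddCommGroup V] [Module R V] [Ring B] [Algebra R B]
    {GV : Grading R V} {GB : Grading R B} (s : V →ₗ[R] C) {i j k l : ZMod 2} {a : B} {v : V}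
    (ha : a ∈ GB.par i) (hv : v ∈ GV.par j) (c b : B) (hcb : c * b ∈ GB.par (k + l)) :
    (TensorProduct.map s (LinearMap.mul' R B) ∘ₗ (TensorProduct.assoc R V B B).toLinearMap ∘ₗ
      GB.swap (GV.tensor GB) ∘ₗ LinearMap.lTensor B (LinearMap.lTensor V (LinearMap.mul' R B) ∘ₗ
        (TensorProduct.assoc R V B B).toLinearMap) ∘ₗ
      (TensorProduct.assoc R B (V ⊗[R] B) B).toLinearMap) ((a ⊗ₜ (v ⊗ₜ c)) ⊗ₜ b) =
      sg R (i * (j + (k + l))) • (s v ⊗ₜ[R] (c * b * a)) := by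
  have := swap_par ha (tmul_mem_par hv hcb)
  simp [this]

theorem rotateTail_tmul {i j k l : ZMod 2} {a c b : K.Cobar} {v : K.bar}
    (ha : a ∈ K.cobarGrading.par i) (hv : v ∈ K.barGrading.par j) (hc : c ∈ K.cobarGrading.par k)
    (hb : b ∈ K.cobarGrading.par l) :
    K.rotateTail ((a ⊗ₜ (v ⊗ₜ c)) ⊗ₜ b) =
      sg R (i * (j + (k + l))) • ((v : C) ⊗ₜ[R] (c * b * a)) := by
  exact map_swap_tmul (LinearMap.ker K.counit).subtype ha hv c b (mul_mem_par hc hb)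

/-- Everything in front of the marked letter is carried to the far end. A prefix u may thus be
appended to b beforehand, with the sign of passing all the rest. -/
theorem rotateTail_mul {i j k : ZMod 2} {u b : K.Cobar}
    {z : K.Cobar ⊗[R] (K.bar ⊗[R] K.Cobar)} (hu : u ∈ K.cobarGrading.par i)
    (hz : z ∈ (K.cobarGrading.tensor (K.barGrading.tensor K.cobarGrading)).par j)
    (hb : b ∈ K.cobarGrading.par k) :
    K.rotateTail ((LinearMap.mulLeft R u).rTensor _ z ⊗ₜ b) =
      sg R (i * (j + k)) • K.rotateTail (z ⊗ₜ (b * u)) := by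
  obtain ⟨n, a, y, p, q, ha, hy, hj, rfl⟩ := exists_sum_of_mem_par hz
  simp only [map_sum, TensorProduct.sum_tmul, Finset.smul_sum]
  refine Finset.sum_congr rfl fun t _ => ?_
  obtain ⟨n', v, c, p', q', hv, hc, hj', h⟩ := exists_sum_of_mem_par (hy t)
  simp only [h, map_sum, TensorProduct.sum_tmul, TensorProduct.tmul_sum, Finset.smul_sum]
  refine Finset.sum_congr rfl fun s _ => ?_
  rw [LinearMap.rTensor_tmul, LinearMap.mulLeft_apply,
    rotateTail_tmul (mul_mem_par hu (ha t)) (hv s) (hc s) hb,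
    rotateTail_tmul (ha t) (hv s) (hc s) (mul_mem_par hb hu), hj t, hj' s]
  simp only [mul_assoc, smul_smul]
  congr 1
  simp only [sg_add, sg_mul_add, sg_add_mul, mul_comm, mul_left_comm, mul_assoc, sg_sq_left]

theorem rotate_one (b : K.Cobar) : K.rotate (1 ⊗ₜ b) = 0 := by
  rw [rotate_eq, mark_one, TensorProduct.zero_tmul, map_zero]

theorem rotate_ι_mul {i j k : ZMod 2} {v : K.bar} {a b : K.Cobar} (hv : v ∈ K.barGrading.par i)
    (ha : a ∈ K.cobarGrading.par j) (hb : b ∈ K.cobarGrading.par k) :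
    K.rotate ((TensorAlgebra.ι R v * a) ⊗ₜ b) = (v : C) ⊗ₜ (a * b) +
      sg R (i * (j + k)) • K.rotate (a ⊗ₜ (b * TensorAlgebra.ι R v)) := by
  rw [rotate_eq, mark_ι_mul, TensorProduct.add_tmul, map_add,
    rotateTail_tmul CoHoch.one_mem_par hv ha hb, rotateTail_mul (ι_mem_par hv)
    (K.mark_deg.par_zero ha) hb, zero_mul, sg_zero, one_smul, mul_one, rotate_eq]

theorem rotate_ι (v : K.bar) (b : K.Cobar) :
    K.rotate (TensorAlgebra.ι R v ⊗ₜ b) = (v : C) ⊗ₜ b := by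
  induction v using K.barGrading.parity_induction with
  | hg i v hv =>
    induction b using K.cobarGrading.parity_induction with
    | hg j b hb =>
      have := rotate_ι_mul hv CoHoch.one_mem_par hb
      rwa [mul_one, one_mul, rotate_one, smul_zero, add_zero] at this
    | ha x y hx hy => rw [TensorProduct.tmul_add, map_add, hx, hy, TensorProduct.tmul_add]
  | ha x y hx hy => rw [map_add, TensorProduct.add_tmul, map_add, hx, hy, Submodule.coe_add,
      TensorProduct.add_tmul]

/-- A one-letter word has nothing to rotate. The correction appears because s⁻¹ only sees x - ε(x)1.
-/
theorem rotate_sInv (x : C) (b : K.Cobar) :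
    K.rotate (K.sInv x ⊗ₜ b) = x ⊗ₜ b - K.counit x • K.hhIncl b := by
  rw [sInv, LinearMap.comp_apply, rotate_ι, proj_coe, TensorProduct.sub_tmul,
    ← TensorProduct.smul_tmul']
  rfl

/-- The cyclic cocycle property of the rotation. -/
theorem rotate_mul {i j k : ZMod 2} {a b w : K.Cobar} (ha : a ∈ K.cobarGrading.par i)
    (hb : b ∈ K.cobarGrading.par j) (hw : w ∈ K.cobarGrading.par k) :
    K.rotate ((a * b) ⊗ₜ w) = K.rotate (a ⊗ₜ (b * w)) +
      sg R (i * (j + k)) • K.rotate (b ⊗ₜ (w * a)) := by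
  refine word_par_induction (G := K.barGrading) (p := fun i a => ∀ k, ∀ w ∈ K.cobarGrading.par k,
    K.rotate ((a * b) ⊗ₜ w) = K.rotate (a ⊗ₜ (b * w)) +
      sg R (i * (j + k)) • K.rotate (b ⊗ₜ (w * a))) ?_ ?_ ?_ ?_ ?_ ha k w hw
  · simp
  · intro i x y hx hy k w hw
    simp only [add_mul, TensorProduct.add_tmul, map_add, mul_add, TensorProduct.tmul_add,
      smul_add, hx k w hw, hy k w hw]
    abel
  · intro i r x hx k w hw
    simp only [smul_mul_assoc, mul_smul_comm, TensorProduct.tmul_smul, ← TensorProduct.smul_tmul',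
      map_smul, hx k w hw, smul_add]
    rw [smul_comm r]
  · intro k w hw
    simp [rotate_one, sg_zero]
  · intro i l v a hv ha ih k w hw
    rw [mul_assoc, rotate_ι_mul hv (mul_mem_par ha hb) hw,
      rotate_ι_mul hv ha (mul_mem_par hb hw), ih _ _ (mul_mem_par hw (ι_mem_par hv))]
    simp only [mul_assoc]
    match_scalars <;>
    simp only [sg_add, sg_mul_add, sg_add_mul, mul_comm, mul_left_comm, mul_assoc, sg_sq_left,
      mul_one]

theorem rotate_deg :
    Deg (K.cobarGrading.tensor K.cobarGrading) K.hhGrading 1 K.rotate := by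
  have h : Deg ((K.cobarGrading.tensor (K.barGrading.tensor K.cobarGrading)).tensor
      K.cobarGrading) K.hhGrading 1 K.rotateTail := by
    refine Deg.comp (k := 0) (l := 1) (K.subtype_deg.map mul'_deg (by norm_num)) ?_ (by norm_num)
    refine Deg.assoc.comp (k := 0) ?_ (by norm_num)
    refine Deg.swap.comp (k := 0) ?_ (by norm_num)
    refine Deg.comp (k := 0) (l := 0) ?_ Deg.assoc (by norm_num)
    exact (mul'_deg.lTensor.comp Deg.assoc (by norm_num)).lTensor
  exact h.comp K.mark_deg.rTensor (by norm_num)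

/-- Both twisting terms of 1 ⊗ w contain s⁻¹1 = 0 up to the choice of sign, and d1 = 0; hence Ω C is
a subcomplex. -/
theorem Laws.hhD_hhIncl (h : K.Laws) (w : K.Cobar) : K.hhD (K.hhIncl w) = K.hhIncl (K.cobarD w) := by
  have h1 : K.comul K.one = ∑ _t : Fin 1, K.one ⊗ₜ[R] K.one := by simp [h.comul_one]
  induction w using K.cobarGrading.parity_induction with
  | hg j w hw =>
    rw [hhD_eq_twD, hhIncl, TensorProduct.mk_apply, twD_tmul K.one_mem_par
      (fun _ => K.one_mem_par) (fun _ => K.one_mem_par) h1 _ _ (fun _ _ => K.sInv_mem_par) hw]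
    simp [h.d_one, sInv_one, sg_zero]
  | ha x y hx hy => simp only [map_add, hx, hy]

/-- The differential of `Ĥ(C)` in terms of rotations of the differential of `Ω C`. -/
theorem Laws.hhD_tmul (h : K.Laws) {n m : ZMod 2} {x : C} {w : K.Cobar} (hx : x ∈ K.par n)
    (hw : w ∈ K.cobarGrading.par m) :
    K.hhD (x ⊗ₜ w) = -K.rotate (K.cobarGen x ⊗ₜ w) + sg R n • (x ⊗ₜ K.cobarD w) -
      K.hhIncl (K.sInv x * w) + sg R ((n + 1) * m) • K.hhIncl (w * K.sInv x) := by
  obtain ⟨k, a, b, p, q, ha, hb, hn, hx', hl, hr⟩ := h.sweedler hx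
  have e1 : K.hhIncl (K.sInv x * w) = ∑ t, K.counit (a t) • K.hhIncl (K.sInv (b t) * w) := by
    conv_lhs => rw [← hl]
    simp [Finset.sum_mul]
  have e2 : K.hhIncl (w * K.sInv x) = ∑ t, K.counit (b t) • K.hhIncl (w * K.sInv (a t)) := by
    conv_lhs => rw [← hr]
    simp [Finset.mul_sum]
  have e3 : K.cobarGen x = -K.sInv (K.d x) + ∑ t, sg R (p t) • (K.sInv (a t) * K.sInv (b t)) := by
    simp only [cobarGen, LinearMap.add_apply, LinearMap.neg_apply, LinearMap.comp_apply, hx',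
      map_sum, TensorProduct.map_tmul, LinearMap.mul'_apply]
    simp [sgn_par (ha _)]
  rw [hhD_eq_twD, twD_tmul hx ha hb hx' _ _ (fun _ _ => K.sInv_mem_par) hw, e1, e2, e3]
  simp only [TensorProduct.add_tmul, TensorProduct.sum_tmul, TensorProduct.neg_tmul, map_add,
    map_neg, map_sum, rotate_sInv, h.counit_d, zero_smul, sub_zero, ← TensorProduct.smul_tmul',
    map_smul, rotate_mul (K.sInv_mem_par (ha _)) (K.sInv_mem_par (hb _)) hw]
  -- The identity already holds for each Sweedler summand. The terms with a counit are the
  -- corrections from `rotate_sInv`; they cancel the two inclusions of Ω C because a surviving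
  -- ε(x₍ᵢ₎) forces x₍ᵢ₎ to be even, which is why only the parity of x₍₂₎ is split.
  have key := Finset.sum_congr (rfl : (Finset.univ : Finset (Fin k)) = _) fun t _ =>
    show -(sg R (p t) • (a t ⊗ₜ[R] (K.sInv (b t) * w))) +
        sg R ((p t + 1) * (q t + m)) • (b t ⊗ₜ[R] (w * K.sInv (a t))) =
      -(sg R (p t) • (a t ⊗ₜ[R] (K.sInv (b t) * w) -
          K.counit (a t) • K.hhIncl (K.sInv (b t) * w) + sg R ((p t + 1) * (q t + 1 + m)) •
          (b t ⊗ₜ[R] (w * K.sInv (a t)) - K.counit (b t) • K.hhIncl (w * K.sInv (a t))))) -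
        K.counit (a t) • K.hhIncl (K.sInv (b t) * w) +
        sg R ((n + 1) * m) • K.counit (b t) • K.hhIncl (w * K.sInv (a t)) by
      have ea := K.sg_counit (ha t)
      have eb := K.counit_of_odd (x := b t)
      have hb := hb t
      rw [hn t]
      have e := sg_sq (R := R) (p t)
      rcases zmod_two_cases (q t) with hq | hq
      · rw [hq]
        match_scalars <;>
        try simp only [sg_add, sg_mul_add, sg_add_mul, sg_one, sg_mul_one, sg_one_mul, sg_mul_zero,
          sg_zero_mul]
        all_goals grind
      · rw [eb (hq ▸ hb), hq]
        match_scalars <;>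
        try simp only [sg_add, sg_mul_add, sg_add_mul, sg_one, sg_mul_one, sg_one_mul]
        all_goals grind
  simp only [Finset.sum_add_distrib, Finset.sum_sub_distrib, Finset.sum_neg_distrib,
    smul_add, smul_sub, Finset.smul_sum] at key ⊢
  linear_combination (norm := module) key

end PreCoalg

end

end CoHoch

namespace CoHoch

noncomputable section

open Grading

/-! ### Sign operators and maps of homogeneous parity. -/

namespace Grading

variable {R M N : Type*} [CommRing R] [AddCommGroup M] [Module R M] [AddCommGroup N] [Module R N]
  {G : Grading R M} {H : Grading R N}

theorem sgn_sgn : G.sgn ∘ₗ G.sgn = LinearMap.id := by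
  refine LinearMap.ext fun x => ?_
  induction x using G.parity_induction with
  | hg i x hx => simp [sgn_par hx, smul_smul, sg_sq]
  | ha x y hx hy => rw [map_add, map_add, hx, hy]

theorem Deg.comp_sgn_of_odd {f : M →ₗ[R] N} (hf : ∀ i, ∀ x ∈ G.par i, f x ∈ H.par (i + 1)) :
    H.sgn ∘ₗ f = -(f ∘ₗ G.sgn) := by
  refine LinearMap.ext fun x => ?_
  induction x using G.parity_induction with
  | hg i x hx => simp [sgn_par hx, sgn_par (hf _ _ hx), sg_add, sg_one]
  | ha x y hx hy => rw [map_add, map_add, hx, hy]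

theorem Deg.comp_sgn_of_even {f : M →ₗ[R] N} (hf : ∀ i, ∀ x ∈ G.par i, f x ∈ H.par i) :
    H.sgn ∘ₗ f = f ∘ₗ G.sgn := by
  refine LinearMap.ext fun x => ?_
  induction x using G.parity_induction with
  | hg i x hx => simp [sgn_par hx, sgn_par (hf _ _ hx)]
  | ha x y hx hy => rw [map_add, map_add, hx, hy]

theorem tensor_sgn : (G.tensor H).sgn = TensorProduct.map G.sgn H.sgn :=
  tensor_ext G H fun i j x hx y hy => by
    rw [sgn_par (tmul_mem_par hx hy), TensorProduct.map_tmul, sgn_par hx, sgn_par hy,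
      TensorProduct.smul_tmul_smul, sg_add]

end Grading

namespace PreCoalg

/-! ### Convolution -/

section Convolution

variable {R C B : Type*} [CommRing R] [AddCommGroup C] [Module R C] [Ring B] [Algebra R B]
  (K : PreCoalg R C)

/-- The convolution product of linear maps `C → B`, without signs. -/
def cv (p q : C →ₗ[R] B) : C →ₗ[R] B := LinearMap.mul' R B ∘ₗ TensorProduct.map p q ∘ₗ K.comul

/-- The unit of the convolution product. -/
def cvOne : C →ₗ[R] B := Algebra.linearMap R B ∘ₗ K.counit

variable {K}

theorem cv_apply {p q : C →ₗ[R] B} {x : C} {T : Type*} [Fintype T]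
    {a b : T → C}
    (hx : K.comul x = ∑ t, a t ⊗ₜ[R] b t) : K.cv p q x = ∑ t, p (a t) * q (b t) := by
  simp [cv, hx, map_sum]

theorem cv_add_left (p p' q : C →ₗ[R] B) : K.cv (p + p') q = K.cv p q + K.cv p' q := by
  simp only [cv, TensorProduct.map_add_left, LinearMap.add_comp, LinearMap.comp_add]

theorem cv_add_right (p q q' : C →ₗ[R] B) : K.cv p (q + q') = K.cv p q + K.cv p q' := by
  simp only [cv, TensorProduct.map_add_right, LinearMap.add_comp, LinearMap.comp_add]

theorem cv_neg_left (p q : C →ₗ[R] B) : K.cv (-p) q = -K.cv p q := by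
  rw [eq_neg_iff_add_eq_zero, ← cv_add_left, neg_add_cancel]; simp [cv]

theorem cv_neg_right (p q : C →ₗ[R] B) : K.cv p (-q) = -K.cv p q := by
  rw [eq_neg_iff_add_eq_zero, ← cv_add_right, neg_add_cancel]; simp [cv]

theorem cv_sub_left (p p' q : C →ₗ[R] B) : K.cv (p - p') q = K.cv p q - K.cv p' q := by
  rw [sub_eq_add_neg, cv_add_left, cv_neg_left, ← sub_eq_add_neg]

theorem cv_sub_right (p q q' : C →ₗ[R] B) : K.cv p (q - q') = K.cv p q - K.cv p q' := by
  rw [sub_eq_add_neg, cv_add_right, cv_neg_right, ← sub_eq_add_neg]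

theorem Laws.cvOne_cv (h : K.Laws) (p : C →ₗ[R] B) : K.cv K.cvOne p = p := by
  refine LinearMap.ext fun x => ?_
  induction x using K.toGrading.parity_induction with
  | hg i x hx =>
    obtain ⟨k, a, b, -, -, -, -, -, hx', hl, -⟩ := h.sweedler hx
    rw [cv_apply hx']
    conv_rhs => rw [← hl]
    simp [cvOne, Algebra.smul_def]
  | ha x y hx hy => rw [map_add, map_add, hx, hy]

theorem Laws.cv_cvOne (h : K.Laws) (p : C →ₗ[R] B) : K.cv p K.cvOne = p := by
  refine LinearMap.ext fun x => ?_
  induction x using K.toGrading.parity_induction with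
  | hg i x hx =>
    obtain ⟨k, a, b, -, -, -, -, -, hx', -, hr⟩ := h.sweedler hx
    rw [cv_apply hx']
    conv_rhs => rw [← hr]
    simp [cvOne, Algebra.smul_def, Algebra.commutes]
  | ha x y hx hy => rw [map_add, map_add, hx, hy]

theorem Laws.cv_sgn (h : K.Laws) (p q : C →ₗ[R] B) :
    K.cv p q ∘ₗ K.sgn = K.cv (p ∘ₗ K.sgn) (q ∘ₗ K.sgn) := by
  have := Deg.comp_sgn_of_even (G := K.toGrading) (H := K.toGrading.tensor K.toGrading)
    (f := K.comul) fun i x hx => h.comul_deg.par_zero hx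
  rw [tensor_sgn] at this
  rw [cv, LinearMap.comp_assoc, LinearMap.comp_assoc, ← this, cv, TensorProduct.map_comp]
  rfl

theorem cv_derivation {GB : Grading R B} {dB : B →ₗ[R] B}
    (hB : ∀ a b, dB (a * b) = dB a * b + GB.sgn a * dB b) (p q : C →ₗ[R] B) :
    dB ∘ₗ K.cv p q = K.cv (dB ∘ₗ p) q + K.cv (GB.sgn ∘ₗ p) (dB ∘ₗ q) := by
  have : dB ∘ₗ LinearMap.mul' R B ∘ₗ TensorProduct.map p q =
      LinearMap.mul' R B ∘ₗ TensorProduct.map (dB ∘ₗ p) q +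
      LinearMap.mul' R B ∘ₗ TensorProduct.map (GB.sgn ∘ₗ p) (dB ∘ₗ q) :=
    TensorProduct.ext' fun x y => by simp [hB]
  simp only [cv, ← LinearMap.comp_assoc] at this ⊢
  rw [this, LinearMap.add_comp]

end Convolution

end PreCoalg

variable {R C : Type*} [CommRing R] [AddCommGroup C] [Module R C]

/-! ### Convolution on chain coalgebras; the cobar differential squares to zero. -/

namespace ChainCoalg

variable {B : Type*} [Ring B] [Algebra R B] (K : ChainCoalg R C)

/-- Coassociativity of K together with associativity of B. No signs arise because `cv` carries none;
Koszul signs are inserted by hand through `sgn`. -/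
theorem cv_assoc (p q r : C →ₗ[R] B) : K.cv (K.cv p q) r = K.cv p (K.cv q r) := by
  have e1 : K.cv (K.cv p q) r = LinearMap.mul' R B ∘ₗ
      TensorProduct.map p (LinearMap.mul' R B ∘ₗ TensorProduct.map q r) ∘ₗ
      (TensorProduct.assoc R C C C).toLinearMap ∘ₗ K.comul.rTensor C ∘ₗ K.comul := by
    have : LinearMap.mul' R B ∘ₗ TensorProduct.map (LinearMap.mul' R B ∘ₗ TensorProduct.map p q) r =
        LinearMap.mul' R B ∘ₗ TensorProduct.map p (LinearMap.mul' R B ∘ₗ TensorProduct.map q r) ∘ₗ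
        (TensorProduct.assoc R C C C).toLinearMap :=
      TensorProduct.ext_threefold fun x y z => by simp [mul_assoc]
    rw [PreCoalg.cv, PreCoalg.cv,
      show TensorProduct.map (LinearMap.mul' R B ∘ₗ TensorProduct.map p q ∘ₗ K.comul) r =
        TensorProduct.map (LinearMap.mul' R B ∘ₗ TensorProduct.map p q) r ∘ₗ K.comul.rTensor C by
        rw [LinearMap.rTensor, ← TensorProduct.map_comp, LinearMap.comp_id, LinearMap.comp_assoc]]
    rw [LinearMap.comp_assoc, ← LinearMap.comp_assoc, this]
    rfl
  rw [e1, K.coassoc, PreCoalg.cv, PreCoalg.cv,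
    show TensorProduct.map p (LinearMap.mul' R B ∘ₗ TensorProduct.map q r ∘ₗ K.comul) =
      TensorProduct.map p (LinearMap.mul' R B ∘ₗ TensorProduct.map q r) ∘ₗ K.comul.lTensor C by
      rw [LinearMap.lTensor, ← TensorProduct.map_comp, LinearMap.comp_id, LinearMap.comp_assoc]]
  rfl

theorem cv_comp_d (p q : C →ₗ[R] B) :
    K.cv p q ∘ₗ K.d = K.cv (p ∘ₗ K.d) q + K.cv (p ∘ₗ K.sgn) (q ∘ₗ K.d) := by
  have e1 : TensorProduct.map p q ∘ₗ TensorProduct.map K.d LinearMap.id =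
      TensorProduct.map (p ∘ₗ K.d) q := by rw [← TensorProduct.map_comp, LinearMap.comp_id]
  have e2 : TensorProduct.map p q ∘ₗ TensorProduct.map K.sgn K.d =
      TensorProduct.map (p ∘ₗ K.sgn) (q ∘ₗ K.d) := by rw [← TensorProduct.map_comp]
  rw [PreCoalg.cv, LinearMap.comp_assoc, LinearMap.comp_assoc, K.comul_d, tensorD,
    ← LinearMap.comp_assoc K.comul, LinearMap.comp_add, e1, e2,
    LinearMap.add_comp, LinearMap.comp_add]
  rfl

theorem d_sgn : K.d ∘ₗ K.sgn = -(K.sgn ∘ₗ K.d) := by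
  rw [Deg.comp_sgn_of_odd fun i x hx => K.laws.d_deg.par_neg_one hx, neg_neg]

/-- On letters, t = s⁻¹ satisfies dt = -td + (t sgn) ⋆ t. Applying d once more and using d² = 0 on
C, the Leibniz rule and associativity of ⋆, all terms cancel in pairs. On products, d² is a
derivation because d anticommutes with `sgn`. -/
theorem cobarD_cobarD (w : K.Cobar) : K.cobarD (K.cobarD w) = 0 := by
  have hs : K.cobarD ∘ₗ K.cobarGrading.sgn = -(K.cobarGrading.sgn ∘ₗ K.cobarD) := by
    rw [Deg.comp_sgn_of_odd fun i x hx => K.laws.cobarD_deg.par_neg_one hx, neg_neg]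
  have ht : K.cobarD ∘ₗ K.sInv = -(K.sInv ∘ₗ K.d) + K.cv (K.sInv ∘ₗ K.sgn) K.sInv :=
    LinearMap.ext K.laws.cobarD_sInv
  have hst : K.cobarGrading.sgn ∘ₗ K.sInv ∘ₗ K.sgn = -K.sInv := by
    rw [← LinearMap.comp_assoc, Deg.comp_sgn_of_odd fun i x hx => K.sInv_mem_par hx,
      LinearMap.neg_comp, LinearMap.comp_assoc, sgn_sgn, LinearMap.comp_id]
  have hgen : K.cobarD ∘ₗ K.cobarD ∘ₗ K.sInv = 0 := by
    have hdd : K.sInv ∘ₗ K.d ∘ₗ K.d = 0 := by rw [K.d_comp_d, LinearMap.comp_zero]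
    have hsd : K.sInv ∘ₗ K.sgn ∘ₗ K.d = -(K.sInv ∘ₗ K.d ∘ₗ K.sgn) := by
      rw [K.d_sgn, LinearMap.comp_neg, neg_neg]
    have h1 : K.cobarD ∘ₗ K.sInv ∘ₗ K.d =
        -K.cv (K.sInv ∘ₗ K.d ∘ₗ K.sgn) K.sInv + K.cv K.sInv (K.sInv ∘ₗ K.d) := by
      rw [← LinearMap.comp_assoc, ht, LinearMap.add_comp, LinearMap.neg_comp,
        LinearMap.comp_assoc, hdd, neg_zero, zero_add, cv_comp_d, LinearMap.comp_assoc, hsd,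
        LinearMap.comp_assoc, sgn_sgn, LinearMap.comp_id, PreCoalg.cv_neg_left]
    have h2 : K.cobarD ∘ₗ K.sInv ∘ₗ K.sgn =
        -(K.sInv ∘ₗ K.d ∘ₗ K.sgn) + K.cv K.sInv (K.sInv ∘ₗ K.sgn) := by
      rw [← LinearMap.comp_assoc, ht, LinearMap.add_comp, LinearMap.neg_comp,
        LinearMap.comp_assoc, K.laws.cv_sgn, LinearMap.comp_assoc, sgn_sgn, LinearMap.comp_id]
    rw [ht, LinearMap.comp_add, LinearMap.comp_neg, h1,
      PreCoalg.cv_derivation (GB := K.cobarGrading) K.cobarD_mul, h2, hst, ht]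
    simp only [PreCoalg.cv_add_left, PreCoalg.cv_add_right, PreCoalg.cv_neg_left,
      PreCoalg.cv_neg_right, cv_assoc]
    abel
  induction w using TensorAlgebra.induction with
  | algebraMap r =>
    rw [Algebra.algebraMap_eq_smul_one, map_smul, PreCoalg.cobarD_one, smul_zero, map_zero]
  | ι v =>
    rw [← PreCoalg.sInv_bar]
    exact LinearMap.congr_fun hgen _
  | mul a b ha hb =>
    have h1 := LinearMap.congr_fun hs a
    have h2 := LinearMap.congr_fun (sgn_sgn (G := K.cobarGrading)) a
    simp only [LinearMap.comp_apply, LinearMap.neg_apply, LinearMap.id_apply] at h1 h2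
    rw [PreCoalg.cobarD_mul, map_add, PreCoalg.cobarD_mul, PreCoalg.cobarD_mul, ha, hb, h1, h2]
    noncomm_ring
  | add a b ha hb => rw [map_add, map_add, ha, hb, add_zero]

end ChainCoalg

end

end CoHoch

namespace CoHoch

noncomputable section

open Grading

/-! ### The coHochschild differential on rotations, and its square. -/

namespace PreCoalg

variable {R C D E B : Type*} [CommRing R] [AddCommGroup C] [Module R C] [AddCommGroup D]
  [Module R D] [AddCommGroup E] [Module R E] {K : PreCoalg R C} {L : PreCoalg R D}
  {P : PreCoalg R E}

/-- The differential of a rotation. -/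
theorem Laws.hhD_rotate (h : K.Laws) {i j : ZMod 2} {a b : K.Cobar}
    (ha : a ∈ K.cobarGrading.par i) (hb : b ∈ K.cobarGrading.par j) :
    K.hhD (K.rotate (a ⊗ₜ b)) = -K.rotate (K.cobarD a ⊗ₜ b) -
      sg R i • K.rotate (a ⊗ₜ K.cobarD b) - K.hhIncl (a * b) +
      sg R (i * j) • K.hhIncl (b * a) := by
  have hD : ∀ {i : ZMod 2} {a : K.Cobar}, a ∈ K.cobarGrading.par i →
      K.cobarD a ∈ K.cobarGrading.par (i + 1) := fun ha => h.cobarD_deg.par_neg_one ha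
  refine word_par_induction (G := K.barGrading) (p := fun i a => ∀ j, ∀ b ∈ K.cobarGrading.par j,
    K.hhD (K.rotate (a ⊗ₜ b)) = -K.rotate (K.cobarD a ⊗ₜ b) -
      sg R i • K.rotate (a ⊗ₜ K.cobarD b) - K.hhIncl (a * b) +
      sg R (i * j) • K.hhIncl (b * a)) ?_ ?_ ?_ ?_ ?_ ha j b hb
  · simp
  · intro i x y hx hy j b hb
    simp only [TensorProduct.add_tmul, map_add, hx j b hb, hy j b hb, add_mul, mul_add, smul_add]
    abel
  · intro i r x hx j b hb
    simp only [← TensorProduct.smul_tmul', map_smul, hx j b hb, smul_mul_assoc, mul_smul_comm,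
      smul_add, smul_sub, smul_neg, smul_comm r]
  · intro j b hb
    simp [rotate_one, cobarD_one, sg_zero]
  · intro i j v a hv ha ih k b hb
    -- For a single letter the formula is a restatement of `hhD_tmul`. The induction then uses the
    -- cyclic Leibniz rule on both sides; the inclusion term 1 ⊗ abv produced by the first rotation
    -- is cancelled by the one from the second.
    have base : ∀ k, ∀ b ∈ K.cobarGrading.par k,
        K.hhD (K.rotate (TensorAlgebra.ι R v ⊗ₜ b)) =
        -K.rotate (K.cobarD (TensorAlgebra.ι R v) ⊗ₜ b) -
        sg R i • K.rotate (TensorAlgebra.ι R v ⊗ₜ K.cobarD b) -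
        K.hhIncl (TensorAlgebra.ι R v * b) +
        sg R (i * k) • K.hhIncl (b * TensorAlgebra.ι R v) := by
      intro k b hb
      rw [rotate_ι, h.hhD_tmul (coe_mem_par K hv) hb, cobarD_ι, rotate_ι, sInv_bar]
      match_scalars <;> simp [sg_add, sg_mul_add, sg_add_mul, sg_one, sg_one_mul, sg_sq, mul_assoc]
    have hι := ι_mem_par hv
    rw [rotate_mul hι ha hb, map_add, map_smul, base _ _ (mul_mem_par ha hb),
      ih _ _ (mul_mem_par hb hι), cobarD_mul_par hι a, cobarD_mul_par ha b, cobarD_mul_par hb]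
    simp only [TensorProduct.add_tmul, TensorProduct.tmul_add, map_add,
      ← TensorProduct.smul_tmul', TensorProduct.tmul_smul, map_smul,
      rotate_mul hι (hD ha) hb, rotate_mul (hD hι) ha hb, rotate_mul hι ha (hD hb), mul_assoc]
    generalize TensorAlgebra.ι R v = x
    match_scalars <;>
    simp only [sg_add, sg_mul_add, sg_add_mul, sg_mul_one, sg_one_mul, sg_one, sg_sq, sg_sq_left,
      mul_comm, mul_left_comm, mul_assoc, mul_neg, neg_mul, mul_one, neg_neg] <;>
    ring

/-! ### Twisting maps and the associated maps into `Ĥ` -/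

/-- `p : C → B` is a twisting map: `d p + p d = p ⋆ p`. -/
structure IsTwisting [Ring B] [Algebra R B] (K : PreCoalg R C) (GB : Grading R B) (dB : B →ₗ[R] B)
    (p : C →ₗ[R] B) : Prop where
  odd : ∀ i, ∀ x ∈ K.par i, p x ∈ GB.par (i + 1)
  d_comp : dB ∘ₗ p = -(p ∘ₗ K.d) + K.cv (p ∘ₗ K.sgn) p

theorem Laws.isTwisting_sInv (h : K.Laws) :
    K.IsTwisting K.cobarGrading K.cobarD K.sInv where
  odd _ _ := K.sInv_mem_par
  d_comp := LinearMap.ext h.cobarD_sInv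

theorem IsTwisting.comp_algHom {p : C →ₗ[R] K.Cobar}
    (hp : K.IsTwisting K.cobarGrading K.cobarD p) {ω : K.Cobar →ₐ[R] L.Cobar}
    (hω : IsChainMap K.cobarGrading K.cobarD L.cobarGrading L.cobarD ω.toLinearMap) :
    K.IsTwisting L.cobarGrading L.cobarD (ω.toLinearMap ∘ₗ p) where
  odd i x hx := Deg.par_zero (hasDegree_iff.mp hω.degree) (hp.odd i x hx)
  d_comp := by
    rw [← LinearMap.comp_assoc, ← hω.comm, LinearMap.comp_assoc, hp.d_comp, LinearMap.comp_add,
      LinearMap.comp_neg]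
    have : LinearMap.mul' R L.Cobar ∘ₗ TensorProduct.map ω.toLinearMap ω.toLinearMap =
        ω.toLinearMap ∘ₗ LinearMap.mul' R K.Cobar := TensorProduct.ext' fun x y => by simp
    simp only [cv, LinearMap.comp_assoc, TensorProduct.map_comp]
    simp only [← LinearMap.comp_assoc, this]

/-- The map `C ⊗ Ω D → Ĥ(D)`, `x ⊗ b ↦ ε(x) 1 ⊗ b + rotate (p x ⊗ b)`. -/
def gam (K : PreCoalg R C) (L : PreCoalg R D) (p : C →ₗ[R] L.Cobar) :
    C ⊗[R] L.Cobar →ₗ[R] L.CoHH :=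
  TensorProduct.map (K.counit.smulRight L.one) LinearMap.id +
    L.rotate ∘ₗ TensorProduct.map p LinearMap.id

theorem gam_tmul (p : C →ₗ[R] L.Cobar) (x : C) (b : L.Cobar) :
    K.gam L p (x ⊗ₜ b) = K.counit x • L.hhIncl b + L.rotate (p x ⊗ₜ b) := by
  simp [gam, hhIncl, TensorProduct.smul_tmul']

/-- Differentiating rotate(px ⊗ w) produces d(px), which the twisting equation replaces by -p(dx)
and products p(x₍₁₎)p(x₍₂₎). The cyclic Leibniz rule splits the rotation of such a product into
exactly a left twist and a right twist. The terms in Ω D match those in which a counit has been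
applied. -/
theorem gam_hhD (hK : K.Laws) (hL : L.Laws) {p : C →ₗ[R] L.Cobar}
    (hp : K.IsTwisting L.cobarGrading L.cobarD p) :
    L.hhD ∘ₗ K.gam L p = K.gam L p ∘ₗ K.twD L.cobarGrading L.cobarD p p := by
  refine tensor_ext K.toGrading L.cobarGrading fun n m x hx w hw => ?_
  obtain ⟨k, a, b, s, q, ha, hb, hn, hx', hl, hr⟩ := hK.sweedler hx
  have e1 : L.hhIncl (p x * w) = ∑ t, K.counit (a t) • L.hhIncl (p (b t) * w) := by
    conv_lhs => rw [← hl]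
    simp [Finset.sum_mul]
  have e2 : L.hhIncl (w * p x) = ∑ t, K.counit (b t) • L.hhIncl (w * p (a t)) := by
    conv_lhs => rw [← hr]
    simp [Finset.mul_sum]
  have e3 : L.cobarD (p x) = -p (K.d x) + ∑ t, sg R (s t) • (p (a t) * p (b t)) := by
    have := LinearMap.congr_fun hp.d_comp x
    simp only [LinearMap.comp_apply, LinearMap.add_apply, LinearMap.neg_apply,
      cv_apply hx'] at this
    simpa [sgn_par (ha _)] using this
  rw [LinearMap.comp_apply, LinearMap.comp_apply, gam_tmul, twD_tmul hx ha hb hx' _ _ hp.odd hw,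
    map_add, map_smul, hL.hhD_hhIncl, hL.hhD_rotate (hp.odd _ _ hx) hw, e1, e2, e3]
  simp only [TensorProduct.add_tmul, TensorProduct.sum_tmul, TensorProduct.neg_tmul, map_add,
    map_sub, map_neg, map_sum, gam_tmul, hK.counit_d, zero_smul, ← TensorProduct.smul_tmul',
    map_smul, rotate_mul (hp.odd _ _ (ha _)) (hp.odd _ _ (hb _)) hw]
  have key := Finset.sum_congr (rfl : (Finset.univ : Finset (Fin k)) = _) fun t _ =>
    show -(sg R (s t) • (L.rotate (p (a t) ⊗ₜ (p (b t) * w)) +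
          sg R ((s t + 1) * (q t + 1 + m)) • L.rotate (p (b t) ⊗ₜ (w * p (a t))))) -
        K.counit (a t) • L.hhIncl (p (b t) * w) +
        sg R ((n + 1) * m) • K.counit (b t) • L.hhIncl (w * p (a t)) =
      -(sg R (s t) • (K.counit (a t) • L.hhIncl (p (b t) * w) +
          L.rotate (p (a t) ⊗ₜ (p (b t) * w)))) +
        sg R ((s t + 1) * (q t + m)) • (K.counit (b t) • L.hhIncl (w * p (a t)) +
          L.rotate (p (b t) ⊗ₜ (w * p (a t)))) by
      have ea := K.sg_counit (ha t)
      have eb := K.counit_of_odd (x := b t)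
      have hb := hb t
      rw [hn t]
      have e := sg_sq (R := R) (s t)
      rcases zmod_two_cases (q t) with hq | hq
      · rw [hq]
        match_scalars <;>
        try simp only [sg_add, sg_mul_add, sg_add_mul, sg_one, sg_mul_one, sg_one_mul, sg_mul_zero,
          sg_zero_mul]
        all_goals grind
      · rw [eb (hq ▸ hb), hq]
        match_scalars <;>
        try simp only [sg_add, sg_mul_add, sg_add_mul, sg_one, sg_mul_one, sg_one_mul]
        all_goals grind
  have ex := K.sg_counit hx
  have ex' : K.counit x • L.hhIncl (L.cobarD w) =
      sg R n • K.counit x • L.hhIncl (L.cobarD w) := by rw [smul_smul, ex]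
  simp only [Finset.sum_add_distrib, Finset.sum_sub_distrib, Finset.sum_neg_distrib,
    smul_add, smul_sub, Finset.smul_sum, sg_add, sg_one, mul_neg, mul_one] at key ⊢
  linear_combination (norm := module) key + ex'

/-- This decomposes each element of Ĥ(C) into an element of Ω C and a rotation, the basis of the
extensionality principle below. -/
theorem gam_sInv : K.gam K K.sInv = LinearMap.id :=
  TensorProduct.ext' fun x b => by rw [gam_tmul, rotate_sInv]; simp

/-- Linear maps out of `Ĥ(C)` agree if they agree on `1 ⊗ w` and on rotations. -/
theorem hh_ext {X : Type*} [AddCommGroup X] [Module R X] {F F' : K.CoHH →ₗ[R] X}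
    (h1 : ∀ w, F (K.hhIncl w) = F' (K.hhIncl w))
    (h2 : ∀ i j, ∀ a ∈ K.cobarGrading.par i, ∀ w ∈ K.cobarGrading.par j,
      F (K.rotate (a ⊗ₜ w)) = F' (K.rotate (a ⊗ₜ w))) : F = F' := by
  refine tensor_ext K.toGrading K.cobarGrading fun n m x hx w hw => ?_
  have := LinearMap.congr_fun (gam_sInv (K := K)) (x ⊗ₜ w)
  rw [gam_tmul, LinearMap.id_apply] at this
  rw [← this, map_add, map_add, map_smul, map_smul, h1, h2 _ _ _ (K.sInv_mem_par hx) _ hw]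

theorem Laws.hhD_deg (h : K.Laws) : Deg K.hhGrading K.hhGrading (-1) K.hhD := by
  have hmap : Deg (K.toGrading.tensor (K.cobarGrading.tensor K.cobarGrading)) K.hhGrading 0
      (LinearMap.lTensor C (LinearMap.mul' R K.Cobar)) := mul'_deg.lTensor
  refine ((tensorD_deg h.d_deg h.cobarD_deg).sub ?_).add ?_
  · refine hmap.comp (k := -1) (Deg.assoc.comp (k := -1) (Deg.rTensor ?_) (by norm_num))
      (by norm_num)
    exact Deg.comp (k := 0) (l := -1) (Deg.sgn.map K.sInv_deg (by norm_num)) h.comul_deg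
      (by norm_num)
  · refine hmap.comp (k := -1) (Deg.assoc.comp (k := -1) (Deg.swap.comp (k := -1)
      (Deg.assoc.comp (k := -1) (Deg.rTensor ?_) (by norm_num)) (by norm_num)) (by norm_num))
      (by norm_num)
    exact Deg.comp (k := 0) (l := -1) K.sInv_deg.rTensor h.comul_deg (by norm_num)

/-- On rotations, the two mixed terms with da and db cancel by sign, and the commutator part cancels
by the Leibniz rule on ab and ba. Nothing about C enters beyond `Laws` and the vanishing of the
square on Ω C. -/
theorem Laws.hhD_hhD (h : K.Laws) (hd : ∀ w, K.cobarD (K.cobarD w) = 0) : K.hhD ∘ₗ K.hhD = 0 := by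
  refine hh_ext (fun w => ?_) fun i j a ha w hw => ?_
  · simp [h.hhD_hhIncl, hd]
  · have hda := h.cobarD_deg.par_neg_one ha
    have hdw := h.cobarD_deg.par_neg_one hw
    simp only [LinearMap.comp_apply, h.hhD_rotate ha hw, map_add, map_sub, map_neg, map_smul,
      h.hhD_rotate hda hw, h.hhD_rotate ha hdw, h.hhD_hhIncl, hd, TensorProduct.zero_tmul,
      TensorProduct.tmul_zero, map_zero, cobarD_mul_par ha, cobarD_mul_par hw,
      LinearMap.zero_apply]
    match_scalars <;>
    simp only [sg_add, sg_mul_add, sg_add_mul, sg_mul_one, sg_one_mul, sg_one, sg_sq, sg_sq_left,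
      mul_comm, mul_left_comm, mul_assoc, mul_neg, neg_mul, mul_one, neg_neg] <;>
    ring

/-! ### The maps induced on `Ĥ` -/

/-- The factorisation separates the coefficient change w ↦ ω(w) from the map attached to the
twisting map ωs⁻¹. The homotopy between hats is built on it. -/
theorem hhHat_eq (ω : K.Cobar →ₐ[R] L.Cobar) :
    K.hhHat L ω = K.gam L (ω.toLinearMap ∘ₗ K.sInv) ∘ₗ LinearMap.lTensor C ω.toLinearMap :=
  TensorProduct.ext' fun x w => by simp [hhHat, gam]

theorem hhHat_hhIncl (ω : K.Cobar →ₐ[R] L.Cobar) (w : K.Cobar) :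
    K.hhHat L ω (K.hhIncl w) = L.hhIncl (ω w) := by
  simp [hhHat, hhIncl, K.counit_one, sInv_one]

/-- Both sides obey the cyclic Leibniz rule in a, since ω is multiplicative and preserves degrees,
and on letters the formula is the definition of ω̂. -/
theorem hhHat_rotate {ω : K.Cobar →ₐ[R] L.Cobar}
    (hω : Deg K.cobarGrading L.cobarGrading 0 ω.toLinearMap) (a w : K.Cobar) :
    K.hhHat L ω (K.rotate (a ⊗ₜ w)) = L.rotate (ω a ⊗ₜ ω w) := by
  induction a using K.cobarGrading.parity_induction with
  | ha x y hx hy => simp only [TensorProduct.add_tmul, map_add, hx, hy]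
  | hg i a ha =>
    induction w using K.cobarGrading.parity_induction with
    | ha x y hx hy => simp only [TensorProduct.tmul_add, map_add, hx, hy]
    | hg j w hw =>
      refine word_par_induction (G := K.barGrading) (p := fun i a => ∀ j,
        ∀ w ∈ K.cobarGrading.par j,
        K.hhHat L ω (K.rotate (a ⊗ₜ w)) = L.rotate (ω a ⊗ₜ ω w)) ?_ ?_ ?_ ?_ ?_ ha j w hw
      · simp
      · intro i x y hx hy j w hw
        simp only [TensorProduct.add_tmul, map_add, hx j w hw, hy j w hw]
      · intro i r x hx j w hw
        simp only [← TensorProduct.smul_tmul', map_smul, hx j w hw]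
      · intro j w hw
        simp [rotate_one]
      · intro i j v a hv ha ih k w hw
        have hv' := ι_mem_par hv
        have hω' : ∀ {i : ZMod 2} {a : K.Cobar}, a ∈ K.cobarGrading.par i →
          ω a ∈ L.cobarGrading.par i := fun ha => hω.par_zero ha
        rw [rotate_mul hv' ha hw, map_add, map_smul, ih _ _ (mul_mem_par hw hv'), rotate_ι, map_mul, map_mul,
          rotate_mul (hω' hv') (hω' ha) (hω' hw)]
        simp [hhHat, sInv_bar]

/-- Functoriality is evident on rotations, though hardly visible on the defining sums over marked
letters. -/
theorem hhHat_comp {ω : K.Cobar →ₐ[R] L.Cobar} {ω' : L.Cobar →ₐ[R] P.Cobar}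
    (hω : Deg K.cobarGrading L.cobarGrading 0 ω.toLinearMap)
    (hω' : Deg L.cobarGrading P.cobarGrading 0 ω'.toLinearMap) :
    K.hhHat P (ω'.comp ω) = L.hhHat P ω' ∘ₗ K.hhHat L ω := by
  have h : Deg K.cobarGrading P.cobarGrading 0 (ω'.comp ω).toLinearMap :=
    hω'.comp hω (by norm_num)
  refine hh_ext (fun w => ?_) fun i j a _ w _ => ?_
  · simp [hhHat_hhIncl]
  · simp [hhHat_rotate h, hhHat_rotate hω, hhHat_rotate hω']

theorem gam_deg {p : C →ₗ[R] L.Cobar} (hp : Deg K.toGrading L.cobarGrading (-1) p) :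
    Deg (K.toGrading.tensor L.cobarGrading) L.hhGrading 0 (K.gam L p) := by
  refine Deg.add (Deg.map (k := 0) ?_ Deg.id (by norm_num))
    (rotate_deg.comp (k := -1) (hp.map Deg.id (by norm_num)) (by norm_num))
  rintro (_ | n) x hx
  · exact Submodule.smul_mem _ _ L.one_mem_zgr
  · simp [K.counit_pos n x hx]

theorem hhHat_deg {ω : K.Cobar →ₐ[R] L.Cobar}
    (hω : Deg K.cobarGrading L.cobarGrading 0 ω.toLinearMap) :
    Deg K.hhGrading L.hhGrading 0 (K.hhHat L ω) := by
  rw [hhHat_eq]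
  exact (gam_deg (hω.comp K.sInv_deg (by norm_num))).comp hω.lTensor (by norm_num)

/-- The formula for the differential of a rotation uses only the product and the differential of the
cobar construction, and ω respects both. -/
theorem hhHat_hhD (hK : K.Laws) (hL : L.Laws) {ω : K.Cobar →ₐ[R] L.Cobar}
    (hω : IsChainMap K.cobarGrading K.cobarD L.cobarGrading L.cobarD ω.toLinearMap) :
    K.hhHat L ω ∘ₗ K.hhD = L.hhD ∘ₗ K.hhHat L ω := by
  have hdeg := hasDegree_iff.mp hω.degree
  refine hh_ext (fun w => ?_) fun i j a ha w hw => ?_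
  · have := LinearMap.congr_fun hω.comm w
    simp only [LinearMap.comp_apply, AlgHom.toLinearMap_apply] at this
    simp only [LinearMap.comp_apply, hhHat_hhIncl, hK.hhD_hhIncl, hL.hhD_hhIncl, this]
  · have e1 := LinearMap.congr_fun hω.comm a
    have e2 := LinearMap.congr_fun hω.comm w
    have ha' := Deg.par_zero hdeg ha
    have hw' := Deg.par_zero hdeg hw
    simp only [LinearMap.comp_apply, AlgHom.toLinearMap_apply] at e1 e2 ha' hw'
    simp only [LinearMap.comp_apply, hhHat_rotate hdeg, hK.hhD_rotate ha hw, map_add, map_sub,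
      map_neg, map_smul, hhHat_hhIncl, hL.hhD_rotate ha' hw', e1, e2, map_mul]

theorem cobarMap_sInv {f : C →ₗ[R] D} (h1 : f K.one = L.one)
    (x : C) : K.cobarMap L f (K.sInv x) = L.sInv (f x) := by
  simp [cobarMap, sInv, proj_coe, h1, proj_one]

theorem cobarMap_deg {f : C →ₗ[R] D} (hf : Deg K.toGrading L.toGrading 0 f) :
    Deg K.cobarGrading L.cobarGrading 0 (K.cobarMap L f).toLinearMap := by
  refine algHom_deg ?_
  have : (K.cobarMap L f).toLinearMap ∘ₗ TensorAlgebra.ι R =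
      L.sInv ∘ₗ f ∘ₗ (LinearMap.ker K.counit).subtype :=
    LinearMap.ext fun v => by simp [cobarMap]
  rw [this]
  exact L.sInv_deg.comp (hf.comp K.subtype_deg (m := 1) (by norm_num)) (by norm_num)

/-- Since Ω f sends a letter to a letter, its hat involves no proper rotation. Naturality questions
thereby reduce to `hhHat_comp`. -/
theorem hhMap_eq_hhHat {f : C →ₗ[R] D} (hε : L.counit ∘ₗ f = K.counit) (h1 : f K.one = L.one) :
    K.hhMap L f = K.hhHat L (K.cobarMap L f) := by
  refine TensorProduct.ext' fun x w => ?_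
  simp only [hhHat_eq, LinearMap.comp_apply, LinearMap.lTensor_tmul, gam_tmul,
    AlgHom.toLinearMap_apply, cobarMap_sInv h1, rotate_sInv, ← hε]
  simp [hhMap]

end PreCoalg

end

end CoHoch

namespace CoHoch

noncomputable section

open Grading

/-! ### The graded tensor product of multiplications -/

section Gmul

variable {R A B A' B' : Type*} [CommRing R] [AddCommGroup A] [Module R A] [AddCommGroup B]
  [Module R B] [AddCommGroup A'] [Module R A'] [AddCommGroup B'] [Module R B']

/-- The multiplication `(a ⊗ b)(a' ⊗ b') = (-1)^{|b| |a'|} aa' ⊗ bb'` on `A ⊗ B`. -/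
def gmul (GA : Grading R A) (GB : Grading R B) (mA : A ⊗[R] A →ₗ[R] A) (mB : B ⊗[R] B →ₗ[R] B) :
    (A ⊗[R] B) ⊗[R] (A ⊗[R] B) →ₗ[R] A ⊗[R] B :=
  TensorProduct.map mA mB ∘ₗ Grading.interchange GB GA

variable {GA : Grading R A} {GB : Grading R B} {mA : A ⊗[R] A →ₗ[R] A} {mB : B ⊗[R] B →ₗ[R] B}
  {GA' : Grading R A'} {GB' : Grading R B'} {mA' : A' ⊗[R] A' →ₗ[R] A'}
  {mB' : B' ⊗[R] B' →ₗ[R] B'}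

theorem gmul_tmul {i j : ZMod 2} (a : A) {b : B} {a' : A} (b' : B) (hb : b ∈ GB.par i)
    (ha' : a' ∈ GA.par j) :
    gmul GA GB mA mB ((a ⊗ₜ b) ⊗ₜ (a' ⊗ₜ b')) =
      sg R (i * j) • (mA (a ⊗ₜ a') ⊗ₜ[R] mB (b ⊗ₜ b')) := by
  rw [gmul, LinearMap.comp_apply, interchange_par a b' hb ha', map_smul, TensorProduct.map_tmul]

theorem gmul_deg (hA : Deg (GA.tensor GA) GA 0 mA) (hB : Deg (GB.tensor GB) GB 0 mB) :
    Deg ((GA.tensor GB).tensor (GA.tensor GB)) (GA.tensor GB) 0 (gmul GA GB mA mB) :=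
  (hA.map hB (add_zero 0)).comp Deg.interchange (by norm_num)

theorem interchange_natural {M N M' N' : Type*} [AddCommGroup M] [Module R M] [AddCommGroup N]
    [Module R N] [AddCommGroup M'] [Module R M'] [AddCommGroup N'] [Module R N'] (f : M →ₗ[R] M')
    (g : N →ₗ[R] N') {α : A →ₗ[R] A'} {β : B →ₗ[R] B'} (hα : Deg GA GA' 0 α) (hβ : Deg GB GB' 0 β) :
    Grading.interchange (A := M') (B' := N') GB' GA' ∘ₗ
      TensorProduct.map (TensorProduct.map f β) (TensorProduct.map α g) =
    TensorProduct.map (TensorProduct.map f α) (TensorProduct.map β g) ∘ₗ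
      Grading.interchange GB GA := by
  refine TensorProduct.ext_fourfold' fun m b a n => ?_
  induction b using GB.parity_induction with
  | hg i b hb =>
    induction a using GA.parity_induction with
    | hg j a ha =>
      simp [interchange_par _ _ hb ha, interchange_par _ _ (hβ.par_zero hb) (hα.par_zero ha)]
    | ha x y hx hy => simp only [TensorProduct.add_tmul, TensorProduct.tmul_add, map_add, hx, hy]
  | ha x y hx hy => simp only [TensorProduct.add_tmul, TensorProduct.tmul_add, map_add, hx, hy]

theorem gmul_natural {α : A →ₗ[R] A'} {β : B →ₗ[R] B'} (hα : Deg GA GA' 0 α)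
    (hβ : Deg GB GB' 0 β) (mα : ∀ x y, α (mA (x ⊗ₜ y)) = mA' (α x ⊗ₜ α y))
    (mβ : ∀ x y, β (mB (x ⊗ₜ y)) = mB' (β x ⊗ₜ β y)) (x y : A ⊗[R] B) :
    TensorProduct.map α β (gmul GA GB mA mB (x ⊗ₜ y)) =
      gmul GA' GB' mA' mB' (TensorProduct.map α β x ⊗ₜ TensorProduct.map α β y) := by
  have h1 := LinearMap.congr_fun (interchange_natural α β hα hβ) (x ⊗ₜ y)
  have h2 : TensorProduct.map α β ∘ₗ TensorProduct.map mA mB =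
      TensorProduct.map mA' mB' ∘ₗ
        TensorProduct.map (TensorProduct.map α α) (TensorProduct.map β β) :=
    TensorProduct.ext_fourfold' fun a a' b b' => by simp [mα, mβ]
  have h3 := LinearMap.congr_fun h2 (Grading.interchange GB GA (x ⊗ₜ y))
  simp only [LinearMap.comp_apply, TensorProduct.map_tmul] at h1 h3
  rw [gmul, gmul, LinearMap.comp_apply, LinearMap.comp_apply, h3, h1]

/-- The tensor product differential is a derivation if the factors are. -/
theorem tensorD_gmul {dA : A →ₗ[R] A} {dB : B →ₗ[R] B} (hmA : Deg (GA.tensor GA) GA 0 mA)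
    (hdA : Deg GA GA (-1) dA) (hdB : Deg GB GB (-1) dB)
    (hA : ∀ i, ∀ a ∈ GA.par i, ∀ b, dA (mA (a ⊗ₜ b)) = mA (dA a ⊗ₜ b) + sg R i • mA (a ⊗ₜ dA b))
    (hB : ∀ i, ∀ a ∈ GB.par i, ∀ b, dB (mB (a ⊗ₜ b)) = mB (dB a ⊗ₜ b) + sg R i • mB (a ⊗ₜ dB b))
    {n : ZMod 2} {x : A ⊗[R] B} (hx : x ∈ (GA.tensor GB).par n) (y : A ⊗[R] B) :
    tensorD GA dA dB (gmul GA GB mA mB (x ⊗ₜ y)) =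
      gmul GA GB mA mB (tensorD GA dA dB x ⊗ₜ y) +
      sg R n • gmul GA GB mA mB (x ⊗ₜ tensorD GA dA dB y) := by
  induction y using (GA.tensor GB).parity_induction with
  | ha x y hx hy =>
    simp only [TensorProduct.tmul_add, map_add, hx, hy, smul_add]; abel
  | hg m y hy =>
    refine tensor_par_induction ?_ ?_ (fun k l _ a' ha' b' _ => ?_) hy
    · simp
    · intro x y hx hy
      simp only [TensorProduct.tmul_add, map_add, hx, hy, smul_add]; abel
    refine tensor_par_induction ?_ ?_ (fun i j hn a ha b hb => ?_) hx
    · simp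
    · intro x y hx hy
      simp only [TensorProduct.add_tmul, map_add, hx, hy, smul_add]; abel
    have haa := hmA.par_zero (tmul_mem_par ha ha')
    have hda' := hdA.par_neg_one ha'
    have hdb := hdB.par_neg_one hb
    rw [gmul_tmul a b' hb ha', map_smul, tensorD_tmul_par _ _ haa, tensorD_tmul_par _ _ ha,
      tensorD_tmul_par _ _ ha', hA _ _ ha, hB _ _ hb]
    simp only [TensorProduct.add_tmul, TensorProduct.tmul_add, map_add, ← TensorProduct.smul_tmul',
      TensorProduct.tmul_smul, map_smul, gmul_tmul (dA a) b' hb ha', gmul_tmul a b' hdb ha',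
      gmul_tmul a b' hb hda', gmul_tmul a (dB b') hb ha', hn]
    match_scalars <;>
    simp only [sg_add, sg_mul_add, sg_add_mul, sg_mul_one, sg_one_mul, sg_one, sg_sq, sg_sq_left,
      mul_comm, mul_left_comm, mul_assoc, mul_one, one_mul]

end Gmul

/-! ### The Milgram map: multiplicativity, degree and naturality. -/

namespace PreCoalg

variable {R C D E F : Type*} [CommRing R] [AddCommGroup C] [Module R C] [AddCommGroup D]
  [Module R D] [AddCommGroup E] [Module R E] [AddCommGroup F] [Module R F] {K : PreCoalg R C}
  {L : PreCoalg R D} {K' : PreCoalg R E} {L' : PreCoalg R F}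

/-- The multiplication of `Ω C ⊗ Ω D`. -/
abbrev cobarMul (K : PreCoalg R C) (L : PreCoalg R D) :
    (K.Cobar ⊗[R] L.Cobar) ⊗[R] (K.Cobar ⊗[R] L.Cobar) →ₗ[R] K.Cobar ⊗[R] L.Cobar :=
  gmul K.cobarGrading L.cobarGrading (LinearMap.mul' R K.Cobar) (LinearMap.mul' R L.Cobar)

/-- Identifies Mathlib's product with the linear map `gmul`, which can be iterated over triple
tensor products and moved through naturality squares. -/
theorem gradedTensorProduct_of_mul (x y : K.Cobar ⊗[R] L.Cobar) :
    GradedTensorProduct.of R (wordGr K.barGrading) (wordGr L.barGrading) x *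
      GradedTensorProduct.of R (wordGr K.barGrading) (wordGr L.barGrading) y =
    GradedTensorProduct.of R (wordGr K.barGrading) (wordGr L.barGrading)
      (cobarMul K L (x ⊗ₜ y)) := by
  induction x using TensorProduct.induction_on with
  | zero => simp
  | add x x' hx hx' => simp only [map_add, add_mul, TensorProduct.add_tmul, hx, hx']
  | tmul a b =>
    induction y using TensorProduct.induction_on with
    | zero => simp
    | add x x' hx hx' => simp only [map_add, mul_add, TensorProduct.tmul_add, hx, hx']
    | tmul a' b' =>
      induction b using L.cobarGrading.induction with
      | h0 => simp
      | ha x x' hx hx' =>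
        simp only [map_add, add_mul, TensorProduct.add_tmul, TensorProduct.tmul_add, hx, hx']
      | hg j b hb =>
        induction a' using K.cobarGrading.induction with
        | h0 => simp
        | ha x x' hx hx' =>
          simp only [map_add, mul_add, TensorProduct.add_tmul, TensorProduct.tmul_add, hx, hx']
        | hg i a' ha' =>
          have := GradedTensorProduct.tmul_coe_mul_coe_tmul (R := R) (wordGr K.barGrading)
            (wordGr L.barGrading) a ⟨b, hb⟩ ⟨a', ha'⟩ b'
          refine this.trans ?_
          rw [gmul_tmul _ _ (mem_par_of_mem hb) (mem_par_of_mem ha'), map_smul,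
            ← Nat.cast_mul, sg_natCast]
          -- The sign of the graded tensor product is a power of an integer unit; it is matched with
          -- the sign in R by parity.
          have e := uzpow_natCast (R := ℕ) (-1) (j * i)
          rw [Nat.cast_id] at e
          rw [e]
          rcases Nat.even_or_odd (j * i) with h | h
          · rw [h.neg_one_pow, h.neg_one_pow, one_smul, one_smul]; rfl
          · rw [h.neg_one_pow, h.neg_one_pow, Units.neg_smul, one_smul, neg_smul, one_smul]; rfl

theorem milgram_one : K.milgram L 1 = 1 ⊗ₜ 1 := by
  simp [milgram, Algebra.TensorProduct.one_def]

theorem milgram_mul (a b : (K.tensor L).Cobar) :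
    K.milgram L (a * b) = cobarMul K L (K.milgram L a ⊗ₜ K.milgram L b) := by
  simp only [milgram, LinearMap.comp_apply, AlgHom.toLinearMap_apply, map_mul,
    LinearEquiv.coe_coe]
  rw [LinearEquiv.symm_apply_eq, ← gradedTensorProduct_of_mul, LinearEquiv.apply_symm_apply,
    LinearEquiv.apply_symm_apply]

theorem milgramGen_tmul (x : C) (y : D) :
    K.milgramGen L (x ⊗ₜ y) =
      L.counit y • (K.sInv x ⊗ₜ 1) + K.counit x • ((1 : K.Cobar) ⊗ₜ[R] L.sInv y) := by
  simp [milgramGen, Algebra.algebraMap_eq_smul_one, TensorProduct.smul_tmul']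

/-- The generator formula is valid on all of C ⊗ D, and not only on the kernel of the counit,
because it vanishes on 1 ⊗ 1. -/
theorem milgram_sInv (z : C ⊗[R] D) : K.milgram L ((K.tensor L).sInv z) = K.milgramGen L z := by
  have h1 : K.milgramGen L (K.tensor L).one = 0 := by
    rw [tensor_one, milgramGen_tmul, sInv_one, sInv_one]; simp
  simp only [milgram, sInv, LinearMap.comp_apply, AlgHom.toLinearMap_apply,
    TensorAlgebra.lift_ι_apply, Submodule.subtype_apply, proj_coe, map_sub, map_smul, h1]
  simp

/-- Each of the two terms carries a counit, so one factor must have degree 0 for the term to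
survive. -/
theorem milgramGen_deg : Deg (K.tensor L).toGrading (K.cobarGrading.tensor L.cobarGrading) (-1)
    (K.milgramGen L) := by
  refine Deg.of_tmul fun i j x hx y hy => ?_
  rw [milgramGen_tmul]
  refine add_mem ?_ ?_
  · by_cases hj : j = 0
    · exact Submodule.smul_mem _ _ (zgr_cast (tmul_mem_zgr (K.sInv_deg.apply hx)
        CoHoch.one_mem_zgr) (by omega))
    · rw [L.counit_of_ne hj hy, zero_smul]; exact zero_mem _
  · by_cases hi : i = 0
    · exact Submodule.smul_mem _ _ (zgr_cast (tmul_mem_zgr CoHoch.one_mem_zgr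
        (L.sInv_deg.apply hy)) (by omega))
    · rw [K.counit_of_ne hi hx, zero_smul]; exact zero_mem _

theorem cobarMul_deg : Deg ((K.cobarGrading.tensor L.cobarGrading).tensor
    (K.cobarGrading.tensor L.cobarGrading)) (K.cobarGrading.tensor L.cobarGrading) 0
    (cobarMul K L) := gmul_deg mul'_deg mul'_deg

theorem milgram_deg : Deg (K.tensor L).cobarGrading (K.cobarGrading.tensor L.cobarGrading) 0
    (K.milgram L) := by
  intro n w hw
  refine word_induction (G := (K.tensor L).barGrading) (p := fun n w => K.milgram L w ∈
      (K.cobarGrading.tensor L.cobarGrading).zgr (n + 0))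
    (fun _ => by simp) (fun _ x y hx hy => by rw [map_add]; exact add_mem hx hy)
    (fun _ r x hx => by rw [map_smul]; exact Submodule.smul_mem _ _ hx)
    ?_ (fun m n v w hv hw ih => ?_) hw
  · rw [milgram_one]
    exact zgr_cast (tmul_mem_zgr CoHoch.one_mem_zgr CoHoch.one_mem_zgr) (by simp)
  · rw [milgram_mul, ← sInv_bar, milgram_sInv]
    have hv' := milgramGen_deg.apply (subtype_deg _ m v hv)
    exact zgr_cast (cobarMul_deg.apply (tmul_mem_zgr hv' ih)) (by push_cast; ring)

theorem cobarMul_tmul {i j : ZMod 2} (a : K.Cobar) {b : L.Cobar} {a' : K.Cobar} (b' : L.Cobar)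
    (hb : b ∈ L.cobarGrading.par i) (ha' : a' ∈ K.cobarGrading.par j) :
    cobarMul K L ((a ⊗ₜ b) ⊗ₜ (a' ⊗ₜ b')) = sg R (i * j) • ((a * a') ⊗ₜ[R] (b * b')) :=
  gmul_tmul a b' hb ha'

theorem tensorD_cobarMul (hK : K.Laws) (hL : L.Laws) {n : ZMod 2} {x : K.Cobar ⊗[R] L.Cobar}
    (hx : x ∈ (K.cobarGrading.tensor L.cobarGrading).par n) (y : K.Cobar ⊗[R] L.Cobar) :
    tensorD K.cobarGrading K.cobarD L.cobarD (cobarMul K L (x ⊗ₜ y)) =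
      cobarMul K L (tensorD K.cobarGrading K.cobarD L.cobarD x ⊗ₜ y) +
      sg R n • cobarMul K L (x ⊗ₜ tensorD K.cobarGrading K.cobarD L.cobarD y) :=
  tensorD_gmul mul'_deg hK.cobarD_deg hL.cobarD_deg (fun _ _ ha b => cobarD_mul_par ha b)
    (fun _ _ ha b => cobarD_mul_par ha b) hx y

theorem milgram_natural {f : C →ₗ[R] E} {g : D →ₗ[R] F} (hf : Deg K.toGrading K'.toGrading 0 f)
    (hg : Deg L.toGrading L'.toGrading 0 g) (hf1 : f K.one = K'.one) (hg1 : g L.one = L'.one)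
    (hfε : K'.counit ∘ₗ f = K.counit) (hgε : L'.counit ∘ₗ g = L.counit) :
    K'.milgram L' ∘ₗ ((K.tensor L).cobarMap (K'.tensor L') (TensorProduct.map f g)).toLinearMap =
    TensorProduct.map (K.cobarMap K' f).toLinearMap (L.cobarMap L' g).toLinearMap ∘ₗ
      K.milgram L := by
  refine linearMap_ext_of_mul (TensorProduct.curry (cobarMul K' L')) ?_ (fun v => ?_) (fun a b => ?_)
    (fun a b => ?_)
  · simp [milgram_one]
  · rw [← sInv_bar]
    generalize (v : C ⊗[R] D) = z
    rw [LinearMap.comp_apply, AlgHom.toLinearMap_apply,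
      cobarMap_sInv (by simp [tensor_one, hf1, hg1]), milgram_sInv, LinearMap.comp_apply,
      milgram_sInv]
    induction z using TensorProduct.induction_on with
    | zero => simp
    | add x y hx hy => simp only [map_add, hx, hy]
    | tmul x y =>
      have h1 := LinearMap.congr_fun hfε x
      have h2 := LinearMap.congr_fun hgε y
      simp only [LinearMap.comp_apply] at h1 h2
      simp [milgramGen_tmul, h1, h2, cobarMap_sInv hf1, cobarMap_sInv hg1]
  · simp [milgram_mul]
  · simp only [LinearMap.comp_apply, milgram_mul]
    exact gmul_natural (cobarMap_deg hf) (cobarMap_deg hg) (by simp) (by simp) _ _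

end PreCoalg

end

end CoHoch

namespace CoHoch

noncomputable section

open Grading

/-! ### The Milgram map is a chain map. -/

namespace PreCoalg

variable {R C D E F : Type*} [CommRing R] [AddCommGroup C] [Module R C] [AddCommGroup D]
  [Module R D] [AddCommGroup E] [Module R E] [AddCommGroup F] [Module R F] {K : PreCoalg R C}
  {L : PreCoalg R D} {K' : PreCoalg R E} {L' : PreCoalg R F}

theorem cobarGen_apply {x : C} {T : Type*} [Fintype T] {a b : T → C} {p : T → ZMod 2}
    (ha : ∀ t, a t ∈ K.par (p t)) (hx : K.comul x = ∑ t, a t ⊗ₜ[R] b t) :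
    K.cobarGen x = -K.sInv (K.d x) + ∑ t, sg R (p t) • (K.sInv (a t) * K.sInv (b t)) := by
  simp [cobarGen, hx, sgn_par (ha _)]

/-- The quadratic part of d s⁻¹(x ⊗ y) goes under q to four families of terms. Two of them carry
ε(y) and ε(x) and give the quadratic parts of ds⁻¹x and ds⁻¹y. The other two are multiples of s⁻¹x ⊗
s⁻¹y arising from x ⊗ 1 | 1 ⊗ y and 1 ⊗ y | x ⊗ 1, and these cancel through the sign of the graded
product. -/
theorem tensorD_milgramGen (hK : K.Laws) (hL : L.Laws) (z : C ⊗[R] D) :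
    tensorD K.cobarGrading K.cobarD L.cobarD (K.milgramGen L z) =
      K.milgram L ((K.tensor L).cobarGen z) := by
  refine LinearMap.congr_fun (f := tensorD K.cobarGrading K.cobarD L.cobarD ∘ₗ K.milgramGen L)
    (g := K.milgram L ∘ₗ (K.tensor L).cobarGen)
    (tensor_ext K.toGrading L.toGrading fun n m x hx y hy => ?_) z
  obtain ⟨k, a, b, p, q, ha, hb, hn, hx', hl, hr⟩ := hK.sweedler hx
  obtain ⟨k', a', b', p', q', ha', hb', hn', hy', hl', hr'⟩ := hL.sweedler hy
  have hxε : K.counit x = ∑ s, K.counit (a s) * K.counit (b s) := by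
    conv_lhs => rw [← hl]
    simp
  have hyε : L.counit y = ∑ s, L.counit (a' s) * L.counit (b' s) := by
    conv_lhs => rw [← hl']
    simp
  have key : ∀ s t, sg R (p s + p' t) • sg R (q s * p' t) •
      cobarMul K L (K.milgramGen L (a s ⊗ₜ a' t) ⊗ₜ K.milgramGen L (b s ⊗ₜ b' t)) =
      (L.counit (a' t) * L.counit (b' t)) • sg R (p s) •
        ((K.sInv (a s) * K.sInv (b s)) ⊗ₜ[R] (1 : L.Cobar)) +
      (L.counit (a' t) * K.counit (b s)) • sg R n • (K.sInv (a s) ⊗ₜ[R] L.sInv (b' t)) -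
      (L.counit (b' t) * K.counit (a s)) • sg R n • (K.sInv (b s) ⊗ₜ[R] L.sInv (a' t)) +
      (K.counit (a s) * K.counit (b s)) • sg R (p' t) •
        ((1 : K.Cobar) ⊗ₜ[R] (L.sInv (a' t) * L.sInv (b' t))) := by
    intro s t
    have h1 : (1 : K.Cobar) ∈ K.cobarGrading.par 0 := CoHoch.one_mem_par
    have h1' : (1 : L.Cobar) ∈ L.cobarGrading.par 0 := CoHoch.one_mem_par
    simp only [milgramGen_tmul, TensorProduct.add_tmul, TensorProduct.tmul_add, map_add,
      ← TensorProduct.smul_tmul', TensorProduct.tmul_smul, map_smul,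
      cobarMul_tmul _ _ h1' (K.sInv_mem_par (hb s)), cobarMul_tmul _ _ h1' h1,
      cobarMul_tmul _ _ (L.sInv_mem_par (ha' t)) (K.sInv_mem_par (hb s)),
      cobarMul_tmul _ _ (L.sInv_mem_par (ha' t)) h1, mul_one, one_mul]
    have e1 := K.counit_of_odd (x := a s)
    have e2 := K.counit_of_odd (x := b s)
    have e3 := L.counit_of_odd (x := a' t)
    have e4 := L.counit_of_odd (x := b' t)
    have ha := ha s
    have hb := hb s
    have ha' := ha' t
    have hb' := hb' t
    rw [hn s]
    rcases zmod_two_cases (p s) with h1 | h1 <;> rcases zmod_two_cases (q s) with h2 | h2 <;>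
    rcases zmod_two_cases (p' t) with h3 | h3 <;> rcases zmod_two_cases (q' t) with h4 | h4 <;>
    rw [h1] at ha ⊢ <;> rw [h2] at hb ⊢ <;> rw [h3] at ha' ⊢ <;> rw [h4] at hb' <;>
    simp only [ha, hb, ha', hb', e1, e2, e3, e4, zero_smul, zero_mul, mul_zero, smul_zero,
      add_zero, zero_add, sub_zero, zero_sub, sg_zero, sg_one, sg_add, sg_mul_add, sg_add_mul,
      one_mul, mul_one] <;>
    match_scalars <;> ring
  -- By counitality this mixed family and the next sum to the same element, and `key` contains them
  -- with opposite signs.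
  have e1 : ∑ s, ∑ t, (L.counit (a' t) * K.counit (b s)) • sg R n •
      (K.sInv (a s) ⊗ₜ[R] L.sInv (b' t)) = sg R n • (K.sInv x ⊗ₜ[R] L.sInv y) := by
    conv_rhs => rw [← hr, ← hl']
    simp only [map_sum, map_smul, TensorProduct.sum_tmul, TensorProduct.tmul_sum, Finset.smul_sum,
      TensorProduct.smul_tmul_smul]
    rw [Finset.sum_comm]
    refine Finset.sum_congr rfl fun s _ => Finset.sum_congr rfl fun t _ => ?_
    module
  have e2 : ∑ s, ∑ t, (L.counit (b' t) * K.counit (a s)) • sg R n •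
      (K.sInv (b s) ⊗ₜ[R] L.sInv (a' t)) = sg R n • (K.sInv x ⊗ₜ[R] L.sInv y) := by
    conv_rhs => rw [← hl, ← hr']
    simp only [map_sum, map_smul, TensorProduct.sum_tmul, TensorProduct.tmul_sum, Finset.smul_sum,
      TensorProduct.smul_tmul_smul]
    rw [Finset.sum_comm]
    refine Finset.sum_congr rfl fun s _ => Finset.sum_congr rfl fun t _ => ?_
    module
  have e3 : ∑ s, ∑ t, (L.counit (a' t) * L.counit (b' t)) • sg R (p s) •
      ((K.sInv (a s) * K.sInv (b s)) ⊗ₜ[R] (1 : L.Cobar)) = L.counit y •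
      ((∑ s, sg R (p s) • (K.sInv (a s) * K.sInv (b s))) ⊗ₜ[R] (1 : L.Cobar)) := by
    simp only [← Finset.sum_smul, ← hyε, TensorProduct.sum_tmul, Finset.smul_sum,
      ← TensorProduct.smul_tmul']
  have e4 : ∑ s, ∑ t, (K.counit (a s) * K.counit (b s)) • sg R (p' t) •
      ((1 : K.Cobar) ⊗ₜ[R] (L.sInv (a' t) * L.sInv (b' t))) = K.counit x •
      ((1 : K.Cobar) ⊗ₜ[R] ∑ t, sg R (p' t) • (L.sInv (a' t) * L.sInv (b' t))) := by
    rw [Finset.sum_comm]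
    simp only [← Finset.sum_smul, ← hxε, TensorProduct.tmul_sum, Finset.smul_sum,
      TensorProduct.tmul_smul]
  have hab : ∀ st : Fin k × Fin k', sg R (q st.1 * p' st.2) • (a st.1 ⊗ₜ[R] a' st.2) ∈
      (K.tensor L).par (p st.1 + p' st.2) := fun st =>
    Submodule.smul_mem _ _ (tmul_mem_par (ha _) (ha' _))
  rw [LinearMap.comp_apply, LinearMap.comp_apply,
    cobarGen_apply hab (tensor_comul_tmul_prod hb ha' hx' hy'), tensor_d_tmul hx, map_add, map_neg,
    map_sum, Fintype.sum_prod_type]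
  simp only [map_smul, map_add, smul_mul_assoc, milgram_mul, milgram_sInv,
    ← TensorProduct.smul_tmul', key, Finset.sum_add_distrib, Finset.sum_sub_distrib, e1, e2, e3, e4]
  simp only [milgramGen_tmul, hK.counit_d, hL.counit_d, zero_smul, add_zero, zero_add, map_add,
    map_smul, tensorD_tmul_par _ _ (K.sInv_mem_par hx), hK.cobarD_sInv, hL.cobarD_sInv, cobarD_one,
    tensorD_tmul_par _ _ (CoHoch.one_mem_par (G := K.barGrading)), TensorProduct.zero_tmul,
    TensorProduct.tmul_zero, sg_zero, one_smul, smul_zero, cobarGen_apply ha hx',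
    cobarGen_apply ha' hy', TensorProduct.add_tmul, TensorProduct.tmul_add,
    TensorProduct.neg_tmul, TensorProduct.tmul_neg]
  rw [smul_smul, K.sg_counit hx]
  module

theorem tensorD_milgram (hK : K.Laws) (hL : L.Laws) (w : (K.tensor L).Cobar) :
    tensorD K.cobarGrading K.cobarD L.cobarD (K.milgram L w) =
      K.milgram L ((K.tensor L).cobarD w) := by
  induction w using (K.tensor L).cobarGrading.parity_induction with
  | ha x y hx hy => simp only [map_add, hx, hy]
  | hg i w hw =>
    refine word_par_induction (G := (K.tensor L).barGrading) (p := fun _ w =>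
      tensorD K.cobarGrading K.cobarD L.cobarD (K.milgram L w) =
        K.milgram L ((K.tensor L).cobarD w)) ?_ ?_ ?_ ?_ (fun i j v w hv hw ih => ?_) hw
    · simp
    · intro i x y hx hy; simp only [map_add, hx, hy]
    · intro i r x hx; simp only [map_smul, hx]
    · simp [milgram_one, cobarD_one, tensorD]
    · have hv' := K.milgram_deg (L := L) |>.par_zero (ι_mem_par hv)
      rw [milgram_mul, tensorD_cobarMul hK hL hv', cobarD_mul_par (ι_mem_par hv), cobarD_ι, map_add,
        map_smul, milgram_mul, milgram_mul, ih, ← tensorD_milgramGen hK hL, ← milgram_sInv, sInv_bar]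

end PreCoalg

end

end CoHoch

namespace CoHoch

noncomputable section

open Grading

/-! ### The extended Milgram map is a natural chain map. -/

namespace PreCoalg

variable {R C D E F : Type*} [CommRing R] [AddCommGroup C] [Module R C] [AddCommGroup D]
  [Module R D] [AddCommGroup E] [Module R E] [AddCommGroup F] [Module R F] {K : PreCoalg R C}
  {L : PreCoalg R D} {K' : PreCoalg R E} {L' : PreCoalg R F}

theorem milgramHat_tmul (z : C ⊗[R] D) (w : (K.tensor L).Cobar) :
    K.milgramHat L (z ⊗ₜ w) = Grading.interchange L.toGrading K.cobarGrading
      (z ⊗ₜ K.milgram L w) := rfl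

theorem milgramHat_deg : Deg (K.tensor L).hhGrading (K.hhGrading.tensor L.hhGrading) 0
    (K.milgramHat L) := Deg.interchange.comp milgram_deg.lTensor (by norm_num)

/-- The statement is made for an arbitrary z of Ω C ⊗ Ω D in place of q(w), so the cobar
construction of the tensor product disappears and z may be taken to be a homogeneous tensor u ⊗ v.
The twist by q s⁻¹(x₍ᵢ₎ ⊗ y₍ᵢ₎) then splits in two, each part with a counit. Counitality contracts
one of the two comultiplications and leaves the twist of the other tensor factor. -/
theorem tensorD_interchange (hK : K.Laws) (hL : L.Laws) {n m l : ZMod 2} {x : C} {y : D}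
    {z : K.Cobar ⊗[R] L.Cobar} (hx : x ∈ K.par n) (hy : y ∈ L.par m)
    (hz : z ∈ (K.cobarGrading.tensor L.cobarGrading).par l)
    {k k' : ℕ} {a b : Fin k → C} {p q : Fin k → ZMod 2} {a' b' : Fin k' → D}
    {p' q' : Fin k' → ZMod 2} (ha : ∀ t, a t ∈ K.par (p t)) (hb : ∀ t, b t ∈ K.par (q t))
    (hn : ∀ t, n = p t + q t) (hx' : K.comul x = ∑ t, a t ⊗ₜ[R] b t)
    (hl : ∑ t, K.counit (a t) • b t = x) (hr : ∑ t, K.counit (b t) • a t = x)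
    (ha' : ∀ t, a' t ∈ L.par (p' t)) (hb' : ∀ t, b' t ∈ L.par (q' t))
    (hn' : ∀ t, m = p' t + q' t) (hy' : L.comul y = ∑ t, a' t ⊗ₜ[R] b' t)
    (hl' : ∑ t, L.counit (a' t) • b' t = y) (hr' : ∑ t, L.counit (b' t) • a' t = y) :
    tensorD K.hhGrading K.hhD L.hhD
      (Grading.interchange L.toGrading K.cobarGrading ((x ⊗ₜ y) ⊗ₜ z)) =
    Grading.interchange L.toGrading K.cobarGrading ((K.tensor L).d (x ⊗ₜ y) ⊗ₜ z) +
    sg R (n + m) • Grading.interchange L.toGrading K.cobarGrading ((x ⊗ₜ y) ⊗ₜ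
      tensorD K.cobarGrading K.cobarD L.cobarD z) -
    ∑ s, ∑ t, sg R (p s + p' t) • sg R (q s * p' t) • Grading.interchange L.toGrading K.cobarGrading
      ((a s ⊗ₜ a' t) ⊗ₜ cobarMul K L (K.milgramGen L (b s ⊗ₜ b' t) ⊗ₜ z)) +
    ∑ s, ∑ t, sg R ((p s + p' t + 1) * (q s + q' t + l)) • sg R (q s * p' t) •
      Grading.interchange L.toGrading K.cobarGrading
      ((b s ⊗ₜ b' t) ⊗ₜ cobarMul K L (z ⊗ₜ K.milgramGen L (a s ⊗ₜ a' t))) := by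
  refine tensor_par_induction ?_ ?_ (fun i j hlij u hu v hv => ?_) hz
  · simp
  · intro z z' h h'
    simp only [TensorProduct.add_tmul, TensorProduct.tmul_add, map_add, h, h', smul_add,
      Finset.sum_add_distrib]
    abel
  have key1 : ∀ s t, sg R (p s + p' t) • sg R (q s * p' t) •
      Grading.interchange L.toGrading K.cobarGrading
      ((a s ⊗ₜ a' t) ⊗ₜ cobarMul K L (K.milgramGen L (b s ⊗ₜ b' t) ⊗ₜ (u ⊗ₜ v))) =
      L.counit (b' t) • sg R (m * i) • sg R (p s) •
        ((a s ⊗ₜ (K.sInv (b s) * u)) ⊗ₜ[R] (a' t ⊗ₜ v)) +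
      K.counit (b s) • (sg R (m * i) * sg R (n + i)) • sg R (p' t) •
        ((a s ⊗ₜ u) ⊗ₜ[R] (a' t ⊗ₜ (L.sInv (b' t) * v))) := by
    intro s t
    have h1' : (1 : L.Cobar) ∈ L.cobarGrading.par 0 := CoHoch.one_mem_par
    have hsu := CoHoch.mul_mem_par (K.sInv_mem_par (hb s)) hu
    simp only [milgramGen_tmul, TensorProduct.add_tmul, TensorProduct.tmul_add, map_add,
      ← TensorProduct.smul_tmul', TensorProduct.tmul_smul, map_smul,
      cobarMul_tmul _ _ h1' hu, cobarMul_tmul _ _ (L.sInv_mem_par (hb' t)) hu, one_mul,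
      interchange_par _ _ (ha' t) hsu, interchange_par _ _ (ha' t) hu]
    have e2 := K.counit_of_odd (x := b s)
    have e4 := L.counit_of_odd (x := b' t)
    have hb := hb s
    have hb' := hb' t
    rw [hn s, hn' t]
    -- Each term contains the counit of one of these two elements, so splitting on their parities
    -- either removes the term or fixes the parity on which its sign depends.
    rcases zmod_two_cases (q s) with h2 | h2 <;> rcases zmod_two_cases (q' t) with h4 | h4 <;>
    rw [h2] at hb ⊢ <;> rw [h4] at hb' ⊢ <;>
    simp only [hb, hb', e2, e4, zero_smul, zero_mul, mul_zero, smul_zero,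
      add_zero, zero_add, sg_zero, sg_one, sg_add, sg_mul_add, sg_add_mul,
      one_mul, mul_one] <;>
    match_scalars <;>
    simp only [sg_sq, sg_sq_left, mul_comm, mul_left_comm, mul_assoc, mul_one, one_mul]
  have key2 : ∀ s t, sg R ((p s + p' t + 1) * (q s + q' t + l)) • sg R (q s * p' t) •
      Grading.interchange L.toGrading K.cobarGrading
      ((b s ⊗ₜ b' t) ⊗ₜ cobarMul K L ((u ⊗ₜ v) ⊗ₜ K.milgramGen L (a s ⊗ₜ a' t))) =
      L.counit (a' t) • sg R (m * i) • sg R ((p s + 1) * (q s + i)) •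
        ((b s ⊗ₜ (u * K.sInv (a s))) ⊗ₜ[R] (b' t ⊗ₜ v)) +
      K.counit (a s) • (sg R (m * i) * sg R (n + i)) • sg R ((p' t + 1) * (q' t + j)) •
        ((b s ⊗ₜ u) ⊗ₜ[R] (b' t ⊗ₜ (v * L.sInv (a' t)))) := by
    intro s t
    have h1 : (1 : K.Cobar) ∈ K.cobarGrading.par 0 := CoHoch.one_mem_par
    have hsu := CoHoch.mul_mem_par hu (K.sInv_mem_par (ha s))
    simp only [milgramGen_tmul, TensorProduct.add_tmul, TensorProduct.tmul_add, map_add,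
      ← TensorProduct.smul_tmul', TensorProduct.tmul_smul, map_smul,
      cobarMul_tmul _ _ hv h1, cobarMul_tmul _ _ hv (K.sInv_mem_par (ha s)), mul_one,
      interchange_par _ _ (hb' t) hsu, interchange_par _ _ (hb' t) hu]
    have e2 := K.counit_of_odd (x := a s)
    have e4 := L.counit_of_odd (x := a' t)
    have ha := ha s
    have ha' := ha' t
    rw [hn s, hn' t, hlij]
    rcases zmod_two_cases (p s) with h2 | h2 <;> rcases zmod_two_cases (p' t) with h4 | h4 <;>
    rw [h2] at ha ⊢ <;> rw [h4] at ha' ⊢ <;>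
    simp only [ha, ha', e2, e4, zero_smul, zero_mul, mul_zero, smul_zero,
      add_zero, zero_add, sg_zero, sg_one, sg_add, sg_mul_add, sg_add_mul,
      one_mul, mul_one] <;>
    match_scalars <;>
    simp only [sg_sq, sg_sq_left, mul_comm, mul_left_comm, mul_assoc, mul_one, one_mul]
  have e1 : ∑ s, ∑ t, L.counit (b' t) • sg R (m * i) • sg R (p s) •
        ((a s ⊗ₜ[R] (K.sInv (b s) * u)) ⊗ₜ[R] (a' t ⊗ₜ[R] v)) = sg R (m * i) •
        ((∑ s, sg R (p s) • (a s ⊗ₜ[R] (K.sInv (b s) * u))) ⊗ₜ[R] (y ⊗ₜ[R] v)) := by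
    conv_rhs => rw [← hr']
    simp only [TensorProduct.sum_tmul, TensorProduct.tmul_sum, Finset.smul_sum,
      ← TensorProduct.smul_tmul', TensorProduct.tmul_smul]
    rw [Finset.sum_comm]
    refine Finset.sum_congr rfl fun s _ => Finset.sum_congr rfl fun t _ => ?_
    module
  have e2 : ∑ s, ∑ t, K.counit (b s) • (sg R (m * i) * sg R (n + i)) • sg R (p' t) •
        ((a s ⊗ₜ[R] u) ⊗ₜ[R] (a' t ⊗ₜ[R] (L.sInv (b' t) * v))) = (sg R (m * i) * sg R (n + i)) •
        ((x ⊗ₜ[R] u) ⊗ₜ[R] ∑ t, sg R (p' t) • (a' t ⊗ₜ[R] (L.sInv (b' t) * v))) := by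
    conv_rhs => rw [← hr]
    simp only [TensorProduct.sum_tmul, TensorProduct.tmul_sum, Finset.smul_sum,
      ← TensorProduct.smul_tmul', TensorProduct.tmul_smul]
    rw [Finset.sum_comm]
    refine Finset.sum_congr rfl fun s _ => Finset.sum_congr rfl fun t _ => ?_
    module
  have e3 : ∑ s, ∑ t, L.counit (a' t) • sg R (m * i) • sg R ((p s + 1) * (q s + i)) •
        ((b s ⊗ₜ[R] (u * K.sInv (a s))) ⊗ₜ[R] (b' t ⊗ₜ[R] v)) = sg R (m * i) •
        ((∑ s, sg R ((p s + 1) * (q s + i)) • (b s ⊗ₜ[R] (u * K.sInv (a s)))) ⊗ₜ[R] (y ⊗ₜ[R] v)) := by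
    conv_rhs => rw [← hl']
    simp only [TensorProduct.sum_tmul, TensorProduct.tmul_sum, Finset.smul_sum,
      ← TensorProduct.smul_tmul', TensorProduct.tmul_smul]
    rw [Finset.sum_comm]
    refine Finset.sum_congr rfl fun s _ => Finset.sum_congr rfl fun t _ => ?_
    module
  have e4 : ∑ s, ∑ t, K.counit (a s) • (sg R (m * i) * sg R (n + i)) •
        sg R ((p' t + 1) * (q' t + j)) • ((b s ⊗ₜ[R] u) ⊗ₜ[R] (b' t ⊗ₜ[R] (v * L.sInv (a' t)))) =
        (sg R (m * i) * sg R (n + i)) • ((x ⊗ₜ[R] u) ⊗ₜ[R] ∑ t, sg R ((p' t + 1) * (q' t + j)) •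
          (b' t ⊗ₜ[R] (v * L.sInv (a' t)))) := by
    conv_rhs => rw [← hl]
    simp only [TensorProduct.sum_tmul, TensorProduct.tmul_sum, Finset.smul_sum,
      ← TensorProduct.smul_tmul', TensorProduct.tmul_smul]
    rw [Finset.sum_comm]
    refine Finset.sum_congr rfl fun s _ => Finset.sum_congr rfl fun t _ => ?_
    module
  simp only [key1, key2, Finset.sum_add_distrib, e1, e2, e3, e4]
  have hdu := hK.cobarD_deg.par_neg_one hu
  have hdy := hL.d_deg.par_neg_one hy
  have Kx := twD_tmul (GB := K.cobarGrading) hx ha hb hx' K.cobarD K.sInv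
    (fun _ _ => K.sInv_mem_par) hu
  have Ly := twD_tmul (GB := L.cobarGrading) hy ha' hb' hy' L.cobarD L.sInv
    (fun _ _ => L.sInv_mem_par) hv
  rw [← hhD_eq_twD] at Kx Ly
  rw [interchange_par _ _ hy hu, map_smul, tensorD_tmul_par _ _ (tmul_mem_par hx hu), Kx, Ly,
    tensor_d_tmul hx, tensorD_tmul_par _ _ hu]
  simp only [TensorProduct.add_tmul, TensorProduct.tmul_add, TensorProduct.sub_tmul,
    TensorProduct.tmul_sub, map_add, ← TensorProduct.smul_tmul', TensorProduct.tmul_smul, map_smul,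
    interchange_par _ _ hy hu, interchange_par _ _ hdy hu, interchange_par _ _ hy hdu]
  match_scalars <;>
  simp only [sg_add, sg_mul_add, sg_add_mul, sg_mul_one, sg_one_mul, sg_one, sg_sq, sg_sq_left,
    mul_comm, mul_left_comm, mul_assoc, mul_neg, neg_mul, mul_one, one_mul, neg_neg]

/-- This is `tensorD_interchange` for z = q(w): multiplicativity of q turns the left and right
twists of w into products of q(w) with the generator formula, and q commutes with the differentials.
-/
theorem milgramHat_hhD (hK : K.Laws) (hL : L.Laws) :
    K.milgramHat L ∘ₗ (K.tensor L).hhD = tensorD K.hhGrading K.hhD L.hhD ∘ₗ K.milgramHat L := by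
  refine TensorProduct.ext_threefold fun x y w => ?_
  induction x using K.toGrading.parity_induction with
  | ha x x' h h' => simp only [TensorProduct.add_tmul, map_add, h, h']
  | hg n x hx =>
    induction y using L.toGrading.parity_induction with
    | ha x x' h h' => simp only [TensorProduct.add_tmul, TensorProduct.tmul_add, map_add, h, h']
    | hg m y hy =>
      induction w using (K.tensor L).cobarGrading.parity_induction with
      | ha x x' h h' => simp only [TensorProduct.tmul_add, map_add, h, h']
      | hg l w hw =>
        obtain ⟨k, a, b, p, q, ha, hb, hn, hx', hl, hr⟩ := hK.sweedler hx
        obtain ⟨k', a', b', p', q', ha', hb', hn', hy', hl', hr'⟩ := hL.sweedler hy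
        have hab : ∀ st : Fin k × Fin k', sg R (q st.1 * p' st.2) • (a st.1 ⊗ₜ[R] a' st.2) ∈
            (K.tensor L).par (p st.1 + p' st.2) := fun st =>
          Submodule.smul_mem _ _ (tmul_mem_par (ha _) (ha' _))
        have hab' : ∀ st : Fin k × Fin k', b st.1 ⊗ₜ[R] b' st.2 ∈
            (K.tensor L).par (q st.1 + q' st.2) := fun st => tmul_mem_par (hb _) (hb' _)
        have hxy : x ⊗ₜ[R] y ∈ (K.tensor L).par (n + m) := tmul_mem_par hx hy
        have e := twD_tmul (GB := (K.tensor L).cobarGrading) hxy hab hab'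
          (tensor_comul_tmul_prod hb ha' hx' hy') (K.tensor L).cobarD (K.tensor L).sInv
          (fun _ _ => (K.tensor L).sInv_mem_par) hw
        rw [← hhD_eq_twD] at e
        rw [LinearMap.comp_apply, LinearMap.comp_apply, e, milgramHat_tmul,
          tensorD_interchange hK hL hx hy (milgram_deg.par_zero hw) ha hb hn hx' hl hr ha' hb' hn'
            hy' hl' hr']
        simp only [Fintype.sum_prod_type, map_add, map_sub, map_sum, map_smul, milgramHat_tmul,
          milgram_mul, milgram_sInv, tensorD_milgram hK hL, TensorProduct.tmul_smul,
          ← TensorProduct.smul_tmul']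

theorem milgramHat_natural {f : C →ₗ[R] E} {g : D →ₗ[R] F} (hf : Deg K.toGrading K'.toGrading 0 f)
    (hg : Deg L.toGrading L'.toGrading 0 g) (hf1 : f K.one = K'.one) (hg1 : g L.one = L'.one)
    (hfε : K'.counit ∘ₗ f = K.counit) (hgε : L'.counit ∘ₗ g = L.counit) :
    K'.milgramHat L' ∘ₗ (K.tensor L).hhMap (K'.tensor L') (TensorProduct.map f g) =
      TensorProduct.map (K.hhMap K' f) (L.hhMap L' g) ∘ₗ K.milgramHat L := by
  refine TensorProduct.ext' fun z w => ?_
  have h1 := LinearMap.congr_fun (milgram_natural hf hg hf1 hg1 hfε hgε) w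
  have h2 := LinearMap.congr_fun (interchange_natural (GA := K.cobarGrading)
    (GA' := K'.cobarGrading) f (L.cobarMap L' g).toLinearMap (cobarMap_deg hf) hg)
    (z ⊗ₜ K.milgram L w)
  simp only [LinearMap.comp_apply, TensorProduct.map_tmul, AlgHom.toLinearMap_apply] at h1 h2
  simp only [LinearMap.comp_apply, hhMap, TensorProduct.map_tmul, milgramHat_tmul,
    AlgHom.toLinearMap_apply, h1]
  exact h2

end PreCoalg

end

end CoHoch

namespace CoHoch

noncomputable section

open Grading

/-! ### Augmentations, the natural inclusion and the natural projection. -/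

namespace PreCoalg

variable {R C D E F : Type*} [CommRing R] [AddCommGroup C] [Module R C] [AddCommGroup D]
  [Module R D] [AddCommGroup E] [Module R E] [AddCommGroup F] [Module R F] {K : PreCoalg R C}
  {L : PreCoalg R D} {K' : PreCoalg R E} {L' : PreCoalg R F}

/-- The augmentation of `Ω C`. -/
abbrev aug (K : PreCoalg R C) : K.Cobar →ₐ[R] R := TensorAlgebra.algebraMapInv

theorem aug_ι (v : K.bar) : K.aug (TensorAlgebra.ι R v) = 0 := by
  simp [TensorAlgebra.algebraMapInv]

theorem aug_sInv (x : C) : K.aug (K.sInv x) = 0 := aug_ι _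

/-- Nonempty words are killed and the empty word is even. As for the counit, Koszul signs next to an
augmentation become irrelevant. -/
theorem aug_of_odd {a : K.Cobar} (ha : a ∈ K.cobarGrading.par 1) : K.aug a = 0 := by
  refine word_par_induction (G := K.barGrading) (p := fun i a => i = 1 → K.aug a = 0)
    (fun _ _ => map_zero _) (fun _ x y hx hy h => by rw [map_add, hx h, hy h, add_zero])
    (fun _ r x hx h => by rw [map_smul, hx h, smul_zero]) (fun h => by simp at h)
    (fun i j v w _ _ _ _ => by rw [map_mul, aug_ι, zero_mul]) ha rfl

theorem hhProj_tmul (x : C) (w : K.Cobar) : K.hhProj (x ⊗ₜ w) = K.aug w • x := by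
  simp [hhProj]

/-- The augmentation of `Ω C ⊗ Ω D`. -/
def augMul (K : PreCoalg R C) (L : PreCoalg R D) : K.Cobar ⊗[R] L.Cobar →ₗ[R] R :=
  LinearMap.mul' R R ∘ₗ TensorProduct.map K.aug.toLinearMap L.aug.toLinearMap

theorem augMul_tmul (u : K.Cobar) (v : L.Cobar) : augMul K L (u ⊗ₜ v) = K.aug u * L.aug v := by
  simp [augMul]

theorem augMul_cobarMul (x y : K.Cobar ⊗[R] L.Cobar) :
    augMul K L (cobarMul K L (x ⊗ₜ y)) = augMul K L x * augMul K L y := by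
  have : augMul K L ∘ₗ cobarMul K L =
      LinearMap.mul' R R ∘ₗ TensorProduct.map (augMul K L) (augMul K L) := by
    refine TensorProduct.ext_fourfold' fun u v u' v' => ?_
    induction v using L.cobarGrading.parity_induction with
    | ha x x' h h' => simp only [TensorProduct.add_tmul, TensorProduct.tmul_add, map_add, h, h']
    | hg i v hv =>
      induction u' using K.cobarGrading.parity_induction with
      | ha x x' h h' => simp only [TensorProduct.add_tmul, TensorProduct.tmul_add, map_add, h, h']
      | hg j u' hu' =>
        rw [LinearMap.comp_apply, cobarMul_tmul _ _ hv hu', LinearMap.comp_apply, map_smul]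
        simp only [augMul_tmul, TensorProduct.map_tmul, LinearMap.mul'_apply, map_mul]
        rcases zmod_two_cases i with rfl | rfl
        · rw [zero_mul, sg_zero, one_smul]; ring
        · rw [aug_of_odd hv]; simp
  have := LinearMap.congr_fun this (x ⊗ₜ y)
  simpa using this

theorem augMul_milgram : augMul K L ∘ₗ K.milgram L = (K.tensor L).aug.toLinearMap := by
  refine linearMap_ext_of_mul (LinearMap.mul R R) ?_ (fun v => ?_) (fun a b => ?_) (fun a b => ?_)
  · simp [milgram_one, augMul_tmul]
  · rw [← sInv_bar, LinearMap.comp_apply, milgram_sInv, AlgHom.toLinearMap_apply, aug_sInv]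
    generalize (v : C ⊗[R] D) = z
    induction z using TensorProduct.induction_on with
    | zero => simp
    | add x y hx hy => rw [map_add, map_add, hx, hy, add_zero]
    | tmul x y => simp [milgramGen_tmul, augMul_tmul, aug_sInv]
  · simp [milgram_mul, augMul_cobarMul]
  · simp

/-- The augmentation of Ω C ⊗ Ω D pulls back along q to that of Ω(C ⊗ D), and the sign in q̂ is
trivial wherever the augmentation does not vanish. -/
theorem hhProj_milgramHat :
    TensorProduct.map K.hhProj L.hhProj ∘ₗ K.milgramHat L = (K.tensor L).hhProj := by
  have key : TensorProduct.map K.hhProj L.hhProj ∘ₗ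
      Grading.interchange L.toGrading K.cobarGrading =
      (TensorProduct.rid R (C ⊗[R] D)).toLinearMap ∘ₗ LinearMap.lTensor _ (augMul K L) := by
    refine TensorProduct.ext_fourfold' fun x y u v => ?_
    induction y using L.toGrading.parity_induction with
    | ha x x' h h' => simp only [TensorProduct.add_tmul, TensorProduct.tmul_add, map_add, h, h']
    | hg i y hy =>
      induction u using K.cobarGrading.parity_induction with
      | ha x x' h h' => simp only [TensorProduct.add_tmul, TensorProduct.tmul_add, map_add, h, h']
      | hg j u hu =>
        rw [LinearMap.comp_apply, interchange_par _ _ hy hu, LinearMap.comp_apply, map_smul]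
        simp only [augMul_tmul, TensorProduct.map_tmul, hhProj_tmul, LinearMap.lTensor_tmul,
          TensorProduct.smul_tmul_smul, LinearEquiv.coe_coe, TensorProduct.rid_tmul]
        rcases zmod_two_cases j with rfl | rfl
        · rw [mul_zero, sg_zero, one_smul]
        · rw [aug_of_odd hu]; simp
  refine TensorProduct.ext' fun z w => ?_
  have h1 := LinearMap.congr_fun key (z ⊗ₜ K.milgram L w)
  have h2 := LinearMap.congr_fun (augMul_milgram (K := K) (L := L)) w
  simp only [LinearMap.comp_apply, AlgHom.toLinearMap_apply] at h1 h2
  rw [LinearMap.comp_apply, milgramHat_tmul, h1, hhProj_tmul, LinearMap.lTensor_tmul, h2]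
  simp

theorem milgramHat_hhIncl :
    K.milgramHat L ∘ₗ (K.tensor L).hhIncl =
      TensorProduct.map K.hhIncl L.hhIncl ∘ₗ K.milgram L := by
  refine LinearMap.ext fun w => ?_
  rw [LinearMap.comp_apply, hhIncl, TensorProduct.mk_apply, milgramHat_tmul, LinearMap.comp_apply]
  generalize K.milgram L w = z
  induction z using TensorProduct.induction_on with
  | zero => simp
  | add x y hx hy => simp only [TensorProduct.tmul_add, map_add, hx, hy]
  | tmul u v =>
    induction u using K.cobarGrading.parity_induction with
    | ha x x' h h' => simp only [TensorProduct.add_tmul, TensorProduct.tmul_add, map_add, h, h']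
    | hg j u hu =>
      rw [tensor_one, interchange_par _ _ L.one_mem_par hu, zero_mul, sg_zero, one_smul]
      simp [hhIncl]

/-- The inserted word b remains beside every marked letter, so every summand of the rotation has
augmentation zero in its second factor. -/
theorem hhProj_rotate_of_aug (a : K.Cobar) {b : K.Cobar} (hb : K.aug b = 0) :
    K.hhProj (K.rotate (a ⊗ₜ b)) = 0 := by
  have key : ∀ i, ∀ a ∈ K.cobarGrading.par i, ∀ j, ∀ b ∈ K.cobarGrading.par j, K.aug b = 0 →
      K.hhProj (K.rotate (a ⊗ₜ b)) = 0 := by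
    intro i a ha
    refine word_par_induction (G := K.barGrading) (p := fun i a => ∀ j,
      ∀ b ∈ K.cobarGrading.par j, K.aug b = 0 → K.hhProj (K.rotate (a ⊗ₜ b)) = 0)
      ?_ ?_ ?_ ?_ ?_ ha
    · simp
    · intro i x y hx hy j b hb h
      rw [TensorProduct.add_tmul, map_add, map_add, hx j b hb h, hy j b hb h, add_zero]
    · intro i r x hx j b hb h
      rw [← TensorProduct.smul_tmul', map_smul, map_smul, hx j b hb h, smul_zero]
    · intro j b _ _
      rw [rotate_one, map_zero]
    · intro i j v w hv hw ih k b hb h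
      rw [rotate_ι_mul hv hw hb, map_add, map_smul, ih _ _ (mul_mem_par hb (ι_mem_par hv))
        (by rw [map_mul, aug_ι, mul_zero]), hhProj_tmul, map_mul, h, mul_zero, zero_smul, smul_zero,
        add_zero]
  induction a using K.cobarGrading.parity_induction with
  | ha x y hx hy => rw [TensorProduct.add_tmul, map_add, map_add, hx, hy, add_zero]
  | hg i a ha =>
    -- The hypothesis ε(b) = 0 is not inherited by summands of b in a form usable for induction. The
    -- expression b - ε(b)1 is additive in b and always has augmentation zero.
    have h0 : b = b - K.aug b • 1 := by rw [hb, zero_smul, sub_zero]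
    rw [h0]
    clear h0 hb
    induction b using K.cobarGrading.parity_induction with
    | ha x y hx hy =>
      rw [map_add, add_smul, add_sub_add_comm, TensorProduct.tmul_add, map_add, map_add, hx, hy,
        add_zero]
    | hg j b hb =>
      rcases zmod_two_cases j with rfl | rfl
      · exact key i a ha 0 _ (sub_mem hb (Submodule.smul_mem _ _ CoHoch.one_mem_par)) (by simp)
      · rw [aug_of_odd hb, zero_smul, sub_zero]
        exact key i a ha 1 b hb (aug_of_odd hb)

/-- If a later letter is marked, v is carried to the right end and the augmentation kills the term;
only the summand marking v itself survives. -/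
theorem hhProj_rotate_ι_mul (v : K.bar) (a b : K.Cobar) :
    K.hhProj (K.rotate ((TensorAlgebra.ι R v * a) ⊗ₜ b)) = (K.aug a * K.aug b) • (v : C) := by
  induction v using K.barGrading.parity_induction with
  | ha x y hx hy =>
    rw [map_add, add_mul, TensorProduct.add_tmul, map_add, map_add, hx, hy, Submodule.coe_add,
      smul_add]
  | hg i v hv =>
    induction a using K.cobarGrading.parity_induction with
    | ha x y hx hy =>
      rw [mul_add, TensorProduct.add_tmul, map_add, map_add, hx, hy, map_add]
      module
    | hg j a ha =>
      induction b using K.cobarGrading.parity_induction with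
      | ha x y hx hy =>
        rw [TensorProduct.tmul_add, map_add, map_add, hx, hy, map_add]
        module
      | hg l b hb =>
        rw [rotate_ι_mul hv ha hb, map_add, map_smul, hhProj_rotate_of_aug _
          (by rw [map_mul, aug_ι, mul_zero]), hhProj_tmul, map_mul, smul_zero, add_zero]

theorem aug_of_mem_pow {k : ℕ} {a : K.Cobar}
    (ha : a ∈ LinearMap.range (TensorAlgebra.ι R : K.bar →ₗ[R] K.Cobar) ^ (k + 1)) :
    K.aug a = 0 := by
  rw [pow_succ'] at ha
  induction ha using Submodule.mul_induction_on' with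
  | mem_mul_mem x hx y hy =>
    obtain ⟨v, rfl⟩ := hx
    rw [map_mul, aug_ι, zero_mul]
  | add x _ y _ hx hy => rw [map_add, hx, hy, add_zero]

/-- In a word of length at least 2 the letters after the first already have augmentation zero. This
is what makes the higher components of ω invisible after projection to C. -/
theorem hhProj_rotate_higher {a : K.Cobar}
    (ha : a ∈ ⨆ k : ℕ, LinearMap.range (TensorAlgebra.ι R : K.bar →ₗ[R] K.Cobar) ^ (k + 2))
    (b : K.Cobar) : K.aug a = 0 ∧ K.hhProj (K.rotate (a ⊗ₜ b)) = 0 := by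
  induction ha using Submodule.iSup_induction' with
  | mem k a ha =>
    refine ⟨aug_of_mem_pow ha, ?_⟩
    rw [pow_succ'] at ha
    induction ha using Submodule.mul_induction_on' with
    | mem_mul_mem x hx y hy =>
      obtain ⟨v, rfl⟩ := hx
      rw [hhProj_rotate_ι_mul, aug_of_mem_pow hy, zero_mul, zero_smul]
    | add x _ y _ hx hy => rw [TensorProduct.add_tmul, map_add, map_add, hx, hy, add_zero]
  | zero => simp
  | add x y _ _ hx hy =>
    rw [map_add, hx.1, hy.1, TensorProduct.add_tmul, map_add, map_add, hx.2, hy.2]; simp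

theorem _root_.CoHoch.Realizes.aug_apply {f : C →ₗ[R] D} {ω : K.Cobar →ₐ[R] L.Cobar} (h : Realizes K L f ω)
    (w : K.Cobar) : L.aug (ω w) = K.aug w := by
  have : L.aug.comp ω = K.aug := by
    refine TensorAlgebra.hom_ext (LinearMap.ext fun v => ?_)
    have h1 := (hhProj_rotate_higher (h.higher v) 1).1
    rw [map_sub, aug_sInv, sub_zero, sInv_bar] at h1
    simp only [LinearMap.comp_apply, AlgHom.toLinearMap_apply, AlgHom.comp_apply, h1, aug_ι]
  exact DFunLike.congr_fun this w

/-- Only the linear part s⁻¹f(x) of ω(s⁻¹x) contributes, and its rotation misses f(x) by ε(x)1,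
which is exactly the first summand of the hat. -/
theorem _root_.CoHoch.Realizes.hhProj_hhHat {f : C →ₗ[R] D} {ω : K.Cobar →ₐ[R] L.Cobar} (h : Realizes K L f ω)
    (hε : L.counit ∘ₗ f = K.counit) : L.hhProj ∘ₗ K.hhHat L ω = f ∘ₗ K.hhProj := by
  refine TensorProduct.ext' fun x w => ?_
  have e : ω (K.sInv x) = (ω (K.sInv x) - L.sInv (f x)) + L.sInv (f x) := by abel
  have h1 := LinearMap.congr_fun hε x
  rw [LinearMap.comp_apply] at h1
  rw [LinearMap.comp_apply, hhHat_eq, LinearMap.comp_apply, LinearMap.lTensor_tmul, gam_tmul,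
    LinearMap.comp_apply, AlgHom.toLinearMap_apply, AlgHom.toLinearMap_apply, e,
    TensorProduct.add_tmul, map_add, map_add, map_add,
    (hhProj_rotate_higher (h.higher x) (ω w)).2, rotate_sInv, h1]
  simp [hhProj_tmul, h.aug_apply]

end PreCoalg

/-! ### Compatibilities of the comultiplication: projection, inclusion, differential, naturality. -/

theorem IsWeakAW.hhProj_hhComul {R C : Type*} [CommRing R] [AddCommGroup C] [Module R C]
    {K : ChainCoalg R C} {ω : K.Cobar →ₐ[R] (K.tensor K.toPreCoalg).Cobar} (h : IsWeakAW K ω) :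
    TensorProduct.map K.hhProj K.hhProj ∘ₗ K.hhComul ω = K.comul ∘ₗ K.hhProj := by
  rw [PreCoalg.hhComul, ← LinearMap.comp_assoc, PreCoalg.hhProj_milgramHat]
  refine Realizes.hhProj_hhHat h (LinearMap.ext fun x => ?_)
  induction x using K.toGrading.parity_induction with
  | ha x y hx hy => rw [map_add, map_add, hx, hy]
  | hg n x hx =>
    obtain ⟨k, a, b, p, q, ha, hb, hn, hx', hl, hr⟩ := K.laws.sweedler hx
    rw [LinearMap.comp_apply, hx']
    conv_rhs => rw [← hl]
    simp [PreCoalg.tensor_counit_tmul]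

theorem hhComul_hhIncl {R C : Type*} [CommRing R] [AddCommGroup C] [Module R C]
    (K : PreCoalg R C) (ω : K.Cobar →ₐ[R] (K.tensor K).Cobar) :
    K.hhComul ω ∘ₗ K.hhIncl = TensorProduct.map K.hhIncl K.hhIncl ∘ₗ K.loopComul ω := by
  refine LinearMap.ext fun w => ?_
  have := LinearMap.congr_fun (PreCoalg.milgramHat_hhIncl (K := K) (L := K)) (ω w)
  simp only [LinearMap.comp_apply] at this
  simp [PreCoalg.hhComul, PreCoalg.loopComul, PreCoalg.hhHat_hhIncl, this]

theorem IsWeakAW.isChainMap_hhComul {R C : Type*} [CommRing R] [AddCommGroup C] [Module R C]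
    {K : ChainCoalg R C} {ω : K.Cobar →ₐ[R] (K.tensor K.toPreCoalg).Cobar} (h : IsWeakAW K ω) :
    IsChainMap K.hhGrading K.hhD (K.hhGrading.tensor K.hhGrading)
      (tensorD K.hhGrading K.hhD K.hhD) (K.hhComul ω) where
  degree := hasDegree_iff.mpr (PreCoalg.milgramHat_deg.comp
    (PreCoalg.hhHat_deg (hasDegree_iff.mp h.degree)) (by norm_num))
  comm := by
    rw [PreCoalg.hhComul, LinearMap.comp_assoc, PreCoalg.hhHat_hhD K.laws (K.laws.tensor K.laws)
      h.toIsChainMap, ← LinearMap.comp_assoc, PreCoalg.milgramHat_hhD K.laws K.laws,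
      LinearMap.comp_assoc]

/-- Rewriting Ĥ(f) as the hat of Ω f, functoriality transports the relation between ω and ω' to the
hats; naturality of q̂ then finishes the square. -/
theorem IsAWMap.hhComul_hhMap {R C D : Type*} [CommRing R] [AddCommGroup C] [Module R C]
    [AddCommGroup D] [Module R D] {K : ChainCoalg R C} {L : ChainCoalg R D}
    {ω : K.Cobar →ₐ[R] (K.tensor K.toPreCoalg).Cobar}
    {ω' : L.Cobar →ₐ[R] (L.tensor L.toPreCoalg).Cobar} {f : C →ₗ[R] D} (hω : IsWeakAW K ω)
    (hω' : IsWeakAW L ω') (hf : IsAWMap K ω L ω' f) :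
    L.hhComul ω' ∘ₗ K.hhMap L.toPreCoalg f =
      TensorProduct.map (K.hhMap L.toPreCoalg f) (K.hhMap L.toPreCoalg f) ∘ₗ K.hhComul ω := by
  have hd := hasDegree_iff.mp hf.degree
  have hff : (K.tensor K.toPreCoalg).Deg (L.tensor L.toPreCoalg).toGrading 0
      (TensorProduct.map f f) := hd.map hd (by norm_num)
  rw [PreCoalg.hhComul, PreCoalg.hhComul, LinearMap.comp_assoc,
    PreCoalg.hhMap_eq_hhHat hf.counit hf.one, ← PreCoalg.hhHat_comp (PreCoalg.cobarMap_deg hd)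
    (hasDegree_iff.mp hω'.degree), hf.comm_aw,
    PreCoalg.hhHat_comp (hasDegree_iff.mp hω.degree) (PreCoalg.cobarMap_deg hff),
    ← PreCoalg.hhMap_eq_hhHat (f := TensorProduct.map f f), ← LinearMap.comp_assoc,
    PreCoalg.milgramHat_natural hd hd hf.one hf.one hf.counit hf.counit,
    PreCoalg.hhMap_eq_hhHat hf.counit hf.one, LinearMap.comp_assoc]
  · refine TensorProduct.ext' fun x y => ?_
    have h1 := LinearMap.congr_fun hf.counit
    simp only [LinearMap.comp_apply] at h1
    simp [PreCoalg.tensor_counit_tmul, h1]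
  · simp [PreCoalg.tensor_one, hf.one]

end

end CoHoch

namespace CoHoch

noncomputable section

open Grading

theorem Grading.Deg.smul {R M N : Type*} [CommRing R] [AddCommGroup M] [Module R M]
    [AddCommGroup N] [Module R N] {G : Grading R M} {H : Grading R N} {k : ℤ} {f : M →ₗ[R] N}
    (hf : Deg G H k f) (r : R) : Deg G H k (r • f) := fun n x hx =>
  Submodule.smul_mem _ _ (hf n x hx)

/-- The map `x ↦ (-1)^{e |x|} x`. -/
def Grading.sgnPow {R M : Type*} [CommRing R] [AddCommGroup M] [Module R M] (G : Grading R M)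
    (e : ZMod 2) : M →ₗ[R] M := if e = 0 then LinearMap.id else G.sgn

theorem Grading.sgnPow_par {R M : Type*} [CommRing R] [AddCommGroup M] [Module R M]
    {G : Grading R M} (e : ZMod 2) {i : ZMod 2} {x : M} (hx : x ∈ G.par i) :
    G.sgnPow e x = sg R (e * i) • x := by
  rcases zmod_two_cases e with rfl | rfl
  · simp [sgnPow, sg_zero]
  · simp [sgnPow, sgn_par hx]

namespace PreCoalg

variable {R C D E F : Type*} [CommRing R] [AddCommGroup C] [Module R C] [AddCommGroup D]
  [Module R D] [AddCommGroup E] [Module R E] [AddCommGroup F] [Module R F] {K : PreCoalg R C}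
  {L : PreCoalg R D} {K' : PreCoalg R E} {L' : PreCoalg R F}

theorem counit_sgn (x : C) : K.counit (K.sgn x) = K.counit x := by
  induction x using K.toGrading.parity_induction with
  | hg i x hx => rw [sgn_par hx, map_smul, smul_eq_mul, K.sg_counit hx]
  | ha x y hx hy => rw [map_add, map_add, map_add, hx, hy]

/-! ### Distributing a factor from the left -/

theorem distribLeft_one (x : D) : L.distribLeft K 1 x = algebraMap R _ (L.counit x) := by
  rw [distribLeft, foldLeft_one]; rfl

theorem distribLeft_ι_mul {i : ZMod 2} {v : K.bar} (hv : v ∈ K.barGrading.par i) (w : K.Cobar)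
    {x : D} {T : Type*} [Fintype T] {a b : T → D} {p q : T → ZMod 2}
    (ha : ∀ t, a t ∈ L.par (p t)) (hb : ∀ t, b t ∈ L.par (q t))
    (hx : L.comul x = ∑ t, a t ⊗ₜ[R] b t) :
    L.distribLeft K (TensorAlgebra.ι R v * w) x = ∑ t, sg R (i * q t + p t) •
      ((L.tensor K).sInv (a t ⊗ₜ (v : C)) * L.distribLeft K w (b t)) := by
  rw [distribLeft, foldLeft_ι_mul]
  simp only [LinearMap.mk₂_apply, LinearMap.comp_apply, wedgeLeftStep, LinearMap.flip_apply,
    TensorProduct.curry_apply, LinearMap.rTensor_tmul, hx, TensorProduct.sum_tmul, map_sum]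
  refine Finset.sum_congr rfl fun t _ => ?_
  simp [swap_par (hb t) hv, sgn_par (ha t), sg_add, ← TensorProduct.smul_tmul',
    TensorProduct.tmul_smul, smul_smul, mul_comm]

theorem wedgeLeftStep_deg (hL : L.Laws) {m : ℕ} {v : K.bar} (hv : v ∈ K.barGrading.gr m) :
    Deg L.toGrading ((L.tensor K).cobarGrading.tensor L.toGrading) m (L.wedgeLeftStep K v) := by
  have h : Deg (L.toGrading.tensor K.barGrading)
      ((L.tensor K).cobarGrading.tensor L.toGrading) 0
      (LinearMap.rTensor D ((L.tensor K).sInv ∘ₗ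
        TensorProduct.map L.sgn (LinearMap.ker K.counit).subtype) ∘ₗ
      (TensorProduct.assoc R D K.bar D).symm.toLinearMap ∘ₗ
      LinearMap.lTensor D (L.toGrading.swap K.barGrading) ∘ₗ
      (TensorProduct.assoc R D D K.bar).toLinearMap ∘ₗ
      LinearMap.rTensor K.bar L.comul) := by
    refine Deg.comp (k := 0) (l := 0)
      (Deg.rTensor (G := L.toGrading.tensor K.barGrading) ?_) ?_ (by norm_num)
    · exact (L.tensor K).sInv_deg.comp (k := 1) (Deg.sgn.map K.subtype_deg (by norm_num))
        (by norm_num)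
    · refine Deg.assoc_symm.comp (k := 0) ?_ (by norm_num)
      refine Deg.swap.lTensor.comp (k := 0) ?_ (by norm_num)
      exact Deg.assoc.comp (k := 0) hL.comul_deg.rTensor (by norm_num)
  intro n x hx
  exact zgr_cast (h.apply (tmul_mem_zgr (mem_zgr_natCast.mpr hx) (mem_zgr_natCast.mpr hv)))
    (by ring)

theorem distribLeft_deg (hL : L.Laws) {n : ℕ} {a : K.Cobar} (ha : a ∈ K.cobarGrading.gr n) :
    Deg L.toGrading (L.tensor K).cobarGrading n (L.distribLeft K a) := by
  refine word_induction (G := K.barGrading) (p := fun n a => Deg L.toGrading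
    (L.tensor K).cobarGrading n (L.distribLeft K a)) (fun _ => by rw [map_zero]; exact Deg.zero)
    (fun _ x y hx hy => by rw [map_add]; exact hx.add hy)
    (fun _ r x hx => by rw [map_smul]; exact hx.smul r) ?_ (fun m n v w hv hw ih => ?_) ha
  · rintro (_ | n) x hx
    · rw [distribLeft_one, Algebra.algebraMap_eq_smul_one]
      exact Submodule.smul_mem _ _ CoHoch.one_mem_zgr
    · rw [distribLeft_one, L.counit_pos n x hx, map_zero]
      exact zero_mem _
  · rw [distribLeft, foldLeft_ι_mul]
    exact mul'_deg.comp (k := m + n) (ih.lTensor.comp (wedgeLeftStep_deg hL hv) rfl)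
      (by push_cast; ring)

theorem distribLeft_mem_par (hL : L.Laws) {i j : ZMod 2} {a : K.Cobar} {x : D}
    (ha : a ∈ K.cobarGrading.par i) (hx : x ∈ L.par j) :
    L.distribLeft K a x ∈ (L.tensor K).cobarGrading.par (i + j) := by
  induction ha using par_induction with
  | mem n h a ha =>
    have := (distribLeft_deg hL ha).par hx
    rw [add_comm, ← h]
    simpa using this
  | zero => simp
  | add y z _ _ hy hz => rw [map_add]; exact add_mem hy hz

/-- Every letter s⁻¹(x₍ᵢ₎ ⊗ cᵢ) has cᵢ in the coideal, so q retains only ε(x₍ᵢ₎)(1 ⊗ s⁻¹cᵢ). All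
shares of x are thus contracted to ε(x). -/
theorem milgram_distribLeft (hL : L.Laws) (a : K.Cobar) (x : D) :
    L.milgram K (L.distribLeft K a x) = L.counit x • (1 ⊗ₜ a) := by
  induction a using K.cobarGrading.parity_induction with
  | ha a b h h' => simp only [map_add, LinearMap.add_apply, h, h', TensorProduct.tmul_add, smul_add]
  | hg i a ha =>
    refine word_par_induction (G := K.barGrading) (p := fun _ a => ∀ x,
      L.milgram K (L.distribLeft K a x) = L.counit x • (1 ⊗ₜ a)) ?_ ?_ ?_ ?_ ?_ ha x
    · simp
    · intro i a b h h' x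
      simp only [map_add, LinearMap.add_apply, h, h', TensorProduct.tmul_add, smul_add]
    · intro i r a h x
      simp only [map_smul, LinearMap.smul_apply, h, TensorProduct.tmul_smul, smul_comm r]
    · intro x
      rw [distribLeft_one, Algebra.algebraMap_eq_smul_one, map_smul, milgram_one]
    · intro i j v w hv hw ih x
      induction x using L.toGrading.parity_induction with
      | ha x y hx hy => simp only [map_add, hx, hy, add_smul]
      | hg n x hx =>
        obtain ⟨k, a, b, p, q, ha, hb, hn, hx', hl, hr⟩ := hL.sweedler hx
        have key : ∀ t, sg R (i * q t + p t) • cobarMul L K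
            (L.milgramGen K (a t ⊗ₜ (v : C)) ⊗ₜ (L.counit (b t) • (1 ⊗ₜ w))) =
            (L.counit (a t) * L.counit (b t)) • ((1 : L.Cobar) ⊗ₜ[R] (TensorAlgebra.ι R v * w)) := by
          intro t
          have hv0 : K.counit (v : C) = 0 := LinearMap.mem_ker.mp v.2
          rw [milgramGen_tmul, hv0, zero_smul, zero_add, sInv_bar, TensorProduct.tmul_smul,
            ← TensorProduct.smul_tmul', map_smul, map_smul, cobarMul_tmul _ _ (ι_mem_par hv)
            CoHoch.one_mem_par, mul_zero, sg_zero, one_smul, mul_one]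
          have e1 := L.sg_counit (ha t)
          have e2 := L.sg_mul_counit (hb t) i
          simp only [smul_smul, sg_add]
          congr 1
          linear_combination (L.counit (b t) * sg R (i * q t)) * e1 + L.counit (a t) * e2
        have hxε : L.counit x = ∑ s, L.counit (a s) * L.counit (b s) := by
          conv_lhs => rw [← hl]
          simp
        simp only [distribLeft_ι_mul hv w ha hb hx', map_sum, map_smul, milgram_mul, milgram_sInv, ih,
          key, ← Finset.sum_smul, ← hxε]

/-- The map `p ⊗ q ↦ (-1)^{e |p|} (x ⊗ p) ⊗ rotate (a ⊗ q)`. -/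
def rotateLeft (L : PreCoalg R D) (K : PreCoalg R C) (e : ZMod 2) (x : D) (a : K.Cobar) :
    L.Cobar ⊗[R] K.Cobar →ₗ[R] L.CoHH ⊗[R] K.CoHH :=
  TensorProduct.map (TensorProduct.mk R D L.Cobar x ∘ₗ L.cobarGrading.sgnPow e)
    (K.rotate ∘ₗ TensorProduct.mk R K.Cobar K.Cobar a)

theorem rotateLeft_tmul (e : ZMod 2) (x : D) (a : K.Cobar) {k : ZMod 2} {u : L.Cobar}
    (hu : u ∈ L.cobarGrading.par k) (v : K.Cobar) :
    rotateLeft L K e x a (u ⊗ₜ v) = sg R (e * k) • ((x ⊗ₜ[R] u) ⊗ₜ[R] K.rotate (a ⊗ₜ v)) := by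
  simp [rotateLeft, sgnPow_par e hu, TensorProduct.smul_tmul']

/-- When a letter is marked it keeps its share x₍ᵢ₎ of x, whereas q replaces the shares of all the
other letters by counits. Counitality then reassembles x in front of the rotation of the
undistributed word. -/
theorem milgramHat_rotate_distribLeft (hL : L.Laws) {i n l : ZMod 2} {a : K.Cobar} {x : D}
    {b : (L.tensor K).Cobar} (ha : a ∈ K.cobarGrading.par i) (hx : x ∈ L.par n)
    (hb : b ∈ (L.tensor K).cobarGrading.par l) :
    L.milgramHat K ((L.tensor K).rotate (L.distribLeft K a x ⊗ₜ b)) =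
      sg R n • rotateLeft L K (i + 1) x a (L.milgram K b) := by
  refine word_par_induction (G := K.barGrading) (p := fun i a => ∀ n, ∀ x ∈ L.par n, ∀ l,
    ∀ b ∈ (L.tensor K).cobarGrading.par l,
    L.milgramHat K ((L.tensor K).rotate (L.distribLeft K a x ⊗ₜ b)) =
      sg R n • rotateLeft L K (i + 1) x a (L.milgram K b)) ?_ ?_ ?_ ?_ ?_ ha n x hx l b hb
  · simp [rotateLeft]
  · intro i y z h h' n x hx l b hb
    simp only [map_add, LinearMap.add_apply, TensorProduct.add_tmul, h n x hx l b hb,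
      h' n x hx l b hb, rotateLeft, LinearMap.comp_add, TensorProduct.map_add_right, smul_add]
  · intro i r y h n x hx l b hb
    simp only [map_smul, LinearMap.smul_apply, ← TensorProduct.smul_tmul', h n x hx l b hb,
      rotateLeft, LinearMap.comp_smul, TensorProduct.map_smul_right, smul_comm r]
  · intro n x hx l b hb
    have h0 : K.rotate ∘ₗ TensorProduct.mk R K.Cobar K.Cobar 1 = 0 :=
      LinearMap.ext fun w => by simp [rotate_one]
    rw [distribLeft_one, Algebra.algebraMap_eq_smul_one, ← TensorProduct.smul_tmul', map_smul,
      rotate_one, smul_zero, map_zero, rotateLeft, h0, TensorProduct.map_zero_right,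
      LinearMap.zero_apply, smul_zero]
  · intro i j v w hv hw ih n x hx l b hb
    obtain ⟨k, a, a', p, q, ha, ha', hn, hx', hl, hr⟩ := hL.sweedler hx
    have hv0 : K.counit (v : C) = 0 := LinearMap.mem_ker.mp v.2
    have hs : ∀ t, (L.tensor K).sInv (a t ⊗ₜ (v : C)) ∈
        (L.tensor K).cobarGrading.par (p t + i) := fun t =>
      par_cast ((L.tensor K).sInv_mem_par (tmul_mem_par (ha t) (coe_mem_par K hv))) (by
        rw [add_assoc, add_assoc, CharTwo.add_self_eq_zero, add_zero])
    have hε : ∀ t, (L.tensor K).counit (a t ⊗ₜ (v : C)) = 0 := fun t => by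
      rw [tensor_counit_tmul, hv0, mul_zero]
    rw [distribLeft_ι_mul hv w ha ha' hx']
    simp only [TensorProduct.sum_tmul, ← TensorProduct.smul_tmul', map_sum, map_smul,
      rotate_mul (hs _) (distribLeft_mem_par hL hw (ha' _)) hb, map_add, rotate_sInv, hε, zero_smul,
      sub_zero, ih _ _ (ha' _) _ _ (mul_mem_par hb (hs _)), milgramHat_tmul, milgram_mul,
      milgram_sInv, milgram_distribLeft hL, milgramGen_tmul, hv0, zero_add, sInv_bar]
    have hy : L.milgram K b ∈ (L.cobarGrading.tensor K.cobarGrading).par l :=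
      milgram_deg.par_zero hb
    refine tensor_par_induction ?_ ?_ (fun c d hcd y hy z hz => ?_) hy
    · simp
    · intro y z h h'
      simp only [TensorProduct.add_tmul, TensorProduct.tmul_add, map_add, smul_add,
        Finset.sum_add_distrib] at h h' ⊢
      rw [← h, ← h', add_add_add_comm]
    have h1 : (1 : L.Cobar) ∈ L.cobarGrading.par 0 := CoHoch.one_mem_par
    simp only [← TensorProduct.smul_tmul', TensorProduct.tmul_smul, map_smul, cobarMul_tmul _ _ hw hy,
      cobarMul_tmul _ _ hz h1, mul_one, one_mul, mul_zero, sg_zero, one_smul,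
      interchange_par _ _ (coe_mem_par K hv) hy, rotateLeft_tmul _ _ _ hy,
      rotate_ι_mul hv hw hz, TensorProduct.tmul_add]
    -- In the first expansion the leading letter is marked and x₍₂₎ is contracted; in the second a
    -- later letter is marked and x₍₁₎ is contracted.
    have e1 : (x ⊗ₜ[R] y) ⊗ₜ[R] ((v : C) ⊗ₜ[R] (w * z)) =
        ∑ t, L.counit (a' t) • ((a t ⊗ₜ[R] y) ⊗ₜ[R] ((v : C) ⊗ₜ[R] (w * z))) := by
      conv_lhs => rw [← hr]
      simp only [TensorProduct.sum_tmul, ← TensorProduct.smul_tmul']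
    have e2 : (x ⊗ₜ[R] y) ⊗ₜ[R] K.rotate (w ⊗ₜ[R] (z * TensorAlgebra.ι R v)) =
        ∑ t, L.counit (a t) • ((a' t ⊗ₜ[R] y) ⊗ₜ[R] K.rotate (w ⊗ₜ[R] (z * TensorAlgebra.ι R v))) := by
      conv_lhs => rw [← hl]
      simp only [TensorProduct.sum_tmul, ← TensorProduct.smul_tmul']
    rw [e1, e2]
    simp only [Finset.smul_sum, ← Finset.sum_add_distrib]
    refine Finset.sum_congr rfl fun t _ => ?_
    have c1 := L.counit_of_odd (x := a t)
    have c2 := L.counit_of_odd (x := a' t)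
    have ha := ha t
    have ha' := ha' t
    rw [hn t, hcd]
    rcases zmod_two_cases (p t) with h2 | h2 <;> rcases zmod_two_cases (q t) with h4 | h4 <;>
    rw [h2] at ha ⊢ <;> rw [h4] at ha' ⊢ <;>
    simp only [ha, ha', c1, c2, zero_smul, zero_mul, mul_zero, smul_zero,
      add_zero, zero_add, sg_zero, sg_one, sg_add, sg_mul_add, sg_add_mul,
      one_mul, mul_one] <;>
    match_scalars <;>
    simp only [sg_sq, sg_sq_left, mul_comm, mul_left_comm, mul_assoc, mul_one, one_mul, mul_neg,
      neg_mul, neg_neg]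

end PreCoalg

end

end CoHoch

namespace CoHoch

noncomputable section

open Grading

namespace PreCoalg

variable {R C D E F : Type*} [CommRing R] [AddCommGroup C] [Module R C] [AddCommGroup D]
  [Module R D] [AddCommGroup E] [Module R E] [AddCommGroup F] [Module R F] {K : PreCoalg R C}
  {L : PreCoalg R D} {K' : PreCoalg R E} {L' : PreCoalg R F}

/-! ### Distributing a factor from the right -/

theorem distribRight_one (y : D) : K.distribRight L 1 y = algebraMap R _ (L.counit y) := by
  rw [distribRight, foldRight_one]; rfl

theorem distribRight_mul_ι {i : ZMod 2} {v : K.bar} (hv : v ∈ K.barGrading.par i) (w : K.Cobar)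
    {y : D} {T : Type*} [Fintype T] {a b : T → D} {p : T → ZMod 2}
    (ha : ∀ t, a t ∈ L.par (p t)) (hy : L.comul y = ∑ t, a t ⊗ₜ[R] b t) :
    K.distribRight L (w * TensorAlgebra.ι R v) y = ∑ t, sg R (i * p t) •
      (K.distribRight L w (a t) * (K.tensor L).sInv ((v : C) ⊗ₜ b t)) := by
  rw [distribRight, foldRight_mul_ι]
  simp only [LinearMap.mk₂_apply, LinearMap.comp_apply, wedgeRightStep,
    TensorProduct.curry_apply, LinearMap.lTensor_tmul, hy, TensorProduct.tmul_sum, map_sum]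
  refine Finset.sum_congr rfl fun t _ => ?_
  simp [swap_par hv (ha t), ← TensorProduct.smul_tmul', TensorProduct.tmul_smul]

theorem wedgeRightStep_deg (hL : L.Laws) {m : ℕ} {v : K.bar} (hv : v ∈ K.barGrading.gr m) :
    Deg L.toGrading (L.toGrading.tensor (K.tensor L).cobarGrading) m (K.wedgeRightStep L v) := by
  have h : Deg (K.barGrading.tensor L.toGrading)
      (L.toGrading.tensor (K.tensor L).cobarGrading) 0
      (LinearMap.lTensor D ((K.tensor L).sInv ∘ₗ
        LinearMap.rTensor D (LinearMap.ker K.counit).subtype) ∘ₗ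
      (TensorProduct.assoc R D K.bar D).toLinearMap ∘ₗ
      LinearMap.rTensor D (K.barGrading.swap L.toGrading) ∘ₗ
      (TensorProduct.assoc R K.bar D D).symm.toLinearMap ∘ₗ
      LinearMap.lTensor K.bar L.comul) := by
    refine Deg.comp (k := 0) (l := 0)
      (Deg.lTensor (G := K.barGrading.tensor L.toGrading) ?_) ?_ (by norm_num)
    · exact (K.tensor L).sInv_deg.comp (k := 1) K.subtype_deg.rTensor (by norm_num)
    · refine Deg.assoc.comp (k := 0) ?_ (by norm_num)
      refine Deg.swap.rTensor.comp (k := 0) ?_ (by norm_num)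
      exact Deg.assoc_symm.comp (k := 0) hL.comul_deg.lTensor (by norm_num)
  intro n y hy
  exact zgr_cast (h.apply (tmul_mem_zgr (mem_zgr_natCast.mpr hv) (mem_zgr_natCast.mpr hy)))
    (by ring)

theorem word_induction_right {V : Type*} [AddCommGroup V] [Module R V] {G : Grading R V}
    {p : ℕ → TensorAlgebra R V → Prop} (zero : ∀ n, p n 0)
    (add : ∀ n x y, p n x → p n y → p n (x + y)) (smul : ∀ n (r : R) x, p n x → p n (r • x))
    (one : p 0 1)
    (snoc : ∀ m n v w, v ∈ G.gr m → w ∈ (wordGrading G).gr n → p n w →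
      p (n + m) (w * TensorAlgebra.ι R v))
    {n : ℕ} {w : TensorAlgebra R V} (hw : w ∈ (wordGrading G).gr n) : p n w := by
  induction hw using Submodule.span_induction with
  | zero => exact zero n
  | add x y _ _ hx hy => exact add n x y hx hy
  | smul r x _ hx => exact smul n r x hx
  | mem w h =>
    obtain ⟨l, rfl, rfl⟩ := h
    induction l using List.reverseRecOn with
    | nil => exact one
    | append_singleton l x ih =>
      simp only [List.map_append, List.map_cons, List.map_nil, List.sum_append, List.sum_cons,
        List.sum_nil, add_zero, List.prod_append, List.prod_cons, List.prod_nil, mul_one]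
      exact snoc _ _ _ _ x.2.2 (Submodule.subset_span ⟨l, rfl, rfl⟩) ih

theorem distribRight_deg (hL : L.Laws) {n : ℕ} {a : K.Cobar} (ha : a ∈ K.cobarGrading.gr n) :
    Deg L.toGrading (K.tensor L).cobarGrading n (K.distribRight L a) := by
  refine word_induction_right (G := K.barGrading) (p := fun n a => Deg L.toGrading
    (K.tensor L).cobarGrading n (K.distribRight L a)) (fun _ => by rw [map_zero]; exact Deg.zero)
    (fun _ x y hx hy => by rw [map_add]; exact hx.add hy)
    (fun _ r x hx => by rw [map_smul]; exact hx.smul r) ?_ (fun m n v w hv hw ih => ?_) ha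
  · rintro (_ | n) x hx
    · rw [distribRight_one, Algebra.algebraMap_eq_smul_one]
      exact Submodule.smul_mem _ _ CoHoch.one_mem_zgr
    · rw [distribRight_one, L.counit_pos n x hx, map_zero]
      exact zero_mem _
  · rw [distribRight, foldRight_mul_ι]
    exact mul'_deg.comp (k := m + n) (ih.rTensor.comp (wedgeRightStep_deg hL hv) rfl)
      (by push_cast; ring)

theorem distribRight_mem_par (hL : L.Laws) {i j : ZMod 2} {a : K.Cobar} {y : D}
    (ha : a ∈ K.cobarGrading.par i) (hy : y ∈ L.par j) :
    K.distribRight L a y ∈ (K.tensor L).cobarGrading.par (i + j) := by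
  induction ha using par_induction with
  | mem n h a ha =>
    have := (distribRight_deg hL ha).par hy
    rw [add_comm, ← h]
    simpa using this
  | zero => simp
  | add y z _ _ hy hz => rw [map_add]; exact add_mem hy hz

/-- The mirror image of `milgram_distribLeft`; the induction appends letters because the
distribution from the right is defined by splitting off the last one. -/
theorem milgram_distribRight (hL : L.Laws) (a : K.Cobar) (y : D) :
    K.milgram L (K.distribRight L a y) = L.counit y • (a ⊗ₜ 1) := by
  induction a using K.cobarGrading.parity_induction with
  | ha a b h h' => simp only [map_add, LinearMap.add_apply, h, h', TensorProduct.add_tmul, smul_add]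
  | hg i a ha =>
    refine word_par_induction_right (G := K.barGrading) (p := fun _ a => ∀ y,
      K.milgram L (K.distribRight L a y) = L.counit y • (a ⊗ₜ 1)) ?_ ?_ ?_ ?_ ?_ ha y
    · simp
    · intro i a b h h' x
      simp only [map_add, LinearMap.add_apply, h, h', TensorProduct.add_tmul, smul_add]
    · intro i r a h x
      simp only [map_smul, LinearMap.smul_apply, h, ← TensorProduct.smul_tmul', smul_comm r]
    · intro x
      rw [distribRight_one, Algebra.algebraMap_eq_smul_one, map_smul, milgram_one]
    · intro i j v w hv hw ih x
      induction x using L.toGrading.parity_induction with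
      | ha x y hx hy => simp only [map_add, hx, hy, add_smul]
      | hg n x hx =>
        obtain ⟨k, a, b, p, q, ha, hb, hn, hx', hl, hr⟩ := hL.sweedler hx
        have key : ∀ t, sg R (i * p t) • cobarMul K L
            ((L.counit (a t) • (w ⊗ₜ 1)) ⊗ₜ K.milgramGen L ((v : C) ⊗ₜ b t)) =
            (L.counit (a t) * L.counit (b t)) • ((w * TensorAlgebra.ι R v) ⊗ₜ[R] (1 : L.Cobar)) := by
          intro t
          have hv0 : K.counit (v : C) = 0 := LinearMap.mem_ker.mp v.2
          rw [milgramGen_tmul, hv0, zero_smul, add_zero, sInv_bar, TensorProduct.tmul_smul,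
            ← TensorProduct.smul_tmul', map_smul, map_smul, cobarMul_tmul _ _ CoHoch.one_mem_par
            (ι_mem_par hv), zero_mul, sg_zero, one_smul, mul_one]
          have e1 := L.sg_mul_counit (ha t) i
          simp only [smul_smul]
          congr 1
          linear_combination L.counit (b t) * e1
        have hxε : L.counit x = ∑ s, L.counit (a s) * L.counit (b s) := by
          conv_lhs => rw [← hl]
          simp
        simp only [distribRight_mul_ι hv w ha hx', map_sum, map_smul, milgram_mul, milgram_sInv, ih,
          key, ← Finset.sum_smul, ← hxε]

/-- The map `p ⊗ q ↦ (-1)^{e |p|} rotate (a ⊗ p) ⊗ (y ⊗ q)`. -/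
def rotateRight (K : PreCoalg R C) (L : PreCoalg R D) (e : ZMod 2) (a : K.Cobar) (y : D) :
    K.Cobar ⊗[R] L.Cobar →ₗ[R] K.CoHH ⊗[R] L.CoHH :=
  TensorProduct.map (K.rotate ∘ₗ TensorProduct.mk R K.Cobar K.Cobar a ∘ₗ K.cobarGrading.sgnPow e)
    (TensorProduct.mk R D L.Cobar y)

theorem rotateRight_tmul (e : ZMod 2) (a : K.Cobar) (y : D) {k : ZMod 2} {u : K.Cobar}
    (hu : u ∈ K.cobarGrading.par k) (v : L.Cobar) :
    rotateRight K L e a y (u ⊗ₜ v) = sg R (e * k) • (K.rotate (a ⊗ₜ u) ⊗ₜ[R] (y ⊗ₜ[R] v)) := by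
  simp [rotateRight, sgnPow_par e hu, ← TensorProduct.smul_tmul', TensorProduct.tmul_smul]

-- Again the marked letter alone keeps its share of y, and counitality restores y. The word is split
-- before its last letter by the general cyclic rule `rotate_mul` for a product.
set_option maxHeartbeats 800000 in
theorem milgramHat_rotate_distribRight (hL : L.Laws) {i n l : ZMod 2} {a : K.Cobar} {y : D}
    {b : (K.tensor L).Cobar} (ha : a ∈ K.cobarGrading.par i) (hy : y ∈ L.par n)
    (hb : b ∈ (K.tensor L).cobarGrading.par l) :
    K.milgramHat L ((K.tensor L).rotate (K.distribRight L a y ⊗ₜ b)) =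
      rotateRight K L n a y (K.milgram L b) := by
  refine word_par_induction_right (G := K.barGrading) (p := fun i a => ∀ n, ∀ y ∈ L.par n, ∀ l,
    ∀ b ∈ (K.tensor L).cobarGrading.par l,
    K.milgramHat L ((K.tensor L).rotate (K.distribRight L a y ⊗ₜ b)) =
      rotateRight K L n a y (K.milgram L b)) ?_ ?_ ?_ ?_ ?_ ha n y hy l b hb
  · simp [rotateRight]
  · intro i y z h h' n x hx l b hb
    simp only [map_add, LinearMap.add_apply, TensorProduct.add_tmul, h n x hx l b hb,
      h' n x hx l b hb, rotateRight, LinearMap.comp_add, LinearMap.add_comp,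
      TensorProduct.map_add_left]
  · intro i r y h n x hx l b hb
    simp only [map_smul, LinearMap.smul_apply, ← TensorProduct.smul_tmul', h n x hx l b hb,
      rotateRight, LinearMap.comp_smul, LinearMap.smul_comp, TensorProduct.map_smul_left]
  · intro n x hx l b hb
    have h0 : K.rotate ∘ₗ TensorProduct.mk R K.Cobar K.Cobar 1 = 0 :=
      LinearMap.ext fun w => by simp [rotate_one]
    rw [distribRight_one, Algebra.algebraMap_eq_smul_one, ← TensorProduct.smul_tmul', map_smul,
      rotate_one, smul_zero, map_zero, rotateRight, ← LinearMap.comp_assoc, h0, LinearMap.zero_comp,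
      TensorProduct.map_zero_left, LinearMap.zero_apply]
  · intro i j v w hv hw ih n x hx l b hb
    obtain ⟨k, a, a', p, q, ha, ha', hn, hx', hl, hr⟩ := hL.sweedler hx
    have hv0 : K.counit (v : C) = 0 := LinearMap.mem_ker.mp v.2
    have hs : ∀ t, (K.tensor L).sInv ((v : C) ⊗ₜ a' t) ∈
        (K.tensor L).cobarGrading.par (i + q t) := fun t =>
      par_cast ((K.tensor L).sInv_mem_par (tmul_mem_par (coe_mem_par K hv) (ha' t))) (by
        rw [add_right_comm, add_assoc i, CharTwo.add_self_eq_zero, add_zero])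
    have hε : ∀ t, (K.tensor L).counit ((v : C) ⊗ₜ a' t) = 0 := fun t => by
      rw [tensor_counit_tmul, hv0, zero_mul]
    -- The first summand marks a letter of w, and the appended letter is reduced by q to a counit of
    -- y₍₂₎. The second marks the appended letter, and the whole distribution over w is reduced to
    -- the counit of y₍₁₎.
    have key : ∀ t, K.milgramHat L ((K.tensor L).rotate
        ((K.distribRight L w (a t) * (K.tensor L).sInv ((v : C) ⊗ₜ a' t)) ⊗ₜ b)) =
        rotateRight K L (p t) w (a t) (L.counit (a' t) •
          cobarMul K L ((TensorAlgebra.ι R v ⊗ₜ 1) ⊗ₜ K.milgram L b)) +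
        sg R ((j + p t) * (i + q t + l)) • Grading.interchange L.toGrading K.cobarGrading
          (((v : C) ⊗ₜ a' t) ⊗ₜ (L.counit (a t) •
            cobarMul K L (K.milgram L b ⊗ₜ (w ⊗ₜ 1)))) := by
      intro t
      have hu := distribRight_mem_par hL hw (ha t)
      have hm := milgram_distribRight (K := K) hL w (a t)
      have hi := ih _ _ (ha t)
      have hu' := hs t
      have hm' : K.milgram L ((K.tensor L).sInv ((v : C) ⊗ₜ a' t)) =
          L.counit (a' t) • (TensorAlgebra.ι R v ⊗ₜ[R] (1 : L.Cobar)) := by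
        rw [milgram_sInv, milgramGen_tmul, hv0, zero_smul, add_zero, sInv_bar]
      have hr' : ∀ c, (K.tensor L).rotate ((K.tensor L).sInv ((v : C) ⊗ₜ a' t) ⊗ₜ c) =
          ((v : C) ⊗ₜ[R] a' t) ⊗ₜ[R] c := fun c => by
        rw [rotate_sInv, hε, zero_smul, sub_zero]
      generalize K.distribRight L w (a t) = u at hu hm hi ⊢
      generalize (K.tensor L).sInv ((v : C) ⊗ₜ a' t) = u' at hu' hm' hr' ⊢
      rw [rotate_mul hu hu' hb, map_add, map_smul, hi _ _ (mul_mem_par hu' hb), hr',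
        milgramHat_tmul, milgram_mul, milgram_mul, hm, hm', TensorProduct.tmul_smul, map_smul,
        ← TensorProduct.smul_tmul', map_smul]
    rw [distribRight_mul_ι hv w ha hx', TensorProduct.sum_tmul, map_sum, map_sum]
    simp only [← TensorProduct.smul_tmul', map_smul, key]
    have hy : K.milgram L b ∈ (K.cobarGrading.tensor L.cobarGrading).par l :=
      milgram_deg.par_zero hb
    refine tensor_par_induction ?_ ?_ (fun c d hcd y hy z hz => ?_) hy
    · simp
    · intro y z h h'
      simp only [TensorProduct.add_tmul, TensorProduct.tmul_add, map_add, smul_add,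
        Finset.sum_add_distrib] at h h' ⊢
      rw [← h, ← h', add_add_add_comm]
    have h1 : (1 : L.Cobar) ∈ L.cobarGrading.par 0 := CoHoch.one_mem_par
    simp only [← TensorProduct.smul_tmul', TensorProduct.tmul_smul, map_smul,
      cobarMul_tmul _ _ h1 hy, cobarMul_tmul _ _ hz hw, mul_one, one_mul, zero_mul, sg_zero,
      one_smul, interchange_par _ _ (ha' _) (CoHoch.mul_mem_par hy hw),
      rotateRight_tmul _ _ _ (CoHoch.mul_mem_par (ι_mem_par hv) hy), rotateRight_tmul _ _ _ hy,
      rotate_mul hw (ι_mem_par hv) hy, rotate_ι, TensorProduct.add_tmul]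
    have e1 : K.rotate (w ⊗ₜ[R] (TensorAlgebra.ι R v * y)) ⊗ₜ[R] (x ⊗ₜ[R] z) =
        ∑ t, L.counit (a' t) •
          (K.rotate (w ⊗ₜ[R] (TensorAlgebra.ι R v * y)) ⊗ₜ[R] (a t ⊗ₜ[R] z)) := by
      conv_lhs => rw [← hr]
      simp only [TensorProduct.sum_tmul, TensorProduct.tmul_sum, ← TensorProduct.smul_tmul',
        TensorProduct.tmul_smul]
    have e2 : ((v : C) ⊗ₜ[R] (y * w)) ⊗ₜ[R] (x ⊗ₜ[R] z) =
        ∑ t, L.counit (a t) • (((v : C) ⊗ₜ[R] (y * w)) ⊗ₜ[R] (a' t ⊗ₜ[R] z)) := by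
      conv_lhs => rw [← hl]
      simp only [TensorProduct.sum_tmul, TensorProduct.tmul_sum, ← TensorProduct.smul_tmul',
        TensorProduct.tmul_smul]
    rw [e1, e2]
    simp only [Finset.smul_sum, ← Finset.sum_add_distrib]
    refine Finset.sum_congr rfl fun t _ => ?_
    have c1 := L.counit_of_odd (x := a t)
    have c2 := L.counit_of_odd (x := a' t)
    have ha := ha t
    have ha' := ha' t
    rw [hn t, hcd]
    generalize K.rotate (w ⊗ₜ[R] (TensorAlgebra.ι R v * y)) ⊗ₜ[R] (a t ⊗ₜ[R] z) = A
    generalize ((v : C) ⊗ₜ[R] (y * w)) ⊗ₜ[R] (a' t ⊗ₜ[R] z) = B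
    rcases zmod_two_cases (p t) with h2 | h2 <;> rcases zmod_two_cases (q t) with h4 | h4 <;>
    rw [h2] at ha ⊢ <;> rw [h4] at ha' ⊢ <;>
    simp only [ha, ha', c1, c2, zero_smul, zero_mul, mul_zero, smul_zero,
      add_zero, zero_add, sg_zero, sg_one, sg_add, sg_mul_add, sg_add_mul,
      one_mul, mul_one] <;>
    match_scalars <;>
    simp only [sg_sq, sg_sq_left, mul_comm, mul_left_comm, mul_assoc, mul_one, one_mul, mul_neg,
      neg_mul, neg_neg]

end PreCoalg

end

end CoHoch

namespace CoHoch

noncomputable section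

open Grading

/-! ### Coherence of the Koszul interchange and of graded products with associativity. -/

section Interchange

variable {R A B G M N P : Type*} [CommRing R] [AddCommGroup A] [Module R A] [AddCommGroup B]
  [Module R B] [AddCommGroup G] [Module R G] [AddCommGroup M] [Module R M] [AddCommGroup N]
  [Module R N] [AddCommGroup P] [Module R P]

/-- Coherence of the Koszul interchange with associativity. -/
theorem interchange_assoc (GA : Grading R A) (GB : Grading R B) (HN : Grading R N)
    (HP : Grading R P) (x : M) (y : N) (z : P) (u : (A ⊗[R] B) ⊗[R] G) :
    TensorProduct.assoc R (M ⊗[R] A) (N ⊗[R] B) (P ⊗[R] G)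
      (LinearMap.rTensor (P ⊗[R] G) (Grading.interchange HN GA)
        (Grading.interchange HP (GA.tensor GB) (((x ⊗ₜ y) ⊗ₜ z) ⊗ₜ u))) =
    LinearMap.lTensor (M ⊗[R] A) (Grading.interchange HP GB)
      (Grading.interchange (HN.tensor HP) GA ((x ⊗ₜ (y ⊗ₜ z)) ⊗ₜ TensorProduct.assoc R A B G u)) := by
  induction u using TensorProduct.induction_on with
  | zero => simp
  | add u u' h h' => simp only [TensorProduct.tmul_add, map_add, h, h']
  | tmul w c =>
    induction w using TensorProduct.induction_on with
    | zero => simp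
    | add u u' h h' => simp only [TensorProduct.tmul_add, TensorProduct.add_tmul, map_add, h, h']
    | tmul a b =>
      induction y using HN.parity_induction with
      | ha u u' h h' => simp only [TensorProduct.tmul_add, TensorProduct.add_tmul, map_add, h, h']
      | hg i y hy =>
        induction z using HP.parity_induction with
        | ha u u' h h' => simp only [TensorProduct.tmul_add, TensorProduct.add_tmul, map_add, h, h']
        | hg j z hz =>
          induction a using GA.parity_induction with
          | ha u u' h h' =>
            simp only [TensorProduct.tmul_add, TensorProduct.add_tmul, map_add, h, h']
          | hg k a ha =>
            induction b using GB.parity_induction with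
            | ha u u' h h' =>
              simp only [TensorProduct.tmul_add, TensorProduct.add_tmul, map_add, h, h']
            | hg l b hb =>
              rw [interchange_par _ _ hz (tmul_mem_par ha hb), TensorProduct.assoc_tmul,
                interchange_par _ _ (tmul_mem_par hy hz) ha, map_smul, map_smul, map_smul,
                LinearMap.rTensor_tmul, LinearMap.lTensor_tmul, interchange_par _ _ hy ha,
                interchange_par _ _ hz hb, ← TensorProduct.smul_tmul', map_smul,
                TensorProduct.assoc_tmul, TensorProduct.tmul_smul, smul_smul, smul_smul]
              congr 1
              rw [mul_add, add_mul, sg_add, sg_add]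
              ring

variable {GA : Grading R A} {GB : Grading R B} {GG : Grading R G} {mA : A ⊗[R] A →ₗ[R] A}
  {mB : B ⊗[R] B →ₗ[R] B} {mG : G ⊗[R] G →ₗ[R] G}

theorem gmul_assoc (x y : (A ⊗[R] B) ⊗[R] G) :
    TensorProduct.assoc R A B G (gmul (GA.tensor GB) GG (gmul GA GB mA mB) mG (x ⊗ₜ y)) =
      gmul GA (GB.tensor GG) mA (gmul GB GG mB mG)
        (TensorProduct.assoc R A B G x ⊗ₜ TensorProduct.assoc R A B G y) := by
  induction x using TensorProduct.induction_on with
  | zero => simp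
  | add u u' h h' => simp only [TensorProduct.add_tmul, map_add, h, h']
  | tmul w c =>
    induction w using TensorProduct.induction_on with
    | zero => simp
    | add u u' h h' => simp only [TensorProduct.add_tmul, map_add, h, h']
    | tmul a b =>
      induction y using TensorProduct.induction_on with
      | zero => simp
      | add u u' h h' => simp only [TensorProduct.tmul_add, map_add, h, h']
      | tmul w c' =>
        induction w using TensorProduct.induction_on with
        | zero => simp
        | add u u' h h' =>
          simp only [TensorProduct.tmul_add, TensorProduct.add_tmul, map_add, h, h']
        | tmul a' b' =>
          induction b using GB.parity_induction with
          | ha u u' h h' =>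
            simp only [TensorProduct.tmul_add, TensorProduct.add_tmul, map_add, h, h']
          | hg i b hb =>
            induction c using GG.parity_induction with
            | ha u u' h h' =>
              simp only [TensorProduct.tmul_add, TensorProduct.add_tmul, map_add, h, h']
            | hg j c hc =>
              induction a' using GA.parity_induction with
              | ha u u' h h' =>
                simp only [TensorProduct.tmul_add, TensorProduct.add_tmul, map_add, h, h']
              | hg k a' ha =>
                induction b' using GB.parity_induction with
                | ha u u' h h' =>
                  simp only [TensorProduct.tmul_add, TensorProduct.add_tmul, map_add, h, h']
                | hg l b' hb' =>
                  rw [gmul_tmul _ _ hc (tmul_mem_par ha hb'), gmul_tmul _ _ hb ha,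
                    TensorProduct.assoc_tmul, TensorProduct.assoc_tmul,
                    gmul_tmul _ _ (tmul_mem_par hb hc) ha, gmul_tmul _ _ hc hb', map_smul,
                    ← TensorProduct.smul_tmul', map_smul, TensorProduct.assoc_tmul,
                    TensorProduct.tmul_smul, smul_smul, smul_smul]
                  congr 1
                  rw [mul_add, add_mul, sg_add, sg_add]
                  ring

end Interchange

namespace PreCoalg

variable {R C D E F : Type*} [CommRing R] [AddCommGroup C] [Module R C] [AddCommGroup D]
  [Module R D] [AddCommGroup E] [Module R E] [AddCommGroup F] [Module R F] {K : PreCoalg R C}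
  {L : PreCoalg R D} {K' : PreCoalg R E} {L' : PreCoalg R F}

/-! ### Associativity of the Milgram maps -/

/-- The algebra map `Ω((C ⊗ D) ⊗ E) → Ω(C ⊗ (D ⊗ E))` induced by associativity. -/
abbrev cobarAssoc (K : PreCoalg R C) (L : PreCoalg R D) (P : PreCoalg R E) :
    ((K.tensor L).tensor P).Cobar →ₐ[R] (K.tensor (L.tensor P)).Cobar :=
  ((K.tensor L).tensor P).cobarMap (K.tensor (L.tensor P)) (TensorProduct.assoc R C D E).toLinearMap

/-- Both composites are multiplicative. On the letter s⁻¹(x ⊗ y ⊗ z) both give the sum of three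
terms, each desuspending one factor and applying counits to the other two. -/
theorem milgram_assoc (K : PreCoalg R C) (L : PreCoalg R D) (P : PreCoalg R E) :
    LinearMap.lTensor K.Cobar (L.milgram P) ∘ₗ K.milgram (L.tensor P) ∘ₗ
      (cobarAssoc K L P).toLinearMap =
    (TensorProduct.assoc R K.Cobar L.Cobar P.Cobar).toLinearMap ∘ₗ
      LinearMap.rTensor P.Cobar (K.milgram L) ∘ₗ (K.tensor L).milgram P := by
  refine linearMap_ext_of_mul (V := ((K.tensor L).tensor P).bar)
    (TensorProduct.curry (gmul K.cobarGrading
    (L.cobarGrading.tensor P.cobarGrading) (LinearMap.mul' R K.Cobar) (cobarMul L P)))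
    ?_ (fun v => ?_) (fun a b => ?_) (fun a b => ?_)
  · simp [milgram_one]
  · rw [← sInv_bar]
    generalize (v : (C ⊗[R] D) ⊗[R] E) = z
    have h1 : (TensorProduct.assoc R C D E).toLinearMap ((K.tensor L).tensor P).one =
      (K.tensor (L.tensor P)).one := rfl
    simp only [LinearMap.comp_apply, AlgHom.toLinearMap_apply, cobarMap_sInv h1, milgram_sInv,
      LinearEquiv.coe_coe]
    induction z using TensorProduct.induction_on with
    | zero => simp
    | add x y hx hy => simp only [map_add, hx, hy]
    | tmul w z =>
      induction w using TensorProduct.induction_on with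
      | zero => simp
      | add x y hx hy => simp only [TensorProduct.add_tmul, map_add, hx, hy]
      | tmul x y =>
        simp only [TensorProduct.assoc_tmul, milgramGen_tmul, tensor_counit_tmul, map_add, map_smul,
          LinearMap.lTensor_tmul, LinearMap.rTensor_tmul, milgram_one, milgram_sInv,
          TensorProduct.tmul_add, TensorProduct.tmul_smul, TensorProduct.add_tmul,
          ← TensorProduct.smul_tmul', smul_add, smul_smul]
        simp only [mul_comm, add_assoc]
  · simp only [LinearMap.comp_apply, AlgHom.toLinearMap_apply, map_mul, milgram_mul,
      TensorProduct.curry_apply]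
    exact gmul_natural (GA := K.cobarGrading) (GA' := K.cobarGrading)
      (GB := (L.tensor P).cobarGrading) (GB' := L.cobarGrading.tensor P.cobarGrading)
      (mA := LinearMap.mul' R K.Cobar) (mA' := LinearMap.mul' R K.Cobar)
      (mB := LinearMap.mul' R (L.tensor P).Cobar) (mB' := cobarMul L P) (α := LinearMap.id)
      (β := L.milgram P) Deg.id milgram_deg (fun _ _ => rfl) milgram_mul _ _
  · simp only [LinearMap.comp_apply, milgram_mul, TensorProduct.curry_apply]
    have := gmul_natural (GA := (K.tensor L).cobarGrading) (GB := P.cobarGrading)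
      (GB' := P.cobarGrading) (mA := LinearMap.mul' R _) (mB := LinearMap.mul' R P.Cobar)
      (mB' := LinearMap.mul' R P.Cobar) (mA' := cobarMul K L) (β := LinearMap.id)
      milgram_deg Deg.id milgram_mul (by simp) ((K.tensor L).milgram P a)
      ((K.tensor L).milgram P b)
    rw [LinearMap.rTensor, cobarMul, this]
    exact gmul_assoc _ _

/-- Associativity of q combined with coherence of the interchange; naturality of the interchange
moves the inner Milgram map past the outer shuffle. -/
theorem milgramHat_assoc (K : PreCoalg R C) (L : PreCoalg R D) (P : PreCoalg R E) :
    LinearMap.lTensor K.CoHH (L.milgramHat P) ∘ₗ K.milgramHat (L.tensor P) ∘ₗ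
      ((K.tensor L).tensor P).hhMap (K.tensor (L.tensor P))
        (TensorProduct.assoc R C D E).toLinearMap =
    (TensorProduct.assoc R K.CoHH L.CoHH P.CoHH).toLinearMap ∘ₗ
      LinearMap.rTensor P.CoHH (K.milgramHat L) ∘ₗ (K.tensor L).milgramHat P := by
  refine TensorProduct.ext' fun z w => ?_
  induction z using TensorProduct.induction_on with
  | zero => simp
  | add z z' h h' => simp only [TensorProduct.add_tmul, map_add, h, h']
  | tmul z0 z =>
  induction z0 using TensorProduct.induction_on with
  | zero => simp
  | add z z' h h' => simp only [TensorProduct.add_tmul, map_add, h, h']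
  | tmul x y =>
  have hq := LinearMap.congr_fun (milgram_assoc K L P) w
  simp only [LinearMap.comp_apply, AlgHom.toLinearMap_apply] at hq
  have n1 := LinearMap.congr_fun (interchange_natural (GA := K.cobarGrading)
    (GA' := K.cobarGrading) (α := LinearMap.id) (β := LinearMap.id) (LinearMap.id (M := C))
    (L.milgram P) Deg.id (Deg.id (G := (L.tensor P).toGrading)))
    ((x ⊗ₜ (y ⊗ₜ z)) ⊗ₜ K.milgram (L.tensor P) (cobarAssoc K L P w))
  have n2 := LinearMap.congr_fun (interchange_natural (α := K.milgram L) (β := LinearMap.id)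
    (LinearMap.id (M := C ⊗[R] D)) (LinearMap.id (M := P.Cobar)) milgram_deg
    (Deg.id (G := P.toGrading))) (((x ⊗ₜ y) ⊗ₜ z) ⊗ₜ (K.tensor L).milgram P w)
  simp only [LinearMap.comp_apply, TensorProduct.map_tmul, LinearMap.id_apply] at n1 n2
  have key := interchange_assoc K.cobarGrading L.cobarGrading L.toGrading P.toGrading x y z
    (LinearMap.rTensor P.Cobar (K.milgram L) ((K.tensor L).milgram P w))
  have g1 : LinearMap.lTensor K.CoHH (L.milgramHat P) =
      LinearMap.lTensor K.CoHH (Grading.interchange P.toGrading L.cobarGrading) ∘ₗ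
        TensorProduct.map (TensorProduct.map LinearMap.id LinearMap.id)
          (TensorProduct.map LinearMap.id (L.milgram P)) := by
    rw [TensorProduct.map_id, milgramHat, LinearMap.lTensor_comp]; rfl
  have g2 : LinearMap.rTensor P.CoHH (K.milgramHat L) =
      LinearMap.rTensor P.CoHH (Grading.interchange L.toGrading K.cobarGrading) ∘ₗ
        TensorProduct.map (TensorProduct.map LinearMap.id (K.milgram L))
          (TensorProduct.map LinearMap.id LinearMap.id) := by
    rw [TensorProduct.map_id, milgramHat, LinearMap.rTensor_comp]; rfl
  have e1 : ((K.tensor L).tensor P).hhMap (K.tensor (L.tensor P))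
      (TensorProduct.assoc R C D E).toLinearMap (((x ⊗ₜ y) ⊗ₜ z) ⊗ₜ w) =
      (x ⊗ₜ[R] (y ⊗ₜ[R] z)) ⊗ₜ[R] cobarAssoc K L P w := rfl
  rw [LinearMap.comp_apply, LinearMap.comp_apply, LinearMap.comp_apply, LinearMap.comp_apply, e1,
    milgramHat_tmul, milgramHat_tmul, g1, g2, LinearMap.comp_apply, LinearMap.comp_apply]
  refine (congrArg (LinearMap.lTensor K.CoHH (Grading.interchange P.toGrading L.cobarGrading))
    n1.symm).trans (Eq.trans ?_ (key.symm.trans (congrArg (fun t =>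
      (TensorProduct.assoc R K.CoHH L.CoHH P.CoHH) (LinearMap.rTensor P.CoHH
        (Grading.interchange L.toGrading K.cobarGrading) t)) n2)))
  exact congrArg (fun t => LinearMap.lTensor K.CoHH (Grading.interchange P.toGrading L.cobarGrading)
    (Grading.interchange (L.tensor P).toGrading K.cobarGrading ((x ⊗ₜ (y ⊗ₜ z)) ⊗ₜ t))) hq

end PreCoalg

end

end CoHoch

namespace CoHoch

noncomputable section

open Grading

namespace PreCoalg

universe v

variable {R : Type*} {C D E F : Type v} [CommRing R] [AddCommGroup C] [Module R C] [AddCommGroup D]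
  [Module R D] [AddCommGroup E] [Module R E] [AddCommGroup F] [Module R F] {K : PreCoalg R C}
  {L : PreCoalg R D} {K' : PreCoalg R E}

theorem distribLeft_mem_zgr (hL : L.Laws) {i j : ℤ} {a : K.Cobar} {x : D}
    (ha : a ∈ K.cobarGrading.zgr i) (hx : x ∈ L.zgr j) :
    L.distribLeft K a x ∈ (L.tensor K).cobarGrading.zgr (i + j) := by
  obtain n | n := i
  · exact zgr_cast ((distribLeft_deg hL ha).apply hx) (add_comm _ _)
  · rw [eq_zero_of_mem_zgr (by simp) ha, map_zero]; exact zero_mem _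

theorem distribRight_mem_zgr (hL : L.Laws) {i j : ℤ} {a : K.Cobar} {x : D}
    (ha : a ∈ K.cobarGrading.zgr i) (hx : x ∈ L.zgr j) :
    K.distribRight L a x ∈ (K.tensor L).cobarGrading.zgr (i + j) := by
  obtain n | n := i
  · exact zgr_cast ((distribRight_deg hL ha).apply hx) (add_comm _ _)
  · rw [eq_zero_of_mem_zgr (by simp) ha, map_zero]; exact zero_mem _

/-! ### The map `Id ∧ ω` -/

/-- The definition gives this on the coideal of D ⊗ C only. It extends to all tensors because the
right-hand side also vanishes at 1 ⊗ 1. -/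
theorem wedgeLeft_sInv (ω : K.Cobar →ₐ[R] K'.Cobar) (x : D) (c : C) :
    L.wedgeLeft K K' ω ((L.tensor K).sInv (x ⊗ₜ c)) =
      L.distribLeft K' (ω (K.sInv c)) (L.sgn x) +
        K.counit c • (L.tensor K').sInv (x ⊗ₜ K'.one) := by
  have h0 : (L.tensor K').sInv (L.one ⊗ₜ K'.one) = 0 := (L.tensor K').sInv_one
  simp only [wedgeLeft, sInv, LinearMap.comp_apply, TensorAlgebra.lift_ι_apply,
    Submodule.subtype_apply, proj_coe, map_sub, map_smul, tensor_one] at h0 ⊢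
  simp [h0, proj_one, K.counit_one]

theorem wedgeLeft_deg (hL : L.Laws) {ω : K.Cobar →ₐ[R] K'.Cobar}
    (hω : Deg K.cobarGrading K'.cobarGrading 0 ω.toLinearMap) :
    Deg (L.tensor K).cobarGrading (L.tensor K').cobarGrading 0 (L.wedgeLeft K K' ω).toLinearMap := by
  refine algHom_deg ?_
  have e : (L.wedgeLeft K K' ω).toLinearMap ∘ₗ TensorAlgebra.ι R =
      ((L.wedgeLeft K K' ω).toLinearMap ∘ₗ (L.tensor K).sInv) ∘ₗ
        (LinearMap.ker (L.tensor K).counit).subtype :=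
    LinearMap.ext fun v => by simp [sInv_bar]
  rw [e]
  refine Deg.comp (l := -1) ?_ (L.tensor K).subtype_deg (by norm_num)
  refine Deg.of_tmul fun i j x hx c hc => ?_
  rw [LinearMap.comp_apply, AlgHom.toLinearMap_apply, wedgeLeft_sInv]
  refine add_mem ?_ ?_
  · exact zgr_cast (distribLeft_mem_zgr hL (hω.apply (K.sInv_deg.apply hc)) (Deg.sgn.apply hx))
      (by ring)
  · by_cases hj : j = 0
    · exact Submodule.smul_mem _ _ (zgr_cast ((L.tensor K').sInv_deg.apply
        (tmul_mem_zgr hx K'.one_mem_zgr)) (by omega))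
    · rw [K.counit_of_ne hj hc, zero_smul]; exact zero_mem _

/-- On a letter s⁻¹(x ⊗ c), q contracts the distributed x to ε(x) and leaves ε(x)(1 ⊗ ω(s⁻¹c)); the
extra letter s⁻¹(x ⊗ 1) supplies the term with ε(c). -/
theorem milgram_wedgeLeft (hL : L.Laws) {ω : K.Cobar →ₐ[R] K'.Cobar}
    (hω : Deg K.cobarGrading K'.cobarGrading 0 ω.toLinearMap) :
    L.milgram K' ∘ₗ (L.wedgeLeft K K' ω).toLinearMap =
      TensorProduct.map LinearMap.id ω.toLinearMap ∘ₗ L.milgram K := by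
  refine linearMap_ext_of_mul (V := (L.tensor K).bar) (TensorProduct.curry (cobarMul L K')) ?_
    (fun v => ?_) (fun a b => ?_) (fun a b => ?_)
  · simp [milgram_one]
  · rw [← sInv_bar]
    generalize (v : D ⊗[R] C) = z
    rw [LinearMap.comp_apply, AlgHom.toLinearMap_apply, LinearMap.comp_apply, milgram_sInv]
    induction z using TensorProduct.induction_on with
    | zero => simp
    | add x y hx hy => simp only [map_add, hx, hy]
    | tmul x c =>
      rw [wedgeLeft_sInv, map_add, map_smul, milgram_distribLeft hL, counit_sgn, milgram_sInv,
        milgramGen_tmul, milgramGen_tmul, K'.counit_one, sInv_one]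
      simp [add_comm]
  · simp [milgram_mul]
  · simp only [LinearMap.comp_apply, milgram_mul]
    exact gmul_natural (GA := L.cobarGrading) (GA' := L.cobarGrading) (GB := K.cobarGrading)
      (GB' := K'.cobarGrading) (mA := LinearMap.mul' R L.Cobar) (mA' := LinearMap.mul' R L.Cobar)
      (mB := LinearMap.mul' R K.Cobar) (mB' := LinearMap.mul' R K'.Cobar) Deg.id hω
      (fun _ _ => rfl) (by simp) _ _

theorem hhIncl_apply (w : K.Cobar) : K.hhIncl w = K.one ⊗ₜ w := rfl

theorem hhHat_tmul (ω : K.Cobar →ₐ[R] K'.Cobar) (x : C) (w : K.Cobar) :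
    K.hhHat K' ω (x ⊗ₜ w) = K.counit x • K'.hhIncl (ω w) + K'.rotate (ω (K.sInv x) ⊗ₜ ω w) := by
  rw [hhHat_eq, LinearMap.comp_apply, LinearMap.lTensor_tmul, gam_tmul]
  rfl

theorem hhHat_tmul_of_sInv {ω : K.Cobar →ₐ[R] K'.Cobar} {x : C} {a : K'.Cobar} {r : R} {z : E}
    (h : ω (K.sInv x) = a + r • K'.sInv z) (w : K.Cobar) :
    K.hhHat K' ω (x ⊗ₜ w) = K.counit x • K'.hhIncl (ω w) + (K'.rotate (a ⊗ₜ ω w) +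
      r • (z ⊗ₜ ω w - K'.counit z • K'.hhIncl (ω w))) := by
  rw [hhHat_tmul, h, TensorProduct.add_tmul, map_add, ← TensorProduct.smul_tmul', map_smul,
    rotate_sInv]

/-- The first factor x ⊗ c of the hat contributes the rotation of ω(s⁻¹c) with x distributed over
it, which `milgramHat_rotate_distribLeft` evaluates, and the letter s⁻¹(x ⊗ 1). The terms with
ε(x)ε(c) cancel, and the remaining two are the two summands of ω̂ applied to the second factor. -/
theorem milgramHat_wedgeLeft (hL : L.Laws) {ω : K.Cobar →ₐ[R] K'.Cobar}
    (hω : Deg K.cobarGrading K'.cobarGrading 0 ω.toLinearMap) :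
    L.milgramHat K' ∘ₗ (L.tensor K).hhHat (L.tensor K') (L.wedgeLeft K K' ω) =
      LinearMap.lTensor L.CoHH (K.hhHat K' ω) ∘ₗ L.milgramHat K := by
  refine TensorProduct.ext_threefold fun x c b => ?_
  induction x using L.toGrading.parity_induction with
  | ha x x' h h' => simp only [TensorProduct.add_tmul, map_add, h, h']
  | hg n x hx =>
  induction c using K.toGrading.parity_induction with
  | ha x x' h h' => simp only [TensorProduct.tmul_add, TensorProduct.add_tmul, map_add, h, h']
  | hg m c hc =>
  induction b using (L.tensor K).cobarGrading.parity_induction with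
  | ha x x' h h' => simp only [TensorProduct.tmul_add, map_add, h, h']
  | hg l b hb =>
  have hωc : ω (K.sInv c) ∈ K'.cobarGrading.par (m + 1) := hω.par_zero (K.sInv_mem_par hc)
  have hWb : L.wedgeLeft K K' ω b ∈ (L.tensor K').cobarGrading.par l :=
    (wedgeLeft_deg hL hω).par_zero hb
  have hq := LinearMap.congr_fun (milgram_wedgeLeft hL hω) b
  rw [LinearMap.comp_apply, AlgHom.toLinearMap_apply, LinearMap.comp_apply] at hq
  have hε : (L.tensor K').counit (x ⊗ₜ K'.one) = L.counit x := by
    rw [tensor_counit_tmul, K'.counit_one, mul_one]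
  have hr := milgramHat_rotate_distribLeft hL hωc hx hWb
  have hs := hhHat_tmul_of_sInv (wedgeLeft_sInv (L := L) (K' := K') ω x c) b
  rw [sgn_par hx, map_smul, hε, tensor_counit_tmul, ← TensorProduct.smul_tmul', map_smul] at hs
  rw [LinearMap.comp_apply, LinearMap.comp_apply, milgramHat_tmul, hs]
  generalize L.wedgeLeft K K' ω b = b' at hr hq hs ⊢
  generalize L.distribLeft K' (ω (K.sInv c)) x = a' at hr hs ⊢
  rw [map_add, map_add, map_smul, map_smul, map_smul, map_sub, map_smul, hr, hhIncl_apply,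
    milgramHat_tmul, milgramHat_tmul, hq]
  clear hq hWb hr hs
  generalize hf : ω (K.sInv c) = a at hωc ⊢
  have hy : L.milgram K b ∈ (L.cobarGrading.tensor K.cobarGrading).par l := milgram_deg.par_zero hb
  refine tensor_par_induction ?_ ?_ (fun i j _ u hu v hv => ?_) hy
  · simp
  · intro y z h h'
    simp only [TensorProduct.tmul_add, map_add, smul_add, smul_sub] at h h' ⊢
    rw [← h, ← h']
    abel
  have e := K.sg_mul_counit' hc i
  rw [interchange_par _ _ hc hu, TensorProduct.map_tmul, LinearMap.id_apply, rotateLeft_tmul _ _ _ hu,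
    tensor_one, interchange_par _ _ K'.one_mem_par hu, interchange_par _ _ K'.one_mem_par hu,
    zero_mul, sg_zero, one_smul, one_smul, map_smul, LinearMap.lTensor_tmul, hhHat_tmul, hf,
    hhIncl_apply, TensorProduct.tmul_add, TensorProduct.tmul_smul, AlgHom.toLinearMap_apply,
    smul_add (sg R (m * i)), smul_smul (sg R (m * i)) (K.counit c), e, add_mul, add_mul, one_mul,
    add_assoc, CharTwo.add_self_eq_zero, add_zero]
  have hn := sg_sq (R := R) n
  linear_combination (norm := module) hn • (sg R (m * i) • (x ⊗ₜ[R] u) ⊗ₜ[R] K'.rotate (a ⊗ₜ[R] ω v))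

/-! ### The map `ω ∧ Id` -/

theorem wedgeRight_sInv (ω : K.Cobar →ₐ[R] K'.Cobar) (c : C) (y : D) :
    K.wedgeRight K' L ω ((K.tensor L).sInv (c ⊗ₜ y)) =
      K'.distribRight L (ω (K.sInv c)) y +
        K.counit c • (K'.tensor L).sInv (K'.one ⊗ₜ y) := by
  have h0 : (K'.tensor L).sInv (K'.one ⊗ₜ L.one) = 0 := (K'.tensor L).sInv_one
  simp only [wedgeRight, sInv, LinearMap.comp_apply, TensorAlgebra.lift_ι_apply,
    Submodule.subtype_apply, proj_coe, map_sub, map_smul, tensor_one] at h0 ⊢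
  simp [h0, proj_one, K.counit_one, ← TensorProduct.smul_tmul']

theorem wedgeRight_deg (hL : L.Laws) {ω : K.Cobar →ₐ[R] K'.Cobar}
    (hω : Deg K.cobarGrading K'.cobarGrading 0 ω.toLinearMap) :
    Deg (K.tensor L).cobarGrading (K'.tensor L).cobarGrading 0
      (K.wedgeRight K' L ω).toLinearMap := by
  refine algHom_deg ?_
  have e : (K.wedgeRight K' L ω).toLinearMap ∘ₗ TensorAlgebra.ι R =
      ((K.wedgeRight K' L ω).toLinearMap ∘ₗ (K.tensor L).sInv) ∘ₗ
        (LinearMap.ker (K.tensor L).counit).subtype :=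
    LinearMap.ext fun v => by simp [sInv_bar]
  rw [e]
  refine Deg.comp (l := -1) ?_ (K.tensor L).subtype_deg (by norm_num)
  refine Deg.of_tmul fun i j c hc y hy => ?_
  rw [LinearMap.comp_apply, AlgHom.toLinearMap_apply, wedgeRight_sInv]
  refine add_mem ?_ ?_
  · exact zgr_cast (distribRight_mem_zgr hL (hω.apply (K.sInv_deg.apply hc)) hy) (by ring)
  · by_cases hi : i = 0
    · exact Submodule.smul_mem _ _ (zgr_cast ((K'.tensor L).sInv_deg.apply
        (tmul_mem_zgr K'.one_mem_zgr hy)) (by omega))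
    · rw [K.counit_of_ne hi hc, zero_smul]; exact zero_mem _

theorem milgram_wedgeRight (hL : L.Laws) {ω : K.Cobar →ₐ[R] K'.Cobar}
    (hω : Deg K.cobarGrading K'.cobarGrading 0 ω.toLinearMap) :
    K'.milgram L ∘ₗ (K.wedgeRight K' L ω).toLinearMap =
      TensorProduct.map ω.toLinearMap LinearMap.id ∘ₗ K.milgram L := by
  refine linearMap_ext_of_mul (V := (K.tensor L).bar) (TensorProduct.curry (cobarMul K' L)) ?_
    (fun v => ?_) (fun a b => ?_) (fun a b => ?_)
  · simp [milgram_one]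
  · rw [← sInv_bar]
    generalize (v : C ⊗[R] D) = z
    rw [LinearMap.comp_apply, AlgHom.toLinearMap_apply, LinearMap.comp_apply, milgram_sInv]
    induction z using TensorProduct.induction_on with
    | zero => simp
    | add x y hx hy => simp only [map_add, hx, hy]
    | tmul c y =>
      rw [wedgeRight_sInv, map_add, map_smul, milgram_distribRight hL, milgram_sInv,
        milgramGen_tmul, milgramGen_tmul, K'.counit_one, sInv_one]
      simp
  · simp [milgram_mul]
  · simp only [LinearMap.comp_apply, milgram_mul]
    exact gmul_natural (GA := K.cobarGrading) (GA' := K'.cobarGrading) (GB := L.cobarGrading)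
      (GB' := L.cobarGrading) (mA := LinearMap.mul' R K.Cobar) (mA' := LinearMap.mul' R K'.Cobar)
      (mB := LinearMap.mul' R L.Cobar) (mB' := LinearMap.mul' R L.Cobar) hω Deg.id
      (by simp) (fun _ _ => rfl) _ _

/-- The same comparison as for Id ∧ ω, with `milgramHat_rotate_distribRight` evaluating the rotated
distribution. -/
theorem milgramHat_wedgeRight (hL : L.Laws) {ω : K.Cobar →ₐ[R] K'.Cobar}
    (hω : Deg K.cobarGrading K'.cobarGrading 0 ω.toLinearMap) :
    K'.milgramHat L ∘ₗ (K.tensor L).hhHat (K'.tensor L) (K.wedgeRight K' L ω) =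
      LinearMap.rTensor L.CoHH (K.hhHat K' ω) ∘ₗ K.milgramHat L := by
  refine TensorProduct.ext_threefold fun c y b => ?_
  induction y using L.toGrading.parity_induction with
  | ha x x' h h' => simp only [TensorProduct.tmul_add, TensorProduct.add_tmul, map_add, h, h']
  | hg n y hy =>
  induction c using K.toGrading.parity_induction with
  | ha x x' h h' => simp only [TensorProduct.add_tmul, map_add, h, h']
  | hg m c hc =>
  induction b using (K.tensor L).cobarGrading.parity_induction with
  | ha x x' h h' => simp only [TensorProduct.tmul_add, map_add, h, h']
  | hg l b hb =>
  have hωc : ω (K.sInv c) ∈ K'.cobarGrading.par (m + 1) := hω.par_zero (K.sInv_mem_par hc)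
  have hWb : K.wedgeRight K' L ω b ∈ (K'.tensor L).cobarGrading.par l :=
    (wedgeRight_deg hL hω).par_zero hb
  have hq := LinearMap.congr_fun (milgram_wedgeRight hL hω) b
  rw [LinearMap.comp_apply, AlgHom.toLinearMap_apply, LinearMap.comp_apply] at hq
  have hε : (K'.tensor L).counit (K'.one ⊗ₜ y) = L.counit y := by
    rw [tensor_counit_tmul, K'.counit_one, one_mul]
  have hr := milgramHat_rotate_distribRight hL hωc hy hWb
  have hs := hhHat_tmul_of_sInv (wedgeRight_sInv (L := L) (K' := K') ω c y) b
  clear hWb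
  generalize K.wedgeRight K' L ω = W at hr hq hs ⊢
  generalize W b = b' at hr hq hs ⊢
  generalize hf : ω (K.sInv c) = a at hωc hr hs ⊢
  generalize K'.distribRight L a y = a' at hr hs ⊢
  rw [hε, tensor_counit_tmul] at hs
  rw [LinearMap.comp_apply, LinearMap.comp_apply, milgramHat_tmul, hs]
  rw [map_add, map_add, map_smul, map_smul, map_sub, map_smul, hr, hhIncl_apply, milgramHat_tmul,
    milgramHat_tmul, hq]
  clear hq hr hs
  have hz : K.milgram L b ∈ (K.cobarGrading.tensor L.cobarGrading).par l := milgram_deg.par_zero hb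
  refine tensor_par_induction ?_ ?_ (fun i j _ u hu v hv => ?_) hz
  · simp
  · intro y z h h'
    simp only [TensorProduct.tmul_add, map_add, smul_add, smul_sub] at h h' ⊢
    rw [← h, ← h']
    abel
  have hωu : ω u ∈ K'.cobarGrading.par i := hω.par_zero hu
  rw [interchange_par _ _ hy hu, TensorProduct.map_tmul, LinearMap.id_apply,
    AlgHom.toLinearMap_apply, rotateRight_tmul _ _ _ hωu, interchange_par _ _ hy hωu, tensor_one,
    interchange_par _ _ L.one_mem_par hωu, map_smul, LinearMap.rTensor_tmul, hhHat_tmul, hf,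
    hhIncl_apply, zero_mul, sg_zero, one_smul, TensorProduct.add_tmul, ← TensorProduct.smul_tmul']
  module

end PreCoalg

/-! ### Coassociativity -/

section Coassoc

variable {R C : Type*} [CommRing R] [AddCommGroup C] [Module R C] {K : ChainCoalg R C}
  {ω : K.Cobar →ₐ[R] (K.tensor K.toPreCoalg).Cobar}

open PreCoalg

/-- The iterated Milgram map `Ĥ(C ⊗ (C ⊗ C)) → Ĥ(C) ⊗ (Ĥ(C) ⊗ Ĥ(C))`. -/
def milgramHatTriple (K : ChainCoalg R C) :
    (triple K).CoHH →ₗ[R] K.CoHH ⊗[R] (K.CoHH ⊗[R] K.CoHH) :=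
  LinearMap.lTensor K.CoHH (K.milgramHat K.toPreCoalg) ∘ₗ
    K.milgramHat (K.tensor K.toPreCoalg)

theorem awLeft_deg (hω : IsWeakAW K ω) :
    Deg K.cobarGrading (triple K).cobarGrading 0 (awLeft K ω).toLinearMap :=
  Deg.comp (k := 0) (l := 0) (wedgeLeft_deg K.laws (hasDegree_iff.mp hω.degree))
    (hasDegree_iff.mp hω.degree) (by norm_num)

theorem awRight_deg (hω : IsWeakAW K ω) :
    Deg K.cobarGrading (triple K).cobarGrading 0 (awRight K ω).toLinearMap :=
  Deg.comp (k := 0) (l := 0) (cobarMap_deg Deg.assoc) (Deg.comp (k := 0) (l := 0)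
    (wedgeRight_deg K.laws (hasDegree_iff.mp hω.degree)) (hasDegree_iff.mp hω.degree)
    (by norm_num)) (by norm_num)

/-- The inner ω̂ of 1 ⊗ ψ̂ is pulled through q̂, where it becomes the hat of Id ∧ ω; functoriality
then merges it with the first ω̂. -/
theorem comulRight_hhComul (hω : IsWeakAW K ω) :
    comulRight (K.hhComul ω) = milgramHatTriple K ∘ₗ K.hhHat (triple K) (awLeft K ω) := by
  have hd := hasDegree_iff.mp hω.degree
  rw [awLeft, hhHat_comp hd (wedgeLeft_deg K.laws hd), milgramHatTriple, LinearMap.comp_assoc,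
    ← LinearMap.comp_assoc _ _ (K.milgramHat _), milgramHat_wedgeLeft K.laws hd, comulRight, hhComul,
    LinearMap.lTensor_comp]
  simp only [LinearMap.comp_assoc]

/-- As for the other iterate, now with ω ∧ Id. Associativity of q̂ brings the bracketing (C ⊗ C) ⊗ C
into the form used by the iterated Milgram map. -/
theorem comulLeft_hhComul (hω : IsWeakAW K ω) :
    comulLeft (K.hhComul ω) = milgramHatTriple K ∘ₗ K.hhHat (triple K) (awRight K ω) := by
  have hd := hasDegree_iff.mp hω.degree
  have hc : (triple K).counit ∘ₗ (TensorProduct.assoc R C C C).toLinearMap =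
      ((K.tensor K.toPreCoalg).tensor K.toPreCoalg).counit :=
    TensorProduct.ext_threefold fun x y z => (mul_assoc _ _ _).symm
  rw [awRight, hhHat_comp (Deg.comp (k := 0) (l := 0) (wedgeRight_deg K.laws hd) hd (by norm_num))
    (cobarMap_deg Deg.assoc), hhHat_comp hd (wedgeRight_deg K.laws hd),
    ← hhMap_eq_hhHat hc rfl, milgramHatTriple, ← LinearMap.comp_assoc, LinearMap.comp_assoc _ _
    (LinearMap.lTensor _ _), milgramHat_assoc, comulLeft, hhComul, LinearMap.rTensor_comp]
  simp only [LinearMap.comp_assoc]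
  rw [← LinearMap.comp_assoc _ _ ((K.tensor K.toPreCoalg).milgramHat _),
    milgramHat_wedgeRight K.laws hd]
  simp only [LinearMap.comp_assoc]

theorem IsStrictAW.coassoc (h : IsStrictAW K ω) :
    comulLeft (K.hhComul ω) = comulRight (K.hhComul ω) := by
  rw [comulLeft_hhComul h.1, comulRight_hhComul h.1, h.2]

end Coassoc

end

end CoHoch

namespace CoHoch

noncomputable section

open Grading

/-! ### The differential of an element distributed over a word. -/

section SgnPow

variable {R M : Type*} [CommRing R] [AddCommGroup M] [Module R M] {G : Grading R M}

theorem Grading.sgnPow_one : G.sgnPow 1 = G.sgn := by simp [Grading.sgnPow]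

theorem Grading.sgnPow_comp_sgnPow (e e' : ZMod 2) :
    G.sgnPow e ∘ₗ G.sgnPow e' = G.sgnPow (e + e') := by
  refine LinearMap.ext fun x => ?_
  induction x using G.parity_induction with
  | hg i x hx =>
    rw [LinearMap.comp_apply, sgnPow_par _ hx, map_smul, sgnPow_par _ hx, sgnPow_par _ hx,
      smul_smul, add_mul, sg_add, mul_comm]
  | ha x y hx hy => rw [map_add, map_add, hx, hy]

end SgnPow

namespace PreCoalg

section Convolution

variable {R C B : Type*} [CommRing R] [AddCommGroup C] [Module R C] [Ring B] [Algebra R B]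
  {K : PreCoalg R C}

theorem cv_smul_left (r : R) (p q : C →ₗ[R] B) : K.cv (r • p) q = r • K.cv p q := by
  simp only [cv, TensorProduct.map_smul_left, LinearMap.smul_comp, LinearMap.comp_smul]

theorem cv_smul_right (r : R) (p q : C →ₗ[R] B) : K.cv p (r • q) = r • K.cv p q := by
  simp only [cv, TensorProduct.map_smul_right, LinearMap.smul_comp, LinearMap.comp_smul]

theorem Laws.cv_sgnPow (h : K.Laws) (e : ZMod 2) (p q : C →ₗ[R] B) :
    K.cv p q ∘ₗ K.sgnPow e = K.cv (p ∘ₗ K.sgnPow e) (q ∘ₗ K.sgnPow e) := by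
  rcases zmod_two_cases e with rfl | rfl
  · simp [sgnPow]
  · simp only [sgnPow_one, h.cv_sgn]

theorem Laws.d_comp_sgnPow (h : K.Laws) (e : ZMod 2) :
    K.sgnPow e ∘ₗ K.d = sg R e • (K.d ∘ₗ K.sgnPow e) := by
  refine LinearMap.ext fun x => ?_
  induction x using K.toGrading.parity_induction with
  | hg i x hx =>
    rw [LinearMap.comp_apply, sgnPow_par _ (h.d_deg.par_neg_one hx), LinearMap.smul_apply,
      LinearMap.comp_apply, sgnPow_par _ hx, map_smul, smul_smul, ← sg_add, mul_add, mul_one,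
      add_comm]
  | ha x y hx hy => rw [map_add, map_add, hx, hy]

theorem cvOne_comp_sgnPow (e : ZMod 2) :
    (K.cvOne : C →ₗ[R] B) ∘ₗ K.sgnPow e = K.cvOne := by
  rcases zmod_two_cases e with rfl | rfl
  · simp [sgnPow]
  · refine LinearMap.ext fun x => ?_
    rw [sgnPow_one, LinearMap.comp_apply, cvOne, LinearMap.comp_apply, LinearMap.comp_apply,
      counit_sgn]

end Convolution

universe v

variable {R : Type*} {C D E : Type v} [CommRing R] [AddCommGroup C] [Module R C] [AddCommGroup D]
  [Module R D] [AddCommGroup E] [Module R E] {K : PreCoalg R C} {K' : PreCoalg R E}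

/-- The map `x ↦ s⁻¹(x ⊗ c)`. -/
def leftLetter (L : PreCoalg R D) (K : PreCoalg R C) (c : C) : D →ₗ[R] (L.tensor K).Cobar :=
  (L.tensor K).sInv ∘ₗ (TensorProduct.mk R D C).flip c

theorem leftLetter_apply (L : PreCoalg R D) (K : PreCoalg R C) (c : C) (x : D) :
    L.leftLetter K c x = (L.tensor K).sInv (x ⊗ₜ c) := rfl

variable {L : ChainCoalg R D}

theorem distribLeft_one_eq : L.distribLeft K 1 = L.cvOne :=
  LinearMap.ext fun x => distribLeft_one x

/-- Read as a map of x, distribution is an iterated convolution of the one-letter maps. The sign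
powers record how far x₍₂₎ has to move. -/
theorem distribLeft_ι_mul_eq {i : ZMod 2} {v : K.bar} (hv : v ∈ K.barGrading.par i) (w : K.Cobar) :
    L.distribLeft K (TensorAlgebra.ι R v * w) =
      L.cv (L.leftLetter K v ∘ₗ L.sgn) (L.distribLeft K w ∘ₗ L.sgnPow i) := by
  refine LinearMap.ext fun x => ?_
  induction x using L.toGrading.parity_induction with
  | ha x y hx hy => rw [map_add, map_add, hx, hy]
  | hg n x hx =>
    obtain ⟨k, a, b, p, q, ha, hb, hn, hx', -, -⟩ := L.laws.sweedler hx
    rw [distribLeft_ι_mul hv w ha hb hx', cv_apply hx']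
    refine Finset.sum_congr rfl fun t _ => ?_
    rw [LinearMap.comp_apply, LinearMap.comp_apply, sgn_par (ha t), sgnPow_par _ (hb t), map_smul,
      map_smul, smul_mul_smul_comm, sg_add, mul_comm (sg R (i * q t)), leftLetter_apply]

theorem distribLeft_ι (v : K.bar) :
    L.distribLeft K (TensorAlgebra.ι R v) = L.leftLetter K v ∘ₗ L.sgn := by
  induction v using K.barGrading.parity_induction with
  | hg i v hv =>
    have := distribLeft_ι_mul_eq (L := L) hv 1
    rwa [mul_one, distribLeft_one_eq, cvOne_comp_sgnPow, L.laws.cv_cvOne] at this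
  | ha x y hx hy =>
    rw [map_add, map_add, hx, hy]
    refine LinearMap.ext fun x => ?_
    simp [leftLetter, TensorProduct.tmul_add]

/-- To distribute x over ab is to distribute x₍₁₎ over a and x₍₂₎ over b; coassociativity makes this
independent of where the word is cut, which is why the left factor must be a chain coalgebra. -/
theorem distribLeft_mul {i : ZMod 2} {a : K.Cobar} (ha : a ∈ K.cobarGrading.par i) (b : K.Cobar) :
    L.distribLeft K (a * b) = L.cv (L.distribLeft K a) (L.distribLeft K b ∘ₗ L.sgnPow i) := by
  refine word_par_induction (G := K.barGrading) (p := fun i a =>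
    L.distribLeft K (a * b) = L.cv (L.distribLeft K a) (L.distribLeft K b ∘ₗ L.sgnPow i))
    ?_ ?_ ?_ ?_ ?_ ha
  · intro i; simp [cv]
  · intro i x y hx hy; rw [add_mul, map_add, map_add, cv_add_left, hx, hy]
  · intro i r x hx; rw [smul_mul_assoc, map_smul, map_smul, cv_smul_left, hx]
  · rw [one_mul, distribLeft_one_eq, L.laws.cvOne_cv]; rfl
  · intro i j v w hv hw ih
    rw [mul_assoc, distribLeft_ι_mul_eq hv, ih, distribLeft_ι_mul_eq hv, L.laws.cv_sgnPow,
      ← L.cv_assoc, LinearMap.comp_assoc, sgnPow_comp_sgnPow, add_comm j]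

theorem distribLeft_sInv (c : C) :
    L.distribLeft K (K.sInv c) =
      (L.leftLetter K c - K.counit c • L.leftLetter K K.one) ∘ₗ L.sgn := by
  have : K.sInv c = TensorAlgebra.ι R (K.proj c) := rfl
  rw [this, distribLeft_ι]
  refine LinearMap.ext fun x => ?_
  simp [leftLetter, proj_coe, TensorProduct.tmul_sub, TensorProduct.tmul_smul]

theorem cobarD_leftLetter (hK : K.Laws) {n : ZMod 2} {x : D} (hx : x ∈ L.par n) {c : C} {k k' : ℕ}
    {a b : Fin k → D} {a' b' : Fin k' → C} {p q : Fin k → ZMod 2} {p' : Fin k' → ZMod 2}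
    (ha : ∀ t, a t ∈ L.par (p t)) (hb : ∀ t, b t ∈ L.par (q t)) (ha' : ∀ t, a' t ∈ K.par (p' t))
    (hx' : L.comul x = ∑ t, a t ⊗ₜ[R] b t) (hc : K.comul c = ∑ t, a' t ⊗ₜ[R] b' t) :
    (L.tensor K).cobarD (L.leftLetter K c x) =
      -(L.leftLetter K c (L.d x) + sg R n • L.leftLetter K (K.d c) x) +
        ∑ s, ∑ t, sg R (p s + p' t) • sg R (q s * p' t) •
          (L.leftLetter K (a' t) (a s) * L.leftLetter K (b' t) (b s)) := by
  have hz := tensor_comul_tmul_prod (K := L.toPreCoalg) hb ha' hx' hc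
  have hp : ∀ st : Fin k × Fin k', sg R (q st.1 * p' st.2) • (a st.1 ⊗ₜ[R] a' st.2) ∈
      (L.tensor K).par (p st.1 + p' st.2) := fun st =>
    Submodule.smul_mem _ _ (tmul_mem_par (G := L.toGrading) (H := K.toGrading) (ha st.1) (ha' st.2))
  rw [leftLetter_apply, (L.laws.tensor hK).cobarD_sInv,
    cobarGen_apply hp hz, tensor_d_tmul hx, Fintype.sum_prod_type, map_add, map_smul]
  refine congrArg₂ _ rfl (Finset.sum_congr rfl fun s _ => Finset.sum_congr rfl fun t _ => ?_)
  rw [map_smul, smul_mul_assoc]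
  rfl

-- The quadratic part of d s⁻¹(x ⊗ v) includes the pairs x₍₁₎ ⊗ 1 | x₍₂₎ ⊗ v and x₍₁₎ ⊗ v | x₍₂₎ ⊗
-- 1. They are absent from the distribution of x over dv since s⁻¹1 = 0. They make up the graded
-- commutator with σ : x ↦ s⁻¹(x ⊗ 1).
set_option maxHeartbeats 1000000 in
theorem cobarD_distribLeft_ι (hK : K.Laws) {i : ZMod 2} {v : K.bar} (hv : v ∈ K.barGrading.par i) :
    (L.tensor K).cobarD ∘ₗ L.distribLeft K (TensorAlgebra.ι R v) =
      L.distribLeft K (TensorAlgebra.ι R v) ∘ₗ L.d +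
      L.distribLeft K (K.cobarD (TensorAlgebra.ι R v)) ∘ₗ L.sgn +
      L.cv (L.leftLetter K K.one) (L.distribLeft K (TensorAlgebra.ι R v)) -
      sg R i • L.cv (L.distribLeft K (TensorAlgebra.ι R v) ∘ₗ L.sgn)
        (L.leftLetter K K.one ∘ₗ L.sgnPow i) := by
  refine LinearMap.ext fun x => ?_
  induction x using L.toGrading.parity_induction with
  | ha x y hx hy => rw [map_add, map_add, hx, hy]
  | hg n x hx =>
  obtain ⟨k, a, b, p, q, ha, hb, hn, hx', -, -⟩ := L.laws.sweedler hx
  obtain ⟨k', a', b', p', q', ha', hb', hn', hv', hl, hr⟩ := hK.sweedler (coe_mem_par K hv)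
  have hε : K.counit v = 0 := v.2
  have hgen : K.cobarD (TensorAlgebra.ι R v) =
      -K.sInv (K.d v) + ∑ t, sg R (p' t) • (K.sInv (a' t) * K.sInv (b' t)) := by
    have := hK.cobarD_sInv v
    rw [sInv_bar] at this
    rw [this, cobarGen_apply ha' hv']
  have hD : ∀ t, L.distribLeft K (K.sInv (a' t) * K.sInv (b' t)) x = ∑ s,
      (sg R (p s) • (L.leftLetter K (a' t) (a s) - K.counit (a' t) • L.leftLetter K K.one (a s))) *
      (sg R ((p' t + 1) * q s) • sg R (q s) • (L.leftLetter K (b' t) (b s) -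
        K.counit (b' t) • L.leftLetter K K.one (b s))) := fun t => by
    rw [distribLeft_mul (K.sInv_mem_par (ha' t)), cv_apply hx']
    refine Finset.sum_congr rfl fun s _ => ?_
    rw [LinearMap.comp_apply, sgnPow_par _ (hb s), map_smul, distribLeft_sInv, distribLeft_sInv,
      LinearMap.comp_apply, LinearMap.comp_apply, sgn_par (ha s), sgn_par (hb s), map_smul,
      map_smul]
    rfl
  have e1 : ∀ y, ∑ t, K.counit (a' t) • L.leftLetter K (b' t) y = L.leftLetter K v y := fun y => by
    conv_rhs => rw [← hl]
    simp [leftLetter, TensorProduct.tmul_sum]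
  have e2 : ∀ y, ∑ t, K.counit (b' t) • L.leftLetter K (a' t) y = L.leftLetter K v y := fun y => by
    conv_rhs => rw [← hr]
    simp [leftLetter, TensorProduct.tmul_sum]
  have e3 : ∑ t, K.counit (a' t) * K.counit (b' t) = 0 := by
    have := congrArg K.counit hl
    simpa [hε] using this
  have e1' := fun s => congrArg (fun y => sg R (q s) • (L.leftLetter K K.one (a s) * y)) (e1 (b s))
  have e2' := fun s => congrArg
    (fun y => sg R (i * q s) • (y * L.leftLetter K K.one (b s))) (e2 (a s))
  have e3' := fun s => congrArg
    (fun r => (sg R (q s) * r) • (L.leftLetter K K.one (a s) * L.leftLetter K K.one (b s))) e3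
  have t1 : (L.tensor K).cobarD (L.distribLeft K (TensorAlgebra.ι R v) x) =
      sg R n • (-(L.leftLetter K v (L.d x) + sg R n • L.leftLetter K (K.d v) x) +
        ∑ s, ∑ t, sg R (p s + p' t) • sg R (q s * p' t) •
          (L.leftLetter K (a' t) (a s) * L.leftLetter K (b' t) (b s))) := by
    rw [distribLeft_ι, LinearMap.comp_apply, sgn_par hx, map_smul, map_smul,
      cobarD_leftLetter hK hx ha hb ha' hx' hv']
  have t2 : L.distribLeft K (TensorAlgebra.ι R v) (L.d x) =
      sg R (n + 1) • L.leftLetter K v (L.d x) := by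
    rw [distribLeft_ι, LinearMap.comp_apply, sgn_par (L.laws.d_deg.par_neg_one hx), map_smul]
  have t3 : L.distribLeft K (K.cobarD (TensorAlgebra.ι R v)) x =
      -(sg R n • L.leftLetter K (K.d v) x) + ∑ t, sg R (p' t) • ∑ s,
      (sg R (p s) • (L.leftLetter K (a' t) (a s) - K.counit (a' t) • L.leftLetter K K.one (a s))) *
      (sg R ((p' t + 1) * q s) • sg R (q s) • (L.leftLetter K (b' t) (b s) -
        K.counit (b' t) • L.leftLetter K K.one (b s))) := by
    rw [hgen, map_add, map_neg, map_sum, distribLeft_sInv, hK.counit_d, zero_smul, sub_zero,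
      LinearMap.add_apply, LinearMap.neg_apply, LinearMap.comp_apply, sgn_par hx, map_smul,
      LinearMap.sum_apply]
    simp only [map_smul, LinearMap.smul_apply, hD]
  have t4 : L.cv (L.leftLetter K K.one) (L.distribLeft K (TensorAlgebra.ι R v)) x =
      ∑ s, sg R (q s) • (L.leftLetter K K.one (a s) * L.leftLetter K v (b s)) := by
    rw [cv_apply hx', distribLeft_ι]
    refine Finset.sum_congr rfl fun s _ => ?_
    rw [LinearMap.comp_apply, sgn_par (hb s), map_smul, mul_smul_comm]
  have t5 : L.cv (L.distribLeft K (TensorAlgebra.ι R v) ∘ₗ L.sgn)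
      (L.leftLetter K K.one ∘ₗ L.sgnPow i) x =
      ∑ s, sg R (i * q s) • (L.leftLetter K v (a s) * L.leftLetter K K.one (b s)) := by
    rw [cv_apply hx', distribLeft_ι, LinearMap.comp_assoc, sgn_sgn, LinearMap.comp_id]
    refine Finset.sum_congr rfl fun s _ => ?_
    rw [LinearMap.comp_apply, sgnPow_par _ (hb s), map_smul, mul_smul_comm]
  rw [LinearMap.sub_apply, LinearMap.add_apply, LinearMap.add_apply, LinearMap.smul_apply, t4, t5,
    LinearMap.comp_apply, LinearMap.comp_apply, LinearMap.comp_apply, t1, t2, sgn_par hx, map_smul,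
    t3]
  -- What remains is an identity in a ring with opaque letters, in which only signs and counits
  -- matter.
  clear t1 t2 t3 t4 t5 hD hgen e1 e2
  generalize L.leftLetter K K.one = σ at *
  generalize L.leftLetter K (v : C) = V at *
  generalize L.leftLetter K (K.d v) = V' at *
  generalize hA : (fun t => L.leftLetter K (a' t)) = A at *
  generalize hB : (fun t => L.leftLetter K (b' t)) = B at *
  have hA' : ∀ t, L.leftLetter K (a' t) = A t := fun t => congrFun hA t
  have hB' : ∀ t, L.leftLetter K (b' t) = B t := fun t => congrFun hB t
  simp only [hA', hB'] at *
  clear hA hB hA' hB'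
  have key : ∀ s t, sg R n • sg R (p s + p' t) • sg R (q s * p' t) • (A t (a s) * B t (b s)) =
      sg R n • sg R (p' t) • ((sg R (p s) • (A t (a s) - K.counit (a' t) • σ (a s))) *
        (sg R ((p' t + 1) * q s) • sg R (q s) • (B t (b s) - K.counit (b' t) • σ (b s)))) +
      sg R (q s) • (σ (a s) * (K.counit (a' t) • B t (b s))) -
      sg R i • sg R (i * q s) • ((K.counit (b' t) • A t (a s)) * σ (b s)) -
      (sg R (q s) * (K.counit (a' t) * K.counit (b' t))) • (σ (a s) * σ (b s)) := fun s t => by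
    -- The parity i is that of the desuspended letter, one off from the parity of v in C.
    have hi : i = p' t + q' t + 1 := by
      rw [← hn' t, add_assoc, CharTwo.add_self_eq_zero, add_zero]
    have h1 := K.counit_of_odd (x := a' t)
    have h2 := K.counit_of_odd (x := b' t)
    have ha' := ha' t
    have hb' := hb' t
    rw [hi, hn s]
    generalize A t (a s) = X
    generalize B t (b s) = Y
    generalize σ (a s) = Z
    generalize σ (b s) = W
    generalize K.counit (a' t) = r at *
    generalize K.counit (b' t) = r' at *
    rcases zmod_two_cases (p' t) with h3 | h3 <;> rcases zmod_two_cases (q' t) with h4 | h4 <;>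
    rw [h3] at ha' ⊢ <;> rw [h4] at hb' ⊢
    all_goals try rw [h1 ha']
    all_goals try rw [h2 hb']
    all_goals
      simp only [sg_zero, sg_one, sg_add, sg_mul_add, sg_add_mul, sg_mul_one, sg_one_mul,
        sg_mul_zero, sg_zero_mul, zero_smul, sub_zero, mul_zero, zero_mul, one_smul, smul_mul_smul_comm,
        sub_mul, mul_sub, smul_mul_assoc, mul_smul_comm, smul_zero, add_zero, zero_add, mul_one, one_mul,
        add_mul, mul_add, CharTwo.add_self_eq_zero]
      match_scalars <;> simp only [sg_sq, sg_sq_left, mul_comm, mul_left_comm, mul_assoc, mul_neg,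
        neg_mul, mul_one, one_mul, neg_neg] <;> ring
  have key' := Finset.sum_congr (rfl : (Finset.univ : Finset (Fin k)) = _) fun s _ =>
    Finset.sum_congr (rfl : (Finset.univ : Finset (Fin k')) = _) fun t _ => key s t
  simp only [Finset.sum_add_distrib, Finset.sum_sub_distrib, ← Finset.smul_sum, ← Finset.sum_smul,
    ← Finset.mul_sum, ← Finset.sum_mul] at key'
  have key2 := Finset.sum_congr (rfl : (Finset.univ : Finset (Fin k)) = _) fun s _ => e1' s
  have key3 := Finset.sum_congr (rfl : (Finset.univ : Finset (Fin k)) = _) fun s _ => e2' s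
  -- The term quadratic in σ has coefficient ε(v) = 0.
  simp only [e3, mul_zero, zero_smul, Finset.sum_const_zero, sub_zero, key2, key3] at key'
  have hc : ∀ F : Fin k → Fin k' → (L.tensor K).Cobar,
      ∑ t, sg R (p' t) • ∑ s, F s t = ∑ s, ∑ t, sg R (p' t) • F s t := fun F => by
    simp only [Finset.smul_sum]
    exact Finset.sum_comm
  rw [hc, smul_add, key', sg_add, sg_one]
  module

/-- The differential of a word over which an element is distributed. -/
theorem cobarD_distribLeft (hK : K.Laws) {i : ZMod 2} {a : K.Cobar}
    (ha : a ∈ K.cobarGrading.par i) :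
    (L.tensor K).cobarD ∘ₗ L.distribLeft K a =
      L.distribLeft K a ∘ₗ L.d + L.distribLeft K (K.cobarD a) ∘ₗ L.sgn +
      L.cv (L.leftLetter K K.one) (L.distribLeft K a) -
      sg R i • L.cv (L.distribLeft K a ∘ₗ L.sgn) (L.leftLetter K K.one ∘ₗ L.sgnPow i) := by
  have hS : ∀ {i : ZMod 2} {a : K.Cobar}, a ∈ K.cobarGrading.par i →
      (L.tensor K).cobarGrading.sgn ∘ₗ L.distribLeft K a =
        sg R i • (L.distribLeft K a ∘ₗ L.sgn) := fun {i a} ha => by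
    refine LinearMap.ext fun x => ?_
    induction x using L.toGrading.parity_induction with
    | ha x y hx hy => rw [map_add, map_add, hx, hy]
    | hg n x hx =>
      rw [LinearMap.comp_apply, sgn_par (distribLeft_mem_par L.laws ha hx), LinearMap.smul_apply,
        LinearMap.comp_apply, sgn_par hx, map_smul, smul_smul, sg_add]
  refine word_par_induction (G := K.barGrading) (p := fun i a =>
    (L.tensor K).cobarD ∘ₗ L.distribLeft K a =
      L.distribLeft K a ∘ₗ L.d + L.distribLeft K (K.cobarD a) ∘ₗ L.sgn +
      L.cv (L.leftLetter K K.one) (L.distribLeft K a) -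
      sg R i • L.cv (L.distribLeft K a ∘ₗ L.sgn) (L.leftLetter K K.one ∘ₗ L.sgnPow i))
    ?_ ?_ ?_ ?_ ?_ ha
  · intro i; simp [cv]
  · intro i x y hx hy
    simp only [map_add, LinearMap.comp_add, LinearMap.add_comp, hx, hy, cv_add_left, cv_add_right,
      smul_add]
    abel
  · intro i r x hx
    simp only [map_smul, LinearMap.comp_smul, LinearMap.smul_comp, hx, cv_smul_left, cv_smul_right,
      smul_add, smul_sub, smul_comm r]
  · have h1 : (L.tensor K).cobarD ∘ₗ (L.cvOne : D →ₗ[R] (L.tensor K).Cobar) = 0 :=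
      LinearMap.ext fun x => by
        simp [cvOne, Algebra.algebraMap_eq_smul_one, cobarD_one]
    have h2 : (L.cvOne : D →ₗ[R] (L.tensor K).Cobar) ∘ₗ L.d = 0 :=
      LinearMap.ext fun x => by simp [cvOne, L.laws.counit_d]
    have h3 : (L.cvOne : D →ₗ[R] (L.tensor K).Cobar) ∘ₗ L.sgn = L.cvOne := by
      rw [← sgnPow_one, cvOne_comp_sgnPow]
    rw [distribLeft_one_eq, h1, h2, cobarD_one, map_zero, LinearMap.zero_comp, L.laws.cv_cvOne, h3,
      L.laws.cvOne_cv, sg_zero]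
    simp [sgnPow]
  -- The commutators with σ telescope: convolution on the right of the letter v cancels convolution
  -- on the left of the remaining word w, so σ stays only at the two ends.
  · intro i j v w hv hw ih
    have hι := ι_mem_par hv
    have hcom : L.d ∘ₗ L.sgnPow i = sg R i • (L.sgnPow i ∘ₗ L.d) := by
      rw [L.laws.d_comp_sgnPow, smul_smul, sg_sq, one_smul]
    have hs : L.sgn ∘ₗ L.sgnPow i = L.sgnPow i ∘ₗ L.sgn := by
      rw [← sgnPow_one, sgnPow_comp_sgnPow, sgnPow_comp_sgnPow, add_comm]
    have hs1 : L.sgnPow (i + 1) ∘ₗ L.sgn = L.sgnPow i := by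
      rw [← sgnPow_one, sgnPow_comp_sgnPow, add_assoc, CharTwo.add_self_eq_zero, add_zero]
    have hij : L.sgnPow j ∘ₗ L.sgnPow i = L.sgnPow (i + j) := by rw [sgnPow_comp_sgnPow, add_comm]
    rw [cobarD_mul_par hι, map_add, map_smul, distribLeft_mul hι,
      distribLeft_mul (hK.cobarD_deg.par_neg_one hι), distribLeft_mul hι,
      cv_derivation (GB := (L.tensor K).cobarGrading) (L.tensor K).cobarD_mul, hS hι,
      cobarD_distribLeft_ι hK hv, ← LinearMap.comp_assoc, ih, L.cv_comp_d]
    generalize L.distribLeft K (TensorAlgebra.ι R v) = A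
    generalize L.distribLeft K (K.cobarD (TensorAlgebra.ι R v)) = A'
    generalize L.distribLeft K w = B
    generalize L.distribLeft K (K.cobarD w) = B'
    generalize L.leftLetter K K.one = σ
    simp only [LinearMap.add_comp, LinearMap.sub_comp, LinearMap.smul_comp, L.laws.cv_sgn,
      L.laws.cv_sgnPow, LinearMap.comp_assoc, hcom, hs, hs1, hij, LinearMap.comp_smul, cv_add_left,
      cv_add_right, cv_sub_left, cv_sub_right, cv_smul_left, cv_smul_right, L.cv_assoc, sg_add,
      smul_add, smul_sub, smul_smul]
    match_scalars <;> first | ring1 | linear_combination sg_sq (R := R) i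

end PreCoalg
end
end CoHoch

namespace CoHoch

noncomputable section

open Grading

/-! ### `Id ∧ ω` is a chain map. -/

namespace PreCoalg

/-- An algebra map between cobar constructions is a chain map if it is one on letters. -/
theorem Laws.isChainMap_of_sInv {R C D : Type*} [CommRing R] [AddCommGroup C] [Module R C]
    [AddCommGroup D] [Module R D] {K : PreCoalg R C} {L : PreCoalg R D}
    {ω : K.Cobar →ₐ[R] L.Cobar} (hω : Deg K.cobarGrading L.cobarGrading 0 ω.toLinearMap)
    (h : ∀ x, ω (K.cobarD (K.sInv x)) = L.cobarD (ω (K.sInv x))) :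
    IsChainMap K.cobarGrading K.cobarD L.cobarGrading L.cobarD ω.toLinearMap where
  degree := hasDegree_iff.mpr hω
  comm := by
    have hs := Deg.comp_sgn_of_even fun i x hx => hω.par_zero (i := i) (x := x) hx
    refine LinearMap.ext fun w => ?_
    simp only [LinearMap.comp_apply, AlgHom.toLinearMap_apply]
    induction w using TensorAlgebra.induction with
    | algebraMap r => simp [Algebra.algebraMap_eq_smul_one, cobarD_one]
    | ι v => rw [← sInv_bar]; exact h _
    | mul a b ha hb =>
      have hsa := LinearMap.congr_fun hs a
      simp only [LinearMap.comp_apply, AlgHom.toLinearMap_apply] at hsa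
      rw [cobarD_mul, map_mul, cobarD_mul, map_add, map_mul, map_mul, ha, hb, hsa]
    | add a b ha hb => simp only [map_add, ha, hb]

universe v

variable {R : Type*} {C D E : Type v} [CommRing R] [AddCommGroup C] [Module R C] [AddCommGroup D]
  [Module R D] [AddCommGroup E] [Module R E] {K : PreCoalg R C} {K' : PreCoalg R E}
  {L : ChainCoalg R D}

theorem wedgeLeft_leftLetter (ω : K.Cobar →ₐ[R] K'.Cobar) {n : ZMod 2} {x : D} (hx : x ∈ L.par n)
    (c : C) :
    L.wedgeLeft K K' ω (L.leftLetter K c x) = sg R n • L.distribLeft K' (ω (K.sInv c)) x +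
      K.counit c • L.leftLetter K' K'.one x := by
  rw [leftLetter_apply, wedgeLeft_sInv, sgn_par hx, map_smul]
  rfl

theorem cobarD_distribLeft_par (hK : K.Laws) {i n : ZMod 2} {a : K.Cobar} {x : D}
    (ha : a ∈ K.cobarGrading.par i) (hx : x ∈ L.par n) {k : ℕ} {b b' : Fin k → D}
    {p q : Fin k → ZMod 2} (hb : ∀ t, b t ∈ L.par (p t)) (hb' : ∀ t, b' t ∈ L.par (q t))
    (hx' : L.comul x = ∑ t, b t ⊗ₜ[R] b' t) :
    (L.tensor K).cobarD (L.distribLeft K a x) =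
      L.distribLeft K a (L.d x) + sg R n • L.distribLeft K (K.cobarD a) x +
      ∑ s, L.leftLetter K K.one (b s) * L.distribLeft K a (b' s) -
      ∑ s, (sg R i * sg R (p s) * sg R (i * q s)) •
        (L.distribLeft K a (b s) * L.leftLetter K K.one (b' s)) := by
  have := LinearMap.congr_fun (cobarD_distribLeft (L := L) hK ha) x
  rw [LinearMap.comp_apply] at this
  rw [this, LinearMap.sub_apply, LinearMap.add_apply, LinearMap.add_apply, LinearMap.smul_apply,
    cv_apply hx', cv_apply hx', LinearMap.comp_apply, LinearMap.comp_apply, sgn_par hx, map_smul,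
    Finset.smul_sum]
  refine congrArg₂ _ rfl (Finset.sum_congr rfl fun s _ => ?_)
  rw [LinearMap.comp_apply, LinearMap.comp_apply, sgn_par (hb s), sgnPow_par _ (hb' s), map_smul,
    map_smul, smul_mul_smul_comm, smul_smul, mul_assoc]

/-- The image of s⁻¹(x ⊗ c) is a distribution over ω(s⁻¹c) plus ε(c)σ(x). Expanding the product of
two such images gives the distribution over the quadratic part of ω(ds⁻¹c), the commutator with σ
found in `cobarD_distribLeft`, and a σσ term with coefficient ε(c), which is the quadratic part of
the differential of ε(c)σ(x). -/
theorem cobarD_wedgeLeft_leftLetter (hK : K.Laws) (hK' : K'.Laws) {ω : K.Cobar →ₐ[R] K'.Cobar}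
    (hω : IsChainMap K.cobarGrading K.cobarD K'.cobarGrading K'.cobarD ω.toLinearMap)
    {n m : ZMod 2} {x : D} {c : C} (hx : x ∈ L.par n) (hc : c ∈ K.par m) :
    L.wedgeLeft K K' ω ((L.tensor K).cobarD (L.leftLetter K c x)) =
      (L.tensor K').cobarD (L.wedgeLeft K K' ω (L.leftLetter K c x)) := by
  obtain ⟨k, a, b, p, q, ha, hb, hn, hx', -, -⟩ := L.laws.sweedler hx
  obtain ⟨k', a', b', p', q', ha', hb', hn', hc', hl, hr⟩ := hK.sweedler hc
  have hωp : ∀ {i : ZMod 2} {c : C}, c ∈ K.par i → ω (K.sInv c) ∈ K'.cobarGrading.par (i + 1) :=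
    fun hc => Deg.par_zero (hasDegree_iff.mp hω.degree) (K.sInv_mem_par hc)
  have hD : K'.cobarD (ω (K.sInv c)) = -ω (K.sInv (K.d c)) +
      ∑ t, sg R (p' t) • (ω (K.sInv (a' t)) * ω (K.sInv (b' t))) := by
    have := LinearMap.congr_fun hω.comm (K.sInv c)
    simp only [LinearMap.comp_apply, AlgHom.toLinearMap_apply] at this
    rw [← this, hK.cobarD_sInv, cobarGen_apply ha' hc', map_add, map_neg, map_sum]
    simp only [map_smul, map_mul]
  have h1 : K'.comul K'.one = ∑ _t : Fin 1, K'.one ⊗ₜ[R] K'.one := by simp [hK'.comul_one]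
  have t1 : (L.tensor K').cobarD (L.leftLetter K' K'.one x) = -L.leftLetter K' K'.one (L.d x) +
      ∑ s, sg R (p s) • (L.leftLetter K' K'.one (a s) * L.leftLetter K' K'.one (b s)) := by
    rw [cobarD_leftLetter hK' hx ha hb (fun _ => K'.one_mem_par) hx' h1, hK'.d_one]
    simp [sg_zero, leftLetter_apply]
  have t2 : L.distribLeft K' (K'.cobarD (ω (K.sInv c))) x =
      -L.distribLeft K' (ω (K.sInv (K.d c))) x + ∑ s, ∑ t, sg R (p' t) • sg R ((p' t + 1) * q s) •
        (L.distribLeft K' (ω (K.sInv (a' t))) (a s) *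
          L.distribLeft K' (ω (K.sInv (b' t))) (b s)) := by
    rw [hD, map_add, map_neg, map_sum, LinearMap.add_apply, LinearMap.neg_apply,
      LinearMap.sum_apply, Finset.sum_comm]
    refine congrArg₂ _ rfl (Finset.sum_congr rfl fun t _ => ?_)
    rw [map_smul, LinearMap.smul_apply, distribLeft_mul (hωp (ha' t)), cv_apply hx',
      Finset.smul_sum]
    refine Finset.sum_congr rfl fun s _ => ?_
    rw [LinearMap.comp_apply, sgnPow_par _ (hb s), map_smul, mul_smul_comm]
  have e1 : ∀ y, ∑ t, K.counit (a' t) • L.distribLeft K' (ω (K.sInv (b' t))) y =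
      L.distribLeft K' (ω (K.sInv c)) y := fun y => by
    conv_rhs => rw [← hl]
    simp
  have e2 : ∀ y, ∑ t, K.counit (b' t) • L.distribLeft K' (ω (K.sInv (a' t))) y =
      L.distribLeft K' (ω (K.sInv c)) y := fun y => by
    conv_rhs => rw [← hr]
    simp
  have e3 : ∑ t, K.counit (a' t) * K.counit (b' t) = K.counit c := by
    have := congrArg K.counit hl
    simpa using this
  have e1' := Finset.sum_congr (rfl : (Finset.univ : Finset (Fin k)) = _) fun s _ =>
    congrArg (fun y => L.leftLetter K' K'.one (a s) * y) (e1 (b s))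
  have e2' := Finset.sum_congr (rfl : (Finset.univ : Finset (Fin k)) = _) fun s _ =>
    congrArg (fun y => (sg R (m + 1) * sg R (p s) * sg R ((m + 1) * q s)) •
      (y * L.leftLetter K' K'.one (b s))) (e2 (a s))
  rw [wedgeLeft_leftLetter ω hx, map_add, map_smul, map_smul, t1,
    cobarD_distribLeft_par hK' (hωp hc) hx ha hb hx', t2,
    cobarD_leftLetter hK hx ha hb ha' hx' hc', map_add, map_neg, map_add, map_smul,
    wedgeLeft_leftLetter ω hx, wedgeLeft_leftLetter ω (L.laws.d_deg.par_neg_one hx), hK.counit_d,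
    zero_smul, add_zero, map_sum]
  simp only [map_sum, map_smul, map_mul, wedgeLeft_leftLetter ω (ha _),
    wedgeLeft_leftLetter ω (hb _)]
  clear t1 t2 hD e1 e2 h1
  generalize L.leftLetter K' K'.one = σ at *
  generalize L.distribLeft K' (ω (K.sInv c)) = V at *
  generalize L.distribLeft K' (ω (K.sInv (K.d c))) = V' at *
  generalize hA : (fun t => L.distribLeft K' (ω (K.sInv (a' t)))) = A at *
  generalize hB : (fun t => L.distribLeft K' (ω (K.sInv (b' t)))) = B at *
  have hA' : ∀ t, L.distribLeft K' (ω (K.sInv (a' t))) = A t := fun t => congrFun hA t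
  have hB' : ∀ t, L.distribLeft K' (ω (K.sInv (b' t))) = B t := fun t => congrFun hB t
  simp only [hA', hB'] at *
  clear hA hB hA' hB'
  have key : ∀ s t, sg R (p s + p' t) • sg R (q s * p' t) •
      ((sg R (p s) • A t (a s) + K.counit (a' t) • σ (a s)) *
        (sg R (q s) • B t (b s) + K.counit (b' t) • σ (b s))) =
      sg R (p' t) • sg R ((p' t + 1) * q s) • (A t (a s) * B t (b s)) +
      sg R n • (σ (a s) * (K.counit (a' t) • B t (b s))) -
      sg R n • (sg R (m + 1) * sg R (p s) * sg R ((m + 1) * q s)) •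
        ((K.counit (b' t) • A t (a s)) * σ (b s)) +
      (K.counit (a' t) * K.counit (b' t)) • sg R (p s) • (σ (a s) * σ (b s)) := fun s t => by
    have h1 := K.counit_of_odd (x := a' t)
    have h2 := K.counit_of_odd (x := b' t)
    have ha' := ha' t
    have hb' := hb' t
    rw [hn' t, hn s]
    generalize A t (a s) = X
    generalize B t (b s) = Y
    generalize σ (a s) = Z
    generalize σ (b s) = W
    generalize K.counit (a' t) = r at *
    generalize K.counit (b' t) = r' at *
    rcases zmod_two_cases (p' t) with h3 | h3 <;> rcases zmod_two_cases (q' t) with h4 | h4 <;>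
    rw [h3] at ha' ⊢ <;> rw [h4] at hb' ⊢
    all_goals try rw [h1 ha']
    all_goals try rw [h2 hb']
    all_goals
      simp only [sg_zero, sg_one, sg_add, sg_mul_add, sg_add_mul, sg_mul_one, sg_one_mul,
        sg_mul_zero, sg_zero_mul, zero_smul, sub_zero, mul_zero, zero_mul, one_smul, smul_mul_smul_comm,
        sub_mul, mul_sub, smul_mul_assoc, mul_smul_comm, smul_zero, add_zero, zero_add, mul_one, one_mul,
        add_mul, mul_add, CharTwo.add_self_eq_zero]
      match_scalars <;> simp only [sg_sq, sg_sq_left, mul_comm, mul_left_comm, mul_assoc, mul_neg,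
        neg_mul, mul_one, one_mul, neg_neg]
  have key' := Finset.sum_congr (rfl : (Finset.univ : Finset (Fin k)) = _) fun s _ =>
    Finset.sum_congr (rfl : (Finset.univ : Finset (Fin k')) = _) fun t _ => key s t
  simp only [Finset.sum_add_distrib, Finset.sum_sub_distrib, ← Finset.smul_sum, ← Finset.sum_smul,
    ← Finset.mul_sum, ← Finset.sum_mul, e3, e1', e2'] at key'
  rw [key', sg_add n, sg_one]
  have hs := sg_sq (R := R) n
  match_scalars <;> first | ring1 | linear_combination hs | linear_combination -hs

theorem wedgeLeft_isChainMap (hK : K.Laws) (hK' : K'.Laws) {ω : K.Cobar →ₐ[R] K'.Cobar}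
    (hω : IsChainMap K.cobarGrading K.cobarD K'.cobarGrading K'.cobarD ω.toLinearMap) :
    IsChainMap (L.tensor K).cobarGrading (L.tensor K).cobarD (L.tensor K').cobarGrading
      (L.tensor K').cobarD (L.wedgeLeft K K' ω).toLinearMap :=
  Laws.isChainMap_of_sInv (wedgeLeft_deg L.laws (hasDegree_iff.mp hω.degree)) fun z =>
    LinearMap.congr_fun (f := (L.wedgeLeft K K' ω).toLinearMap ∘ₗ (L.tensor K).cobarD ∘ₗ
        (L.tensor K).sInv)
      (g := (L.tensor K').cobarD ∘ₗ (L.wedgeLeft K K' ω).toLinearMap ∘ₗ (L.tensor K).sInv)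
      (tensor_ext L.toGrading K.toGrading fun _ _ _ hx _ hc =>
        cobarD_wedgeLeft_leftLetter hK hK' hω hx hc) z

end PreCoalg

theorem IsWeakAW.awLeft_isChainMap {R C : Type*} [CommRing R] [AddCommGroup C] [Module R C]
    {K : ChainCoalg R C} {ω : K.Cobar →ₐ[R] (K.tensor K.toPreCoalg).Cobar} (h : IsWeakAW K ω) :
    IsChainMap K.cobarGrading K.cobarD (triple K).cobarGrading (triple K).cobarD
      (awLeft K ω).toLinearMap where
  degree := hasDegree_iff.mpr (awLeft_deg h)
  comm := by
    have hW := (PreCoalg.wedgeLeft_isChainMap (L := K) K.laws (K.laws.tensor K.laws)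
      h.toIsChainMap).comm
    have hω := h.toIsChainMap.comm
    have e : (awLeft K ω).toLinearMap =
      (K.wedgeLeft K.toPreCoalg (K.tensor K.toPreCoalg) ω).toLinearMap ∘ₗ ω.toLinearMap := rfl
    rw [e, LinearMap.comp_assoc, hω, ← LinearMap.comp_assoc, hW, LinearMap.comp_assoc]

end
end CoHoch

namespace CoHoch

noncomputable section

open Grading

/-! ### Convolution inverses -/

namespace ChainCoalg

variable {R C B : Type*} [CommRing R] [AddCommGroup C] [Module R C] [Ring B] [Algebra R B]
  (K : ChainCoalg R C)

/-- In Δ(x) a right factor of full degree m is paired with a left factor of degree 0, which h kills.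
Convolution by h therefore raises the degree in which a map begins to be nonzero. -/
theorem cv_eq_zero_of_lt {h q : C →ₗ[R] B} (hh : ∀ x ∈ K.gr 0, h x = 0) {m : ℕ}
    (hq : ∀ j < m, ∀ x ∈ K.gr j, q x = 0) {x : C} (hx : x ∈ K.gr m) : K.cv h q x = 0 := by
  have hc := K.comul_mem m x hx
  rw [PreCoalg.cv, LinearMap.comp_apply, LinearMap.comp_apply]
  refine Submodule.span_induction (p := fun z _ => LinearMap.mul' R B (TensorProduct.map h q z) = 0)
    ?_ (by simp) (fun y z _ _ hy hz => by rw [map_add, map_add, hy, hz, add_zero])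
    (fun r y _ hy => by rw [map_smul, map_smul, hy, smul_zero]) hc
  rintro _ ⟨i, j, rfl, a, ha, b, hb, rfl⟩
  rw [TensorProduct.map_tmul, LinearMap.mul'_apply]
  rcases Nat.eq_zero_or_pos i with rfl | hi
  · rw [hh a ha, zero_mul]
  · rw [hq j (by omega) b hb, mul_zero]

/-- The partial sums of the geometric series for the convolution inverse of `1 + h`. -/
def cvInvSeq (h : C →ₗ[R] B) : ℕ → C →ₗ[R] B
  | 0 => 0
  | n + 1 => K.cvOne - K.cv h (cvInvSeq h n)

/-- The convolution inverse of `1 + h` for `h` vanishing in degree `0`. -/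
def cvInv (h : C →ₗ[R] B) : C →ₗ[R] B :=
  K.elim fun m => K.cvInvSeq h (m + 1) ∘ₗ (K.gr m).subtype

variable {h : C →ₗ[R] B}

/-- Consecutive differences are obtained from one another by convolution with -h, so in each fixed
degree the geometric series becomes stationary. -/
theorem cvInvSeq_succ_apply (hh : ∀ x ∈ K.gr 0, h x = 0) (n : ℕ) :
    ∀ m < n, ∀ x ∈ K.gr m, K.cvInvSeq h (n + 1) x = K.cvInvSeq h n x := by
  induction n with
  | zero => intro m hm; omega
  | succ n ih =>
    intro m hm x hx
    rw [← sub_eq_zero]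
    have : K.cvInvSeq h (n + 1 + 1) - K.cvInvSeq h (n + 1) =
        -K.cv h (K.cvInvSeq h (n + 1) - K.cvInvSeq h n) := by
      rw [PreCoalg.cv_sub_right, cvInvSeq, cvInvSeq]
      abel
    rw [← LinearMap.sub_apply, this, LinearMap.neg_apply, K.cv_eq_zero_of_lt hh ?_ hx, neg_zero]
    intro j hj y hy
    rw [LinearMap.sub_apply, ih j (by omega) y hy, sub_self]

theorem cvInv_apply (hh : ∀ x ∈ K.gr 0, h x = 0) {m n : ℕ} (hmn : m < n) {x : C}
    (hx : x ∈ K.gr m) : K.cvInv h x = K.cvInvSeq h n x := by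
  induction n, hmn using Nat.le_induction with
  | base => rw [cvInv, elim_apply _ _ hx]; rfl
  | succ n hn ih => rw [ih, K.cvInvSeq_succ_apply hh n m hn x hx]

theorem cvInv_eq (hh : ∀ x ∈ K.gr 0, h x = 0) : K.cvInv h = K.cvOne - K.cv h (K.cvInv h) := by
  refine LinearMap.ext fun x => K.toGrading.induction
    -- In degree m the left side is partial sum m + 1, and inside the convolution partial sum m
    -- suffices, as only degrees below m are seen by h.
    (p := fun x => K.cvInv h x = (K.cvOne - K.cv h (K.cvInv h) : C →ₗ[R] B) x) (by simp) (fun m x hx => ?_)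
    (fun x y hx hy => by rw [map_add, map_add, hx, hy]) x
  have : K.cv h (K.cvInv h - K.cvInvSeq h m) x = 0 := K.cv_eq_zero_of_lt hh (fun j hj y hy => by
    rw [LinearMap.sub_apply, K.cvInv_apply hh hj hy, sub_self]) hx
  rw [PreCoalg.cv_sub_right, LinearMap.sub_apply, sub_eq_zero] at this
  rw [K.cvInv_apply hh (Nat.lt_succ_self m) hx, LinearMap.sub_apply, this]
  rfl

theorem cv_cvInv (hh : ∀ x ∈ K.gr 0, h x = 0) : K.cv (K.cvOne + h) (K.cvInv h) = K.cvOne := by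
  have := K.cvInv_eq hh
  rw [PreCoalg.cv_add_left, K.laws.cvOne_cv]
  nth_rewrite 1 [this]
  abel

/-- The right inverse k has the form 1 - h ⋆ k, whose perturbation again vanishes in degree 0, so k
has a right inverse too. By associativity that must be 1 + h. -/
theorem cvInv_cv (hh : ∀ x ∈ K.gr 0, h x = 0) : K.cv (K.cvInv h) (K.cvOne + h) = K.cvOne := by
  have hh' : ∀ x ∈ K.gr 0, (-K.cv h (K.cvInv h)) x = 0 := fun x hx => by
    rw [LinearMap.neg_apply, K.cv_eq_zero_of_lt hh (fun j hj => absurd hj (Nat.not_lt_zero j)) hx,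
      neg_zero]
  have h1 := K.cv_cvInv hh'
  rw [← sub_eq_add_neg, ← K.cvInv_eq hh] at h1
  have h2 : K.cvOne + h = K.cvInv (-K.cv h (K.cvInv h)) := by
    have := K.cv_assoc (K.cvOne + h) (K.cvInv h) (K.cvInv (-K.cv h (K.cvInv h)))
    rw [h1, K.cv_cvInv hh, K.laws.cvOne_cv, K.laws.cv_cvOne] at this
    exact this.symm
  rw [h2, h1]

/-- The differential of a convolution inverse of a map between twisting maps. -/
theorem cvInv_twist {GB : Grading R B} {dB : B →ₗ[R] B} (h1 : dB 1 = 0)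
    (hB : ∀ a b, dB (a * b) = dB a * b + GB.sgn a * dB b) {φ k F G : C →ₗ[R] B}
    (hφ : ∀ i, ∀ x ∈ K.par i, φ x ∈ GB.par i)
    (hr : K.cv φ k = K.cvOne) (hl : K.cv k φ = K.cvOne)
    (hd : dB ∘ₗ φ - φ ∘ₗ K.d = K.cv G φ - K.cv (φ ∘ₗ K.sgn) F) :
    dB ∘ₗ k - k ∘ₗ K.d = K.cv F k - K.cv (k ∘ₗ K.sgn) G := by
  have e1 : dB ∘ₗ (K.cvOne : C →ₗ[R] B) = 0 :=
    LinearMap.ext fun x => by simp [PreCoalg.cvOne, Algebra.algebraMap_eq_smul_one, h1]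
  have e2 : (K.cvOne : C →ₗ[R] B) ∘ₗ K.d = 0 :=
    LinearMap.ext fun x => by simp [PreCoalg.cvOne, K.laws.counit_d]
  have e3 := PreCoalg.cv_derivation (K := K.toPreCoalg) hB φ k
  have e4 := K.cv_comp_d φ k
  rw [hr, e1, Deg.comp_sgn_of_even hφ] at e3
  rw [hr, e2] at e4
  -- This is the equation φ ⋆ k = 1 differentiated; convolving with the inverse k sgn of φ sgn then
  -- isolates the commutator of k with the differentials.
  have e5 : K.cv (dB ∘ₗ φ - φ ∘ₗ K.d) k + K.cv (φ ∘ₗ K.sgn) (dB ∘ₗ k - k ∘ₗ K.d) = 0 := by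
    rw [PreCoalg.cv_sub_left, PreCoalg.cv_sub_right]
    rw [← sub_self (0 : C →ₗ[R] B)]
    nth_rewrite 1 [e3]
    rw [e4]
    abel
  have e6 := congrArg (K.cv (k ∘ₗ K.sgn)) e5
  have e7 : K.cv (k ∘ₗ K.sgn) (φ ∘ₗ K.sgn) = K.cvOne := by
    rw [← K.laws.cv_sgn, hl, ← sgnPow_one, PreCoalg.cvOne_comp_sgnPow]
  rw [hd, PreCoalg.cv_add_right, ← K.cv_assoc _ (φ ∘ₗ K.sgn), e7, K.laws.cvOne_cv,
    PreCoalg.cv_sub_left, PreCoalg.cv_sub_right, K.cv_assoc G, hr, K.laws.cv_cvOne,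
    K.cv_assoc (φ ∘ₗ K.sgn), ← K.cv_assoc _ (φ ∘ₗ K.sgn), e7, K.laws.cvOne_cv] at e6
  have e8 : K.cv (k ∘ₗ K.sgn) (0 : C →ₗ[R] B) = 0 := by simp [PreCoalg.cv]
  rw [e8] at e6
  rw [← sub_eq_zero, ← e6]
  abel

end ChainCoalg

/-! ### Left and right multiplication by convolution -/

namespace PreCoalg

section Left

variable {R C B : Type*} [CommRing R] [AddCommGroup C] [Module R C] [Ring B] [Algebra R B]

/-- `x ⊗ b ↦ ∑ x₍₁₎ ⊗ p(x₍₂₎) b`. -/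
def ulft (K : PreCoalg R C) (p : C →ₗ[R] B) : C ⊗[R] B →ₗ[R] C ⊗[R] B :=
  LinearMap.lTensor C (LinearMap.mul' R B) ∘ₗ (TensorProduct.assoc R C B B).toLinearMap ∘ₗ
    LinearMap.rTensor B (LinearMap.lTensor C p ∘ₗ K.comul)

variable {K : PreCoalg R C} {GB : Grading R B}

theorem ulft_apply (p : C →ₗ[R] B) (x : C) (w : B) :
    K.ulft p (x ⊗ₜ w) = LinearMap.lTensor C (LinearMap.mulRight R w ∘ₗ p) (K.comul x) := by
  simp only [ulft, LinearMap.comp_apply, LinearMap.rTensor_tmul]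
  generalize K.comul x = z
  induction z using TensorProduct.induction_on with
  | zero => simp
  | tmul y z => simp
  | add y z hy hz => simp only [map_add, TensorProduct.add_tmul, hy, hz]

theorem ulft_tmul {x : C} {T : Type*} [Fintype T] {a b : T → C}
    (hx : K.comul x = ∑ t, a t ⊗ₜ[R] b t) (p : C →ₗ[R] B) (w : B) :
    K.ulft p (x ⊗ₜ w) = ∑ t, a t ⊗ₜ[R] (p (b t) * w) := by
  rw [ulft_apply, hx, map_sum]
  rfl

/-- The unsigned action is multiplicative for convolution, which makes it the better one to
calculate with; the signed twist differs by a single sign operator. -/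
theorem lft_eq_ulft (p : C →ₗ[R] B) : K.lft p = LinearMap.rTensor B K.sgn ∘ₗ K.ulft p := by
  refine TensorProduct.ext' fun x w => ?_
  rw [LinearMap.comp_apply, ulft_apply]
  simp only [lft, LinearMap.comp_apply, LinearMap.rTensor_tmul]
  generalize K.comul x = z
  induction z using TensorProduct.induction_on with
  | zero => simp
  | tmul y z => simp
  | add y z hy hz => simp only [map_add, TensorProduct.add_tmul, hy, hz]

theorem ulft_add (p q : C →ₗ[R] B) : K.ulft (p + q) = K.ulft p + K.ulft q :=
  TensorProduct.ext' fun x w => by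
    rw [LinearMap.add_apply, ulft_apply, ulft_apply, ulft_apply, LinearMap.comp_add,
      LinearMap.lTensor_add, LinearMap.add_apply]

theorem ulft_sub (p q : C →ₗ[R] B) : K.ulft (p - q) = K.ulft p - K.ulft q := by
  rw [eq_sub_iff_add_eq, ← ulft_add, sub_add_cancel]

theorem Laws.ulft_cvOne (h : K.Laws) : K.ulft (K.cvOne : C →ₗ[R] B) = LinearMap.id := by
  refine TensorProduct.ext' fun x w => ?_
  induction x using K.toGrading.parity_induction with
  | ha x y hx hy => rw [TensorProduct.add_tmul, map_add, map_add, hx, hy]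
  | hg i x hx =>
  obtain ⟨k, a, b, p, q, ha, hb, hn, hx', hl, hr⟩ := h.sweedler hx
  rw [ulft_tmul hx', LinearMap.id_apply]
  conv_rhs => rw [← hr]
  rw [TensorProduct.sum_tmul]
  refine Finset.sum_congr rfl fun t _ => ?_
  rw [cvOne, LinearMap.comp_apply, Algebra.linearMap_apply, ← Algebra.smul_def,
    TensorProduct.tmul_smul, TensorProduct.smul_tmul']

theorem ulft_comp_sgn (hK : K.Laws) (p : C →ₗ[R] B) :
    K.ulft p ∘ₗ LinearMap.rTensor B K.sgn = LinearMap.rTensor B K.sgn ∘ₗ K.ulft (p ∘ₗ K.sgn) := by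
  have := Deg.comp_sgn_of_even (G := K.toGrading) (H := K.toGrading.tensor K.toGrading)
    (f := K.comul) fun i x hx => hK.comul_deg.par_zero hx
  rw [tensor_sgn] at this
  refine TensorProduct.ext' fun x w => ?_
  have hx := LinearMap.congr_fun this x
  rw [LinearMap.comp_apply, LinearMap.comp_apply] at hx
  rw [LinearMap.comp_apply, LinearMap.comp_apply, LinearMap.rTensor_tmul, ulft_apply, ulft_apply,
    ← hx]
  generalize K.comul x = z
  induction z using TensorProduct.induction_on with
  | zero => simp
  | tmul y z => simp
  | add y z hy hz => simp only [map_add, hy, hz]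

theorem rgtTail_ulft {k : C →ₗ[R] B} (hk : ∀ j, ∀ z ∈ (K.toGrading.tensor GB).par j,
      K.ulft k z ∈ (K.toGrading.tensor GB).par j) :
    K.ulft k ∘ₗ K.rgtTail GB = K.rgtTail GB ∘ₗ LinearMap.lTensor B (K.ulft k) := by
  refine tensor_ext GB (K.toGrading.tensor GB) fun i j u hu z hz => ?_
  rw [LinearMap.comp_apply, LinearMap.comp_apply, LinearMap.lTensor_tmul, rgtTail_tmul hu hz,
    rgtTail_tmul hu (hk _ _ hz), map_smul]
  congr 1
  clear hz
  induction z using TensorProduct.induction_on with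
  | zero => simp
  | add y z hy hz => simp only [map_add, hy, hz]
  | tmul x w =>
    rw [LinearMap.lTensor_tmul, ulft_apply, ulft_apply]
    generalize K.comul x = z
    induction z using TensorProduct.induction_on with
    | zero => simp
    | tmul y z => simp [mul_assoc]
    | add y z hy hz => simp only [map_add, hy, hz]

theorem rgt_apply (q : C →ₗ[R] B) (x : C) (w : B) :
    K.rgt GB q (x ⊗ₜ w) =
      K.rgtTail GB (TensorProduct.map q ((TensorProduct.mk R C B).flip w) (K.comul x)) := by
  simp only [rgt, LinearMap.comp_apply, LinearMap.rTensor_tmul]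
  generalize K.comul x = z
  induction z using TensorProduct.induction_on with
  | zero => simp
  | tmul y z => simp
  | add y z hy hz => simp only [map_add, TensorProduct.add_tmul, hy, hz]

theorem rgt_add (p q : C →ₗ[R] B) : K.rgt GB (p + q) = K.rgt GB p + K.rgt GB q :=
  TensorProduct.ext' fun x w => by
    rw [LinearMap.add_apply, rgt_apply, rgt_apply, rgt_apply, TensorProduct.map_add_left,
      LinearMap.add_apply, map_add]

theorem ulft_deg (hK : K.Laws) (hB : Deg (GB.tensor GB) GB 0 (LinearMap.mul' R B)) {p : C →ₗ[R] B}
    (hp : Deg K.toGrading GB 0 p) : Deg (K.toGrading.tensor GB) (K.toGrading.tensor GB) 0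
      (K.ulft p) :=
  Deg.comp (k := 0) (l := 0) hB.lTensor (Deg.assoc.comp (k := 0)
    (Deg.comp (k := 0) (l := 0) hp.lTensor hK.comul_deg (by norm_num)).rTensor (by norm_num))
    (by norm_num)

end Left

end PreCoalg

namespace ChainCoalg

variable {R C B : Type*} [CommRing R] [AddCommGroup C] [Module R C] [Ring B] [Algebra R B]
  (K : ChainCoalg R C) {GB : Grading R B}

/-- Coassociativity makes convolution act from the left on C ⊗ B. A convolution inverse thus acts by
the inverse operator. -/
theorem ulft_comp_ulft (p q : C →ₗ[R] B) : K.ulft p ∘ₗ K.ulft q = K.ulft (K.cv p q) := by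
  refine TensorProduct.ext' fun x w => ?_
  have hx := LinearMap.congr_fun K.coassoc x
  simp only [LinearMap.comp_apply, LinearEquiv.coe_coe] at hx
  have h1 : ∀ z : C ⊗[R] C, K.ulft p (LinearMap.lTensor C (LinearMap.mulRight R w ∘ₗ q) z) =
      LinearMap.lTensor C (LinearMap.mulRight R w ∘ₗ LinearMap.mul' R B ∘ₗ TensorProduct.map p q)
        (TensorProduct.assoc R C C C (K.comul.rTensor C z)) := fun z => by
    induction z using TensorProduct.induction_on with
    | zero => simp
    | add y z hy hz => simp only [map_add, hy, hz]
    | tmul y z =>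
      rw [LinearMap.lTensor_tmul, PreCoalg.ulft_apply, LinearMap.rTensor_tmul]
      generalize K.comul y = u
      induction u using TensorProduct.induction_on with
      | zero => simp
      | tmul a b => simp [mul_assoc]
      | add y z hy hz => simp only [map_add, TensorProduct.add_tmul, hy, hz]
  have h2 : ∀ z : C ⊗[R] C, LinearMap.lTensor C (LinearMap.mulRight R w ∘ₗ K.cv p q) z =
      LinearMap.lTensor C (LinearMap.mulRight R w ∘ₗ LinearMap.mul' R B ∘ₗ TensorProduct.map p q)
        (K.comul.lTensor C z) := fun z => by
    rw [← LinearMap.comp_apply, ← LinearMap.lTensor_comp]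
    rfl
  rw [LinearMap.comp_apply, PreCoalg.ulft_apply, PreCoalg.ulft_apply, h1, h2, hx]

/-- The right action uses x₍₁₎ and multiplies at the end of b, the left action uses the last factor
and multiplies at the front. Coassociativity and associativity of B make the two commute, and
preservation of parity keeps the sign. -/
theorem rgt_comp_ulft {k : C →ₗ[R] B} (hk : ∀ j, ∀ z ∈ (K.toGrading.tensor GB).par j,
      K.ulft k z ∈ (K.toGrading.tensor GB).par j) (q : C →ₗ[R] B) :
    K.rgt GB q ∘ₗ K.ulft k = K.ulft k ∘ₗ K.rgt GB q := by
  refine TensorProduct.ext' fun x w => ?_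
  have hx := LinearMap.congr_fun K.coassoc x
  simp only [LinearMap.comp_apply, LinearEquiv.coe_coe] at hx
  have h1 : ∀ z : C ⊗[R] C, K.rgt GB q (LinearMap.lTensor C (LinearMap.mulRight R w ∘ₗ k) z) =
      K.rgtTail GB (TensorProduct.map q (LinearMap.lTensor C (LinearMap.mulRight R w ∘ₗ k))
        (TensorProduct.assoc R C C C (K.comul.rTensor C z))) := fun z => by
    induction z using TensorProduct.induction_on with
    | zero => simp
    | add y z hy hz => simp only [map_add, hy, hz]
    | tmul y z =>
      rw [LinearMap.lTensor_tmul, PreCoalg.rgt_apply, LinearMap.rTensor_tmul]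
      generalize K.comul y = u
      induction u using TensorProduct.induction_on with
      | zero => simp
      | tmul a b => simp
      | add y z hy hz => simp only [map_add, TensorProduct.add_tmul, hy, hz]
  have h2 : ∀ z : C ⊗[R] C,
      K.ulft k (K.rgtTail GB (TensorProduct.map q ((TensorProduct.mk R C B).flip w) z)) =
      K.rgtTail GB (TensorProduct.map q (LinearMap.lTensor C (LinearMap.mulRight R w ∘ₗ k))
        (K.comul.lTensor C z)) := fun z => by
    rw [← LinearMap.comp_apply, PreCoalg.rgtTail_ulft hk]
    induction z using TensorProduct.induction_on with
    | zero => simp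
    | add y z hy hz => simp only [map_add, hy, hz]
    | tmul y z => simp [PreCoalg.ulft_apply]
  rw [LinearMap.comp_apply, LinearMap.comp_apply, PreCoalg.ulft_apply, h1, hx, PreCoalg.rgt_apply,
    h2]

/-- As Δ is a chain map and dB a derivation, all terms cancel except those where a differential
meets the value or the argument of k. -/
theorem tensorD_ulft {dB : B →ₗ[R] B} (hB : ∀ a b, dB (a * b) = dB a * b + GB.sgn a * dB b)
    {k : C →ₗ[R] B} (hk : ∀ i, ∀ x ∈ K.par i, k x ∈ GB.par i) :
    tensorD K.toGrading K.d dB ∘ₗ K.ulft k - K.ulft k ∘ₗ tensorD K.toGrading K.d dB =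
      K.lft (dB ∘ₗ k - k ∘ₗ K.d) := by
  refine TensorProduct.ext' fun x w => ?_
  induction x using K.toGrading.parity_induction with
  | ha x y hx hy => rw [TensorProduct.add_tmul, map_add, map_add, hx, hy]
  | hg n x hx =>
  obtain ⟨l, a, b, p, q, ha, hb, hn, hx', -, -⟩ := K.laws.sweedler hx
  have hd : K.comul (K.d x) = ∑ t, (K.d (a t) ⊗ₜ[R] b t + sg R (p t) • (a t ⊗ₜ[R] K.d (b t))) := by
    have := LinearMap.congr_fun K.comul_d x
    rw [LinearMap.comp_apply, LinearMap.comp_apply, hx', map_sum] at this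
    rw [this]
    exact Finset.sum_congr rfl fun t _ => tensorD_tmul_par _ _ (ha t) _
  rw [LinearMap.sub_apply, LinearMap.comp_apply, LinearMap.comp_apply, PreCoalg.ulft_tmul hx',
    PreCoalg.lft_tmul ha hx', tensorD_tmul_par _ _ hx, map_add, map_smul, PreCoalg.ulft_tmul hx',
    PreCoalg.ulft_apply, hd, map_sum, map_sum, Finset.smul_sum, ← Finset.sum_add_distrib,
    ← Finset.sum_sub_distrib]
  refine Finset.sum_congr rfl fun t _ => ?_
  rw [tensorD_tmul_par _ _ (ha t), hB, sgn_par (hk _ _ (hb t)), hn t, sg_add]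
  simp only [map_add, map_smul, LinearMap.lTensor_tmul, LinearMap.comp_apply,
    LinearMap.mulRight_apply, LinearMap.sub_apply, sub_mul, TensorProduct.tmul_sub,
    TensorProduct.tmul_add, smul_mul_assoc, TensorProduct.tmul_smul, smul_add, smul_sub]
  module

/-- Left multiplication by `k` intertwines twisted differentials. -/
theorem twD_comp_ulft {dB : B →ₗ[R] B} (hB : ∀ a b, dB (a * b) = dB a * b + GB.sgn a * dB b)
    {k F G : C →ₗ[R] B} (hk : ∀ i, ∀ x ∈ K.par i, k x ∈ GB.par i)
    (hk' : ∀ j, ∀ z ∈ (K.toGrading.tensor GB).par j, K.ulft k z ∈ (K.toGrading.tensor GB).par j)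
    (hd : dB ∘ₗ k - k ∘ₗ K.d = K.cv F k - K.cv (k ∘ₗ K.sgn) G) (Q : C →ₗ[R] B) :
    K.twD GB dB F Q ∘ₗ K.ulft k = K.ulft k ∘ₗ K.twD GB dB G Q := by
  have h1 := K.tensorD_ulft hB hk
  have h2 : K.lft F ∘ₗ K.ulft k = LinearMap.rTensor B K.sgn ∘ₗ K.ulft (K.cv F k) := by
    rw [PreCoalg.lft_eq_ulft, LinearMap.comp_assoc, K.ulft_comp_ulft]
  have h3 : K.ulft k ∘ₗ K.lft G =
      LinearMap.rTensor B K.sgn ∘ₗ K.ulft (K.cv (k ∘ₗ K.sgn) G) := by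
    rw [PreCoalg.lft_eq_ulft, ← LinearMap.comp_assoc, PreCoalg.ulft_comp_sgn K.laws,
      LinearMap.comp_assoc, K.ulft_comp_ulft]
  rw [hd, PreCoalg.lft_eq_ulft, PreCoalg.ulft_sub, LinearMap.comp_sub, ← h2, ← h3] at h1
  rw [PreCoalg.twD, PreCoalg.twD, LinearMap.add_comp, LinearMap.sub_comp, LinearMap.comp_add,
    LinearMap.comp_sub, K.rgt_comp_ulft hk']
  linear_combination (norm := module) h1

end ChainCoalg

end

end CoHoch

namespace CoHoch

noncomputable section

/-! ### Derivation homotopies as gauge transformations of twisting maps. -/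

open Grading PreCoalg

theorem PreCoalg.Laws.rgt_cvOne {R C B : Type*} [CommRing R] [AddCommGroup C] [Module R C] [Ring B]
    [Algebra R B] {K : PreCoalg R C} {GB : Grading R B} (hK : K.Laws)
    (h1 : ∀ r : R, algebraMap R B r ∈ GB.par 0) :
    K.rgt GB (K.cvOne : C →ₗ[R] B) = LinearMap.id := by
  refine tensor_ext K.toGrading GB fun n m x hx w hw => ?_
  obtain ⟨k, a, b, p, q, ha, hb, hn, hx', hl, -⟩ := hK.sweedler hx
  have hone : ∀ i, ∀ x ∈ K.par i, (K.cvOne : C →ₗ[R] B) x ∈ GB.par (i + 0) := fun i x hx => by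
    rcases zmod_two_cases i with rfl | rfl
    · exact h1 _
    · rw [cvOne, LinearMap.comp_apply, K.counit_of_odd hx, map_zero]; exact zero_mem _
  rw [rgt_tmul ha hb hx' hone hw, LinearMap.id_apply]
  conv_rhs => rw [← hl, TensorProduct.sum_tmul]
  refine Finset.sum_congr rfl fun t _ => ?_
  rw [cvOne, LinearMap.comp_apply, Algebra.linearMap_apply, ← Algebra.commutes, ← Algebra.smul_def,
    TensorProduct.tmul_smul, smul_smul, add_zero, K.sg_mul_counit' (ha t),
    TensorProduct.smul_tmul']

namespace IsDerivationHomotopy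

variable {R C D : Type*} [CommRing R] [AddCommGroup C] [Module R C] [AddCommGroup D] [Module R D]
  {K : ChainCoalg R C} {L : PreCoalg R D} {f g : K.Cobar →ₐ[R] L.Cobar}
  {H : K.Cobar →ₗ[R] L.Cobar}

theorem map_mul_par (hH : IsDerivationHomotopy K.toPreCoalg L f g H) {i : ZMod 2} {a : K.Cobar}
    (ha : a ∈ K.cobarGrading.par i) (b : K.Cobar) :
    H (a * b) = H a * f b + sg R i • (g a * H b) := by
  induction ha using par_induction with
  | mem n h a ha => rw [hH.map_mul n a ha, ← h, sg_natCast]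
  | zero => simp
  | add x y _ _ hx hy =>
    simp only [add_mul, map_add, hx, hy, smul_add]
    abel

theorem deg (hH : IsDerivationHomotopy K.toPreCoalg L f g H) :
    Deg K.cobarGrading L.cobarGrading 1 H := by
  simpa using hasDegree_iff.mp hH.degree

theorem comp_sInv_deg (hH : IsDerivationHomotopy K.toPreCoalg L f g H) :
    Deg K.toGrading L.cobarGrading 0 (H ∘ₗ K.sInv) :=
  hH.deg.comp K.sInv_deg (by norm_num)

/-- Degree 0 is spanned by 1 and s⁻¹1 = 0. This is the condition under which 1 + Hs⁻¹ has a
convolution inverse. -/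
theorem comp_sInv_zero : ∀ x ∈ K.gr 0, (H ∘ₗ K.sInv) x = 0 := fun x hx => by
  rw [K.gr_zero] at hx
  obtain ⟨r, rfl⟩ := Submodule.mem_span_singleton.mp hx
  rw [LinearMap.comp_apply, map_smul, sInv_one, smul_zero, map_zero]

/-- The homotopy identity evaluated at s⁻¹x, with H of the quadratic part of ds⁻¹x expanded by the
derivation rule. -/
theorem d_comp_sInv (hH : IsDerivationHomotopy K.toPreCoalg L f g H) :
    L.cobarD ∘ₗ H ∘ₗ K.sInv = (H ∘ₗ K.sInv) ∘ₗ K.d +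
      (g.toLinearMap ∘ₗ K.sInv - f.toLinearMap ∘ₗ K.sInv) -
      K.cv ((H ∘ₗ K.sInv) ∘ₗ K.sgn) (f.toLinearMap ∘ₗ K.sInv) +
      K.cv (g.toLinearMap ∘ₗ K.sInv) (H ∘ₗ K.sInv) := by
  refine LinearMap.ext fun x => ?_
  induction x using K.toGrading.parity_induction with
  | ha x y hx hy => rw [map_add, map_add, hx, hy]
  | hg n x hx =>
  obtain ⟨k, a, b, p, q, ha, hb, hn, hx', -, -⟩ := K.laws.sweedler hx
  have h1 := LinearMap.congr_fun hH.comm (K.sInv x)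
  simp only [LinearMap.add_apply, LinearMap.comp_apply, LinearMap.sub_apply,
    K.laws.cobarD_sInv, cobarGen_apply ha hx', map_add, map_neg, map_sum, map_smul,
    hH.map_mul_par (K.sInv_mem_par (ha _)), smul_add, Finset.sum_add_distrib,
    AlgHom.toLinearMap_apply] at h1
  simp only [LinearMap.add_apply, LinearMap.comp_apply, LinearMap.sub_apply, cv_apply hx',
    sgn_par (ha _), map_smul, smul_mul_assoc, AlgHom.toLinearMap_apply]
  have h2 : ∑ t, sg R (p t) • sg R (p t + 1) • (g (K.sInv (a t)) * H (K.sInv (b t))) =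
      -∑ t, g (K.sInv (a t)) * H (K.sInv (b t)) := by
    rw [← Finset.sum_neg_distrib]
    refine Finset.sum_congr rfl fun t _ => ?_
    rw [sg_add, sg_one, smul_smul, ← mul_assoc, sg_sq, one_mul, neg_one_smul]
  rw [h2] at h1
  linear_combination (norm := module) h1

/-- The relation between the maps `f s⁻¹`, `g s⁻¹` and `1 + H s⁻¹`. -/
theorem twist (hH : IsDerivationHomotopy K.toPreCoalg L f g H) :
    L.cobarD ∘ₗ (K.cvOne + H ∘ₗ K.sInv) - (K.cvOne + H ∘ₗ K.sInv) ∘ₗ K.d =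
      K.cv (g.toLinearMap ∘ₗ K.sInv) (K.cvOne + H ∘ₗ K.sInv) -
      K.cv ((K.cvOne + H ∘ₗ K.sInv) ∘ₗ K.sgn) (f.toLinearMap ∘ₗ K.sInv) := by
  have e1 : L.cobarD ∘ₗ (K.cvOne : C →ₗ[R] L.Cobar) = 0 :=
    LinearMap.ext fun x => by simp [cvOne, Algebra.algebraMap_eq_smul_one, cobarD_one]
  have e2 : (K.cvOne : C →ₗ[R] L.Cobar) ∘ₗ K.d = 0 :=
    LinearMap.ext fun x => by simp [cvOne, K.laws.counit_d]
  have e3 : (K.cvOne : C →ₗ[R] L.Cobar) ∘ₗ K.sgn = K.cvOne := by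
    rw [← sgnPow_one, cvOne_comp_sgnPow]
  rw [LinearMap.comp_add, LinearMap.add_comp, LinearMap.add_comp, e1, e2, e3, hH.d_comp_sInv,
    cv_add_left, cv_add_right, K.laws.cvOne_cv, K.laws.cv_cvOne]
  abel

/-- `1 ⊗ H` is a homotopy with respect to the twisted differentials. -/
theorem twD_map (hH : IsDerivationHomotopy K.toPreCoalg L f g H)
    (hf : Deg K.cobarGrading L.cobarGrading 0 f.toLinearMap)
    (hg : Deg K.cobarGrading L.cobarGrading 0 g.toLinearMap) :
    K.twD L.cobarGrading L.cobarD (g.toLinearMap ∘ₗ K.sInv) (f.toLinearMap ∘ₗ K.sInv) ∘ₗ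
        TensorProduct.map K.sgn H + TensorProduct.map K.sgn H ∘ₗ K.hhD =
      K.rgt L.cobarGrading (K.cvOne + H ∘ₗ K.sInv) ∘ₗ LinearMap.lTensor C g.toLinearMap -
      K.ulft (K.cvOne + H ∘ₗ K.sInv) ∘ₗ LinearMap.lTensor C f.toLinearMap := by
  rw [rgt_add, ulft_add, K.laws.rgt_cvOne fun r => algebraMap_mem_par r, K.laws.ulft_cvOne]
  refine tensor_ext K.toGrading K.cobarGrading fun n m x hx w hw => ?_
  obtain ⟨k, a, b, p, q, ha, hb, hn, hx', -, -⟩ := K.laws.sweedler hx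
  have hgw : g w ∈ L.cobarGrading.par m := hg.par_zero hw
  have hHw : H w ∈ L.cobarGrading.par (m + 1) := hH.deg.par_one hw
  have hF : ∀ i, ∀ x ∈ K.par i, (f.toLinearMap ∘ₗ K.sInv) x ∈ L.cobarGrading.par (i + 1) :=
    fun i x hx => hf.par_zero (K.sInv_mem_par hx)
  have hh : ∀ i, ∀ x ∈ K.par i, (H ∘ₗ K.sInv) x ∈ L.cobarGrading.par (i + 0) :=
    fun i x hx => hH.comp_sInv_deg.par_zero (by rwa [add_zero])
  have hcomm := LinearMap.congr_fun hH.comm w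
  simp only [LinearMap.add_apply, LinearMap.comp_apply, LinearMap.sub_apply,
    AlgHom.toLinearMap_apply] at hcomm
  rw [LinearMap.add_apply, LinearMap.comp_apply, LinearMap.comp_apply, TensorProduct.map_tmul,
    sgn_par hx, ← TensorProduct.smul_tmul', map_smul, twD_tmul hx ha hb hx' _ _ hF hHw, hhD_eq_twD,
    twD_tmul hx ha hb hx' _ _ (fun _ _ => K.sInv_mem_par) hw, LinearMap.sub_apply,
    LinearMap.comp_apply, LinearMap.comp_apply, LinearMap.add_apply, LinearMap.add_apply,
    LinearMap.lTensor_tmul, LinearMap.lTensor_tmul, AlgHom.toLinearMap_apply,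
    AlgHom.toLinearMap_apply, rgt_tmul ha hb hx' hh hgw, ulft_tmul hx', LinearMap.id_apply,
    LinearMap.id_apply]
  simp only [map_add, map_sub, map_sum, map_smul, TensorProduct.map_tmul, sgn_par hx,
    sgn_par (ha _), sgn_par (hb _), sgn_par (K.laws.d_deg.par_neg_one hx),
    hH.map_mul_par (K.sInv_mem_par (hb _)), hH.map_mul_par hw, LinearMap.comp_apply,
    AlgHom.toLinearMap_apply]
  -- The derivation rule leaves g on the left and f on the right of H(w). These products cancel
  -- against the left twist by gs⁻¹ and the right twist by fs⁻¹; what is left are the two actions of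
  -- Hs⁻¹.
  have key := Finset.sum_congr (rfl : (Finset.univ : Finset (Fin k)) = _) fun t _ =>
    show -(sg R n • sg R (p t) • (a t ⊗ₜ[R] (g (K.sInv (b t)) * H w))) +
        sg R n • sg R ((p t + 1) * (q t + (m + 1))) • (b t ⊗ₜ[R] (H w * f (K.sInv (a t)))) -
        sg R (p t) • ((sg R (p t) • a t) ⊗ₜ[R] (H (K.sInv (b t)) * f w +
          sg R (q t + 1) • (g (K.sInv (b t)) * H w))) +
        sg R ((p t + 1) * (q t + m)) • ((sg R (q t) • b t) ⊗ₜ[R] (H w * f (K.sInv (a t)) +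
          sg R m • (g w * H (K.sInv (a t))))) =
      sg R ((p t + 0) * (q t + m)) • (b t ⊗ₜ[R] (g w * H (K.sInv (a t)))) -
        a t ⊗ₜ[R] (H (K.sInv (b t)) * f w) by
      rw [hn t]
      simp only [TensorProduct.tmul_add, TensorProduct.tmul_smul, ← TensorProduct.smul_tmul',
        smul_add, add_zero]
      match_scalars <;> simp only [sg_add, sg_mul_add, sg_add_mul, sg_mul_one, sg_one_mul, sg_one,
        sg_zero, sg_zero_mul, sg_sq, sg_sq_left, mul_comm, mul_left_comm, mul_assoc, mul_neg,
        neg_mul, mul_one, one_mul, neg_neg] <;> ring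
  have h2 := congrArg (fun y => x ⊗ₜ[R] y) hcomm
  simp only [TensorProduct.tmul_add, TensorProduct.tmul_sub] at h2
  simp only [Finset.sum_add_distrib, Finset.sum_sub_distrib, Finset.sum_neg_distrib,
    ← Finset.smul_sum, smul_add, smul_sub, ← TensorProduct.smul_tmul', TensorProduct.tmul_smul,
    sg_smul_sg_smul, sg_add n, sg_one] at key ⊢
  linear_combination (norm := module) key + h2

end IsDerivationHomotopy

end

end CoHoch

namespace CoHoch

noncomputable section

/-! ### The homotopy between the maps induced on Ĥ. -/

open Grading PreCoalg

theorem ChainCoalg.cvInv_deg {R C B : Type*} [CommRing R] [AddCommGroup C] [Module R C] [Ring B]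
    [Algebra R B] (K : ChainCoalg R C) {GB : Grading R B}
    (hm : Deg (GB.tensor GB) GB 0 (LinearMap.mul' R B)) (h1 : ∀ r : R, algebraMap R B r ∈ GB.zgr 0)
    {h : C →ₗ[R] B} (hh : Deg K.toGrading GB 0 h) : Deg K.toGrading GB 0 (K.cvInv h) := by
  have hone : Deg K.toGrading GB 0 (K.cvOne : C →ₗ[R] B) := by
    rintro (_ | n) x hx
    · exact h1 _
    · rw [cvOne, LinearMap.comp_apply, K.counit_pos n x hx, map_zero]
      exact zero_mem _
  have hseq : ∀ n, Deg K.toGrading GB 0 (K.cvInvSeq h n) := fun n => by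
    induction n with
    | zero => exact Deg.zero
    | succ n ih =>
      exact hone.sub (hm.comp (k := 0) (Deg.comp (k := 0) (l := 0) (hh.map ih (by norm_num))
        K.laws.comul_deg (by norm_num)) (by norm_num))
  intro n x hx
  rw [ChainCoalg.cvInv, elim_apply _ _ hx]
  exact hseq (n + 1) n x hx

/-- A chain algebra map commutes with the twisted differentials. -/
theorem PreCoalg.Laws.lTensor_hhD {R C D : Type*} [CommRing R] [AddCommGroup C] [Module R C]
    [AddCommGroup D] [Module R D] {K : PreCoalg R C} {L : PreCoalg R D} (hK : K.Laws)
    {g : K.Cobar →ₐ[R] L.Cobar}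
    (hg : IsChainMap K.cobarGrading K.cobarD L.cobarGrading L.cobarD g.toLinearMap) :
    LinearMap.lTensor C g.toLinearMap ∘ₗ K.hhD =
      K.twD L.cobarGrading L.cobarD (g.toLinearMap ∘ₗ K.sInv) (g.toLinearMap ∘ₗ K.sInv) ∘ₗ
        LinearMap.lTensor C g.toLinearMap := by
  have hgd := hasDegree_iff.mp hg.degree
  refine tensor_ext K.toGrading K.cobarGrading fun n m x hx w hw => ?_
  obtain ⟨k, a, b, p, q, ha, hb, hn, hx', -, -⟩ := hK.sweedler hx
  have hgw : g w ∈ L.cobarGrading.par m := Deg.par_zero hgd hw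
  have hG : ∀ i, ∀ x ∈ K.par i, (g.toLinearMap ∘ₗ K.sInv) x ∈ L.cobarGrading.par (i + 1) :=
    fun i x hx => Deg.par_zero hgd (K.sInv_mem_par hx)
  have hc := LinearMap.congr_fun hg.comm w
  simp only [LinearMap.comp_apply, AlgHom.toLinearMap_apply] at hc
  rw [LinearMap.comp_apply, LinearMap.comp_apply, hhD_eq_twD,
    twD_tmul hx ha hb hx' _ _ (fun _ _ => K.sInv_mem_par) hw, LinearMap.lTensor_tmul,
    AlgHom.toLinearMap_apply, twD_tmul hx ha hb hx' _ _ hG hgw]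
  simp only [map_add, map_sub, map_sum, map_smul, LinearMap.lTensor_tmul, LinearMap.comp_apply,
    AlgHom.toLinearMap_apply, map_mul, hc]

namespace IsDerivationHomotopy

variable {R C D : Type*} [CommRing R] [AddCommGroup C] [Module R C] [AddCommGroup D] [Module R D]
  {K : ChainCoalg R C} {L : PreCoalg R D} {f g : K.Cobar →ₐ[R] L.Cobar}
  {H : K.Cobar →ₗ[R] L.Cobar}

/-- The map `x ⊗ b ↦ -rotate (H(s⁻¹x) ⊗ b)`. -/
def rotateHom (L : PreCoalg R D) (h : C →ₗ[R] L.Cobar) : C ⊗[R] L.Cobar →ₗ[R] L.CoHH :=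
  -(L.rotate ∘ₗ LinearMap.rTensor L.Cobar h)

theorem rotateHom_tmul (h : C →ₗ[R] L.Cobar) (x : C) (w : L.Cobar) :
    rotateHom L h (x ⊗ₜ w) = -L.rotate (h x ⊗ₜ w) := rfl

/-- Differentiating the rotation of h = Hs⁻¹ brings in dh, hence G - F, h ⋆ F and G ⋆ h. The cyclic
Leibniz rule splits the rotated products: two of the pieces are cancelled by the twists of the
source, left by F and right by G, and the others form the two actions of 1 + h followed by `gam`. -/
theorem hhD_rotateHom (hL : L.Laws) (hH : IsDerivationHomotopy K.toPreCoalg L f g H)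
    (hf : Deg K.cobarGrading L.cobarGrading 0 f.toLinearMap)
    (hg : Deg K.cobarGrading L.cobarGrading 0 g.toLinearMap) :
    L.hhD ∘ₗ rotateHom L (H ∘ₗ K.sInv) + rotateHom L (H ∘ₗ K.sInv) ∘ₗ
        K.twD L.cobarGrading L.cobarD (f.toLinearMap ∘ₗ K.sInv) (g.toLinearMap ∘ₗ K.sInv) =
      K.gam L (g.toLinearMap ∘ₗ K.sInv) ∘ₗ K.ulft (K.cvOne + H ∘ₗ K.sInv) -
      K.gam L (f.toLinearMap ∘ₗ K.sInv) ∘ₗ K.rgt L.cobarGrading (K.cvOne + H ∘ₗ K.sInv) := by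
  have hF : ∀ i, ∀ x ∈ K.par i, (f.toLinearMap ∘ₗ K.sInv) x ∈ L.cobarGrading.par (i + 1) :=
    fun i x hx => hf.par_zero (K.sInv_mem_par hx)
  have hG : ∀ i, ∀ x ∈ K.par i, (g.toLinearMap ∘ₗ K.sInv) x ∈ L.cobarGrading.par (i + 1) :=
    fun i x hx => hg.par_zero (K.sInv_mem_par hx)
  have hh : ∀ i, ∀ x ∈ K.par i, (H ∘ₗ K.sInv) x ∈ L.cobarGrading.par i :=
    fun i x hx => hH.comp_sInv_deg.par_zero hx
  have hd := hH.d_comp_sInv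
  rw [rgt_add, ulft_add, K.laws.rgt_cvOne fun r => algebraMap_mem_par r, K.laws.ulft_cvOne]
  generalize H ∘ₗ K.sInv = h at *
  generalize f.toLinearMap ∘ₗ K.sInv = F at *
  generalize g.toLinearMap ∘ₗ K.sInv = G at *
  refine tensor_ext K.toGrading L.cobarGrading fun n m x hx w hw => ?_
  obtain ⟨k, a, b, p, q, ha, hb, hn, hx', hl, hr⟩ := K.laws.sweedler hx
  have hdx : L.cobarD (h x) = h (K.d x) + (G x - F x) - ∑ t, sg R (p t) • (h (a t) * F (b t)) +
      ∑ t, G (a t) * h (b t) := by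
    have := LinearMap.congr_fun hd x
    simpa [cv_apply hx', sgn_par (ha _)] using this
  have e1 : L.hhIncl (h x * w) = ∑ t, K.counit (a t) • L.hhIncl (h (b t) * w) := by
    conv_lhs => rw [← hl]
    simp [Finset.sum_mul]
  have e2 : L.hhIncl (w * h x) = ∑ t, K.counit (b t) • L.hhIncl (w * h (a t)) := by
    conv_lhs => rw [← hr]
    simp [Finset.mul_sum]
  have hh' : ∀ i, ∀ x ∈ K.par i, h x ∈ L.cobarGrading.par (i + 0) :=
    fun i x hx => by rw [add_zero]; exact hh i x hx
  rw [LinearMap.add_apply, LinearMap.comp_apply, LinearMap.comp_apply, rotateHom_tmul, map_neg,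
    hL.hhD_rotate (hh _ _ hx) hw, hdx, e1, e2, twD_tmul hx ha hb hx' _ _ hG hw,
    LinearMap.sub_apply, LinearMap.comp_apply, LinearMap.comp_apply, LinearMap.add_apply,
    LinearMap.add_apply, LinearMap.id_apply, rgt_tmul ha hb hx' hh' hw, ulft_tmul hx']
  simp only [map_add, map_sub, map_sum, map_smul, gam_tmul, rotateHom_tmul,
    TensorProduct.add_tmul, TensorProduct.sub_tmul, TensorProduct.sum_tmul,
    ← TensorProduct.smul_tmul', rotate_mul (hh _ _ (ha _)) (hF _ _ (hb _)) hw,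
    rotate_mul (hG _ _ (ha _)) (hh _ _ (hb _)) hw]
  have key := Finset.sum_congr (rfl : (Finset.univ : Finset (Fin k)) = _) fun t _ =>
    show -(sg R (p t) • (L.rotate (h (a t) ⊗ₜ (F (b t) * w)) +
          sg R (p t * (q t + 1 + m)) • L.rotate (F (b t) ⊗ₜ (w * h (a t))))) +
        (L.rotate (G (a t) ⊗ₜ (h (b t) * w)) +
          sg R ((p t + 1) * (q t + m)) • L.rotate (h (b t) ⊗ₜ (w * G (a t)))) +
        K.counit (a t) • L.hhIncl (h (b t) * w) -
        sg R (n * m) • K.counit (b t) • L.hhIncl (w * h (a t)) +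
        sg R (p t) • L.rotate (h (a t) ⊗ₜ (F (b t) * w)) -
        sg R ((p t + 1) * (q t + m)) • L.rotate (h (b t) ⊗ₜ (w * G (a t))) =
      (K.counit (a t) • L.hhIncl (h (b t) * w) + L.rotate (G (a t) ⊗ₜ (h (b t) * w))) -
      sg R ((p t + 0) * (q t + m)) • (K.counit (b t) • L.hhIncl (w * h (a t)) +
        L.rotate (F (b t) ⊗ₜ (w * h (a t)))) by
      have h2 := K.counit_of_odd (x := b t)
      have hb := hb t
      rw [hn t]
      rcases zmod_two_cases (q t) with h3 | h3 <;> rw [h3] at hb ⊢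
      all_goals try rw [h2 hb]
      all_goals
        simp only [add_zero, zero_add, zero_smul, smul_zero]
        match_scalars <;> simp only [sg_add, sg_mul_add, sg_add_mul, sg_mul_one, sg_one_mul, sg_one,
          sg_zero, sg_zero_mul, sg_sq, sg_sq_left, mul_comm, mul_left_comm, mul_assoc, mul_neg,
          neg_mul, mul_one, one_mul, neg_neg] <;> ring
  simp only [Finset.sum_add_distrib, Finset.sum_sub_distrib, Finset.sum_neg_distrib,
    Finset.smul_sum, smul_add, smul_sub, smul_neg] at key ⊢
  linear_combination (norm := module) key

/-- The homotopy between the maps induced on `Ĥ` by homotopic maps of cobar constructions. -/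
theorem exists_hhHat (hL : L.Laws) (hH : IsDerivationHomotopy K.toPreCoalg L f g H)
    (hf : IsChainMap K.cobarGrading K.cobarD L.cobarGrading L.cobarD f.toLinearMap)
    (hg : IsChainMap K.cobarGrading K.cobarD L.cobarGrading L.cobarD g.toLinearMap) :
    ∃ X, Deg K.hhGrading L.hhGrading 1 X ∧
      L.hhD ∘ₗ X + X ∘ₗ K.hhD = K.hhHat L g - K.hhHat L f := by
  have hfd := hasDegree_iff.mp hf.degree
  have hgd := hasDegree_iff.mp hg.degree
  have hA := hH.twD_map hfd hgd
  have hB := hH.hhD_rotateHom hL hfd hgd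
  have hz := comp_sInv_zero (K := K) (L := L) (H := H)
  have hr := K.cv_cvInv hz
  have hl := K.cvInv_cv hz
  have hkd := K.cvInv_deg (GB := L.cobarGrading) mul'_deg
    (fun r => by rw [Algebra.algebraMap_eq_smul_one]; exact Submodule.smul_mem _ _ one_mem_zgr)
    hH.comp_sInv_deg
  have hud := ulft_deg K.laws mul'_deg hkd
  have hup : ∀ j, ∀ z ∈ (K.toGrading.tensor L.cobarGrading).par j,
      K.ulft (K.cvInv (H ∘ₗ K.sInv)) z ∈ (K.toGrading.tensor L.cobarGrading).par j :=
    fun j z hz => hud.par_zero hz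
  have hφ : ∀ i, ∀ x ∈ K.par i,
      (K.cvOne + H ∘ₗ K.sInv : C →ₗ[R] L.Cobar) x ∈ L.cobarGrading.par i := fun i x hx => by
    refine add_mem ?_ (hH.comp_sInv_deg.par_zero hx)
    rcases zmod_two_cases i with rfl | rfl
    · exact algebraMap_mem_par _
    · rw [cvOne, LinearMap.comp_apply, K.counit_of_odd hx, map_zero]; exact zero_mem _
  have hkt := K.cvInv_twist cobarD_one L.cobarD_mul hφ hr hl hH.twist
  have hC := K.twD_comp_ulft (GB := L.cobarGrading) L.cobarD_mul (fun i x hx => hkd.par_zero hx)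
    hup hkt
  have hR := K.rgt_comp_ulft hup (K.cvOne + H ∘ₗ K.sInv)
  have hΓ := gam_hhD K.laws hL (K.laws.isTwisting_sInv.comp_algHom hf)
  have hg' := K.laws.lTensor_hhD hg
  have hkφ := K.ulft_comp_ulft (K.cvInv (H ∘ₗ K.sInv)) (K.cvOne + H ∘ₗ K.sInv)
  have hφk := K.ulft_comp_ulft (K.cvOne + H ∘ₗ K.sInv) (K.cvInv (H ∘ₗ K.sInv))
  rw [hl, K.laws.ulft_cvOne] at hkφ
  rw [hr, K.laws.ulft_cvOne] at hφk
  have hFd : Deg K.toGrading L.cobarGrading (-1) (f.toLinearMap ∘ₗ K.sInv) :=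
    Deg.comp (k := -1) (l := 0) hfd K.sInv_deg (by norm_num)
  -- Let U, V denote left multiplication by φ⁻¹ and φ, W right multiplication by φ, and Γ the maps
  -- `gam`. U changes the left twist from G to F, so both summands compose. The boundary of the
  -- first is (Γ_G V - Γ_F W)U(1 ⊗ g), that of the second is Γ_F U(W(1 ⊗ g) - V(1 ⊗ f)). As UV = VU
  -- = 1 and U commutes with W, the sum is Γ_G(1 ⊗ g) - Γ_F(1 ⊗ f).
  refine ⟨rotateHom L (H ∘ₗ K.sInv) ∘ₗ K.ulft (K.cvInv (H ∘ₗ K.sInv)) ∘ₗ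
    LinearMap.lTensor C g.toLinearMap + K.gam L (f.toLinearMap ∘ₗ K.sInv) ∘ₗ
    K.ulft (K.cvInv (H ∘ₗ K.sInv)) ∘ₗ TensorProduct.map K.sgn H, ?_, ?_⟩
  · refine Deg.add (Deg.comp (k := 0) (l := 1) (Deg.neg (Deg.comp (k := 0) (l := 1) rotate_deg
      hH.comp_sInv_deg.rTensor (by norm_num))) (hud.comp (k := 0) (Deg.lTensor hgd) (by norm_num))
      (by norm_num)) ?_
    exact (gam_deg hFd).comp (k := 1) (hud.comp (k := 1) (Deg.sgn.map hH.deg (by norm_num))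
      (by norm_num)) (by norm_num)
  rw [hhHat_eq, hhHat_eq]
  have hC1 := hC (g.toLinearMap ∘ₗ K.sInv)
  have hC2 := hC (f.toLinearMap ∘ₗ K.sInv)
  clear hC hkt hφ hup hud hkd hr hl hz hfd hgd hFd
  generalize K.ulft (K.cvInv (H ∘ₗ K.sInv)) = U at *
  generalize K.ulft (K.cvOne + H ∘ₗ K.sInv) = V at *
  generalize rotateHom L (H ∘ₗ K.sInv) = Θ at *
  generalize K.rgt L.cobarGrading (K.cvOne + H ∘ₗ K.sInv) = W at *
  generalize LinearMap.lTensor C g.toLinearMap = gs at *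
  generalize LinearMap.lTensor C f.toLinearMap = fs at *
  generalize TensorProduct.map K.sgn H = Hs at *
  generalize f.toLinearMap ∘ₗ K.sInv = F at *
  generalize g.toLinearMap ∘ₗ K.sInv = G at *
  refine LinearMap.ext fun z => ?_
  have e1 := LinearMap.congr_fun hB (U (gs z))
  have e2 := congrArg (fun y => K.gam L F (U y)) (LinearMap.congr_fun hA z)
  have e3 := LinearMap.congr_fun hC1 (gs z)
  have e4 := LinearMap.congr_fun hC2 (Hs z)
  have e5 := LinearMap.congr_fun hg' z
  have e6 := LinearMap.congr_fun hkφ (fs z)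
  have e7 := LinearMap.congr_fun hφk (gs z)
  have e8 := LinearMap.congr_fun hR (gs z)
  have e9 := LinearMap.congr_fun hΓ (U (Hs z))
  simp only [LinearMap.add_apply, LinearMap.sub_apply, LinearMap.comp_apply, LinearMap.id_apply,
    map_add, map_sub] at e1 e2 e3 e4 e5 e6 e7 e8 e9 ⊢
  rw [e3, ← e5, e7, e8] at e1
  rw [e6, ← e4, ← e9] at e2
  linear_combination (norm := module) e1 + e2

end IsDerivationHomotopy

end

end CoHoch

namespace CoHoch

noncomputable section

/-! ### Tensor products of chain coalgebras, and the homotopy for quasistrict structures. -/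

open Grading PreCoalg

section TensorD

variable {R M N P : Type*} [CommRing R] [AddCommGroup M] [Module R M] [AddCommGroup N]
  [Module R N] [AddCommGroup P] [Module R P]

theorem tensorD_comp_tensorD {G : Grading R M} {H : Grading R N} {dM : M →ₗ[R] M} {dN : N →ₗ[R] N}
    (hM : dM ∘ₗ dM = 0) (hN : dN ∘ₗ dN = 0) (hdM : Deg G G (-1) dM) :
    tensorD G dM dN ∘ₗ tensorD G dM dN = 0 := by
  refine tensor_ext G H fun i j x hx y hy => ?_
  have h1 := LinearMap.congr_fun hM x
  have h2 := LinearMap.congr_fun hN y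
  simp only [LinearMap.comp_apply, LinearMap.zero_apply] at h1 h2
  rw [LinearMap.comp_apply, tensorD_tmul_par _ _ hx, map_add, map_smul, tensorD_tmul_par _ _ hx,
    tensorD_tmul_par _ _ (hdM.par_neg_one hx), h1, h2, sg_add, sg_one]
  simp

theorem lTensor_tensorD {G : Grading R M} {dM : M →ₗ[R] M} {dN : N →ₗ[R] N} {dP : P →ₗ[R] P}
    {f : N →ₗ[R] P} (hf : f ∘ₗ dN = dP ∘ₗ f) :
    LinearMap.lTensor M f ∘ₗ tensorD G dM dN = tensorD G dM dP ∘ₗ LinearMap.lTensor M f := by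
  refine TensorProduct.ext' fun x y => ?_
  have := LinearMap.congr_fun hf y
  simp only [LinearMap.comp_apply] at this
  simp [tensorD, this]

end TensorD

namespace ChainCoalg

variable {R C D : Type*} [CommRing R] [AddCommGroup C] [Module R C] [AddCommGroup D] [Module R D]

theorem tensor_comul_d (K : ChainCoalg R C) (L : ChainCoalg R D) :
    (K.tensor L.toPreCoalg).comul ∘ₗ (K.tensor L.toPreCoalg).d =
      tensorD (K.tensor L.toPreCoalg).toGrading (K.tensor L.toPreCoalg).d
        (K.tensor L.toPreCoalg).d ∘ₗ (K.tensor L.toPreCoalg).comul := by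
  refine tensor_ext K.toGrading L.toGrading fun n m x hx y hy => ?_
  obtain ⟨k, a, b, p, q, ha, hb, hn, hx', -, -⟩ := K.laws.sweedler hx
  obtain ⟨k', a', b', p', q', ha', hb', hn', hy', -, -⟩ := L.laws.sweedler hy
  have hdx : K.comul (K.d x) = ∑ t, (K.d (a t) ⊗ₜ b t + sg R (p t) • (a t ⊗ₜ[R] K.d (b t))) := by
    have := LinearMap.congr_fun K.comul_d x
    simp only [LinearMap.comp_apply] at this
    rw [this, hx', map_sum]
    exact Finset.sum_congr rfl fun t _ => tensorD_tmul_par _ _ (ha t) _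
  have hdy : L.comul (L.d y) =
      ∑ t, (L.d (a' t) ⊗ₜ b' t + sg R (p' t) • (a' t ⊗ₜ[R] L.d (b' t))) := by
    have := LinearMap.congr_fun L.comul_d y
    simp only [LinearMap.comp_apply] at this
    rw [this, hy', map_sum]
    exact Finset.sum_congr rfl fun t _ => tensorD_tmul_par _ _ (ha' t) _
  have hcomul : ∀ u v, (K.tensor L.toPreCoalg).comul (u ⊗ₜ v) =
      Grading.interchange K.toGrading L.toGrading (K.comul u ⊗ₜ L.comul v) := fun _ _ => rfl
  have hdC := K.laws.d_deg
  have hdD := L.laws.d_deg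
  rw [LinearMap.comp_apply, LinearMap.comp_apply, tensor_d_tmul hx, map_add, map_smul, hcomul,
    hcomul, hcomul, hdx, hdy, hx', hy']
  simp only [TensorProduct.sum_tmul, TensorProduct.tmul_sum, map_sum, Finset.smul_sum,
    ← Finset.sum_add_distrib]
  refine Finset.sum_congr rfl fun t _ => Finset.sum_congr rfl fun s _ => ?_
  have e : tensorD (K.tensor L.toPreCoalg).toGrading (K.tensor L.toPreCoalg).d
      (K.tensor L.toPreCoalg).d ((a s ⊗ₜ a' t) ⊗ₜ (b s ⊗ₜ b' t)) = _ :=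
    tensorD_tmul_par _ _ (tmul_mem_par (ha s) (ha' t)) _
  simp only [TensorProduct.add_tmul, TensorProduct.tmul_add, ← TensorProduct.smul_tmul',
    TensorProduct.tmul_smul, map_add, map_smul, interchange_par _ _ (hb s) (ha' t),
    interchange_par _ _ (hdC.par_neg_one (hb s)) (ha' t),
    interchange_par _ _ (hb s) (hdD.par_neg_one (ha' t)), e, tensor_d_tmul (ha s),
    tensor_d_tmul (hb s), hn s]
  match_scalars <;> simp only [sg_add, sg_mul_add, sg_add_mul, sg_mul_one, sg_one_mul, sg_one,
    sg_zero, sg_sq, sg_sq_left, mul_comm, mul_left_comm, mul_assoc, mul_neg, neg_mul, mul_one,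
    one_mul, neg_neg]

theorem _root_.CoHoch.interchange_assoc_apply {A B G M N P : Type*} [AddCommGroup A] [Module R A]
    [AddCommGroup B] [Module R B] [AddCommGroup G] [Module R G] [AddCommGroup M] [Module R M]
    [AddCommGroup N] [Module R N] [AddCommGroup P] [Module R P] (GA : Grading R A)
    (GB : Grading R B) (HN : Grading R N) (HP : Grading R P) (v : (M ⊗[R] N) ⊗[R] P)
    (u : (A ⊗[R] B) ⊗[R] G) :
    TensorProduct.assoc R (M ⊗[R] A) (N ⊗[R] B) (P ⊗[R] G)
      (LinearMap.rTensor (P ⊗[R] G) (Grading.interchange HN GA)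
        (Grading.interchange HP (GA.tensor GB) (v ⊗ₜ u))) =
    LinearMap.lTensor (M ⊗[R] A) (Grading.interchange HP GB)
      (Grading.interchange (HN.tensor HP) GA
        (TensorProduct.assoc R M N P v ⊗ₜ TensorProduct.assoc R A B G u)) := by
  induction v using TensorProduct.induction_on with
  | zero => simp
  | add v v' h h' => simp only [TensorProduct.add_tmul, map_add, h, h']
  | tmul w z =>
    induction w using TensorProduct.induction_on with
    | zero => simp
    | add v v' h h' => simp only [TensorProduct.add_tmul, map_add, h, h']
    | tmul x y => exact interchange_assoc GA GB HN HP x y z u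

/-- Naturality pulls the inner comultiplications through the interchange, coassociativity applies in
each factor, and coherence of the interchange identifies the resulting shuffles. -/
theorem tensor_coassoc (K : ChainCoalg R C) (L : ChainCoalg R D) :
    (TensorProduct.assoc R _ _ _).toLinearMap ∘ₗ
        (K.tensor L.toPreCoalg).comul.rTensor (C ⊗[R] D) ∘ₗ (K.tensor L.toPreCoalg).comul =
      (K.tensor L.toPreCoalg).comul.lTensor (C ⊗[R] D) ∘ₗ (K.tensor L.toPreCoalg).comul := by
  have e1 := interchange_natural (A := D) (B := C) (M := C) (N := D)
    (GB' := K.toGrading) K.comul LinearMap.id L.laws.comul_deg (Deg.id (G := K.toGrading))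
  have e2 := interchange_natural (A := D) (B := C) (M := C) (N := D)
    (GA' := L.toGrading) LinearMap.id L.comul (Deg.id (G := L.toGrading)) K.laws.comul_deg
  refine TensorProduct.ext' fun x y => ?_
  have hx := LinearMap.congr_fun K.coassoc x
  have hy := LinearMap.congr_fun L.coassoc y
  have f1 := LinearMap.congr_fun e1 (K.comul x ⊗ₜ L.comul y)
  have f2 := LinearMap.congr_fun e2 (K.comul x ⊗ₜ L.comul y)
  simp only [LinearMap.comp_apply, LinearEquiv.coe_coe, TensorProduct.map_tmul,
    TensorProduct.map_id] at hx hy f1 f2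
  have h := interchange_assoc_apply L.toGrading L.toGrading K.toGrading K.toGrading
    (K.comul.rTensor C (K.comul x)) (L.comul.rTensor D (L.comul y))
  rw [hx, hy] at h
  simp only [PreCoalg.tensor, LinearMap.comp_apply, LinearMap.rTensor_comp, LinearMap.lTensor_comp,
    TensorProduct.map_tmul, LinearEquiv.coe_coe]
  simp only [LinearMap.rTensor, LinearMap.lTensor] at h f1 f2 ⊢
  rw [← f1, ← f2, h]

/-- The tensor product of chain coalgebras. -/
def tensorCoalg (K : ChainCoalg R C) (L : ChainCoalg R D) : ChainCoalg R (C ⊗[R] D) where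
  toPreCoalg := K.tensor L.toPreCoalg
  d_mem := ((K.laws.tensor L.laws).d_deg.isDifferential
    (tensorD_comp_tensorD (H := L.toGrading) K.d_comp_d L.d_comp_d K.laws.d_deg)).mem
  d_zero := ((K.laws.tensor L.laws).d_deg.isDifferential
    (tensorD_comp_tensorD (H := L.toGrading) K.d_comp_d L.d_comp_d K.laws.d_deg)).zero
  d_comp_d := tensorD_comp_tensorD (H := L.toGrading) K.d_comp_d L.d_comp_d K.laws.d_deg
  comul_mem := hasDegree_iff.mpr (K.laws.tensor L.laws).comul_deg
  comul_d := tensor_comul_d K L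
  counit_d := LinearMap.ext (K.laws.tensor L.laws).counit_d
  coassoc := tensor_coassoc K L
  rTensor_counit := (K.laws.tensor L.laws).rTensor_counit
  lTensor_counit := (K.laws.tensor L.laws).lTensor_counit
  comul_one := (K.laws.tensor L.laws).comul_one

end ChainCoalg

theorem milgramHatTriple_hhD {R C : Type*} [CommRing R] [AddCommGroup C] [Module R C]
    (K : ChainCoalg R C) :
    milgramHatTriple K ∘ₗ (triple K).hhD =
      tensorD K.hhGrading K.hhD (tensorD K.hhGrading K.hhD K.hhD) ∘ₗ milgramHatTriple K := by
  rw [milgramHatTriple, LinearMap.comp_assoc,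
    show _ ∘ₗ (triple K).hhD = _ from milgramHat_hhD K.laws (K.laws.tensor K.laws),
    ← LinearMap.comp_assoc, lTensor_tensorD (milgramHat_hhD K.laws K.laws), LinearMap.comp_assoc]

theorem milgramHatTriple_deg {R C : Type*} [CommRing R] [AddCommGroup C] [Module R C]
    (K : ChainCoalg R C) :
    Deg (triple K).hhGrading (K.hhGrading.tensor (K.hhGrading.tensor K.hhGrading)) 0
      (milgramHatTriple K) :=
  Deg.comp (k := 0) (l := 0) (Deg.lTensor milgramHat_deg) milgramHat_deg (by norm_num)

/-- The triple tensor product is itself a chain coalgebra, so the general result on cobar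
constructions applies to it. -/
theorem triple_cobarD_cobarD {R C : Type*} [CommRing R] [AddCommGroup C] [Module R C]
    (K : ChainCoalg R C) (w : (triple K).Cobar) :
    (triple K).cobarD ((triple K).cobarD w) = 0 :=
  (K.tensorCoalg (K.tensorCoalg K)).cobarD_cobarD w

/-- The difference g - f = dH + Hd commutes with the differentials because both square to zero. So
only one end of the homotopy must be shown to be a chain map directly. -/
theorem IsDerivationHomotopy.isChainMap_right {R C D : Type*} [CommRing R] [AddCommGroup C]
    [Module R C] [AddCommGroup D] [Module R D] {K : PreCoalg R C} {L : PreCoalg R D}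
    {f g : K.Cobar →ₐ[R] L.Cobar} {H : K.Cobar →ₗ[R] L.Cobar}
    (hK : ∀ w, K.cobarD (K.cobarD w) = 0) (hL : ∀ w, L.cobarD (L.cobarD w) = 0)
    (hH : IsDerivationHomotopy K L f g H)
    (hf : IsChainMap K.cobarGrading K.cobarD L.cobarGrading L.cobarD f.toLinearMap)
    (hg : Deg K.cobarGrading L.cobarGrading 0 g.toLinearMap) :
    IsChainMap K.cobarGrading K.cobarD L.cobarGrading L.cobarD g.toLinearMap :=
  ⟨hasDegree_iff.mpr hg, LinearMap.ext fun w => by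
    have h1 := LinearMap.congr_fun hH.comm (K.cobarD w)
    have h2 := congrArg L.cobarD (LinearMap.congr_fun hH.comm w)
    have h3 := LinearMap.congr_fun hf.comm w
    simp only [LinearMap.comp_apply, LinearMap.add_apply, LinearMap.sub_apply, map_add, map_sub,
      hK, hL, map_zero, add_zero, zero_add] at h1 h2 h3 ⊢
    rw [h1, h3] at h2
    exact sub_left_injective h2⟩

theorem IsQuasistrictAW.exists_homotopy {R C : Type*} [CommRing R] [AddCommGroup C] [Module R C]
    {K : ChainCoalg R C} {ω : K.Cobar →ₐ[R] (K.tensor K.toPreCoalg).Cobar}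
    (h : IsQuasistrictAW K ω) :
    ∃ h, IsChainHomotopy K.hhGrading K.hhD
      (K.hhGrading.tensor (K.hhGrading.tensor K.hhGrading))
      (tensorD K.hhGrading K.hhD (tensorD K.hhGrading K.hhD K.hhD))
      (comulLeft (K.hhComul ω)) (comulRight (K.hhComul ω)) h := by
  obtain ⟨hω, H, hH⟩ := h
  have hf := hω.awLeft_isChainMap
  have hK3 := K.laws.tensor (K.laws.tensor K.laws)
  have hg := hH.isChainMap_right K.cobarD_cobarD (triple_cobarD_cobarD K) hf (awRight_deg hω)
  obtain ⟨X, hXd, hX⟩ := hH.exists_hhHat hK3 hf hg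
  -- The given homotopy starts at (Id ∧ ω)ω, which corresponds to (1 ⊗ ψ̂)ψ̂; the sign reverses its
  -- direction.
  refine ⟨-(milgramHatTriple K ∘ₗ X), hasDegree_iff.mpr (Deg.neg
    (Deg.comp (k := 1) (l := 0) (milgramHatTriple_deg K) hXd (by norm_num))), ?_⟩
  rw [comulLeft_hhComul hω, comulRight_hhComul hω]
  refine LinearMap.ext fun z => ?_
  have h1 := congrArg (milgramHatTriple K) (LinearMap.congr_fun hX z)
  have h2 := LinearMap.congr_fun (milgramHatTriple_hhD K) (X z)
  simp only [LinearMap.comp_apply, LinearMap.add_apply, LinearMap.sub_apply, LinearMap.neg_apply,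
    map_add, map_sub, map_neg] at h1 h2 ⊢
  rw [← h2, ← neg_add, h1, neg_sub]

end

end CoHoch

theorem mainTheorem4 {R : Type*} [CommRing R] [IsDomain R] [IsPrincipalIdealRing R]
    {C : Type*} [AddCommGroup C] [Module R C] [Module.Free R C] (K : CoHoch.ChainCoalg R C)
    (ω : K.Cobar →ₐ[R] (K.tensor K.toPreCoalg).Cobar) (hω : CoHoch.IsWeakAW K ω) :
    CoHoch.IsDifferential K.hhGrading K.hhD ∧
    CoHoch.IsChainMap K.hhGrading K.hhD (K.hhGrading.tensor K.hhGrading)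
      (CoHoch.tensorD K.hhGrading K.hhD K.hhD) (K.hhComul ω) ∧
    K.hhComul ω ∘ₗ K.hhIncl = TensorProduct.map K.hhIncl K.hhIncl ∘ₗ K.loopComul ω ∧
    TensorProduct.map K.hhProj K.hhProj ∘ₗ K.hhComul ω = K.comul ∘ₗ K.hhProj ∧
    (∀ {C' : Type*} [AddCommGroup C'] [Module R C'] [Module.Free R C']
      (K' : CoHoch.ChainCoalg R C') (ω' : K'.Cobar →ₐ[R] (K'.tensor K'.toPreCoalg).Cobar)
      (f : C →ₗ[R] C'), CoHoch.IsWeakAW K' ω' → CoHoch.IsAWMap K ω K' ω' f →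
      K'.hhComul ω' ∘ₗ K.hhMap K'.toPreCoalg f =
        TensorProduct.map (K.hhMap K'.toPreCoalg f) (K.hhMap K'.toPreCoalg f) ∘ₗ K.hhComul ω) ∧
    (CoHoch.IsStrictAW K ω →
      CoHoch.comulLeft (K.hhComul ω) = CoHoch.comulRight (K.hhComul ω)) ∧
    (CoHoch.IsQuasistrictAW K ω →
      ∃ h, CoHoch.IsChainHomotopy K.hhGrading K.hhD
        (K.hhGrading.tensor (K.hhGrading.tensor K.hhGrading))
        (CoHoch.tensorD K.hhGrading K.hhD (CoHoch.tensorD K.hhGrading K.hhD K.hhD))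
        (CoHoch.comulLeft (K.hhComul ω)) (CoHoch.comulRight (K.hhComul ω)) h) := by
  have hd : K.hhD ∘ₗ K.hhD = 0 := K.laws.hhD_hhD K.cobarD_cobarD
  exact ⟨K.laws.hhD_deg.isDifferential hd, hω.isChainMap_hhComul, CoHoch.hhComul_hhIncl _ ω,
    hω.hhProj_hhComul, fun K' ω' f hω' hf => hf.hhComul_hhMap hω hω', fun h => h.coassoc,
    fun h => h.exists_homotopy⟩
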